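/- **Games.** Two players are $\top$ (machine) and $\bot$ (environment). A move is a finite string over the keyboard alphabet; a labmove is a move labelled by a player; a run is a finite or infinite sequence of labmoves, a position is a finite run. A game $A$ is a pair $(\mathbf{Lr}^A,\mathbf{Wn}^A)$: $\mathbf{Lr}^A$ is a set of runs (the legal ones) containing a run iff it contains all its nonempty finite initial segments; $\mathbf{Wn}^A$ sends each run to its winner. A run is $\wp$-illegal if the last move of its shortest illegal initial segment is labelled $\wp$; such a run must be won by the adversary $\neg\wp$ of $\wp$. A run $\Omega$ is a $\wp$-delay of $\Gamma$ if both have the same subsequence of $\top$-labelled and the same subsequence of $\bot$-labelled moves, and whenever the $n$-th $\wp$-labelled move is later than the $k$-th $\neg\wp$-labelled move in $\Gamma$, so it is in $\Omega$. $A$ is static if, for every $\wp$ and every $\wp$-delay $\Omega$ of a run $\Gamma$: if $\Gamma$ is not $\wp$-illegal then neither is $\Omega$, and if $\Gamma$ is won by $\wp$ then so is $\Omega$. **Operations.** $\neg\Gamma$ is $\Gamma$ with all labels switched; $\Gamma^{\alpha}$ keeps the moves of the form $\alpha\beta$ and deletes their prefix $\alpha$; for an infinite bitstring $x$, $\Gamma^{\preceq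 x}$ keeps the moves $u.\beta$ with $u$ a finite initial segment of $x$ and deletes their prefix "$u.$"; for $\vec x=x_1,\dots,x_n$, $\Gamma^{\preceq a;\vec x}$ keeps the moves $a;u_1,\dots,u_n.\beta$ with each $u_j$ a finite initial segment of $x_j$ and deletes their prefix "$a;u_1,\dots,u_n.$". An infinite bitstring is essentially finite if it has finitely many $1$s. The winner is specified below for legal runs only. $\neg A$: $\Gamma$ is legal iff $\neg\Gamma\in\mathbf{Lr}^A$, and is won by $\top$ iff $\mathbf{Wn}^A\langle\neg\Gamma\rangle=\bot$. $A_1\wedge A_2$ and $A_1\vee A_2$: $\Gamma$ is legal iff all its moves are of the form $1.\alpha$ or $2.\alpha$ and $\Gamma^{i.}\in\mathbf{Lr}^{A_i}$ for $i=1,2$; $\top$ wins iff it wins $\Gamma^{i.}$ in $A_i$ for both (resp. some) $i$. Countable branching recurrence $!A$ and corecurrence $?A$: $\Gamma$ is legal iff all its moves are of the form $w.\alpha$ with $w$ a finite bitstring and $\Gamma^{\preceq x}\in\mathbf{Lr}^A$ for all infinite bitstrings $x$; $\top$ wins iff it wins $\Gamma^{\preceq v}$ in $A$ for all (resp. some)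 infinite but essentially finite $v$. **Formulas and cirquents.** Formulas are built from the atoms $P_0,P_1,\dots$ and their negations by $\wedge,\vee,!,?$; $\neg F$ for a formula $F$ is the De Morgan dual ($\neg{!}F={?}\neg F$ etc.). An interpretation $^*$ sends atoms to static games and extends to formulas through the operations. A cirquent is a triple $(\langle F_1,\dots,F_k\rangle,\langle U_1,\dots,U_m\rangle,\langle O_1,\dots,O_n\rangle)$ with $k,m,n\ge1$, $F_a$ formulas (their occurrences are called oformulas), and $U_i$ (undergroups) and $O_j$ (overgroups) nonempty sets of oformulas, such that every oformula is in some undergroup and some overgroup. The game $C^*$ of such a cirquent $C$: $\Gamma$ is legal iff every move is $a;u_1,\dots,u_n.\alpha$ with $1\le a\le k$ and finite bitstrings $u_j$ that are empty whenever $F_a\notin O_j$, and $\Gamma^{\preceq a;\vec x}\in\mathbf{Lr}^{F_a^*}$ for all $a$ and all $n$-tuples $\vec x$ of infinite bitstrings; $\top$ wins iff for every $i$ and every $n$-tuple $\vec x$ of infinite but essentially finite bitstrings there is $F_a\in U_i$ such that $\top$ wins $\Gamma^{\preceq a;\vec x}$ in $F_a^*$. **$\mathbf{CL15}(\aleph_0)$.**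 Axioms: $(\langle\neg F_1,F_1,\dots,\neg F_n,F_n\rangle,\langle\{\neg F_1,F_1\},\dots,\{\neg F_n,F_n\}\rangle,\langle\{\neg F_1,F_1\},\dots,\{\neg F_n,F_n\}\rangle)$, $n\ge1$. One-premise rules: *Exchange* swaps two adjacent oformulas (keeping their memberships), undergroups, or overgroups. *Duplication* replaces an undergroup or an overgroup by two adjacent copies. *Merging* replaces two adjacent overgroups by their union. The other rules are described from conclusion to premise. *Weakening*: remove an oformula $F$ from an undergroup $U$ with at least two elements; if $U$ was the only undergroup containing $F$, delete $F$ altogether, and delete the overgroups that become empty. *Contraction* ($?F$ becomes $?F,?F$) and *Disjunction* ($E\vee F$ becomes $E,F$): replace an oformula by two adjacent ones, belonging to the same groups as the original. *Conjunction*: replace $E\wedge F$ by adjacent $E,F$ in the same overgroups, and replace every undergroup $\Gamma$ containing $E\wedge F$ by two adjacent ones, in which $E\wedge F$ is replaced by $E$ and by $F$, respectively. *Recurrence*: replace $!F$ by $F$ and insert a new overgroup $\{F\}$. *Corecurrence*: replace $?F$ by $F$ and additionally include $F$ in any (possibly zero) number of the existing overgroups. A proof of $C$ is a nonempty sequence of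 cirquents that starts with an axiom, ends with $C$, and in which every later cirquent follows from the preceding one by a rule. **Machines.** An easy-play machine (EPM) is a deterministic algorithmic device with an internal memory and a read-only run tape that at any time spells the current position. On each clock cycle, depending algorithmically on its memory and the run tape, it updates its memory and does one of the following: nothing; makes a move, which is appended to the run tape with label $\top$; or grants permission, in which case the environment may make at most one (arbitrary) move, which is appended with label $\bot$. It starts with initial memory and empty run tape. A computation branch is an infinite sequence of configurations obtained in this way; it is fair if permission is granted infinitely often in it. The machine wins a game $A$ if for each of its computation branches, the run spelled on the run tape is won by $\top$ in $A$, and the branch is fair or this run is $\bot$-illegal. A uniform solution of a cirquent $C$ is an EPM that wins $C^*$ for every interpretation $^*$; $C$ is uniformly valid if it has a uniform solution. **Theorem.** Every cirquent provable in $\mathbf{CL15}(\aleph_0)$ is uniformly valid. Furthermore, there is an effective procedure that takes an arbitrary $\mathbf{CL15}(\aleph_0)$-proof of an arbitrary cirquent $C$ and constructs (a program of) a uniform solution of $C$. -/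

import Mathlib

namespace CoL

/-! ### Moves, runs, positions -/

/-- The two players: `true` is the machine `⊤`, `false` is the environment `⊥`;
the adversary of `p` is `!p`. -/
abbrev Player := Bool

/-- The machine `⊤`. -/
abbrev top : Player := true

/-- The environment `⊥`. -/
abbrev bot : Player := false

/-- The keyboard alphabet, as ASCII codes. -/
abbrev Sym := Fin 128

/-- A move is a finite string over the keyboard alphabet. -/
abbrev Move := List Sym

/-- A labmove is a move labelled with a player. -/
abbrev LabMove := Player × Move

/-- A position is a finite run. -/
abbrev Position := List LabMove

/-- A run is a finite or infinite sequence of labmoves. -/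
abbrev Run := Stream'.Seq LabMove

/-- The finite run with the given list of labmoves. -/
abbrev Position.toRun (Φ : Position) : Run := Stream'.Seq.ofList Φ

/-- The ASCII full stop. -/
def dot : Sym := 46

/-- The ASCII comma. -/
def comma : Sym := 44

/-- The ASCII semicolon. -/
def semicolon : Sym := 59

/-- The ASCII digit `d` (for `d < 10`). -/
def digit (d : ℕ) : Sym := Fin.ofNat 128 (48 + d)

/-- A natural number in decimal notation. -/
def numeral (a : ℕ) : Move := ((Nat.digits 10 a).map digit).reverse

/-- A finite bitstring as a string of the digits `0` and `1`. -/
def bits (u : List Bool) : Move := u.map fun b => digit b.toNat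

/-- The run obtained as the limit of an increasing (for the prefix order) sequence of positions:
its `n`-th entry is the `n`-th entry of any of the positions that is long enough. -/
noncomputable def Run.limit (s : ℕ → Position) : Run :=
  open Classical in ⟨fun n => if h : ∃ t, n < (s t).length then (s h.choose)[n]? else none, by
    classical
    intro n hn
    by_contra hc
    have h' : ∃ t, n + 1 < (s t).length := by
      by_contra h
      exact hc (dif_neg h)
    have h : ∃ t, n < (s t).length := by
      obtain ⟨t, ht⟩ := h'
      exact ⟨t, by omega⟩
    have hn' : (s h.choose)[n]? = none := (dif_pos h).symm.trans hn
    rw [List.getElem?_eq_none_iff] at hn'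
    have := h.choose_spec
    omega⟩

/-- Apply `f` to every labmove of a run, in order, deleting those on which `f` is `none`. -/
noncomputable def Run.filterMap (f : LabMove → Option LabMove) (Γ : Run) : Run :=
  Run.limit fun n => (Γ.take n).filterMap f

/-- `¬Γ`: all labels are changed to the opposite ones. -/
def Run.neg (Γ : Run) : Run := Γ.map fun m => (!m.1, m.2)

/-- Given a relation `P m β` ("the move `m` looks like some admissible prefix followed by `β`"),
delete from `Γ` all moves that do not look like this, and replace the others by their `β`. -/
noncomputable def Run.project (P : Move → Move → Prop) (Γ : Run) : Run :=
  open Classical in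
  Γ.filterMap fun m => if h : ∃ β, P m.2 β then some (m.1, h.choose) else none

/-- `Γ^α`: keep the moves of the form `αβ`, and delete the prefix `α` from them. -/
noncomputable def Run.sub (α : Move) (Γ : Run) : Run := Γ.project fun m β => m = α ++ β

/-- The finite bitstring `u` is an initial segment of the infinite bitstring `x`. -/
def IsInitial (u : List Bool) (x : ℕ → Bool) : Prop := u = (List.range u.length).map x

/-- An infinite bitstring is essentially finite if it has only finitely many `1`s. -/
def EssFinite (x : ℕ → Bool) : Prop := {i | x i = true}.Finite

/-- `Γ^{⪯x}`: keep the moves of the form `u.β` with `u` a finite initial segment of `x`, and delete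
the prefix `u.` from them. -/
noncomputable def Run.branch (x : ℕ → Bool) (Γ : Run) : Run :=
  Γ.project fun m β => ∃ u, IsInitial u x ∧ m = bits u ++ dot :: β

/-- The move `a;u₁,…,uₙ.β`. -/
def cirMove {n : ℕ} (a : ℕ) (u : Fin n → List Bool) (β : Move) : Move :=
  numeral a ++ semicolon :: ([comma].intercalate (List.ofFn fun j => bits (u j)) ++ dot :: β)

/-- `Γ^{⪯a;x₁,…,xₙ}`: keep the moves of the form `a;u₁,…,uₙ.β` with every `uⱼ` a finite initial
segment of `xⱼ`, and delete the prefix `a;u₁,…,uₙ.` from them. -/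
noncomputable def Run.thread {n : ℕ} (a : ℕ) (x : Fin n → ℕ → Bool) (Γ : Run) : Run :=
  Γ.project fun m β => ∃ u : Fin n → List Bool, (∀ j, IsInitial (u j) (x j)) ∧ m = cirMove a u β

/-! ### Games -/

/-- A run is in `L` iff all its nonempty finite initial segments are. -/
def IsLegality (L : Set Run) : Prop :=
  ∀ Γ : Run, Γ ∈ L ↔ ∀ n, Γ.take n ≠ [] → Position.toRun (Γ.take n) ∈ L

/-- With `L` the set of legal runs, the last move of the shortest illegal initial segment of `Γ`
exists and is labelled with `p`. -/
def IllegalBy (L : Set Run) (p : Player) (Γ : Run) : Prop :=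
  ∃ n α, Γ.get? n = some (p, α) ∧ (∀ m ≤ n, Position.toRun (Γ.take m) ∈ L) ∧
    Position.toRun (Γ.take (n + 1)) ∉ L

/-- A (constant) game. -/
structure Game where
  /-- the set of legal runs -/
  Lr : Set Run
  /-- the winner of each run -/
  Wn : Run → Player
  lr_iff : IsLegality Lr
  wn_illegal : ∀ p Γ, IllegalBy Lr p Γ → Wn Γ = !p

/-- `Γ` is a `p`-illegal run of `A`. -/
def Game.Illegal (A : Game) (p : Player) (Γ : Run) : Prop := IllegalBy A.Lr p Γ

theorem IllegalBy.unique {L : Set Run} {p q : Player} {Γ : Run}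
    (hp : IllegalBy L p Γ) (hq : IllegalBy L q Γ) : p = q := by
  obtain ⟨n, α, h1, h2, h3⟩ := hp
  obtain ⟨k, β, g1, g2, g3⟩ := hq
  have hnk : n = k := by
    rcases lt_trichotomy n k with h | h | h
    · exact absurd (g2 (n + 1) h) h3
    · exact h
    · exact absurd (h2 (k + 1) h) g3
  subst hnk
  rw [h1] at g1
  simpa using congrArg (Option.map Prod.fst) g1

theorem IllegalBy.not_mem {L : Set Run} (hL : IsLegality L) {p : Player} {Γ : Run}
    (h : IllegalBy L p Γ) : Γ ∉ L := by
  obtain ⟨n, α, h1, h2, h3⟩ := h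
  intro hΓ
  refine h3 ((hL Γ).1 hΓ (n + 1) ?_)
  intro h0
  have := Stream'.Seq.get?_mem_take (Nat.lt_succ_self n) h1
  rw [Nat.succ_eq_add_one, h0] at this
  simp at this

/-- The game with the set `L` of legal runs in which a legal run is won by `⊤` iff it satisfies `W`
(and an illegal run is lost by the player who made the first illegal move). -/
noncomputable def Game.ofWin (L : Set Run) (hL : IsLegality L) (W : Run → Prop) : Game :=
  open Classical in
  { Lr := L
    Wn := fun Γ => if Γ ∈ L then decide (W Γ) else if IllegalBy L top Γ then bot else top
    lr_iff := hL
    wn_illegal := by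
      intro p Γ h
      rw [if_neg (h.not_mem hL)]
      cases p
      · rw [if_neg fun h' => by simpa using h.unique h']
        rfl
      · rw [if_pos h]
        rfl }

/-- `NthAt Γ p n i` says that the `n`-th (counting
from `0`) `p`-labelled move of `Γ` stands at place `i` of `Γ`. -/
def NthAt (Γ : Run) (p : Player) (n i : ℕ) : Prop :=
  (∃ α, Γ.get? i = some (p, α)) ∧ ((Γ.take i).filter fun m => m.1 = p).length = n

/-- `Ω` is a `p`-delay of `Γ`. -/
def IsDelay (p : Player) (Ω Γ : Run) : Prop :=
  (∀ q : Player, Ω.filterMap (fun m => if m.1 = q then some m else none) =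
    Γ.filterMap (fun m => if m.1 = q then some m else none)) ∧
  ∀ n k i j, NthAt Γ p n i → NthAt Γ (!p) k j → j < i →
    ∀ i' j', NthAt Ω p n i' → NthAt Ω (!p) k j' → j' < i'

/-- Static games. -/
def Game.Static (A : Game) : Prop :=
  ∀ (p : Player) (Γ Ω : Run), IsDelay p Ω Γ →
    (¬ A.Illegal p Γ → ¬ A.Illegal p Ω) ∧ (A.Wn Γ = p → A.Wn Ω = p)

/-! ### Legality of the sets of runs used below -/

theorem take_eq (Γ : Run) {m n : ℕ} (h : m ≤ n) : Γ.take m = (Γ.take n).take m := by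
  apply List.ext_getElem?
  intro k
  rw [List.getElem?_take]
  simp only [Stream'.Seq.getElem?_take]
  by_cases hk : k < m
  · simp [hk, lt_of_lt_of_le hk h]
  · simp [hk]

theorem take_toRun (Φ : Position) (n : ℕ) : (Position.toRun Φ).take n = Φ.take n := by
  apply List.ext_getElem?
  intro k
  rw [List.getElem?_take, Stream'.Seq.getElem?_take]
  simp [Position.toRun]

theorem mem_of_mem_take {Γ : Run} {m : LabMove} {n : ℕ} (h : m ∈ Γ.take n) : m ∈ Γ := by
  obtain ⟨i, hi⟩ := List.getElem?_of_mem h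
  rw [Stream'.Seq.getElem?_take] at hi
  split_ifs at hi with hin
  exact Stream'.Seq.get?_mem hi

theorem mem_take_of_mem {Γ : Run} {m : LabMove} (h : m ∈ Γ) : ∃ n, m ∈ Γ.take n := by
  obtain ⟨i, hi⟩ := h
  exact ⟨i + 1, Stream'.Seq.get?_mem_take (Nat.lt_succ_self i) hi.symm⟩

theorem get?_limit {s : ℕ → Position} (hs : ∀ i j, i ≤ j → s i <+: s j) {n t : ℕ}
    (h : n < (s t).length) : (Run.limit s).get? n = (s t)[n]? := by
  classical
  have hex : ∃ t, n < (s t).length := ⟨t, h⟩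
  have e : (Run.limit s).get? n = (s hex.choose)[n]? := dif_pos hex
  rw [e]
  have hc := hex.choose_spec
  rcases le_total hex.choose t with hle | hle
  · obtain ⟨r, hr⟩ := hs _ _ hle
    rw [← hr, List.getElem?_append_left hc]
  · obtain ⟨r, hr⟩ := hs _ _ hle
    rw [← hr, List.getElem?_append_left h]

theorem filterMap_prefix (f : LabMove → Option LabMove) (Γ : Run) (i j : ℕ) (h : i ≤ j) :
    (Γ.take i).filterMap f <+: (Γ.take j).filterMap f := by
  rw [take_eq Γ h]
  exact List.IsPrefix.filterMap f (List.take_prefix _ _)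

theorem take_filterMap_length (f : LabMove → Option LabMove) (Γ : Run) (t : ℕ) :
    (Γ.filterMap f).take ((Γ.take t).filterMap f).length = (Γ.take t).filterMap f := by
  apply List.ext_getElem?
  intro k
  rw [Stream'.Seq.getElem?_take]
  split_ifs with hk
  · exact get?_limit (filterMap_prefix f Γ) hk
  · rw [List.getElem?_eq_none (by omega)]

theorem take_filterMap (f : LabMove → Option LabMove) (Γ : Run) (n : ℕ) :
    ∃ t, (Γ.filterMap f).take n <+: (Γ.take t).filterMap f := by
  induction n with
  | zero => exact ⟨0, by simp⟩
  | succ n ih =>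
    obtain ⟨t, ht⟩ := ih
    by_cases h : ∃ t, n < ((Γ.take t).filterMap f).length
    · obtain ⟨r, hr⟩ := h
      refine ⟨r, ?_⟩
      rw [take_eq (Γ.filterMap f) hr, take_filterMap_length]
      exact List.take_prefix _ _
    · refine ⟨t, ?_⟩
      have e : (Γ.filterMap f).get? n = none := dif_neg h
      have : (Γ.filterMap f).take (n + 1) = (Γ.filterMap f).take n := by
        apply List.ext_getElem?
        intro k
        simp only [Stream'.Seq.getElem?_take]
        by_cases hk : k < n
        · simp [hk, Nat.lt_succ_of_lt hk]
        · by_cases hk' : k = n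
          · subst hk'; simp [e]
          · have : ¬ k < n + 1 := by omega
            simp [hk, this]
      rw [this]
      exact ht

theorem filterMap_toRun (f : LabMove → Option LabMove) (Φ : Position) :
    (Position.toRun Φ).filterMap f = Position.toRun (Φ.filterMap f) := by
  ext1 n
  have e : ((Position.toRun Φ).take Φ.length).filterMap f = Φ.filterMap f := by
    rw [take_toRun, List.take_length]
  by_cases h : n < (Φ.filterMap f).length
  · have := get?_limit (filterMap_prefix f (Position.toRun Φ)) (n := n) (t := Φ.length)
      (by rw [e]; exact h)
    rw [e] at this
    rw [show ((Position.toRun Φ).filterMap f).get? n = _ from this]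
    simp [Position.toRun]
  · have hno : ¬ ∃ t, n < (((Position.toRun Φ).take t).filterMap f).length := by
      rintro ⟨t, ht⟩
      rw [take_toRun] at ht
      have := (List.IsPrefix.filterMap f (List.take_prefix t Φ)).length_le
      omega
    rw [show ((Position.toRun Φ).filterMap f).get? n = none from dif_neg hno]
    simp only [Position.toRun, Stream'.Seq.ofList_get?]
    rw [List.getElem?_eq_none (by omega)]

theorem IsLegality.empty_mem {L : Set Run} (hL : IsLegality L) : Position.toRun [] ∈ L := by
  rw [hL]
  intro n hn
  exact absurd (by rw [take_toRun]; simp) hn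

theorem IsLegality.mem_iff {L : Set Run} (hL : IsLegality L) (Γ : Run) :
    Γ ∈ L ↔ ∀ n, Position.toRun (Γ.take n) ∈ L := by
  rw [hL Γ]
  refine ⟨fun h n => ?_, fun h n _ => h n⟩
  by_cases h0 : Γ.take n = []
  · rw [h0]; exact hL.empty_mem
  · exact h n h0

theorem IsLegality.of_forall {L : Set Run} (h0 : Position.toRun [] ∈ L)
    (h : ∀ Γ : Run, Γ ∈ L ↔ ∀ n, Position.toRun (Γ.take n) ∈ L) : IsLegality L := by
  intro Γ
  rw [h Γ]
  refine ⟨fun h n _ => h n, fun h n => ?_⟩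
  by_cases hn : Γ.take n = []
  · rw [hn]; exact h0
  · exact h n hn

theorem IsLegality.filterMap {L : Set Run} (hL : IsLegality L) (f : LabMove → Option LabMove) :
    IsLegality {Γ | Γ.filterMap f ∈ L} := by
  refine .of_forall ?_ ?_
  · have := filterMap_toRun f []
    show (Position.toRun []).filterMap f ∈ L
    rw [this]
    exact hL.empty_mem
  intro Γ
  simp only [Set.mem_ofPred_eq, filterMap_toRun]
  rw [hL.mem_iff]
  constructor
  · intro h t
    have := h ((Γ.take t).filterMap f).length
    rwa [take_filterMap_length] at this
  · intro h n
    obtain ⟨t, ht⟩ := take_filterMap f Γ n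
    have := (hL.mem_iff _).1 (h t) ((Γ.filterMap f).take n).length
    rwa [take_toRun, ← List.prefix_iff_eq_take.1 ht] at this

theorem isLegality_forall_mem (p : LabMove → Prop) : IsLegality {Γ : Run | ∀ m ∈ Γ, p m} := by
  refine .of_forall ?_ ?_
  · rintro m ⟨i, hi⟩
    exact absurd hi (by simp [Position.toRun, Stream'.Seq.ofList, Stream'.get])
  intro Γ
  constructor
  · rintro h n m hm
    obtain ⟨k, hk⟩ := mem_take_of_mem hm
    rw [take_toRun] at hk
    exact h m (mem_of_mem_take (List.mem_of_mem_take hk))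
  · intro h m hm
    obtain ⟨k, hk⟩ := mem_take_of_mem hm
    refine h k m (mem_of_mem_take (n := k) ?_)
    rw [take_toRun, ← take_eq Γ le_rfl]
    exact hk

theorem IsLegality.and {L L' : Set Run} (hL : IsLegality L) (hL' : IsLegality L') :
    IsLegality {Γ | Γ ∈ L ∧ Γ ∈ L'} := by
  refine .of_forall ⟨hL.empty_mem, hL'.empty_mem⟩ fun Γ => ?_
  simp only [Set.mem_ofPred_eq, forall_and]
  rw [hL.mem_iff Γ, hL'.mem_iff Γ]

theorem IsLegality.all {ι : Sort*} {L : ι → Set Run} (hL : ∀ i, IsLegality (L i)) :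
    IsLegality {Γ | ∀ i, Γ ∈ L i} := by
  refine .of_forall (fun i => (hL i).empty_mem) fun Γ => ?_
  simp only [Set.mem_ofPred_eq]
  rw [forall_comm]
  exact forall_congr' fun i => (hL i).mem_iff Γ

theorem IsLegality.neg {L : Set Run} (hL : IsLegality L) : IsLegality {Γ | Γ.neg ∈ L} := by
  have e : ∀ Γ : Run, Γ.neg = Γ.filterMap fun m => some (!m.1, m.2) := by
    intro Γ
    ext1 n
    rw [Run.neg, Stream'.Seq.map_get?]
    have hl : ∀ t, ((Γ.take t).filterMap fun m => some ((!m.1, m.2) : LabMove)) =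
        (Γ.take t).map fun m => (!m.1, m.2) := fun t => by rw [List.filterMap_eq_map']
    by_cases h : ∃ t, n < ((Γ.take t).filterMap fun m => some ((!m.1, m.2) : LabMove)).length
    · obtain ⟨t, ht⟩ := h
      rw [show (Γ.filterMap fun m => some ((!m.1, m.2) : LabMove)).get? n = _ from
        get?_limit (filterMap_prefix _ Γ) ht, hl, List.getElem?_map, Stream'.Seq.getElem?_take]
      rw [hl, List.length_map] at ht
      rw [if_pos (lt_of_lt_of_le ht Stream'.Seq.length_take_le)]
    · rw [show (Γ.filterMap fun m => some ((!m.1, m.2) : LabMove)).get? n = none from dif_neg h]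
      rw [Option.map_eq_none_iff]
      by_contra hc
      obtain ⟨m, hm⟩ := Option.ne_none_iff_exists'.1 hc
      refine h ⟨n + 1, ?_⟩
      rw [hl, List.length_map]
      by_contra hlt
      have h1 : (Γ.take (n + 1))[n]? = none := List.getElem?_eq_none (by omega)
      rw [Stream'.Seq.getElem?_take, if_pos (Nat.lt_succ_self n), hm] at h1
      exact absurd h1 (by simp)
  simp only [e]
  exact hL.filterMap _

/-! ### Game operations -/

/-- Negation `¬A`. -/
noncomputable def Game.neg (A : Game) : Game :=
  .ofWin {Γ | Γ.neg ∈ A.Lr} A.lr_iff.neg fun Ω => A.Wn Ω.neg = bot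

/-- The prefixes `1.` and `2.`. -/
def compPrefix (i : ℕ) : Move := [digit i, dot]

/-- The legal runs of `A ∧ B` and of `A ∨ B`. -/
def parLegal (A B : Game) : Set Run :=
  {Γ | (∀ m ∈ Γ, ∃ α, m.2 = compPrefix 1 ++ α ∨ m.2 = compPrefix 2 ++ α) ∧
    Γ.sub (compPrefix 1) ∈ A.Lr ∧ Γ.sub (compPrefix 2) ∈ B.Lr}

theorem isLegality_parLegal (A B : Game) : IsLegality (parLegal A B) :=
  (isLegality_forall_mem _).and ((A.lr_iff.filterMap _).and (B.lr_iff.filterMap _))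

/-- Parallel conjunction `A ∧ B`. -/
noncomputable def Game.conj (A B : Game) : Game :=
  .ofWin (parLegal A B) (isLegality_parLegal A B) fun Ω =>
    A.Wn (Ω.sub (compPrefix 1)) = top ∧ B.Wn (Ω.sub (compPrefix 2)) = top

/-- Parallel disjunction `A ∨ B`. -/
noncomputable def Game.disj (A B : Game) : Game :=
  .ofWin (parLegal A B) (isLegality_parLegal A B) fun Ω =>
    A.Wn (Ω.sub (compPrefix 1)) = top ∨ B.Wn (Ω.sub (compPrefix 2)) = top

/-- The legal runs of the countable branching recurrence and corecurrence of `A`. -/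
def recLegal (A : Game) : Set Run :=
  {Γ | (∀ m ∈ Γ, ∃ w α, m.2 = bits w ++ dot :: α) ∧ ∀ x : ℕ → Bool, Γ.branch x ∈ A.Lr}

theorem isLegality_recLegal (A : Game) : IsLegality (recLegal A) :=
  (isLegality_forall_mem _).and (.all fun _ => A.lr_iff.filterMap _)

/-- Countable branching recurrence. -/
noncomputable def Game.recur (A : Game) : Game :=
  .ofWin (recLegal A) (isLegality_recLegal A) fun Ω =>
    ∀ v, EssFinite v → A.Wn (Ω.branch v) = top

/-- Countable branching corecurrence. -/
noncomputable def Game.corecur (A : Game) : Game :=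
  .ofWin (recLegal A) (isLegality_recLegal A) fun Ω =>
    ∃ v, EssFinite v ∧ A.Wn (Ω.branch v) = top

/-! ### Formulas and interpretations -/

/-- Formulas in the signature of negation (of atoms), conjunction, disjunction, countable branching
recurrence and corecurrence. -/
inductive Formula where
  | atom (P : ℕ)
  | natom (P : ℕ)
  | conj (E F : Formula)
  | disj (E F : Formula)
  | recur (F : Formula)
  | corecur (F : Formula)

/-- The formula abbreviated as `¬F`. -/
def Formula.neg : Formula → Formula
  | atom P => natom P
  | natom P => atom P
  | conj E F => disj E.neg F.neg
  | disj E F => conj E.neg F.neg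
  | recur F => corecur F.neg
  | corecur F => recur F.neg

/-- A formula written out in prefix notation; the symbols are coded by numbers, and an atom is
followed by its index. -/
def Formula.word : Formula → List ℕ
  | atom P => [0, P]
  | natom P => [1, P]
  | conj E F => 2 :: (E.word ++ F.word)
  | disj E F => 3 :: (E.word ++ F.word)
  | recur F => 4 :: F.word
  | corecur F => 5 :: F.word

/-- An interpretation sends every atom to a static game. -/
structure Interpretation where
  game : ℕ → Game
  static : ∀ P, (game P).Static

/-- The game `F^*`. -/
noncomputable def Formula.interp (I : Interpretation) : Formula → Game
  | atom P => I.game P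
  | natom P => (I.game P).neg
  | conj E F => (E.interp I).conj (F.interp I)
  | disj E F => (E.interp I).disj (F.interp I)
  | recur F => (F.interp I).recur
  | corecur F => (F.interp I).corecur

/-! ### Cirquents -/

/-- A cirquent. Its oformulas are identified with their places `0, …, k - 1` in the list `forms`, and
undergroups and overgroups are sets of such places. -/
structure Cirquent where
  forms : List Formula
  undergroups : List (Finset ℕ)
  overgroups : List (Finset ℕ)
  forms_ne : forms ≠ []
  under_ne : undergroups ≠ []
  over_ne : overgroups ≠ []
  under_mem : ∀ U ∈ undergroups, U.Nonempty ∧ U ⊆ Finset.range forms.length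
  over_mem : ∀ O ∈ overgroups, O.Nonempty ∧ O ⊆ Finset.range forms.length
  under_cover : ∀ a < forms.length, ∃ U ∈ undergroups, a ∈ U
  over_cover : ∀ a < forms.length, ∃ O ∈ overgroups, a ∈ O

/-- The legal runs of `C^*`. -/
def Cirquent.legal (I : Interpretation) (C : Cirquent) : Set Run :=
  {Γ | (∀ m ∈ Γ, ∃ (a : Fin C.forms.length) (u : Fin C.overgroups.length → List Bool) (α : Move),
      m.2 = cirMove (a + 1) u α ∧ ∀ j, (a : ℕ) ∉ C.overgroups[j] → u j = []) ∧
    ∀ (a : Fin C.forms.length) (x : Fin C.overgroups.length → ℕ → Bool),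
      Γ.thread (a + 1) x ∈ (C.forms[a].interp I).Lr}

theorem Cirquent.isLegality_legal (I : Interpretation) (C : Cirquent) : IsLegality (C.legal I) :=
  (isLegality_forall_mem _).and
    (.all fun a => .all fun _ => (C.forms[a].interp I).lr_iff.filterMap _)

/-- The game `C^*`. -/
noncomputable def Cirquent.interp (I : Interpretation) (C : Cirquent) : Game :=
  .ofWin (C.legal I) (C.isLegality_legal I) fun Ω =>
    ∀ U ∈ C.undergroups, ∀ x : Fin C.overgroups.length → ℕ → Bool, (∀ j, EssFinite (x j)) →
      ∃ a : Fin C.forms.length, (a : ℕ) ∈ U ∧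
        (C.forms[a].interp I).Wn (Ω.thread (a + 1) x) = top

/-! ### The calculus -/

/-- The axiom determined by a list of formulas. -/
def IsAxiom (C : Cirquent) : Prop :=
  ∃ Fs : List Formula, Fs ≠ [] ∧
    C.forms = Fs.flatMap (fun F => [F.neg, F]) ∧
    C.undergroups = (List.range Fs.length).map (fun i => {2 * i, 2 * i + 1}) ∧
    C.overgroups = (List.range Fs.length).map (fun i => {2 * i, 2 * i + 1})

/-- What becomes of a group when the oformula at place `a` is replaced by two adjacent oformulas
(at places `a` and `a + 1`): if the group contained the oformula `a`, it now contains the elements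
of `N` instead; the oformulas to the right of `a` are renumbered. -/
def splitGroup (a : ℕ) (N : Finset ℕ) (G : Finset ℕ) : Finset ℕ :=
  G.biUnion fun i => if i < a then {i} else if i = a then N else {i + 1}

/-- What becomes of a group when the oformula at place `a` is deleted. -/
def deleteFrom (a : ℕ) (G : Finset ℕ) : Finset ℕ :=
  (G.erase a).image fun i => if i < a then i else i - 1

/-- `Rule A B`: the cirquent `B` follows from the premise `A` by one of the rules other than
Axiom. -/
inductive Rule (A B : Cirquent) : Prop
  | undergroupExchange (L R : List (Finset ℕ)) (G H : Finset ℕ)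
      (hF : B.forms = A.forms) (hO : B.overgroups = A.overgroups)
      (hA : A.undergroups = L ++ [G, H] ++ R) (hB : B.undergroups = L ++ [H, G] ++ R)
  | overgroupExchange (L R : List (Finset ℕ)) (G H : Finset ℕ)
      (hF : B.forms = A.forms) (hU : B.undergroups = A.undergroups)
      (hA : A.overgroups = L ++ [G, H] ++ R) (hB : B.overgroups = L ++ [H, G] ++ R)
  | oformulaExchange (L R : List Formula) (E F : Formula)
      (hA : A.forms = L ++ [E, F] ++ R) (hB : B.forms = L ++ [F, E] ++ R)
      (hU : B.undergroups = A.undergroups.map (Finset.image (Equiv.swap L.length (L.length + 1))))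
      (hO : B.overgroups = A.overgroups.map (Finset.image (Equiv.swap L.length (L.length + 1))))
  | undergroupDuplication (L R : List (Finset ℕ)) (G : Finset ℕ)
      (hF : B.forms = A.forms) (hO : B.overgroups = A.overgroups)
      (hA : A.undergroups = L ++ [G] ++ R) (hB : B.undergroups = L ++ [G, G] ++ R)
  | overgroupDuplication (L R : List (Finset ℕ)) (G : Finset ℕ)
      (hF : B.forms = A.forms) (hU : B.undergroups = A.undergroups)
      (hA : A.overgroups = L ++ [G] ++ R) (hB : B.overgroups = L ++ [G, G] ++ R)
  | merging (L R : List (Finset ℕ)) (G H : Finset ℕ)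
      (hF : B.forms = A.forms) (hU : B.undergroups = A.undergroups)
      (hA : A.overgroups = L ++ [G, H] ++ R) (hB : B.overgroups = L ++ [G ∪ H] ++ R)
  /- Weakening, when the oformula `a` is in another undergroup as well. -/
  | weakeningArc (L R : List (Finset ℕ)) (U : Finset ℕ) (a : ℕ)
      (hB : B.undergroups = L ++ [U] ++ R) (ha : a ∈ U) (hU : 2 ≤ U.card)
      (hother : ∃ G ∈ L ++ R, a ∈ G)
      (hF : A.forms = B.forms) (hA : A.undergroups = L ++ [U.erase a] ++ R) (hO : A.overgroups = B.overgroups)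
  /- Weakening, when `U` is the only undergroup that contains the oformula `a`. -/
  | weakeningOformula (L R : List (Finset ℕ)) (U : Finset ℕ) (a : ℕ)
      (hB : B.undergroups = L ++ [U] ++ R) (ha : a ∈ U) (hU : 2 ≤ U.card)
      (honly : ∀ G ∈ L ++ R, a ∉ G)
      (hF : A.forms = B.forms.eraseIdx a)
      (hA : A.undergroups = (L ++ [U] ++ R).map (deleteFrom a))
      (hO : A.overgroups = (B.overgroups.map (deleteFrom a)).filter (fun O => O.Nonempty))
  | contraction (L R : List Formula) (F : Formula)
      (hB : B.forms = L ++ [F.corecur] ++ R) (hA : A.forms = L ++ [F.corecur, F.corecur] ++ R)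
      (hU : A.undergroups = B.undergroups.map (splitGroup L.length {L.length, L.length + 1}))
      (hO : A.overgroups = B.overgroups.map (splitGroup L.length {L.length, L.length + 1}))
  | disjunction (L R : List Formula) (E F : Formula)
      (hB : B.forms = L ++ [E.disj F] ++ R) (hA : A.forms = L ++ [E, F] ++ R)
      (hU : A.undergroups = B.undergroups.map (splitGroup L.length {L.length, L.length + 1}))
      (hO : A.overgroups = B.overgroups.map (splitGroup L.length {L.length, L.length + 1}))
  | conjunction (L R : List Formula) (E F : Formula)
      (hB : B.forms = L ++ [E.conj F] ++ R) (hA : A.forms = L ++ [E, F] ++ R)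
      (hU : A.undergroups = B.undergroups.flatMap fun G =>
        if L.length ∈ G then
          [splitGroup L.length {L.length} G, splitGroup L.length {L.length + 1} G]
        else [splitGroup L.length ∅ G])
      (hO : A.overgroups = B.overgroups.map (splitGroup L.length {L.length, L.length + 1}))
  | recurrence (L R : List Formula) (F : Formula) (O O' : List (Finset ℕ))
      (hB : B.forms = L ++ [F.recur] ++ R) (hA : A.forms = L ++ [F] ++ R)
      (hU : A.undergroups = B.undergroups)
      (hOB : B.overgroups = O ++ O') (hOA : A.overgroups = O ++ [{L.length}] ++ O')
  | corecurrence (L R : List Formula) (F : Formula)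
      (hB : B.forms = L ++ [F.corecur] ++ R) (hA : A.forms = L ++ [F] ++ R)
      (hU : A.undergroups = B.undergroups)
      (hO : List.Forall₂ (fun G' G => G' = G ∨ G' = insert L.length G) A.overgroups B.overgroups)

/-- The list `P` of cirquents is a proof of `C`. -/
def IsProof (P : List Cirquent) (C : Cirquent) : Prop :=
  (∃ A, P.head? = some A ∧ IsAxiom A) ∧ P.IsChain Rule ∧ P.getLast? = some C

/-- `C` is provable. -/
def Cirquent.Provable (C : Cirquent) : Prop := ∃ P, IsProof P C

/-- Written-out cirquents: the formulas in prefix notation, and the undergroups and overgroups as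
lists of places. -/
abbrev CirquentWord := List (List ℕ) × List (List ℕ) × List (List ℕ)

/-- A cirquent written out, each group as the increasing list of its elements. -/
def Cirquent.word (C : Cirquent) : CirquentWord :=
  (C.forms.map Formula.word, C.undergroups.map (fun G => G.sort (· ≤ ·)),
    C.overgroups.map (fun G => G.sort (· ≤ ·)))

/-! ### Easy-play machines -/

/-- What a machine may do, apart from updating its internal configuration, on a clock cycle: nothing,
grant permission to the environment, or make a move. -/
inductive Action where
  | idle
  | grant
  | move (α : Move)

/-- Actions as an encodable type. -/
def Action.equiv : Action ≃ Option (Option Move) where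
  toFun
    | idle => none
    | grant => some none
    | move α => some (some α)
  invFun
    | none => idle
    | some none => grant
    | some (some α) => move α
  left_inv a := by cases a <;> rfl
  right_inv a := by rcases a with _ | _ | _ <;> rfl

instance : Primcodable Action := Primcodable.ofEquiv _ Action.equiv

/-- An easy-play machine, given by a program `code` for its transition function `trans`. The
internal configuration (control state and work memory) is coded by a natural number, with `0` for the
initial one. On each clock cycle the machine, depending on its internal configuration and on the
content of the run tape, updates the former and performs an action. -/
structure EPM where
  code : Nat.Partrec.Code
  trans : ℕ × Position → ℕ × Action
  code_eval : ∀ c, code.eval (Encodable.encode c) = Part.some (Encodable.encode (trans c))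

/-- A configuration `(s, Φ)` consists of the internal configuration `s` and the position `Φ` spelled on
the run tape. `M.Succ c d` says that `d` is a successor of `c`: a move of the machine is appended
to the run tape, and whenever permission is granted, the environment may make at most one move,
which is appended as well. -/
def EPM.Succ (M : EPM) (c d : ℕ × Position) : Prop :=
  d.1 = (M.trans c).1 ∧
    match (M.trans c).2 with
    | .idle => d.2 = c.2
    | .move α => d.2 = c.2 ++ [(top, α)]
    | .grant => d.2 = c.2 ∨ ∃ α, d.2 = c.2 ++ [(bot, α)]

/-- Computation branches of `M`. -/
def EPM.IsBranch (M : EPM) (B : ℕ → ℕ × Position) : Prop :=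
  B 0 = (0, []) ∧ ∀ t, M.Succ (B t) (B (t + 1))

/-- The run spelled by a computation branch. -/
noncomputable def spelled (B : ℕ → ℕ × Position) : Run := Run.limit fun t => (B t).2

/-- A branch is fair if permission is granted infinitely many times. -/
def EPM.Fair (M : EPM) (B : ℕ → ℕ × Position) : Prop :=
  ∀ t₀, ∃ t ≥ t₀, (M.trans (B t)).2 = .grant

/-- `M` wins `A`. -/
def EPM.Wins (M : EPM) (A : Game) : Prop :=
  ∀ B, M.IsBranch B →
    A.Wn (spelled B) = top ∧ (M.Fair B ∨ A.Illegal bot (spelled B))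

/-- `M` is a uniform solution of `C`. -/
def EPM.IsUniformSolution (M : EPM) (C : Cirquent) : Prop :=
  ∀ I : Interpretation, M.Wins (C.interp I)

/-- `C` is uniformly valid. -/
def Cirquent.UniformlyValid (C : Cirquent) : Prop := ∃ M : EPM, M.IsUniformSolution C

end CoL

/-! Legality and victory in `C^*` are both stated thread by thread, a thread being what is seen of a
run from an oformula `a` and a tuple of infinite bitstrings. Soundness is proved by induction along
the proof: axioms are won by copy-cat, and every rule converts a strategy for its premise into one
for its conclusion by translating single moves in such a way that threads of the two plays coincide.

Copy-cat. In a pair `¬F, F` every move of the environment is repeated in the other oformula. A copy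
comes after its original, so each thread of `¬F` is a `⊤`-delay of the corresponding thread of `F`
with labels switched. This is the only place where staticness matters. Compound games are not shown
to be static; instead the property `Game.Transfer`, which speaks about legal runs only, is derived
from staticness (`Game.Static.transfer`) and passed through all operations (`Formula.transfer`). It
yields `Paired.solves`.

Rules. A move of the environment in the conclusion becomes a finite list of moves in the premise,
and a move of the machine in the premise becomes a finite list of moves in the conclusion.
`Sim.wins` says when this turns a winning strategy into a winning strategy. The dictionary for
bitstrings is as follows. Overgroup duplication: the string of the overgroup is the interleaving of
the strings of its two copies. Recurrence: the branch of `!F` is the string of the new overgroup.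
Corecurrence: the branch of `?F` is the interleaving of the strings of the overgroups that `F`
joins. Contraction: the first bit of the branch of `?F` chooses the copy. Exchange, undergroup
duplication and weakening only rename or drop places. An interleaving of finitely many essentially
finite strings is essentially finite, which is what the countable operations require. Since finite
strings of unequal lengths are not the parts of a single interleaved string, such a move is replaced
by the finite family `cover` of moves, of which a thread sees at most one.

In merging, and in corecurrence without new overgroups, some threads of one play have no permanent
counterpart in the other. There the translated move is pushed down to a bitstring at least as long
as everything relevant played before; a thread that sees this move has looked so far exactly like a
thread that does have a counterpart. For this reason strategies carry a bound for the sizes of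
earlier moves, and `Sim` asks for agreement of histories only at the moment of a visible move.

Effectiveness. An application of a rule is determined, as far as the translations are concerned, by
a few numbers and lists. Whether such data fit two written-out cirquents is decided by a primitive
recursive check, so the program of the machine can search for them, and then recompute the whole
play from the run tape on every clock cycle (`exists_computable_solutions`). -/

namespace CoL

/-! ### Limits of chains of positions -/

/-- A sequence of positions that increases for the prefix order. -/
def Chain (s : ℕ → Position) : Prop := ∀ i j, i ≤ j → s i <+: s j

theorem Chain.of_succ {s : ℕ → Position} (h : ∀ i, s i <+: s (i + 1)) : Chain s := by
  intro i j hij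
  induction j, hij using Nat.le_induction with
  | base => exact List.prefix_rfl
  | succ j _ ih => exact ih.trans (h j)

theorem Chain.filterMap {s : ℕ → Position} (h : Chain s) (f : LabMove → Option LabMove) :
    Chain fun r => (s r).filterMap f :=
  fun i j hij => (h i j hij).filterMap f

theorem chain_take (Γ : Run) : Chain fun n => Γ.take n := by
  intro i j hij
  show Γ.take i <+: Γ.take j
  rw [take_eq Γ hij]
  exact List.take_prefix _ _

theorem take_limit_length {s : ℕ → Position} (hs : Chain s) (t : ℕ) :
    (Run.limit s).take (s t).length = s t := by
  apply List.ext_getElem?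
  intro k
  rw [Stream'.Seq.getElem?_take]
  split_ifs with hk
  · exact get?_limit hs hk
  · rw [List.getElem?_eq_none (by omega)]

theorem take_succ_of_none {Γ : Run} {n : ℕ} (e : Γ.get? n = none) :
    Γ.take (n + 1) = Γ.take n := by
  apply List.ext_getElem?
  intro k
  simp only [Stream'.Seq.getElem?_take]
  by_cases hk : k < n
  · simp [hk, Nat.lt_succ_of_lt hk]
  · by_cases hk' : k = n
    · subst hk'; simp [e]
    · have : ¬ k < n + 1 := by omega
      simp [hk, this]

theorem take_succ_of_some {Γ : Run} {n : ℕ} {m : LabMove} (e : Γ.get? n = some m) :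
    Γ.take (n + 1) = Γ.take n ++ [m] := by
  have hl : (Γ.take n).length = n := by
    apply le_antisymm Stream'.Seq.length_take_le
    by_contra hc
    push Not at hc
    have h1 : (Γ.take n)[(Γ.take n).length]? = none := List.getElem?_eq_none le_rfl
    rw [Stream'.Seq.getElem?_take, if_pos hc] at h1
    have := Γ.le_stable hc.le h1
    rw [e] at this
    simp at this
  apply List.ext_getElem?
  intro k
  rw [Stream'.Seq.getElem?_take, List.getElem?_append, hl, Stream'.Seq.getElem?_take]
  rcases lt_trichotomy k n with h | h | h
  · simp [h, Nat.lt_succ_of_lt h]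
  · subst h; simp [e]
  · have h1 : ¬ k < n + 1 := by omega
    have h2 : ¬ k < n := by omega
    rw [if_neg h1, if_neg h2, List.getElem?_eq_none]
    simp; omega

theorem take_limit_prefix {s : ℕ → Position} (hs : Chain s) (n : ℕ) :
    ∃ t, (Run.limit s).take n <+: s t := by
  induction n with
  | zero => exact ⟨0, by simp⟩
  | succ n ih =>
    by_cases h : ∃ t, n < (s t).length
    · obtain ⟨r, hr⟩ := h
      refine ⟨r, ?_⟩
      rw [take_eq _ (show n + 1 ≤ (s r).length from hr), take_limit_length hs]
      exact List.take_prefix _ _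
    · obtain ⟨t, ht⟩ := ih
      refine ⟨t, ?_⟩
      rw [take_succ_of_none (show (Run.limit s).get? n = none from dif_neg h)]
      exact ht

/-- Only the mutual cofinality of the chains matters; this later allows a run tape to be compared
with a play that is ahead of it by pending replies. -/
theorem limit_congr {s s' : ℕ → Position} (hs : Chain s) (hs' : Chain s')
    (h : ∀ i, ∃ j, s i <+: s' j) (h' : ∀ i, ∃ j, s' i <+: s j) : Run.limit s = Run.limit s' := by
  have key : ∀ {s s' : ℕ → Position}, Chain s → Chain s' → (∀ i, ∃ j, s i <+: s' j) →
      ∀ n, (∃ t, n < (s t).length) → (Run.limit s).get? n = (Run.limit s').get? n := by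
    intro s s' hs hs' h n ⟨t, ht⟩
    obtain ⟨j, hj⟩ := h t
    rw [get?_limit hs ht, get?_limit hs' (lt_of_lt_of_le ht hj.length_le)]
    obtain ⟨r, hr⟩ := hj
    rw [← hr, List.getElem?_append_left ht]
  ext1 n
  by_cases h1 : ∃ t, n < (s t).length
  · exact key hs hs' h n h1
  by_cases h2 : ∃ t, n < (s' t).length
  · exact (key hs' hs h' n h2).symm
  rw [show (Run.limit s).get? n = none from dif_neg h1,
    show (Run.limit s').get? n = none from dif_neg h2]

theorem limit_take (Γ : Run) : (Run.limit fun n => Γ.take n) = Γ := by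
  ext1 n
  by_cases h : ∃ t, n < (Γ.take t).length
  · obtain ⟨t, ht⟩ := h
    rw [get?_limit (chain_take Γ) ht, Stream'.Seq.getElem?_take, if_pos]
    exact lt_of_lt_of_le ht Stream'.Seq.length_take_le
  · rw [show (Run.limit fun n => Γ.take n).get? n = none from dif_neg h]
    by_contra hc
    obtain ⟨m, hm⟩ := Option.ne_none_iff_exists'.1 (Ne.symm hc)
    refine h ⟨n + 1, ?_⟩
    by_contra hlt
    have h1 : (Γ.take (n + 1))[n]? = none := List.getElem?_eq_none (by omega)
    rw [Stream'.Seq.getElem?_take, if_pos (Nat.lt_succ_self n), hm] at h1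
    exact absurd h1 (by simp)

/-- Continuity of projections: with it, threads of infinite plays are handled through threads of
positions. -/
theorem filterMap_limit {s : ℕ → Position} (hs : Chain s) (f : LabMove → Option LabMove) :
    (Run.limit s).filterMap f = Run.limit fun r => (s r).filterMap f := by
  refine limit_congr ((chain_take _).filterMap f) (hs.filterMap f) ?_ ?_
  · intro i
    obtain ⟨t, ht⟩ := take_limit_prefix hs i
    exact ⟨t, ht.filterMap f⟩
  · intro i
    refine ⟨(s i).length, ?_⟩
    show _ <+: ((Run.limit s).take _).filterMap f
    rw [take_limit_length hs]

theorem filterMap_filterMap (f g : LabMove → Option LabMove) (Γ : Run) :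
    (Γ.filterMap f).filterMap g = Γ.filterMap fun m => (f m).bind g := by
  show (Run.limit _).filterMap g = Run.limit _
  rw [filterMap_limit ((chain_take Γ).filterMap f)]
  congr 1
  funext r
  rw [List.filterMap_filterMap]

theorem mem_of_limit {L : Set Run} (hL : IsLegality L) {s : ℕ → Position} (hs : Chain s) :
    Run.limit s ∈ L ↔ ∀ r, Position.toRun (s r) ∈ L := by
  rw [hL.mem_iff]
  constructor
  · intro h r
    have := h (s r).length
    rwa [take_limit_length hs] at this
  · intro h n
    obtain ⟨t, ht⟩ := take_limit_prefix hs n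
    have := (hL.mem_iff _).1 (h t) ((Run.limit s).take n).length
    rwa [take_toRun, ← List.prefix_iff_eq_take.1 ht] at this

theorem IsLegality.prefix {L : Set Run} (hL : IsLegality L) {Φ Ψ : Position} (h : Φ <+: Ψ)
    (hΨ : Position.toRun Ψ ∈ L) : Position.toRun Φ ∈ L := by
  have := (hL.mem_iff _).1 hΨ Φ.length
  rwa [take_toRun, ← List.prefix_iff_eq_take.1 h] at this

/-- Cutting a projection comes from cutting the original. The clauses "for every initial segment" in
the notions of delay pass through projections for this reason. -/
theorem list_take_filterMap {α β : Type*} (f : α → Option β) (l : List α) (t : ℕ) :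
    ∃ t', (l.filterMap f).take t = (l.take t').filterMap f := by
  induction l generalizing t with
  | nil => exact ⟨0, by simp⟩
  | cons a l ih =>
    cases h : f a with
    | none =>
      obtain ⟨t', ht⟩ := ih t
      exact ⟨t' + 1, by simp [h, ht]⟩
    | some b =>
      cases t with
      | zero => exact ⟨0, by simp⟩
      | succ t =>
        obtain ⟨t', ht⟩ := ih t
        exact ⟨t' + 1, by simp [h, ht]⟩

theorem run_take_filterMap (f : LabMove → Option LabMove) (Γ : Run) (t : ℕ) :
    ∃ t', (Γ.filterMap f).take t = (Γ.take t').filterMap f := by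
  obtain ⟨r, hr⟩ := take_filterMap f Γ t
  obtain ⟨t', ht'⟩ := list_take_filterMap f (Γ.take r) ((Γ.filterMap f).take t).length
  rw [← List.prefix_iff_eq_take.1 hr] at ht'
  rcases le_total t' r with h | h
  · exact ⟨t', by rw [ht', ← take_eq Γ h]⟩
  · refine ⟨r, ?_⟩
    rw [ht', List.take_of_length_le]
    exact Stream'.Seq.length_take_le.trans h

/-! ### Projections that do not touch the labels -/

/-- Apply `g` to the move of a labmove. -/
def lab {M : Type*} (g : M → Option Move) (e : Player × M) : Option LabMove :=
  (g e.2).map fun β => (e.1, β)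

/-- The labmoves of the player `q`. -/
def sel (q : Player) (m : LabMove) : Option LabMove := if m.1 = q then some m else none

/-- A projection that ignores labels commutes with the selection of a player, so relations stated
through `sel` survive in every thread. -/
theorem sel_lab (q : Player) (g : Move → Option Move) (m : LabMove) :
    (lab g m).bind (sel q) = (sel q m).bind (lab g) := by
  rcases m with ⟨p, α⟩
  by_cases h : p = q
  · subst h
    cases hg : g α <;> simp [lab, sel, hg]
  · cases hg : g α <;> simp [lab, sel, hg, h]

theorem filterMap_lab_sel (q : Player) (g : Move → Option Move) (l : Position) :
    (l.filterMap (lab g)).filterMap (sel q) = (l.filterMap (sel q)).filterMap (lab g) := by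
  rw [List.filterMap_filterMap, List.filterMap_filterMap]
  congr 1
  funext m
  exact sel_lab q g m

/-! ### Delays -/

/-- `Ω` is ahead of `Γ` as far as the adversary of `p` is concerned, and behind as far as `p` is
concerned. -/
def Behind (p : Player) (Ω Γ : Position) : Prop :=
  Ω.filterMap (sel p) <+: Γ.filterMap (sel p) ∧ Γ.filterMap (sel !p) <+: Ω.filterMap (sel !p)

theorem Behind.lab {p : Player} {Ω Γ : Position} (h : Behind p Ω Γ) (g : Move → Option Move) :
    Behind p (Ω.filterMap (lab g)) (Γ.filterMap (lab g)) := by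
  constructor
  · rw [filterMap_lab_sel, filterMap_lab_sel]
    exact h.1.filterMap _
  · rw [filterMap_lab_sel, filterMap_lab_sel]
    exact h.2.filterMap _

/-- The position `Ω` may be obtained from `Γ` by delaying, omitting some moves of `p`, and adding
some moves of the adversary. -/
def PosDelay (p : Player) (Ω Γ : Position) : Prop :=
  Behind p Ω Γ ∧ ∀ t, ∃ s, Behind p (Ω.take t) (Γ.take s)

theorem PosDelay.lab {p : Player} {Ω Γ : Position} (h : PosDelay p Ω Γ) (g : Move → Option Move) :
    PosDelay p (Ω.filterMap (lab g)) (Γ.filterMap (lab g)) := by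
  refine ⟨h.1.lab g, fun t => ?_⟩
  obtain ⟨t', ht'⟩ := list_take_filterMap (CoL.lab g) Ω t
  obtain ⟨s, hs⟩ := h.2 t'
  refine ⟨((Γ.take s).filterMap (CoL.lab g)).length, ?_⟩
  rw [ht', ← List.prefix_iff_eq_take.1 ((List.take_prefix s Γ).filterMap _)]
  exact hs.lab g

/-- A description of delays through finite initial segments. -/
def RunDelay (p : Player) (Ω Γ : Run) : Prop :=
  (∀ q, Ω.filterMap (sel q) = Γ.filterMap (sel q)) ∧ ∀ t, ∃ s, Behind p (Ω.take t) (Γ.take s)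

theorem RunDelay.lab {p : Player} {Ω Γ : Run} (h : RunDelay p Ω Γ) (g : Move → Option Move) :
    RunDelay p (Ω.filterMap (lab g)) (Γ.filterMap (lab g)) := by
  have e : ∀ (q : Player) (Δ : Run), (Δ.filterMap (CoL.lab g)).filterMap (sel q) =
      (Δ.filterMap (sel q)).filterMap (CoL.lab g) := by
    intro q Δ
    rw [filterMap_filterMap, filterMap_filterMap]
    congr 1
    funext m
    exact sel_lab q g m
  refine ⟨fun q => by rw [e, e, h.1], fun t => ?_⟩
  obtain ⟨t', ht'⟩ := run_take_filterMap (CoL.lab g) Ω t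
  obtain ⟨s, hs⟩ := h.2 t'
  refine ⟨((Γ.take s).filterMap (CoL.lab g)).length, ?_⟩
  rw [ht', take_filterMap_length]
  exact hs.lab g

theorem filter_eq_filterMap_sel (q : Player) (l : Position) :
    (l.filter fun m => m.1 = q) = l.filterMap (sel q) := by
  rw [← List.filterMap_eq_filter]
  congr 1
  funext m
  simp [sel, Option.guard]

/-- Translates places of moves into lengths of selected initial segments, the language of
`RunDelay`. -/
theorem lt_of_nthAt {Γ : Run} {q : Player} {n i s : ℕ} (h : NthAt Γ q n i) :
    i < s ↔ n < ((Γ.take s).filterMap (sel q)).length := by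
  obtain ⟨⟨α, hα⟩, hn⟩ := h
  rw [filter_eq_filterMap_sel] at hn
  have h1 : ((Γ.take (i + 1)).filterMap (sel q)).length = n + 1 := by
    rw [take_succ_of_some hα, List.filterMap_append]
    simp [sel, hn]
  constructor
  · intro hs
    have : _ ≤ ((Γ.take s).filterMap (sel q)).length :=
      ((chain_take Γ) (i + 1) s hs).filterMap (sel q) |>.length_le
    change ((Γ.take (i + 1)).filterMap (sel q)).length ≤ _ at this
    omega
  · intro hs
    by_contra hc
    have : _ ≤ ((Γ.take i).filterMap (sel q)).length :=
      ((chain_take Γ) s i (by omega)).filterMap (sel q) |>.length_le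
    change ((Γ.take s).filterMap (sel q)).length ≤ _ at this
    omega

/-- Cut `Ω` just after its `n`-th `p`-move and take the matching cut of `Γ`. That cut contains the
`n`-th `p`-move of `Γ`, hence also the earlier `k`-th move of the adversary, and then the cut of `Ω`
contains the latter as well. -/
theorem RunDelay.isDelay {p : Player} {Ω Γ : Run} (h : RunDelay p Ω Γ) : IsDelay p Ω Γ := by
  refine ⟨h.1, ?_⟩
  intro n k i j hi hj hji i' j' hi' hj'
  obtain ⟨s, hs1, hs2⟩ := h.2 (i' + 1)
  have h1 := (lt_of_nthAt hi').1 (Nat.lt_succ_self i')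
  have h2 := (lt_of_nthAt hi).2 (lt_of_lt_of_le h1 hs1.length_le)
  have h3 := (lt_of_nthAt hj).1 (hji.trans h2)
  have h4 := (lt_of_nthAt hj').2 (lt_of_lt_of_le h3 hs2.length_le)
  have : j' ≠ i' := by
    rintro rfl
    obtain ⟨⟨α, hα⟩, -⟩ := hi'
    obtain ⟨⟨β, hβ⟩, -⟩ := hj'
    rw [hα] at hβ
    have : p = !p := by simpa using congrArg (Option.map Prod.fst) hβ
    cases p <;> simp at this
  omega

/-- What is needed of a game to win a copycat play. -/
structure Game.Transfer (A : Game) : Prop where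
  legal : ∀ p Ω α Γ, PosDelay p (Ω ++ [(p, α)]) Γ → Position.toRun Γ ∈ A.Lr →
    Position.toRun Ω ∈ A.Lr → Position.toRun (Ω ++ [(p, α)]) ∈ A.Lr
  win : ∀ p Ω Γ, RunDelay p Ω Γ → Ω ∈ A.Lr → Γ ∈ A.Lr → A.Wn Γ = p → A.Wn Ω = p

theorem sel_sel (p q : Player) (l : Position) : (l.filterMap (sel p)).filterMap (sel q) =
    if p = q then l.filterMap (sel p) else [] := by
  rw [List.filterMap_filterMap]
  split_ifs with h
  · subst h
    congr 1
    funext m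
    by_cases hm : m.1 = p <;> simp [sel, hm]
  · rw [List.filterMap_eq_nil_iff]
    intro m _
    by_cases hm : m.1 = p
    · simp [sel, hm, h]
    · simp [sel, hm]

theorem sel_rest {p : Player} {X Y R : Position}
    (h : X.filterMap (sel p) ++ R = Y.filterMap (sel p)) :
    R.filterMap (sel p) = R ∧ R.filterMap (sel !p) = [] := by
  have e := congrArg (List.filterMap (sel p)) h
  have e' := congrArg (List.filterMap (sel !p)) h
  rw [List.filterMap_append, sel_sel, sel_sel, if_pos rfl, if_pos rfl, ← h] at e
  rw [List.filterMap_append, sel_sel, sel_sel, if_neg (by cases p <;> simp)] at e'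
  exact ⟨List.append_cancel_left e, by simpa using e'⟩

/-- A `PosDelay` need not be a delay, because moves of `p` may be missing in `Ω` and moves of the
adversary in `Γ`. Appending the missing ones (`R` and `T`) makes it a genuine delay, to which
staticness applies. -/
theorem Game.Static.transfer {A : Game} (h : A.Static) : A.Transfer where
  win p Ω Γ hd _ _ hw := (h p Γ Ω hd.isDelay).2 hw
  legal p Ω α Γ hd hΓ hΩ := by
    by_contra hc
    obtain ⟨⟨⟨R, hR⟩, T, hT⟩, hts⟩ := hd
    have hsR := sel_rest hR
    have hsT := sel_rest hT
    rw [Bool.not_not] at hsT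
    set Ω' := Ω ++ [(p, α)] with hΩ'
    -- Segments inside `Ω'` are matched as in `PosDelay`; segments that reach into `R` are matched
    -- with the whole of `Γ`, without `T`.
    have hdel : RunDelay p (Position.toRun (Ω' ++ R)) (Position.toRun (Γ ++ T)) := by
      constructor
      · intro q
        rw [filterMap_toRun, filterMap_toRun, List.filterMap_append (l := Ω'),
          List.filterMap_append (l := Γ)]
        by_cases hq : q = p
        · subst hq
          rw [hsR.1, hR, hsT.2, List.append_nil]
        · have hq : q = !p := by cases p <;> cases q <;> simp_all
          subst hq
          rw [hsR.2, hsT.1, hT, List.append_nil]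
      · intro t
        rw [take_toRun]
        rcases le_total t Ω'.length with ht | ht
        · obtain ⟨s, hs⟩ := hts t
          rcases le_total s Γ.length with hsl | hsl
          · refine ⟨s, ?_⟩
            rw [take_toRun, List.take_append_of_le_length ht, List.take_append_of_le_length hsl]
            exact hs
          · refine ⟨Γ.length, ?_⟩
            rw [take_toRun, List.take_append_of_le_length ht, List.take_left]
            rwa [List.take_of_length_le hsl] at hs
        · refine ⟨Γ.length, ?_⟩
          rw [take_toRun, List.take_left, List.take_append, List.take_of_length_le ht]
          constructor
          · rw [List.filterMap_append (l := Ω'), ← hR]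
            refine (List.prefix_append_right_inj _).2 ?_
            have := (List.take_prefix (t - Ω'.length) R).filterMap (sel p)
            rwa [hsR.1] at this
          · rw [List.filterMap_append (l := Ω'), ← hT, List.append_assoc]
            exact List.prefix_append _ _
    have hill : A.Illegal p (Position.toRun (Ω' ++ R)) := by
      refine ⟨Ω.length, α, ?_, ?_, ?_⟩
      · rw [Position.toRun, Stream'.Seq.ofList_get?]
        simp [hΩ']
      · intro m hm
        rw [take_toRun, hΩ', List.append_assoc, List.take_append_of_le_length hm]
        exact A.lr_iff.prefix (List.take_prefix _ _) hΩ
      · rw [take_toRun]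
        have : (Ω' ++ R).take (Ω.length + 1) = Ω' := by
          rw [List.take_append_of_le_length (by simp [hΩ'])]
          exact List.take_of_length_le (by simp [hΩ'])
        rw [this]
        exact hc
    -- By staticness the blame goes back to `Γ ++ T`. But `Γ` is legal and `T` consists of moves of
    -- the adversary only, so the first illegal move cannot be one of `p`.
    have hill' : A.Illegal p (Position.toRun (Γ ++ T)) := by
      by_contra hn
      exact (h p _ _ hdel.isDelay).1 hn hill
    obtain ⟨n, β, h1, h2, h3⟩ := hill'
    rcases lt_or_ge n Γ.length with hn | hn
    · rw [take_toRun, List.take_append_of_le_length hn] at h3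
      exact h3 (A.lr_iff.prefix (List.take_prefix _ _) hΓ)
    · simp only [Position.toRun, Stream'.Seq.ofList_get?, List.getElem?_append_right hn] at h1
      have hmem := List.mem_of_getElem? h1
      rw [← hsT.1, List.mem_filterMap] at hmem
      obtain ⟨a, -, ha⟩ := hmem
      by_cases hap : a.1 = !p
      · simp [sel, hap] at ha
        rw [ha] at hap
        cases p <;> simp at hap
      · simp [sel, hap] at ha

end CoL

/-! ### Transfer for compound games and De Morgan duality. -/

namespace CoL

theorem mem_toRun {Φ : Position} {m : LabMove} : m ∈ Position.toRun Φ ↔ m ∈ Φ := by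
  constructor
  · intro h
    obtain ⟨n, hn⟩ := mem_take_of_mem h
    rw [take_toRun] at hn
    exact List.mem_of_mem_take hn
  · intro h
    apply mem_of_mem_take (n := Φ.length)
    rwa [take_toRun, List.take_length]

open Classical in
/-- The `β` with `P α β`, if there is one. -/
noncomputable def pick (P : Move → Move → Prop) (α : Move) : Option Move :=
  if h : ∃ β, P α β then some h.choose else none

theorem pick_eq_some {P : Move → Move → Prop} (hP : ∀ α β β', P α β → P α β' → β = β')
    {α β : Move} : pick P α = some β ↔ P α β := by
  unfold pick
  split_ifs with h
  · constructor
    · intro e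
      rw [← Option.some.inj e]
      exact h.choose_spec
    · intro e
      rw [hP _ _ _ h.choose_spec e]
  · simp only [false_iff]
    exact fun e => h ⟨β, e⟩

theorem project_eq (P : Move → Move → Prop) (Γ : Run) :
    Γ.project P = Γ.filterMap (lab (pick P)) := by
  unfold Run.project
  congr 1
  funext m
  unfold lab pick
  split_ifs <;> rfl

theorem ofWin_wn {L : Set Run} {hL : IsLegality L} {W : Run → Prop} {Γ : Run} (h : Γ ∈ L) :
    (Game.ofWin L hL W).Wn Γ = top ↔ W Γ := by
  unfold Game.ofWin
  simp [h]

/-- The legal runs of `G` are those whose moves are of a certain form and whose threads (given by `g`)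
are legal runs of the games `H i`. -/
def Decomp (G : Game) {ι : Type*} (form : Move → Prop) (g : ι → Move → Option Move)
    (H : ι → Game) : Prop :=
  ∀ Γ, Γ ∈ G.Lr ↔ (∀ m ∈ Γ, form m.2) ∧ ∀ i, Γ.filterMap (lab (g i)) ∈ (H i).Lr

/-- The component `i` of a move in a parallel combination. -/
noncomputable def side (i : Bool) : Move → Option Move :=
  pick fun m β => m = compPrefix (i.toNat + 1) ++ β

/-- The branch `x` of a move in a recurrence. -/
noncomputable def brn (x : ℕ → Bool) : Move → Option Move :=
  pick fun m β => ∃ u, IsInitial u x ∧ m = bits u ++ dot :: β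

/-- The form of the moves of parallel combinations. -/
def ParForm (m : Move) : Prop := ∃ α, m = compPrefix 1 ++ α ∨ m = compPrefix 2 ++ α

/-- The form of the moves of recurrences. -/
def RecForm (m : Move) : Prop := ∃ w α, m = bits w ++ dot :: α

theorem mem_parLegal {A B : Game} {Γ : Run} : Γ ∈ parLegal A B ↔
    (∀ m ∈ Γ, ParForm m.2) ∧ ∀ i : Bool, Γ.filterMap (lab (side i)) ∈ (cond i B A).Lr := by
  unfold parLegal Run.sub
  simp only [project_eq]
  refine and_congr Iff.rfl ?_
  rw [Bool.forall_bool]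
  exact Iff.rfl

theorem decomp_conj (A B : Game) :
    Decomp (A.conj B) ParForm side (fun i => cond i B A) := fun _ => mem_parLegal

theorem decomp_disj (A B : Game) :
    Decomp (A.disj B) ParForm side (fun i => cond i B A) := fun _ => mem_parLegal

theorem mem_recLegal {A : Game} {Γ : Run} : Γ ∈ recLegal A ↔
    (∀ m ∈ Γ, RecForm m.2) ∧ ∀ x, Γ.filterMap (lab (brn x)) ∈ A.Lr := by
  unfold recLegal Run.branch
  simp only [project_eq]
  exact Iff.rfl

theorem decomp_recur (A : Game) : Decomp A.recur RecForm brn fun _ => A := fun _ => mem_recLegal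

theorem decomp_corecur (A : Game) : Decomp A.corecur RecForm brn fun _ => A :=
  fun _ => mem_recLegal

theorem conj_wn {A B : Game} {Γ : Run} (h : Γ ∈ (A.conj B).Lr) : (A.conj B).Wn Γ = top ↔
    ∀ i : Bool, (cond i B A).Wn (Γ.filterMap (lab (side i))) = top := by
  rw [Bool.forall_bool]
  refine (ofWin_wn h).trans ?_
  unfold Run.sub
  simp only [project_eq]
  rfl

theorem disj_wn {A B : Game} {Γ : Run} (h : Γ ∈ (A.disj B).Lr) : (A.disj B).Wn Γ = top ↔
    ∃ i : Bool, (cond i B A).Wn (Γ.filterMap (lab (side i))) = top := by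
  rw [Bool.exists_bool]
  refine (ofWin_wn h).trans ?_
  unfold Run.sub
  simp only [project_eq]
  rfl

theorem recur_wn {A : Game} {Γ : Run} (h : Γ ∈ A.recur.Lr) : A.recur.Wn Γ = top ↔
    ∀ v, EssFinite v → A.Wn (Γ.filterMap (lab (brn v))) = top := by
  refine (ofWin_wn h).trans ?_
  unfold Run.branch
  simp only [project_eq]
  rfl

theorem corecur_wn {A : Game} {Γ : Run} (h : Γ ∈ A.corecur.Lr) : A.corecur.Wn Γ = top ↔
    ∃ v, EssFinite v ∧ A.Wn (Γ.filterMap (lab (brn v))) = top := by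
  refine (ofWin_wn h).trans ?_
  unfold Run.branch
  simp only [project_eq]
  rfl

/-- All operations determine legality by the form of moves and by threads, and delays pass to
threads; so only the winning condition has to be treated separately for each operation. -/
theorem Decomp.transfer {G : Game} {ι : Type*} {form : Move → Prop} {g : ι → Move → Option Move}
    {H : ι → Game} (hG : Decomp G form g H) (hH : ∀ i, (H i).Transfer)
    (hW : ∀ p Γ Ω, Γ ∈ G.Lr → Ω ∈ G.Lr → (∀ i, (H i).Wn (Γ.filterMap (lab (g i))) = p →
      (H i).Wn (Ω.filterMap (lab (g i))) = p) → G.Wn Γ = p → G.Wn Ω = p) : G.Transfer where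
  win p Ω Γ hd hΩ hΓ hw :=
    hW p Γ Ω hΓ hΩ (fun i => (hH i).win p _ _ (hd.lab _) (((hG _).1 hΩ).2 i) (((hG _).1 hΓ).2 i)) hw
  legal p Ω α Γ hd hΓ hΩ := by
    rw [hG] at hΓ hΩ ⊢
    refine ⟨?_, fun i => ?_⟩
    · intro m hm
      rw [mem_toRun, List.mem_append, List.mem_singleton] at hm
      rcases hm with hm | rfl
      · exact hΩ.1 m (mem_toRun.2 hm)
      · refine hΓ.1 _ (mem_toRun.2 ?_)
        -- The move `α` occurs among the `p`-moves of the legal position `Γ`, hence it has the right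
        -- form.
        have h1 : ((p, α) : LabMove) ∈ (Ω ++ [(p, α)]).filterMap (sel p) := by
          rw [List.mem_filterMap]
          exact ⟨(p, α), by simp, by simp [sel]⟩
        have h2 := hd.1.1.subset h1
        rw [List.mem_filterMap] at h2
        obtain ⟨a, ha, hs⟩ := h2
        unfold sel at hs
        split_ifs at hs
        rwa [← Option.some.inj hs]
    · have h1 := hΓ.2 i
      have h2 := hΩ.2 i
      have h3 := hd.lab (g i)
      rw [filterMap_toRun] at h1 h2 ⊢
      rw [List.filterMap_append] at h3 ⊢
      cases hg : g i α with
      | none => simpa [lab, hg] using h2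
      | some β =>
        have : List.filterMap (lab (g i)) [((p, α) : LabMove)] = [(p, β)] := by simp [lab, hg]
        rw [this] at h3 ⊢
        exact (hH i).legal p _ β _ h3 h1 h2

/-- Winning conditions are stated for `⊤`; the case of `⊥` is treated by contraposition. -/
theorem eq_of_top_iff {p a b : Player} (h : p = top → a = top → b = top)
    (h' : p = bot → b = top → a = top) (ha : a = p) : b = p := by
  revert h h' ha
  cases p <;> cases a <;> cases b <;> simp

theorem Game.Transfer.conj {A B : Game} (hA : A.Transfer) (hB : B.Transfer) :
    (A.conj B).Transfer := by
  refine (decomp_conj A B).transfer (fun i => by cases i <;> assumption) ?_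
  intro p Γ Ω hΓ hΩ h
  apply eq_of_top_iff
  · rintro rfl hw
    rw [conj_wn hΓ] at hw
    rw [conj_wn hΩ]
    exact fun i => h i (hw i)
  · rintro rfl hw
    rw [conj_wn hΩ] at hw
    rw [conj_wn hΓ]
    intro i
    by_contra hc
    have := h i (by simpa using hc)
    rw [hw i] at this
    simp at this

theorem Game.Transfer.disj {A B : Game} (hA : A.Transfer) (hB : B.Transfer) :
    (A.disj B).Transfer := by
  refine (decomp_disj A B).transfer (fun i => by cases i <;> assumption) ?_
  intro p Γ Ω hΓ hΩ h
  apply eq_of_top_iff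
  · rintro rfl hw
    rw [disj_wn hΓ] at hw
    rw [disj_wn hΩ]
    obtain ⟨i, hi⟩ := hw
    exact ⟨i, h i hi⟩
  · rintro rfl hw
    rw [disj_wn hΩ] at hw
    rw [disj_wn hΓ]
    obtain ⟨i, hi⟩ := hw
    refine ⟨i, ?_⟩
    by_contra hc
    have := h i (by simpa using hc)
    rw [hi] at this
    simp at this

theorem Game.Transfer.recur {A : Game} (hA : A.Transfer) : A.recur.Transfer := by
  refine (decomp_recur A).transfer (fun _ => hA) ?_
  intro p Γ Ω hΓ hΩ h
  apply eq_of_top_iff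
  · rintro rfl hw
    rw [recur_wn hΓ] at hw
    rw [recur_wn hΩ]
    exact fun v hv => h v (hw v hv)
  · rintro rfl hw
    rw [recur_wn hΩ] at hw
    rw [recur_wn hΓ]
    intro v hv
    by_contra hc
    have := h v (by simpa using hc)
    rw [hw v hv] at this
    simp at this

theorem Game.Transfer.corecur {A : Game} (hA : A.Transfer) : A.corecur.Transfer := by
  refine (decomp_corecur A).transfer (fun _ => hA) ?_
  intro p Γ Ω hΓ hΩ h
  apply eq_of_top_iff
  · rintro rfl hw
    rw [corecur_wn hΓ] at hw
    rw [corecur_wn hΩ]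
    obtain ⟨v, hv, hi⟩ := hw
    exact ⟨v, hv, h v hi⟩
  · rintro rfl hw
    rw [corecur_wn hΩ] at hw
    rw [corecur_wn hΓ]
    obtain ⟨v, hv, hi⟩ := hw
    refine ⟨v, hv, ?_⟩
    by_contra hc
    have := h v (by simpa using hc)
    rw [hi] at this
    simp at this

/-! ### Negation -/

/-- The labmove with the label switched. -/
def flip (m : LabMove) : LabMove := (!m.1, m.2)

@[simp] theorem flip_flip (m : LabMove) : flip (flip m) = m := by simp [flip]

theorem neg_eq (Γ : Run) : Γ.neg = Γ.filterMap fun m => some (flip m) := by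
  conv_rhs => rw [← limit_take Γ]
  rw [filterMap_limit (chain_take Γ)]
  ext1 n
  have hc : Chain fun r => (Γ.take r).filterMap fun m => some (flip m) :=
    (chain_take Γ).filterMap _
  rw [Run.neg, Stream'.Seq.map_get?]
  cases h : Γ.get? n with
  | none =>
    rw [show (Run.limit _).get? n = none from dif_neg ?_]
    · rfl
    · rintro ⟨t, ht⟩
      rw [List.filterMap_eq_map', List.length_map] at ht
      have : (Γ.take t)[n]? = none := by
        rw [Stream'.Seq.getElem?_take, h]; simp
      rw [List.getElem?_eq_none_iff] at this
      omega
  | some m =>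
    have h1 := take_succ_of_some h
    have h2 : (Γ.take (n + 1))[n]? = some m := by
      rw [Stream'.Seq.getElem?_take, h]; simp
    obtain ⟨hlt, -⟩ := List.getElem?_eq_some_iff.1 h2
    rw [get?_limit hc (t := n + 1) (by rwa [List.filterMap_eq_map', List.length_map]),
      List.filterMap_eq_map', List.getElem?_map, h2]
    rfl

theorem neg_neg_run (Γ : Run) : Γ.neg.neg = Γ := by
  rw [Run.neg, Run.neg, ← Stream'.Seq.map_comp]
  convert Stream'.Seq.map_id Γ
  funext m
  simp

theorem neg_toRun (Φ : Position) : (Position.toRun Φ).neg = Position.toRun (Φ.map flip) := by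
  rw [neg_eq, filterMap_toRun, List.filterMap_eq_map']

theorem lab_flip (g : Move → Option Move) (m : LabMove) :
    lab g (flip m) = (lab g m).map flip := by
  unfold lab flip
  cases g m.2 <;> rfl

theorem filterMap_neg (g : Move → Option Move) (Γ : Run) :
    Γ.neg.filterMap (lab g) = (Γ.filterMap (lab g)).neg := by
  rw [neg_eq, neg_eq, filterMap_filterMap, filterMap_filterMap]
  congr 1
  funext m
  simp only [Option.bind_some]
  rw [lab_flip]
  cases lab g m <;> rfl

theorem mem_neg {Γ : Run} {m : LabMove} : m ∈ Γ.neg ↔ flip m ∈ Γ := by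
  rw [Run.neg]
  constructor
  · intro h
    obtain ⟨a, ha, rfl⟩ := Stream'.Seq.exists_of_mem_map h
    simpa [flip] using ha
  · intro h
    have := Stream'.Seq.mem_map flip h
    rwa [flip_flip] at this

theorem sel_flip (q : Player) (l : Position) :
    (l.map flip).filterMap (sel q) = (l.filterMap (sel !q)).map flip := by
  induction l with
  | nil => rfl
  | cons m l ih =>
    rcases m with ⟨p, α⟩
    rw [List.map_cons, List.filterMap_cons, List.filterMap_cons, ih]
    cases p <;> cases q <;> simp [sel, flip]

theorem Behind.neg {p : Player} {Ω Γ : Position} (h : Behind p Ω Γ) :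
    Behind (!p) (Ω.map flip) (Γ.map flip) := by
  constructor
  · rw [sel_flip, sel_flip, Bool.not_not]
    exact h.1.map _
  · rw [sel_flip, sel_flip, Bool.not_not]
    exact h.2.map _

theorem PosDelay.neg {p : Player} {Ω Γ : Position} (h : PosDelay p Ω Γ) :
    PosDelay (!p) (Ω.map flip) (Γ.map flip) := by
  refine ⟨h.1.neg, fun t => ?_⟩
  obtain ⟨s, hs⟩ := h.2 t
  refine ⟨s, ?_⟩
  rw [← List.map_take, ← List.map_take]
  exact hs.neg

theorem take_neg (Γ : Run) (t : ℕ) : Γ.neg.take t = (Γ.take t).map flip := by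
  apply List.ext_getElem?
  intro k
  rw [List.getElem?_map, Stream'.Seq.getElem?_take, Stream'.Seq.getElem?_take, Run.neg,
    Stream'.Seq.map_get?]
  split_ifs <;> rfl

theorem RunDelay.neg {p : Player} {Ω Γ : Run} (h : RunDelay p Ω Γ) :
    RunDelay (!p) Ω.neg Γ.neg := by
  have e : ∀ (q : Player) (Δ : Run),
      Δ.neg.filterMap (sel q) = (Δ.filterMap (sel !q)).neg := by
    intro q Δ
    rw [neg_eq, neg_eq, filterMap_filterMap, filterMap_filterMap]
    congr 1
    funext m
    rcases m with ⟨p, α⟩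
    cases p <;> cases q <;> simp [sel, flip]
  refine ⟨fun q => by rw [e, e, h.1], fun t => ?_⟩
  obtain ⟨s, hs⟩ := h.2 t
  refine ⟨s, ?_⟩
  rw [take_neg, take_neg]
  exact hs.neg

theorem neg_wn {A : Game} {Γ : Run} (h : Γ ∈ A.neg.Lr) : A.neg.Wn Γ = top ↔ A.Wn Γ.neg = bot :=
  ofWin_wn h

/-- Switching labels turns a `p`-delay into a delay for the adversary of `p`, which is why
`Transfer` quantifies over both players. -/
theorem Game.Transfer.neg {A : Game} (hA : A.Transfer) : A.neg.Transfer where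
  legal p Ω α Γ hd hΓ hΩ := by
    change (Position.toRun _).neg ∈ A.Lr at hΓ hΩ ⊢
    rw [neg_toRun] at hΓ hΩ ⊢
    have := hd.neg
    rw [List.map_append] at this ⊢
    exact hA.legal _ _ _ _ this hΓ hΩ
  win p Ω Γ hd hΩ hΓ := by
    have key := hA.win (!p) _ _ hd.neg hΩ hΓ
    apply eq_of_top_iff
    · rintro rfl hw
      rw [neg_wn hΓ] at hw
      rw [neg_wn hΩ]
      exact key hw
    · rintro rfl hw
      rw [neg_wn hΩ] at hw
      rw [neg_wn hΓ]
      by_contra hc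
      have := key (by simpa using hc)
      rw [hw] at this
      simp at this

/-- The staticness of the atoms enters the proof of soundness here only. -/
theorem Formula.transfer (I : Interpretation) (F : Formula) : (F.interp I).Transfer := by
  induction F with
  | atom P => exact (I.static P).transfer
  | natom P => exact (I.static P).transfer.neg
  | conj E F hE hF => exact hE.conj hF
  | disj E F hE hF => exact hE.disj hF
  | recur F hF => exact hF.recur
  | corecur F hF => exact hF.corecur

theorem Formula.neg_neg (F : Formula) : F.neg.neg = F := by
  induction F <;> simp_all [Formula.neg]

theorem Decomp.dual {G G' : Game} {ι : Type*} {form : Move → Prop} {g : ι → Move → Option Move}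
    {H H' : ι → Game} (hG : Decomp G form g H) (hG' : Decomp G' form g H')
    (h : ∀ i Γ, Γ ∈ (H' i).Lr ↔ Γ.neg ∈ (H i).Lr) (Γ : Run) : Γ ∈ G'.Lr ↔ Γ.neg ∈ G.Lr := by
  rw [hG, hG']
  refine and_congr ?_ (forall_congr' fun i => ?_)
  · constructor
    · intro h m hm
      exact h (flip m) (mem_neg.1 hm)
    · intro h m hm
      exact h (flip m) (mem_neg.2 (by simpa using hm))
  · rw [filterMap_neg, h]

/-- `¬F` is a De Morgan dual and not literally the negated game. Dual operations have the same legal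
runs up to labels and complementary winning conditions, so the two agree on legal runs, which is all
that copy-cat needs. -/
theorem Formula.neg_interp (I : Interpretation) (F : Formula) :
    (∀ Γ, Γ ∈ (F.neg.interp I).Lr ↔ Γ.neg ∈ (F.interp I).Lr) ∧
    ∀ Γ, Γ ∈ (F.neg.interp I).Lr →
      ((F.neg.interp I).Wn Γ = top ↔ (F.interp I).Wn Γ.neg = bot) := by
  have nt : ∀ {a : Player}, a = bot ↔ ¬ a = top := by simp
  induction F with
  | atom P => exact ⟨fun Γ => Iff.rfl, fun Γ hΓ => neg_wn hΓ⟩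
  | natom P =>
    have h : ∀ Γ, Γ ∈ (I.game P).Lr ↔ Γ.neg ∈ (I.game P).neg.Lr := by
      intro Γ
      show _ ↔ Γ.neg.neg ∈ (I.game P).Lr
      rw [neg_neg_run]
    refine ⟨h, fun Γ hΓ => ?_⟩
    change (I.game P).Wn Γ = top ↔ (I.game P).neg.Wn Γ.neg = bot
    rw [nt, neg_wn ((h Γ).1 hΓ), neg_neg_run]
    simp
  | conj E F hE hF =>
    have h := (decomp_conj (E.interp I) (F.interp I)).dual
      (decomp_disj (E.neg.interp I) (F.neg.interp I)) (by
        rintro (_ | _)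
        · exact hE.1
        · exact hF.1)
    refine ⟨h, fun Γ hΓ => ?_⟩
    have h2 := mem_parLegal.1 hΓ
    change (Game.disj _ _).Wn Γ = top ↔ (Game.conj _ _).Wn Γ.neg = bot
    rw [nt, disj_wn hΓ, conj_wn ((h Γ).1 hΓ), not_forall]
    refine exists_congr fun i => ?_
    rw [filterMap_neg, ← nt]
    cases i
    · exact hE.2 _ (h2.2 false)
    · exact hF.2 _ (h2.2 true)
  | disj E F hE hF =>
    have h := (decomp_disj (E.interp I) (F.interp I)).dual
      (decomp_conj (E.neg.interp I) (F.neg.interp I)) (by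
        rintro (_ | _)
        · exact hE.1
        · exact hF.1)
    refine ⟨h, fun Γ hΓ => ?_⟩
    have h2 := mem_parLegal.1 hΓ
    change (Game.conj _ _).Wn Γ = top ↔ (Game.disj _ _).Wn Γ.neg = bot
    rw [nt, conj_wn hΓ, disj_wn ((h Γ).1 hΓ), not_exists]
    refine forall_congr' fun i => ?_
    rw [filterMap_neg, ← nt]
    cases i
    · exact hE.2 _ (h2.2 false)
    · exact hF.2 _ (h2.2 true)
  | recur F hF =>
    have h := (decomp_recur (F.interp I)).dual
      (decomp_corecur (F.neg.interp I)) (fun _ => hF.1)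
    refine ⟨h, fun Γ hΓ => ?_⟩
    have h2 := mem_recLegal.1 hΓ
    change (Game.corecur _).Wn Γ = top ↔ (Game.recur _).Wn Γ.neg = bot
    rw [nt, corecur_wn hΓ, recur_wn ((h Γ).1 hΓ)]
    push Not
    refine exists_congr fun v => and_congr Iff.rfl ?_
    rw [filterMap_neg]
    exact (hF.2 _ (h2.2 v)).trans nt
  | corecur F hF =>
    have h := (decomp_corecur (F.interp I)).dual
      (decomp_recur (F.neg.interp I)) (fun _ => hF.1)
    refine ⟨h, fun Γ hΓ => ?_⟩
    have h2 := mem_recLegal.1 hΓ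
    change (Game.recur _).Wn Γ = top ↔ (Game.corecur _).Wn Γ.neg = bot
    rw [nt, recur_wn hΓ, corecur_wn ((h Γ).1 hΓ)]
    push Not
    refine forall_congr' fun v => imp_congr Iff.rfl ?_
    rw [filterMap_neg]
    exact (hF.2 _ (h2.2 v)).trans nt

end CoL

namespace CoL

/-! ### Structured moves and strategies -/

/-- A move `a;u₁,…,uₙ.β` of a cirquent, with `a` counted from `0`, as a triple. -/
abbrev PMove := ℕ × List (List Bool) × Move

/-- Finite sequences of labelled structured moves. -/
abbrev SPos := List (Player × PMove)

/-- The size of a structured move. -/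
def PMove.size (m : PMove) : ℕ := m.2.1.flatten.length + m.2.2.length

/-- The greatest size of the elements of a list. -/
def sizes (l : List PMove) : ℕ := (l.map PMove.size).foldr max 0

theorem size_le_sizes {l : List PMove} {m : PMove} (h : m ∈ l) : m.size ≤ sizes l := by
  induction l with
  | nil => simp at h
  | cons a l ih =>
    simp only [sizes, List.map_cons, List.foldr_cons] at ih ⊢
    rcases List.mem_cons.1 h with rfl | h
    · exact le_max_left _ _
    · exact (ih h).trans (le_max_right _ _)

/-- A game on structured moves: a run is legal iff its moves are well-formed and all its threads (given
by `pr`) are legal. -/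
structure Sys (ι : Type) where
  wf : PMove → Prop
  pr : ι → PMove → Option Move
  G : ι → Game

/-- The thread `i` of a position. -/
def Sys.view {ι : Type} (𝒮 : Sys ι) (i : ι) (φ : SPos) : Position := φ.filterMap (lab (𝒮.pr i))

/-- Legal positions. -/
def Sys.Legal {ι : Type} (𝒮 : Sys ι) (φ : SPos) : Prop :=
  (∀ e ∈ φ, 𝒮.wf e.2) ∧ ∀ i, Position.toRun (𝒮.view i φ) ∈ (𝒮.G i).Lr

theorem Sys.Legal.prefix {ι : Type} {𝒮 : Sys ι} {φ ψ : SPos} (h : 𝒮.Legal ψ) (hp : φ <+: ψ) :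
    𝒮.Legal φ :=
  ⟨fun e he => h.1 e (hp.subset he), fun i => (𝒮.G i).lr_iff.prefix (hp.filterMap _) (h.2 i)⟩

theorem Sys.legal_nil {ι : Type} (𝒮 : Sys ι) : 𝒮.Legal [] :=
  ⟨by simp, fun i => (𝒮.G i).lr_iff.empty_mem⟩

/-- A strategy takes a number, which bounds the sizes of all earlier moves, and a list of moves of the
environment, and returns a new bound and a list of replies. -/
abbrev Strategy := ℕ × List PMove → ℕ × List PMove

/-- The bounds returned by the strategy are bounds. -/
def Strategy.Bounding (S : Strategy) : Prop :=
  ∀ N E, N ≤ (S (N, E)).1 ∧ (∀ m ∈ E, m.size ≤ (S (N, E)).1) ∧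
    ∀ m ∈ (S (N, E)).2, m.size ≤ (S (N, E)).1

/-- The positions that arise when the environment plays the moves `E r` in round `r`. -/
def hist (S : Strategy) (N : ℕ → ℕ) (E : ℕ → List PMove) : ℕ → SPos
  | 0 => []
  | r + 1 => hist S N E r ++ ((E r).map (fun m => (bot, m)) ++
      (S (N r, E r)).2.map fun m => (top, m))

theorem hist_prefix (S : Strategy) (N : ℕ → ℕ) (E : ℕ → List PMove) {r s : ℕ} (h : r ≤ s) :
    hist S N E r <+: hist S N E s := by
  induction s, h using Nat.le_induction with
  | base => exact List.prefix_rfl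
  | succ j _ ih => exact ih.trans (List.prefix_append _ _)

theorem chain_view {ι : Type} (𝒮 : Sys ι) (i : ι) (S : Strategy) (N : ℕ → ℕ)
    (E : ℕ → List PMove) : Chain fun r => 𝒮.view i (hist S N E r) :=
  fun _ _ h => (hist_prefix S N E h).filterMap _

/-- The environment has made the first illegal move in `Φ`. -/
def Sys.BotIllegal {ι : Type} (𝒮 : Sys ι) (Φ : ℕ → SPos) : Prop :=
  ∃ r q m, q ++ [(bot, m)] <+: Φ r ∧ 𝒮.Legal q ∧ ¬ 𝒮.Legal (q ++ [(bot, m)])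

/-- The strategy `S` wins the game with the winning condition `W` on the threads of legal runs. -/
def Strategy.Wins {ι : Type} (S : Strategy) (𝒮 : Sys ι) (W : (ι → Run) → Prop) : Prop :=
  ∀ N E, (∀ r, (S (N r, E r)).1 ≤ N (r + 1)) → 𝒮.BotIllegal (hist S N E) ∨
    (∀ r, 𝒮.Legal (hist S N E r)) ∧
      W fun i => Run.limit fun r => 𝒮.view i (hist S N E r)

/-! ### Simulation -/

/-- An event in a simultaneous play of a conclusion and a premise: a move of the environment in
the conclusion or a move of the machine in the premise, together with a bound for sizes. -/
abbrev Event := ℕ × Player × PMove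

/-- What happens in the premise. -/
def upView (tr : ℕ → PMove → List PMove) (e : Event) : SPos :=
  if e.2.1 = bot then (tr e.1 e.2.2).map (fun m => (bot, m)) else [(top, e.2.2)]

/-- What happens in the conclusion. -/
def downView (back : ℕ → PMove → List PMove) (e : Event) : SPos :=
  if e.2.1 = bot then [(bot, e.2.2)] else (back e.1 e.2.2).map (fun m => (top, m))

/-- The numbers in the events are increasing bounds. -/
def Bounded (J : List Event) : Prop :=
  (J.Pairwise fun e e' => e.1 ≤ e'.1 ∧ (e.2.1 = bot ∨ e'.2.1 = bot → e.2.2.size ≤ e'.1)) ∧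
    ∀ e ∈ J, e.2.1 = bot → e.2.2.size ≤ e.1

theorem Bounded.prefix {J K : List Event} (h : Bounded K) (hp : J <+: K) : Bounded J :=
  ⟨h.1.sublist hp.sublist, fun e he => h.2 e (hp.subset he)⟩

/-- The moves of the environment are well-formed in the conclusion, and those of the machine in the
premise. -/
def GoodEvents {ι κ : Type} (𝒜 : Sys ι) (ℬ : Sys κ) (J : List Event) : Prop :=
  ∀ e ∈ J, if e.2.1 = bot then ℬ.wf e.2.2 else 𝒜.wf e.2.2

/-- A move of the environment is translated by `tr`, one of the machine by `back`. -/
structure Sim {ι κ : Type} (𝒜 : Sys ι) (ℬ : Sys κ) (tr back : ℕ → PMove → List PMove) :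
    Prop where
  wfE : ∀ n m, ℬ.wf m → m.size ≤ n → ∀ m' ∈ tr n m, 𝒜.wf m'
  wfM : ∀ n m', 𝒜.wf m' → ∀ m ∈ back n m', ℬ.wf m
  locE : ∀ J n m i, Bounded (J ++ [(n, bot, m)]) → GoodEvents 𝒜 ℬ (J ++ [(n, bot, m)]) →
    (tr n m).filterMap (𝒜.pr i) = [] ∨ ∃ j, 𝒜.G i = ℬ.G j ∧
      (tr n m).filterMap (𝒜.pr i) = (ℬ.pr j m).toList ∧
      𝒜.view i (J.flatMap (upView tr)) = ℬ.view j (J.flatMap (downView back))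
  locM : ∀ J n m j, Bounded (J ++ [(n, top, m)]) → GoodEvents 𝒜 ℬ (J ++ [(n, top, m)]) →
    (back n m).filterMap (ℬ.pr j) = [] ∨ ∃ i, 𝒜.G i = ℬ.G j ∧
      (𝒜.pr i m).toList = (back n m).filterMap (ℬ.pr j) ∧
      𝒜.view i (J.flatMap (upView tr)) = ℬ.view j (J.flatMap (downView back))

theorem filterMap_lab_map {M : Type*} (g : M → Option Move) (p : Player) (l : List M) :
    (l.map fun m => (p, m)).filterMap (lab g) = (l.filterMap g).map fun β => (p, β) := by
  induction l with
  | nil => rfl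
  | cons a l ih =>
    simp only [List.map_cons, List.filterMap_cons, lab] at ih ⊢
    cases g a <;> simp [ih]

theorem filterMap_lab_single {M : Type*} (g : M → Option Move) (p : Player) (m : M) :
    [(p, m)].filterMap (lab g) = (g m).toList.map fun β => (p, β) := by
  simp only [List.filterMap_cons, lab]
  cases g m <;> simp

section
variable {ι κ : Type} {𝒜 : Sys ι} {ℬ : Sys κ} {tr back : ℕ → PMove → List PMove}

theorem goodEvents_of_legal {J : List Event} (hA : 𝒜.Legal (J.flatMap (upView tr)))
    (hB : ℬ.Legal (J.flatMap (downView back))) : GoodEvents 𝒜 ℬ J := by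
  intro e he
  split_ifs with h
  · refine hB.1 (bot, e.2.2) (List.mem_flatMap.2 ⟨e, he, ?_⟩)
    simp [downView, h]
  · refine hA.1 (top, e.2.2) (List.mem_flatMap.2 ⟨e, he, ?_⟩)
    simp [upView, h]

theorem GoodEvents.snoc {J : List Event} (h : GoodEvents 𝒜 ℬ J) {e : Event}
    (he : if e.2.1 = bot then ℬ.wf e.2.2 else 𝒜.wf e.2.2) : GoodEvents 𝒜 ℬ (J ++ [e]) := by
  intro e' he'
  rcases List.mem_append.1 he' with h' | h'
  · exact h e' h'
  · rw [List.mem_singleton] at h'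
    subst h'
    exact he

/-- A thread of the premise either does not notice the translated moves, or by `locE` has exactly
the content, before and after, of some thread of the conclusion. -/
theorem Sim.env_legal (sim : Sim 𝒜 ℬ tr back) {J : List Event} {n : ℕ} {m : PMove}
    (hb : Bounded (J ++ [(n, bot, m)])) (hA : 𝒜.Legal (J.flatMap (upView tr)))
    (hB : ℬ.Legal (J.flatMap (downView back) ++ [(bot, m)])) :
    𝒜.Legal ((J ++ [(n, bot, m)]).flatMap (upView tr)) := by
  have hwf : ℬ.wf m := hB.1 (bot, m) (by simp)
  have hgood : GoodEvents 𝒜 ℬ (J ++ [(n, bot, m)]) :=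
    (goodEvents_of_legal hA (hB.prefix (List.prefix_append _ _))).snoc (by simpa using hwf)
  have e : (J ++ [(n, bot, m)]).flatMap (upView tr) =
      J.flatMap (upView tr) ++ (tr n m).map fun m => (bot, m) := by simp [upView]
  rw [e]
  refine ⟨?_, fun i => ?_⟩
  · intro e he
    rcases List.mem_append.1 he with he | he
    · exact hA.1 e he
    · obtain ⟨m', hm', rfl⟩ := List.mem_map.1 he
      exact sim.wfE n m hwf (hb.2 (n, bot, m) (by simp) rfl) m' hm'
  · unfold Sys.view
    rw [List.filterMap_append, filterMap_lab_map]
    rcases sim.locE J n m i hb hgood with h | ⟨j, hG, h1, h2⟩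
    · rw [h]
      rw [List.map_nil, List.append_nil]
      exact hA.2 i
    · have := hB.2 j
      unfold Sys.view at this h2
      rw [List.filterMap_append, filterMap_lab_single] at this
      rw [h1, h2, hG]
      exact this

/-- The mirror image of `Sim.env_legal`, with `locM` and the roles of premise and conclusion
exchanged. -/
theorem Sim.machine_legal (sim : Sim 𝒜 ℬ tr back) {J : List Event} {n : ℕ} {m : PMove}
    (hb : Bounded (J ++ [(n, top, m)])) (hB : ℬ.Legal (J.flatMap (downView back)))
    (hA : 𝒜.Legal (J.flatMap (upView tr) ++ [(top, m)])) :
    ℬ.Legal ((J ++ [(n, top, m)]).flatMap (downView back)) := by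
  have hwf : 𝒜.wf m := hA.1 (top, m) (by simp)
  have hgood : GoodEvents 𝒜 ℬ (J ++ [(n, top, m)]) :=
    (goodEvents_of_legal (hA.prefix (List.prefix_append _ _)) hB).snoc (by simpa using hwf)
  have e : (J ++ [(n, top, m)]).flatMap (downView back) =
      J.flatMap (downView back) ++ (back n m).map fun m => (top, m) := by simp [downView]
  rw [e]
  refine ⟨?_, fun j => ?_⟩
  · intro e he
    rcases List.mem_append.1 he with he | he
    · exact hB.1 e he
    · obtain ⟨m', hm', rfl⟩ := List.mem_map.1 he
      exact sim.wfM n m hwf m' hm'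
  · unfold Sys.view
    rw [List.filterMap_append, filterMap_lab_map]
    rcases sim.locM J n m j hb hgood with h | ⟨i, hG, h1, h2⟩
    · rw [h]
      rw [List.map_nil, List.append_nil]
      exact hB.2 j
    · have := hA.2 i
      unfold Sys.view at this h2
      rw [List.filterMap_append, filterMap_lab_single] at this
      rw [← h1, ← h2, ← hG]
      exact this

/-- There is only one first illegal move. If it belongs to the environment, a move of the machine
after a legal position is legal; this covers plays in which `S` wins the premise merely because of
an illegal move of the environment. -/
theorem Sys.BotIllegal.not_top {Φ : ℕ → SPos} (hΦ : ∀ r s, r ≤ s → Φ r <+: Φ s)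
    (h : 𝒜.BotIllegal Φ) {r : ℕ} {q : SPos} {m : PMove} (hq : q ++ [(top, m)] <+: Φ r)
    (hl : 𝒜.Legal q) : 𝒜.Legal (q ++ [(top, m)]) := by
  obtain ⟨r', q', m', h1, h2, h3⟩ := h
  have g1 := h1.trans (hΦ r' (max r r') (le_max_right _ _))
  have g2 := hq.trans (hΦ r (max r r') (le_max_left _ _))
  rcases lt_trichotomy q.length q'.length with hlt | heq | hlt
  · have := List.prefix_of_prefix_length_le g2 ((List.prefix_append q' [(bot, m')]).trans g1)
      (by simpa using hlt)
    exact h2.prefix this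
  · have := List.prefix_of_prefix_length_le g2 g1 (by simp [heq])
    have := this.eq_of_length (by simp [heq])
    have := (List.append_inj this heq).2
    simp at this
  · have := List.prefix_of_prefix_length_le g1 ((List.prefix_append q [(top, m)]).trans g2)
      (by simpa using hlt)
    exact absurd (hl.prefix this) h3

/-- The strategy for the conclusion obtained from a strategy for the premise. -/
def Strategy.lift (tr back : ℕ → PMove → List PMove) (S : Strategy) : Strategy := fun x =>
  let n := max x.1 (sizes x.2)
  let r := S (n, x.2.flatMap (tr n))
  let M := r.2.flatMap (back r.1)
  (max r.1 (sizes M), M)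

theorem Strategy.Bounding.lift {S : Strategy} (hS : S.Bounding) :
    (S.lift tr back).Bounding := by
  intro N E
  have h := hS (max N (sizes E)) (E.flatMap (tr (max N (sizes E))))
  refine ⟨?_, fun m hm => ?_, fun m hm => ?_⟩
  · exact (le_max_left _ _).trans (h.1.trans (le_max_left _ _))
  · exact (size_le_sizes hm).trans ((le_max_right _ _).trans (h.1.trans (le_max_left _ _)))
  · exact (size_le_sizes hm).trans (le_max_right _ _)

/-- The events of a play of `S.lift tr back`. -/
def events (tr : ℕ → PMove → List PMove) (S : Strategy) (N : ℕ → ℕ) (E : ℕ → List PMove) :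
    ℕ → List Event
  | 0 => []
  | r + 1 =>
    let n := max (N r) (sizes (E r))
    let x := S (n, (E r).flatMap (tr n))
    events tr S N E r ++ ((E r).map (fun m => (n, bot, m)) ++ x.2.map fun m => (x.1, top, m))

theorem flatMap_upView_events (S : Strategy) (N : ℕ → ℕ) (E : ℕ → List PMove) (r : ℕ) :
    (events tr S N E r).flatMap (upView tr) =
      hist S (fun r => max (N r) (sizes (E r)))
        (fun r => (E r).flatMap (tr (max (N r) (sizes (E r))))) r := by
  induction r with
  | zero => rfl
  | succ r ih =>
    simp only [events, hist, List.flatMap_append, ih, List.flatMap_map, List.map_flatMap]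
    simp [upView, List.map_eq_flatMap]

theorem flatMap_downView_events (S : Strategy) (N : ℕ → ℕ) (E : ℕ → List PMove) (r : ℕ) :
    (events tr S N E r).flatMap (downView back) = hist (S.lift tr back) N E r := by
  induction r with
  | zero => rfl
  | succ r ih =>
    simp only [events, hist, List.flatMap_append, ih, List.flatMap_map, Strategy.lift,
      List.map_flatMap]
    simp [downView, List.map_eq_flatMap]

/-- Every event is tagged with the bound valid when it happens. Moves of the environment precede,
within a round, the replies in the premise, whose tag is the bound returned by `S`. -/
theorem bounded_events {S : Strategy} (hS : S.Bounding) {N : ℕ → ℕ} {E : ℕ → List PMove}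
    (h : ∀ r, (S.lift tr back (N r, E r)).1 ≤ N (r + 1)) (r : ℕ) :
    Bounded (events tr S N E r) ∧ ∀ e ∈ events tr S N E r, e.1 ≤ N r ∧ e.2.2.size ≤ N r := by
  induction r with
  | zero => exact ⟨⟨List.Pairwise.nil, by simp [events]⟩, by simp [events]⟩
  | succ r ih =>
    obtain ⟨⟨ih1, ih2⟩, ih3⟩ := ih
    set n := max (N r) (sizes (E r)) with hn
    set x := S (n, (E r).flatMap (tr n)) with hx
    have hb := hS n ((E r).flatMap (tr n))
    rw [← hx] at hb
    have h1 : x.1 ≤ N (r + 1) := (le_max_left _ _).trans (h r)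
    have h2 : N r ≤ n := le_max_left _ _
    have h3 : ∀ m ∈ E r, m.size ≤ n := fun m hm => (size_le_sizes hm).trans (le_max_right _ _)
    have he : events tr S N E (r + 1) = events tr S N E r ++
      ((E r).map (fun m => ((n, bot, m) : Event)) ++ x.2.map fun m => (x.1, top, m)) := rfl
    rw [he]
    refine ⟨⟨?_, ?_⟩, ?_⟩
    · rw [List.pairwise_append, List.pairwise_append]
      refine ⟨ih1, ⟨?_, ?_, ?_⟩, ?_⟩
      · rw [List.pairwise_map]
        exact List.pairwise_of_forall_mem_list fun a ha b _ => ⟨le_rfl, fun _ => h3 a ha⟩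
      · rw [List.pairwise_map]
        exact List.pairwise_of_forall_mem_list fun a ha b _ => ⟨le_rfl, fun _ => hb.2.2 a ha⟩
      · intro a ha b hb'
        obtain ⟨m, hm, rfl⟩ := List.mem_map.1 ha
        obtain ⟨m', hm', rfl⟩ := List.mem_map.1 hb'
        exact ⟨hb.1, fun _ => (h3 m hm).trans hb.1⟩
      · intro a ha b hb'
        have := ih3 a ha
        rcases List.mem_append.1 hb' with hb' | hb'
        · obtain ⟨m', hm', rfl⟩ := List.mem_map.1 hb'
          exact ⟨this.1.trans h2, fun _ => this.2.trans h2⟩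
        · obtain ⟨m', hm', rfl⟩ := List.mem_map.1 hb'
          exact ⟨this.1.trans (h2.trans hb.1), fun _ => this.2.trans (h2.trans hb.1)⟩
    · intro e he hbot
      rcases List.mem_append.1 he with he | he
      · exact ih2 e he hbot
      rcases List.mem_append.1 he with he | he
      · obtain ⟨m', hm', rfl⟩ := List.mem_map.1 he
        exact h3 m' hm'
      · obtain ⟨m', hm', rfl⟩ := List.mem_map.1 he
        simp at hbot
    · intro e he
      rcases List.mem_append.1 he with he | he
      · have := ih3 e he
        omega
      rcases List.mem_append.1 he with he | he
      · obtain ⟨m', hm', rfl⟩ := List.mem_map.1 he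
        exact ⟨hb.1.trans h1, (h3 m' hm').trans (hb.1.trans h1)⟩
      · obtain ⟨m', hm', rfl⟩ := List.mem_map.1 he
        exact ⟨h1, (hb.2.2 m' hm').trans h1⟩

/-- The two plays are projections of one list of events. Legality is maintained event by event, and
victory is carried by those pairs of threads (related by `ρ`) that agree in every play; `hW` says
that these suffice to deduce `WB` from `WA`. -/
theorem Sim.wins (sim : Sim 𝒜 ℬ tr back) {S : Strategy} (hS : S.Bounding)
    {WA : (ι → Run) → Prop} {WB : (κ → Run) → Prop} (hwin : S.Wins 𝒜 WA) {ρ : ι → κ → Prop}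
    (hρ : ∀ i j, ρ i j → ∀ J, Bounded J → GoodEvents 𝒜 ℬ J →
      𝒜.view i (J.flatMap (upView tr)) = ℬ.view j (J.flatMap (downView back)))
    (hW : ∀ tA tB, (∀ j, tB j ∈ (ℬ.G j).Lr) → (∀ i j, ρ i j → tA i = tB j) → WA tA → WB tB) :
    (S.lift tr back).Wins ℬ WB := by
  intro N E hN
  by_cases hbi : ℬ.BotIllegal (hist (S.lift tr back) N E)
  · exact Or.inl hbi
  refine Or.inr ?_
  set NA := fun r => max (N r) (sizes (E r)) with hNA
  set EA := fun r => (E r).flatMap (tr (NA r)) with hEA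
  have hbd := bounded_events hS hN
  have hup : ∀ r, (events tr S N E r).flatMap (upView tr) = hist S NA EA r :=
    flatMap_upView_events S N E
  have hdown : ∀ r, (events tr S N E r).flatMap (downView back) = hist (S.lift tr back) N E r :=
    flatMap_downView_events S N E
  -- The enlarged bounds still form an admissible sequence; the winning of a strategy is quantified
  -- over all sequences of large enough bounds for this purpose.
  have hwinA := hwin NA EA (fun r => (le_max_left _ _).trans ((hN r).trans (le_max_left _ _)))
  -- Moves of the environment are legal in the conclusion by assumption, and legality goes up to the
  -- premise; moves of the machine are legal in the premise since `S` wins, and legality goes down.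
  have key : ∀ (r : ℕ) (K : List Event), K <+: events tr S N E r →
      𝒜.Legal (K.flatMap (upView tr)) ∧ ℬ.Legal (K.flatMap (downView back)) := by
    intro r K
    induction K using List.reverseRecOn with
    | nil => exact fun _ => ⟨𝒜.legal_nil, ℬ.legal_nil⟩
    | append_singleton K e ih =>
      intro hK
      obtain ⟨lA, lB⟩ := ih ((List.prefix_append _ _).trans hK)
      have hb := (hbd r).1.prefix hK
      obtain ⟨T, hT⟩ := hK
      obtain ⟨n, p, m⟩ := e
      cases p
      · have e1 : (K ++ [((n, bot, m) : Event)]).flatMap (downView back) =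
            K.flatMap (downView back) ++ [(bot, m)] := by simp [downView]
        have hl : ℬ.Legal (K.flatMap (downView back) ++ [(bot, m)]) := by
          by_contra hc
          refine hbi ⟨r, _, m, ?_, lB, hc⟩
          rw [← hdown, ← hT, List.flatMap_append, e1]
          exact List.prefix_append _ _
        exact ⟨sim.env_legal hb lA hl, e1 ▸ hl⟩
      · have e1 : (K ++ [((n, top, m) : Event)]).flatMap (upView tr) =
            K.flatMap (upView tr) ++ [(top, m)] := by simp [upView]
        have hp : K.flatMap (upView tr) ++ [(top, m)] <+: hist S NA EA r := by
          rw [← hup, ← hT, List.flatMap_append, e1]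
          exact List.prefix_append _ _
        have hl : 𝒜.Legal (K.flatMap (upView tr) ++ [(top, m)]) := by
          rcases hwinA with h | h
          · exact h.not_top (fun _ _ => hist_prefix S NA EA) hp lA
          · exact (h.1 r).prefix hp
        exact ⟨e1 ▸ hl, sim.machine_legal hb lB hl⟩
  have hlA : ∀ r, 𝒜.Legal (hist S NA EA r) := fun r => hup r ▸ (key r _ List.prefix_rfl).1
  have hlB : ∀ r, ℬ.Legal (hist (S.lift tr back) N E r) :=
    fun r => hdown r ▸ (key r _ List.prefix_rfl).2
  have hWA : WA fun i => Run.limit fun r => 𝒜.view i (hist S NA EA r) := by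
    rcases hwinA with ⟨r, q, m, h1, h2, h3⟩ | h
    · exact absurd ((hlA r).prefix h1) h3
    · exact h.2
  refine ⟨hlB, hW _ _ ?_ ?_ hWA⟩
  · intro j
    exact (mem_of_limit (ℬ.G j).lr_iff (chain_view ℬ j _ N E)).2 fun r => (hlB r).2 j
  · intro i j hij
    congr 1
    funext r
    have hk := key r _ List.prefix_rfl
    rw [← hup, ← hdown]
    exact hρ i j hij _ (hbd r).1 (goodEvents_of_legal hk.1 hk.2)

theorem view_congr {i : ι} {j : κ} {J : List Event}
    (h : ∀ e ∈ J, (upView tr e).filterMap (lab (𝒜.pr i)) =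
      (downView back e).filterMap (lab (ℬ.pr j))) :
    𝒜.view i (J.flatMap (upView tr)) = ℬ.view j (J.flatMap (downView back)) := by
  unfold Sys.view
  rw [List.filterMap_flatMap, List.filterMap_flatMap]
  exact List.flatMap_congr h

/-- The thread `i` of the premise always equals the thread `j` of the conclusion. -/
def Matches (𝒜 : Sys ι) (ℬ : Sys κ) (tr back : ℕ → PMove → List PMove) (i : ι) (j : κ) : Prop :=
  𝒜.G i = ℬ.G j ∧
  (∀ n m, ℬ.wf m → m.size ≤ n → (tr n m).filterMap (𝒜.pr i) = (ℬ.pr j m).toList) ∧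
  ∀ n m, 𝒜.wf m → (𝒜.pr i m).toList = (back n m).filterMap (ℬ.pr j)

theorem Matches.view_eq {i : ι} {j : κ} (h : Matches 𝒜 ℬ tr back i j) {J : List Event}
    (hb : Bounded J) (hg : GoodEvents 𝒜 ℬ J) :
    𝒜.view i (J.flatMap (upView tr)) = ℬ.view j (J.flatMap (downView back)) := by
  refine view_congr fun e he => ?_
  have := hg e he
  unfold upView downView
  split_ifs with hp
  · rw [if_pos hp] at this
    rw [filterMap_lab_map, filterMap_lab_single, h.2.1 _ _ this (hb.2 e he hp)]
  · rw [if_neg hp] at this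
    rw [filterMap_lab_map, filterMap_lab_single, h.2.2 e.1 _ this]

/-- A simulation in which every relevant thread of the premise matches one of the conclusion, and
conversely. -/
theorem Sim.of_matches
    (wfE : ∀ n m, ℬ.wf m → m.size ≤ n → ∀ m' ∈ tr n m, 𝒜.wf m')
    (wfM : ∀ n m', 𝒜.wf m' → ∀ m ∈ back n m', ℬ.wf m)
    (hA : ∀ i, (∃ j, Matches 𝒜 ℬ tr back i j) ∨ ∀ m, 𝒜.wf m → 𝒜.pr i m = none)
    (hB : ∀ j, (∃ i, Matches 𝒜 ℬ tr back i j) ∨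
      ∀ n m, 𝒜.wf m → (back n m).filterMap (ℬ.pr j) = []) : Sim 𝒜 ℬ tr back where
  wfE := wfE
  wfM := wfM
  locE J n m i hb hg := by
    have hwf : ℬ.wf m := by simpa using hg (n, bot, m) (by simp)
    have hs : m.size ≤ n := hb.2 (n, bot, m) (by simp) rfl
    rcases hA i with ⟨j, hj⟩ | h
    · exact Or.inr ⟨j, hj.1, hj.2.1 n m hwf hs, hj.view_eq (hb.prefix (List.prefix_append _ _))
        fun e he => hg e (List.mem_append_left _ he)⟩
    · left
      rw [List.filterMap_eq_nil_iff]
      exact fun m' hm' => h m' (wfE n m hwf hs m' hm')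
  locM J n m j hb hg := by
    have hwf : 𝒜.wf m := by simpa using hg (n, top, m) (by simp)
    rcases hB j with ⟨i, hi⟩ | h
    · exact Or.inr ⟨i, hi.1, hi.2.2 n m hwf, hi.view_eq (hb.prefix (List.prefix_append _ _))
        fun e he => hg e (List.mem_append_left _ he)⟩
    · exact Or.inl (h n m hwf)

end

end CoL

namespace CoL

/-! ### Finite and infinite bitstrings -/

theorem isInitial_iff {u : List Bool} {x : ℕ → Bool} :
    IsInitial u x ↔ ∀ i, i < u.length → u.getD i false = x i := by
  unfold IsInitial
  constructor
  · intro h i hi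
    rw [List.getD_eq_getElem _ _ hi, ← Option.some_inj, ← List.getElem?_eq_getElem hi]
    conv_lhs => rw [h]
    simp [hi]
  · intro h
    apply List.ext_getElem (by simp)
    intro i h1 h2
    have := h i h1
    rw [List.getD_eq_getElem _ _ h1] at this
    simp [this]

/-- The initial segment of length `n`. -/
def trunc (n : ℕ) (x : ℕ → Bool) : List Bool := (List.range n).map x

@[simp] theorem length_trunc (n : ℕ) (x : ℕ → Bool) : (trunc n x).length = n := by simp [trunc]

theorem isInitial_trunc (n : ℕ) (x : ℕ → Bool) : IsInitial (trunc n x) x := by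
  simp [IsInitial, trunc]

@[simp] theorem isInitial_nil (x : ℕ → Bool) : IsInitial [] x := by simp [IsInitial]

theorem IsInitial.eq_trunc {u : List Bool} {x : ℕ → Bool} (h : IsInitial u x) :
    u = trunc u.length x := h

theorem isInitial_take {u : List Bool} {x : ℕ → Bool} {n : ℕ} (h : u.length ≤ n) :
    IsInitial u x ↔ u = (trunc n x).take u.length := by
  have : (trunc n x).take u.length = trunc u.length x := by
    simp [trunc, ← List.map_take, List.take_range, h]
  rw [this]
  rfl

theorem isInitial_congr {u : List Bool} {x y : ℕ → Bool} (h : ∀ i < u.length, x i = y i) :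
    IsInitial u x ↔ IsInitial u y := by
  rw [isInitial_iff, isInitial_iff]
  exact forall₂_congr fun i hi => by rw [h i hi]

theorem IsInitial.take {u : List Bool} {x : ℕ → Bool} (h : IsInitial u x) (n : ℕ) :
    IsInitial (u.take n) x := by
  rw [isInitial_iff] at h ⊢
  intro i hi
  rw [List.length_take] at hi
  rw [← h i (by omega), List.getD_eq_getElem?_getD, List.getD_eq_getElem?_getD,
    List.getElem?_take_of_lt (by omega)]

/-- All bitstrings of length `n`. -/
def allBits : ℕ → List (List Bool)
  | 0 => [[]]
  | n + 1 => (allBits n).flatMap fun w => [false :: w, true :: w]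

theorem mem_allBits {n : ℕ} {w : List Bool} : w ∈ allBits n ↔ w.length = n := by
  induction n generalizing w with
  | zero => simp [allBits]
  | succ n ih =>
    simp only [allBits, List.mem_flatMap, List.mem_cons, List.not_mem_nil, or_false]
    constructor
    · rintro ⟨v, hv, rfl | rfl⟩ <;> simp [ih.1 hv]
    · intro h
      cases w with
      | nil => simp at h
      | cons b w =>
        refine ⟨w, ih.2 (by simpa using h), ?_⟩
        cases b <;> simp

theorem nodup_allBits (n : ℕ) : (allBits n).Nodup := by
  induction n with
  | zero => simp [allBits]
  | succ n ih =>
    rw [allBits, List.nodup_flatMap]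
    refine ⟨fun w _ => by simp, ?_⟩
    refine ih.imp fun {a b} hab => ?_
    rw [Function.onFun, List.disjoint_left]
    intro c hc hc'
    simp only [List.mem_cons, List.not_mem_nil, or_false] at hc hc'
    rcases hc with rfl | rfl <;> rcases hc' with h | h <;> simp_all

/-- Used for families of moves of which a given thread sees at most one. -/
theorem filterMap_unique {α β : Type*} [DecidableEq α] {l : List α} (hl : l.Nodup) (a : α) {f : α → Option β}
    (h : ∀ b ∈ l, b ≠ a → f b = none) :
    l.filterMap f = if a ∈ l then (f a).toList else [] := by
  induction l with
  | nil => simp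
  | cons b l ih =>
    rw [List.nodup_cons] at hl
    have ih := ih hl.2 fun c hc => h c (List.mem_cons_of_mem _ hc)
    rw [List.filterMap_cons, ih]
    by_cases hab : b = a
    · subst hab
      rw [if_neg hl.1, if_pos (by simp)]
      cases f b <;> rfl
    · rw [h b (by simp) hab]
      have : a ∈ b :: l ↔ a ∈ l := by simp [Ne.symm hab]
      simp only [this]

/-- The `i`-th of the `k` strings whose interleaving is `w`. -/
def unweave (k i : ℕ) (w : List Bool) : List Bool :=
  (List.range ((w.length + (k - 1 - i)) / k)).map fun t => w.getD (k * t + i) false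

/-- The interleaving of the `k` first strings. -/
def weave (k : ℕ) (x : ℕ → ℕ → Bool) : ℕ → Bool := fun i => x (i % k) (i / k)

/-- The quotient counts the places congruent to `i` modulo `k` below `L`, so it is the length of the
`i`-th part of a string of length `L`. -/
theorem lt_unweave {k i L t : ℕ} (hi : i < k) : t < (L + (k - 1 - i)) / k ↔ k * t + i < L := by
  rw [Nat.lt_iff_add_one_le, Nat.le_div_iff_mul_le (by omega)]
  have : (t + 1) * k = k * t + k := by ring
  omega

theorem isInitial_weave {k : ℕ} (hk : 0 < k) {w : List Bool} {x : ℕ → ℕ → Bool} :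
    IsInitial w (weave k x) ↔ ∀ i < k, IsInitial (unweave k i w) (x i) := by
  simp only [isInitial_iff]
  constructor
  · intro h i hi t ht
    have hlen : (unweave k i w).length = (w.length + (k - 1 - i)) / k := by simp [unweave]
    rw [hlen] at ht
    have e := h (k * t + i) ((lt_unweave hi).1 ht)
    rw [List.getD_eq_getElem _ _ (hlen ▸ ht)]
    simp only [unweave, List.getElem_map, List.getElem_range]
    rw [e, weave, Nat.mul_add_mod, Nat.mod_eq_of_lt hi, Nat.mul_add_div hk, Nat.div_eq_of_lt hi,
      Nat.add_zero]
  · intro h s hs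
    have hi : s % k < k := Nat.mod_lt _ hk
    have hlen : (unweave k (s % k) w).length = (w.length + (k - 1 - s % k)) / k := by
      simp [unweave]
    have hts : k * (s / k) + s % k = s := Nat.div_add_mod s k
    have ht : s / k < (unweave k (s % k) w).length := by
      rw [hlen, lt_unweave hi, hts]
      exact hs
    have := h (s % k) hi (s / k) ht
    rw [List.getD_eq_getElem _ _ ht] at this
    simp only [unweave, List.getElem_map, List.getElem_range, hts] at this
    rw [this, weave]

theorem weave_unweave {k : ℕ} (x : ℕ → Bool) : (weave k fun i t => x (k * t + i)) = x := by
  funext s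
  simp only [weave]
  rw [Nat.div_add_mod]

/-- The ones of the interleaving lie in the images of finitely many finite sets. Thus interleaved
strings remain admissible for the countable winning conditions. -/
theorem EssFinite.weave {k : ℕ} (hk : 0 < k) {x : ℕ → ℕ → Bool} (h : ∀ i, EssFinite (x i)) :
    EssFinite (weave k x) := by
  have : {s | CoL.weave k x s = true} ⊆
      ⋃ i ∈ Finset.range k, (fun t => k * t + i) '' {t | x i t = true} := by
    intro s hs
    simp only [Set.mem_iUnion]
    exact ⟨s % k, by simpa using Nat.mod_lt _ hk, s / k, hs, Nat.div_add_mod s k⟩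
  refine Set.Finite.subset ?_ this
  exact Set.Finite.biUnion (Finset.finite_toSet _) fun i _ => (h i).image _

/-- The greatest length of an element. -/
def maxLen (us : List (List Bool)) : ℕ := (us.map List.length).foldr max 0

theorem length_le_maxLen {us : List (List Bool)} {u : List Bool} (h : u ∈ us) :
    u.length ≤ maxLen us := by
  induction us with
  | nil => simp at h
  | cons a l ih =>
    simp only [maxLen, List.map_cons, List.foldr_cons] at ih ⊢
    rcases List.mem_cons.1 h with rfl | h
    · exact le_max_left _ _
    · exact (ih h).trans (le_max_right _ _)

/-- Strings (of the same length) that cover all interleavings of extensions of the given strings. -/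
def cover (us : List (List Bool)) : List (List Bool) :=
  (allBits (us.length * maxLen us)).filter fun w => (List.range us.length).all fun i =>
    decide (us.getD i [] = (unweave us.length i w).take (us.getD i []).length)

theorem nodup_cover (us : List (List Bool)) : (cover us).Nodup := (nodup_allBits _).filter _

/-- The strings in `cover us` are long enough for each of their parts to decide whether the
corresponding element of `us` is an initial segment. -/
theorem trunc_mem_cover {us : List (List Bool)} (hk : 0 < us.length) {x : ℕ → ℕ → Bool} :
    trunc (us.length * maxLen us) (weave us.length x) ∈ cover us ↔
      ∀ i < us.length, IsInitial (us.getD i []) (x i) := by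
  set k := us.length with hk'
  set L := k * maxLen us
  have h1 := (isInitial_weave hk).1 (isInitial_trunc L (weave k x))
  simp only [cover, List.mem_filter, mem_allBits, length_trunc, List.all_eq_true,
    List.mem_range, decide_eq_true_eq, ← hk']
  rw [and_iff_right rfl]
  refine forall₂_congr fun i hi => ?_
  have h2 := h1 i hi
  have hle : (us.getD i []).length ≤ (unweave k i (trunc L (weave k x))).length := by
    -- As `L` is a multiple of `k`, all parts have the same length `L / k`.
    have e : (unweave k i (trunc L (weave k x))).length = maxLen us := by
      simp only [unweave, List.length_map, List.length_range, length_trunc, L]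
      rw [Nat.mul_add_div hk, Nat.div_eq_of_lt (by omega), Nat.add_zero]
    rw [e]
    rw [List.getD_eq_getElem _ _ hi]
    exact length_le_maxLen (List.getElem_mem hi)
  rw [h2.eq_trunc, ← isInitial_take hle]

theorem length_of_mem_cover {us : List (List Bool)} {w : List Bool} (h : w ∈ cover us) :
    w.length = us.length * maxLen us := mem_allBits.1 (List.mem_filter.1 h).1

/-! ### Strings -/

theorem digit_inj {a b : ℕ} (ha : a < 10) (hb : b < 10) (h : digit a = digit b) : a = b := by
  have := congrArg Fin.val h
  simp only [digit, Fin.ofNat] at this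
  omega

theorem digit_ne_dot {a : ℕ} (ha : a < 10) : digit a ≠ dot := by
  intro h
  have := congrArg Fin.val h
  simp only [digit, Fin.ofNat, dot] at this
  change (48 + a) % 128 = 46 at this
  omega

/-- Split a move `w.γ` into the bitstring `w` and `γ`. -/
def parseBits : Move → Option (List Bool × Move)
  | [] => none
  | c :: l =>
    if c = dot then some ([], l)
    else if c = digit 0 then (parseBits l).map fun p => (false :: p.1, p.2)
    else if c = digit 1 then (parseBits l).map fun p => (true :: p.1, p.2)
    else none

theorem parseBits_bits (w : List Bool) (γ : Move) :
    parseBits (bits w ++ dot :: γ) = some (w, γ) := by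
  induction w with
  | nil => simp [bits, parseBits]
  | cons b w ih =>
    simp only [bits, List.map_cons, List.cons_append, parseBits] at ih ⊢
    have h10 : digit 1 ≠ digit 0 := by decide
    cases b
    · rw [if_neg (digit_ne_dot (by simp)), if_pos (by rfl), ih]
      rfl
    · rw [if_neg (digit_ne_dot (by simp)), if_neg (by exact h10), if_pos (by rfl), ih]
      rfl

theorem parseBits_eq_some {m : Move} {w : List Bool} {γ : Move} :
    parseBits m = some (w, γ) ↔ m = bits w ++ dot :: γ := by
  constructor
  · intro h
    induction m generalizing w with
    | nil => simp [parseBits] at h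
    | cons c l ih =>
      rw [parseBits] at h
      split_ifs at h with h1 h2 h3
      · simp only [Option.some.injEq, Prod.mk.injEq] at h
        rw [h1, ← h.1, h.2]
        rfl
      · rw [Option.map_eq_some_iff] at h
        obtain ⟨⟨v, δ⟩, hv, he⟩ := h
        simp only [Prod.mk.injEq] at he
        obtain ⟨rfl, rfl⟩ := he
        rw [ih hv, h2]
        rfl
      · rw [Option.map_eq_some_iff] at h
        obtain ⟨⟨v, δ⟩, hv, he⟩ := h
        simp only [Prod.mk.injEq] at he
        obtain ⟨rfl, rfl⟩ := he
        rw [ih hv, h3]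
        rfl
  · rintro rfl
    exact parseBits_bits w γ

theorem brn_unique (x : ℕ → Bool) (α β β' : Move) (h : ∃ u, IsInitial u x ∧ α = bits u ++ dot :: β)
    (h' : ∃ u, IsInitial u x ∧ α = bits u ++ dot :: β') : β = β' := by
  obtain ⟨u, -, hu⟩ := h
  obtain ⟨v, -, hv⟩ := h'
  rw [← parseBits_eq_some] at hu hv
  rw [hu] at hv
  simpa using congrArg (Option.map Prod.snd) hv

theorem brn_eq_some {x : ℕ → Bool} {m β : Move} :
    brn x m = some β ↔ ∃ u, IsInitial u x ∧ m = bits u ++ dot :: β :=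
  pick_eq_some (brn_unique x)

open Classical in
theorem brn_bits (x : ℕ → Bool) (w : List Bool) (γ : Move) :
    brn x (bits w ++ dot :: γ) = if IsInitial w x then some γ else none := by
  split_ifs with h
  · exact brn_eq_some.2 ⟨w, h, rfl⟩
  · rw [Option.eq_none_iff_forall_not_mem]
    intro β hβ
    obtain ⟨u, hu, he⟩ := brn_eq_some.1 hβ
    rw [← parseBits_eq_some, parseBits_bits] at he
    simp only [Option.some.injEq, Prod.mk.injEq] at he
    exact h (he.1 ▸ hu)

theorem side_eq_some {i : Bool} {m β : Move} :
    side i m = some β ↔ m = compPrefix (i.toNat + 1) ++ β :=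
  pick_eq_some fun α β β' h h' => by rw [h] at h'; exact List.append_cancel_left h'

/-- The part of a move of a corecurrence that goes to the branches that begin with `i`. -/
def half (i : Bool) (m : Move) : Option Move :=
  if m.head? = some dot then some m
  else if m.head? = some (digit i.toNat) then some m.tail else none

theorem half_digit (i j : Bool) (m : Move) :
    half i (digit j.toNat :: m) = if i = j then some m else none := by
  unfold half
  rw [if_neg]
  · cases i <;> cases j <;> simp <;> decide
  · simp only [List.head?_cons, Option.some.injEq]
    exact digit_ne_dot (by cases j <;> simp)

theorem side_compPrefix (i j : Bool) (m : Move) :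
    side i (compPrefix (j.toNat + 1) ++ m) = if i = j then some m else none := by
  split_ifs with h
  · subst h
    rw [side_eq_some]
  · rw [Option.eq_none_iff_forall_not_mem]
    intro β hβ
    have hβ := side_eq_some.1 hβ
    simp only [compPrefix, List.cons_append, List.cons.injEq] at hβ
    have := digit_inj (by cases j <;> simp) (by cases i <;> simp) hβ.1
    revert this h
    cases i <;> cases j <;> simp

end CoL

namespace CoL

/-! ### The games of cirquents on structured moves -/

/-- The oformula at place `a`. -/
def Cirquent.form (C : Cirquent) (a : ℕ) : Formula := C.forms.getD a (.atom 0)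

/-- The overgroup at place `j`. -/
def Cirquent.overgroup (C : Cirquent) (j : ℕ) : Finset ℕ := C.overgroups.getD j ∅

/-- The strings `us` are initial segments of the infinite strings `x`. -/
def Vis (x : ℕ → ℕ → Bool) (us : List (List Bool)) : Prop :=
  ∀ j, IsInitial (us.getD j []) (x j)

/-- Threads of the game of a cirquent. -/
abbrev Thread := ℕ × (ℕ → ℕ → Bool)

open Classical in
/-- What is seen of a move in a thread. -/
noncomputable def pj (i : Thread) (m : PMove) : Option Move :=
  if m.1 = i.1 ∧ Vis i.2 m.2.1 then some m.2.2 else none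

/-- Well-formed moves of the game of a cirquent. -/
def Cirquent.Wf (C : Cirquent) (m : PMove) : Prop :=
  m.1 < C.forms.length ∧ m.2.1.length = C.overgroups.length ∧
    ∀ j, m.1 ∉ C.overgroup j → m.2.1.getD j [] = []

/-- The game of a cirquent on structured moves. -/
noncomputable def Cirquent.sys (I : Interpretation) (C : Cirquent) : Sys Thread :=
  ⟨C.Wf, pj, fun i => (C.form i.1).interp I⟩

/-- The winning condition of the game of a cirquent. -/
def Cirquent.Won (I : Interpretation) (C : Cirquent) (t : Thread → Run) : Prop :=
  ∀ U ∈ C.undergroups, ∀ x : ℕ → ℕ → Bool, (∀ j, EssFinite (x j)) →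
    ∃ a ∈ U, ((C.form a).interp I).Wn (t (a, x)) = top

/-- `S` wins the game of `C` under the interpretation `I`. -/
def Strategy.Solves (S : Strategy) (I : Interpretation) (C : Cirquent) : Prop :=
  S.Wins (C.sys I) (C.Won I)

open Classical in
theorem pj_eq {i i' : Thread} {m m' : PMove} (hβ : m.2.2 = m'.2.2)
    (h : m.1 = i.1 ∧ Vis i.2 m.2.1 ↔ m'.1 = i'.1 ∧ Vis i'.2 m'.2.1) : pj i m = pj i' m' := by
  unfold pj
  rw [hβ]
  exact if_congr h rfl rfl

theorem pj_none {i : Thread} {m : PMove} (h : m.1 = i.1 → ¬ Vis i.2 m.2.1) : pj i m = none :=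
  if_neg fun h' => h h'.1 h'.2

theorem pj_some {i : Thread} {m : PMove} (h : m.1 = i.1) (h' : Vis i.2 m.2.1) :
    pj i m = some m.2.2 := if_pos ⟨h, h'⟩

theorem pj_eq_some {i : Thread} {m : PMove} {β : Move} (h : pj i m = some β) :
    m.1 = i.1 ∧ Vis i.2 m.2.1 ∧ m.2.2 = β := by
  unfold pj at h
  split_ifs at h with h'
  exact ⟨h'.1, h'.2, Option.some.inj h⟩

theorem filterMap_single {α β : Type*} (f : α → Option β) (a : α) :
    [a].filterMap f = (f a).toList := by
  rw [List.filterMap_cons]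
  cases f a <;> rfl

/-- The list of the first `n` values. -/
def tab (n : ℕ) (f : ℕ → List Bool) : List (List Bool) := (List.range n).map f

@[simp] theorem length_tab (n : ℕ) (f : ℕ → List Bool) : (tab n f).length = n := by simp [tab]

theorem getD_tab (n : ℕ) (f : ℕ → List Bool) (j : ℕ) :
    (tab n f).getD j [] = if j < n then f j else [] := by
  split_ifs with h
  · rw [List.getD_eq_getElem _ _ (by simpa using h)]
    simp [tab]
  · rw [List.getD_eq_default]
    simpa using h

theorem getD_eq_nil {us : List (List Bool)} {j : ℕ} (h : us.length ≤ j) : us.getD j [] = [] :=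
  List.getD_eq_default _ _ h

theorem vis_iff {x : ℕ → ℕ → Bool} {us : List (List Bool)} :
    Vis x us ↔ ∀ j < us.length, IsInitial (us.getD j []) (x j) := by
  refine ⟨fun h j _ => h j, fun h j => ?_⟩
  by_cases hj : j < us.length
  · exact h j hj
  · rw [getD_eq_nil (by omega)]
    exact isInitial_nil _

theorem vis_tab {x : ℕ → ℕ → Bool} {n : ℕ} {f : ℕ → List Bool} :
    Vis x (tab n f) ↔ ∀ j < n, IsInitial (f j) (x j) := by
  rw [vis_iff, length_tab]
  exact forall₂_congr fun j hj => by rw [getD_tab, if_pos hj]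

/-- Extend each string by zeros. Every move is thus seen in some thread, so conditions on the form
of a move can be read off the threads. -/
theorem exists_vis (us : List (List Bool)) : ∃ x, Vis x us :=
  ⟨fun j i => (us.getD j []).getD i false, fun _ => isInitial_iff.2 fun _ _ => rfl⟩

/-! ### Looking into one oformula -/

/-- The game of a cirquent, with the threads of the oformula `a` further divided into threads. -/
noncomputable def Cirquent.refined {κ : Type} (I : Interpretation) (C : Cirquent) (a : ℕ)
    (form : Move → Prop) (g : κ → Move → Option Move) (H : κ → Game) : Sys (Thread × κ) where
  wf m := C.Wf m ∧ (m.1 = a → form m.2.2)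
  pr i m := if i.1.1 = a then (pj i.1 m).bind (g i.2) else pj i.1 m
  G i := if i.1.1 = a then H i.2 else (C.form i.1.1).interp I

theorem refined_view {κ : Type} {I : Interpretation} {C : Cirquent} {a : ℕ}
    {form : Move → Prop} {g : κ → Move → Option Move} {H : κ → Game} (i : Thread) (k : κ)
    (φ : SPos) : (C.refined I a form g H).view (i, k) φ =
      if i.1 = a then ((C.sys I).view i φ).filterMap (lab (g k)) else (C.sys I).view i φ := by
  unfold Sys.view Cirquent.refined Cirquent.sys
  split_ifs with h
  · rw [List.filterMap_filterMap]
    congr 1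
    funext e
    simp only [lab]
    rw [if_pos h]
    cases pj i e.2 <;> rfl
  · congr 1
    funext e
    simp only [lab, if_neg h]

/-- The refinement does not change which positions are legal; it only replaces legality in a
compound game by legality of its parts, the level at which rules for `∧`, `∨`, `!`, `?` match
threads. -/
theorem refined_legal {κ : Type} [Nonempty κ] {I : Interpretation} {C : Cirquent} {a : ℕ}
    {form : Move → Prop} {g : κ → Move → Option Move} {H : κ → Game}
    (hD : Decomp ((C.form a).interp I) form g H) (φ : SPos) :
    (C.refined I a form g H).Legal φ ↔ (C.sys I).Legal φ := by
  constructor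
  · intro h
    refine ⟨fun e he => (h.1 e he).1, fun i => ?_⟩
    by_cases hi : i.1 = a
    · show _ ∈ ((C.form i.1).interp I).Lr
      rw [hi, hD]
      refine ⟨fun m hm => ?_, fun k => ?_⟩
      · rw [mem_toRun] at hm
        obtain ⟨e, he, hem⟩ := List.mem_filterMap.1 hm
        unfold lab at hem
        rw [Option.map_eq_some_iff] at hem
        obtain ⟨β, hβ, rfl⟩ := hem
        obtain ⟨h1, -, h3⟩ := pj_eq_some hβ
        have := (h.1 e he).2 (h1.trans hi)
        rwa [h3] at this
      · have := h.2 (i, k)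
        rw [refined_view, if_pos hi] at this
        simp only [Cirquent.refined, if_pos hi] at this
        rw [filterMap_toRun]
        exact this
    -- The threads of other oformulas do not depend on the second index, so any one will do.
    · have := h.2 (i, Classical.arbitrary κ)
      rw [refined_view, if_neg hi] at this
      simp only [Cirquent.refined, if_neg hi] at this
      exact this
  · intro h
    refine ⟨fun e he => ⟨h.1 e he, fun hea => ?_⟩, fun ⟨i, k⟩ => ?_⟩
    · obtain ⟨x, hx⟩ := exists_vis e.2.2.1
      have := h.2 (a, x)
      have := ((hD _).1 this).1 (e.1, e.2.2.2) (mem_toRun.2 (List.mem_filterMap.2 ⟨e, he, ?_⟩))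
      · exact this
      · simp only [lab, Cirquent.sys]
        rw [pj_some hea hx]
        rfl
    · rw [refined_view]
      have := h.2 i
      simp only [Cirquent.refined]
      split_ifs with hi
      · change _ ∈ ((C.form i.1).interp I).Lr at this
        rw [hi, hD] at this
        have := this.2 k
        rwa [filterMap_toRun] at this
      · exact this

/-- The winning condition of `C.refined`, given one for `C`. -/
theorem Strategy.Wins.of_refined {κ : Type} [Nonempty κ] {I : Interpretation} {C : Cirquent}
    {a : ℕ} {form : Move → Prop} {g : κ → Move → Option Move} {H : κ → Game}
    (hD : Decomp ((C.form a).interp I) form g H) {S : Strategy} {W : (Thread × κ → Run) → Prop}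
    (h : S.Wins (C.refined I a form g H) W)
    (hW : ∀ (t : Thread → Run) (t' : Thread × κ → Run),
      (∀ i, t i ∈ ((C.form i.1).interp I).Lr) →
      (∀ i k, i.1 = a → t' (i, k) = (t i).filterMap (lab (g k))) →
      (∀ i k, i.1 ≠ a → t' (i, k) = t i) → W t' → C.Won I t) : S.Solves I C := by
  intro N E hN
  rcases h N E hN with ⟨r, q, m, h1, h2, h3⟩ | ⟨h1, h2⟩
  · rw [refined_legal hD] at h2 h3
    exact Or.inl ⟨r, q, m, h1, h2, h3⟩
  · have h1' : ∀ r, (C.sys I).Legal (hist S N E r) := fun r => (refined_legal hD _).1 (h1 r)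
    refine Or.inr ⟨h1', hW _ _ ?_ ?_ ?_ h2⟩
    · intro i
      exact (mem_of_limit ((C.sys I).G i).lr_iff (chain_view (C.sys I) i S N E)).2
        fun r => (h1' r).2 i
    · intro i k hi
      rw [filterMap_limit (chain_view (C.sys I) i S N E)]
      congr 1
      funext r
      rw [refined_view, if_pos hi]
    · intro i k hi
      congr 1
      funext r
      rw [refined_view, if_neg hi]

/-! ### Renaming, omitting and adding oformulas and groups -/

/-- The oformula `a` of the premise is the oformula `ι[a]` of the conclusion, and the overgroup `j` of
the premise is the overgroup `γ[j]` of the conclusion. -/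
structure Reindexes (A B : Cirquent) (ι γ : List ℕ) : Prop where
  length_forms : ι.length = A.forms.length
  idx_forms : ∀ a < ι.length, ι.idxOf (ι.getD a 0) = a
  lt_forms : ∀ a < ι.length, ι.getD a 0 < B.forms.length
  form : ∀ a < ι.length, A.form a = B.form (ι.getD a 0)
  length_over : γ.length = A.overgroups.length
  idx_over : ∀ j < γ.length, γ.idxOf (γ.getD j 0) = j
  lt_over : ∀ j < γ.length, γ.getD j 0 < B.overgroups.length
  mem_iff : ∀ a < ι.length, ∀ j < γ.length, a ∈ A.overgroup j ↔ ι.getD a 0 ∈ B.overgroup (γ.getD j 0)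
  not_mem : ∀ a < ι.length, ∀ j < B.overgroups.length, j ∉ γ → ι.getD a 0 ∉ B.overgroup j
  under : ∀ U ∈ B.undergroups, ∃ V ∈ A.undergroups, ∀ b ∈ V, ι.getD b 0 ∈ U

/-- Translation of moves of the environment. -/
def reindexUp (ι γ : List ℕ) (_ : ℕ) (m : PMove) : List PMove :=
  if ι.idxOf m.1 < ι.length then
    [(ι.idxOf m.1, tab γ.length fun j => m.2.1.getD (γ.getD j 0) [], m.2.2)] else []

/-- Translation of moves of the machine. -/
def reindexDown (ι γ : List ℕ) (n : ℕ) (_ : ℕ) (m : PMove) : List PMove :=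
  [(ι.getD m.1 0, tab n fun j => m.2.1.getD (γ.idxOf j) [], m.2.2)]

theorem getD_idxOf {l : List ℕ} {b : ℕ} (h : l.idxOf b < l.length) : l.getD (l.idxOf b) 0 = b := by
  rw [List.getD_eq_getElem _ _ h, List.getElem_idxOf h]

section
variable {A B : Cirquent} {ι γ : List ℕ}

/-- `ι` and `γ` list without repetition the surviving oformulas and overgroups by their places in
`B`. Moves in other oformulas are ignored, and strings are carried over along `γ`. -/
theorem Reindexes.matches (h : Reindexes A B ι γ) (I : Interpretation) {a : ℕ} (ha : a < ι.length)
    {x x' : ℕ → ℕ → Bool} (hx : ∀ j < γ.length, x' j = x (γ.getD j 0)) :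
    Matches (A.sys I) (B.sys I) (reindexUp ι γ) (reindexDown ι γ B.overgroups.length)
      (a, x') (ι.getD a 0, x) := by
  refine ⟨?_, ?_, ?_⟩
  · show (A.form a).interp I = (B.form (ι.getD a 0)).interp I
    rw [h.form a ha]
  · intro n m hm _
    show _ = (pj _ m).toList
    unfold reindexUp
    split_ifs with hlt
    · rw [filterMap_single]
      congr 1
      refine pj_eq rfl ?_
      have e : ι.idxOf m.1 = a ↔ m.1 = ι.getD a 0 := by
        constructor
        · rintro rfl
          rw [getD_idxOf hlt]
        · intro e
          rw [e, h.idx_forms a ha]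
      refine (and_congr e Iff.rfl).trans (and_congr_right fun hma => ?_)
      rw [vis_tab]
      constructor
      · intro hv j
        by_cases hj : j ∈ γ
        · have hj' := List.idxOf_lt_length_iff.2 hj
          have := hv _ hj'
          simp only at this
          rwa [hx _ hj', getD_idxOf hj'] at this
        -- An overgroup outside `γ` contains no surviving oformula, so a well-formed move has the
        -- empty string there.
        · by_cases hjn : j < B.overgroups.length
          · rw [hm.2.2 j (hma ▸ h.not_mem a ha j hjn hj)]
            exact isInitial_nil _
          · rw [getD_eq_nil (by rw [hm.2.1]; omega)]
            exact isInitial_nil _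
      · intro hv j hj
        simp only
        rw [hx j hj]
        exact hv _
    · rw [pj_none]
      · rfl
      · intro e
        rw [e, h.idx_forms a ha] at hlt
        exact absurd ha hlt
  · intro n m hm
    show (pj _ m).toList = _
    unfold reindexDown
    rw [filterMap_single]
    congr 1
    refine pj_eq rfl ?_
    have hm1 : m.1 < ι.length := by rw [h.length_forms]; exact hm.1
    have e : m.1 = a ↔ ι.getD m.1 0 = ι.getD a 0 := by
      constructor
      · rintro rfl; rfl
      · intro e
        have := h.idx_forms _ hm1
        rw [e, h.idx_forms a ha] at this
        exact this.symm
    refine and_congr e ?_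
    rw [vis_tab]
    constructor
    · intro hv j _
      by_cases hj : γ.idxOf j < γ.length
      · have := hv (γ.idxOf j)
        simp only at this
        rwa [hx _ hj, getD_idxOf hj] at this
      · rw [getD_eq_nil (by rw [hm.2.1, ← h.length_over]; omega)]
        exact isInitial_nil _
    · intro hv j
      by_cases hj : j < γ.length
      · have := hv _ (h.lt_over j hj)
        rw [h.idx_over j hj] at this
        simp only
        rwa [hx j hj]
      · rw [getD_eq_nil (by rw [hm.2.1, ← h.length_over]; omega)]
        exact isInitial_nil _

theorem Reindexes.sim (h : Reindexes A B ι γ) (I : Interpretation) :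
    Sim (A.sys I) (B.sys I) (reindexUp ι γ) (reindexDown ι γ B.overgroups.length) := by
  refine Sim.of_matches ?_ ?_ ?_ ?_
  · intro n m hm _ m' hm'
    unfold reindexUp at hm'
    split_ifs at hm' with hlt
    · rw [List.mem_singleton] at hm'
      subst hm'
      refine ⟨by rw [← h.length_forms]; exact hlt, by simp [h.length_over], ?_⟩
      intro j hj
      rw [getD_tab]
      split_ifs with hjl
      · refine hm.2.2 _ fun hc => hj ?_
        rw [h.mem_iff _ hlt j hjl, getD_idxOf hlt]
        exact hc
      · rfl
    · simp at hm'
  · intro n m hm m' hm'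
    have hm1 : m.1 < ι.length := by rw [h.length_forms]; exact hm.1
    rw [reindexDown, List.mem_singleton] at hm'
    subst hm'
    refine ⟨h.lt_forms _ hm1, by simp, ?_⟩
    intro j hj
    rw [getD_tab]
    split_ifs with hjl
    · by_cases hjg : γ.idxOf j < γ.length
      · refine hm.2.2 _ fun hc => hj ?_
        rw [h.mem_iff _ hm1 _ hjg, getD_idxOf hjg] at hc
        exact hc
      · exact getD_eq_nil (by rw [hm.2.1, ← h.length_over]; omega)
    · rfl
  · intro i
    by_cases hi : i.1 < ι.length
    · refine Or.inl ⟨(ι.getD i.1 0, fun j => i.2 (γ.idxOf j)), h.matches I hi fun j hj => ?_⟩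
      rw [h.idx_over j hj]
    · refine Or.inr fun m hm => pj_none fun e => ?_
      rw [h.length_forms, ← e] at hi
      exact absurd hm.1 hi
  · intro i
    by_cases hi : ι.idxOf i.1 < ι.length
    · refine Or.inl ⟨(ι.idxOf i.1, fun j => i.2 (γ.getD j 0)), ?_⟩
      have := h.matches I hi (x := i.2) (x' := fun j => i.2 (γ.getD j 0)) fun j hj => rfl
      rwa [getD_idxOf hi] at this
    · refine Or.inr fun n m hm => ?_
      have hm1 : m.1 < ι.length := by rw [h.length_forms]; exact hm.1
      rw [reindexDown, filterMap_single]
      show (pj _ _).toList = _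
      rw [pj_none]
      · rfl
      · intro e
        change ι.getD m.1 0 = i.1 at e
        rw [← e, h.idx_forms _ hm1] at hi
        exact absurd hm1 hi

theorem Reindexes.solves (h : Reindexes A B ι γ) {I : Interpretation} {S : Strategy}
    (hS : S.Bounding)
    (hw : S.Solves I A) :
    (S.lift (reindexUp ι γ) (reindexDown ι γ B.overgroups.length)).Solves I B := by
  refine (h.sim I).wins hS hw (ρ := fun i j => ∃ a x' x, a < ι.length ∧
    (∀ j < γ.length, x' j = x (γ.getD j 0)) ∧ i = (a, x') ∧ j = (ι.getD a 0, x)) ?_ ?_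
  · rintro i j ⟨a, x', x, ha, hx, rfl, rfl⟩ J hb hg
    exact (h.matches I ha hx).view_eq hb hg
  · intro tA tB _ ht hWA U hU x hx
    obtain ⟨V, hV, hVU⟩ := h.under U hU
    obtain ⟨a, ha, hwin⟩ := hWA V hV (fun j => x (γ.getD j 0)) fun j => hx _
    have hal : a < ι.length := by
      rw [h.length_forms]
      exact Finset.mem_range.1 ((A.under_mem V hV).2 ha)
    refine ⟨ι.getD a 0, hVU a ha, ?_⟩
    rw [← h.form a hal, ← ht (a, fun j => x (γ.getD j 0)) (ι.getD a 0, x)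
      ⟨a, _, x, hal, fun j _ => rfl, rfl, rfl⟩]
    exact hwin

end

end CoL

namespace CoL

/-! ### Overgroup duplication and merging -/

/-- Replace the string at place `j` by two strings. -/
def splitAt (j : ℕ) (u v : List Bool) (us : List (List Bool)) : List (List Bool) :=
  tab (us.length + 1) fun i =>
    if i < j then us.getD i [] else if i = j then u else if i = j + 1 then v else us.getD (i - 1) []

/-- Replace the strings at the places `j` and `j + 1` by one string. -/
def joinAt (j : ℕ) (w : List Bool) (us : List (List Bool)) : List (List Bool) :=
  tab (us.length - 1) fun i =>
    if i < j then us.getD i [] else if i = j then w else us.getD (i + 1) []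

theorem vis_splitAt {j : ℕ} {u v : List Bool} {us : List (List Bool)} {x : ℕ → ℕ → Bool}
    (hj : j < us.length) : Vis x (splitAt j u v us) ↔ IsInitial u (x j) ∧ IsInitial v (x (j + 1)) ∧
      (∀ i < j, IsInitial (us.getD i []) (x i)) ∧
      ∀ i > j, IsInitial (us.getD i []) (x (i + 1)) := by
  unfold splitAt
  rw [vis_tab]
  constructor
  · intro h
    refine ⟨?_, ?_, fun i hi => ?_, fun i hi => ?_⟩
    · simpa using h j (by omega)
    · simpa using h (j + 1) (by omega)
    · simpa [hi] using h i (by omega)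
    · by_cases hil : i < us.length
      · have := h (i + 1) (by omega)
        rwa [if_neg (by omega), if_neg (by omega), if_neg (by omega), Nat.add_sub_cancel] at this
      · rw [getD_eq_nil (by omega)]
        exact isInitial_nil _
  · rintro ⟨h1, h2, h3, h4⟩ i hi
    split_ifs with c1 c2 c3
    · exact h3 i c1
    · rw [c2]; exact h1
    · rw [c3]; exact h2
    · have := h4 (i - 1) (by omega)
      rwa [Nat.sub_add_cancel (by omega)] at this

theorem vis_joinAt {j : ℕ} {w : List Bool} {us : List (List Bool)} {x : ℕ → ℕ → Bool}
    (hj : j + 1 < us.length) : Vis x (joinAt j w us) ↔ IsInitial w (x j) ∧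
      (∀ i < j, IsInitial (us.getD i []) (x i)) ∧
      ∀ i > j, IsInitial (us.getD (i + 1) []) (x i) := by
  unfold joinAt
  rw [vis_tab]
  constructor
  · intro h
    refine ⟨?_, fun i hi => ?_, fun i hi => ?_⟩
    · simpa using h j (by omega)
    · simpa [hi] using h i (by omega)
    · by_cases hil : i + 1 < us.length
      · have := h i (by omega)
        rwa [if_neg (by omega), if_neg (by omega)] at this
      · rw [getD_eq_nil (by omega)]
        exact isInitial_nil _
  · rintro ⟨h1, h2, h3⟩ i hi
    split_ifs with c1 c2
    · exact h2 i c1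
    · rw [c2]; exact h1
    · exact h3 i (by omega)

theorem vis_at {x : ℕ → ℕ → Bool} {us : List (List Bool)} (j : ℕ) :
    Vis x us ↔ IsInitial (us.getD j []) (x j) ∧ (∀ i < j, IsInitial (us.getD i []) (x i)) ∧
      ∀ i > j, IsInitial (us.getD i []) (x i) := by
  refine ⟨fun h => ⟨h _, fun i _ => h i, fun i _ => h i⟩, fun ⟨h1, h2, h3⟩ i => ?_⟩
  rcases lt_trichotomy i j with hi | rfl | hi
  · exact h2 i hi
  · exact h1
  · exact h3 i hi

theorem vis_at₂ {x : ℕ → ℕ → Bool} {us : List (List Bool)} (j : ℕ) :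
    Vis x us ↔ (IsInitial (us.getD j []) (x j) ∧ IsInitial (us.getD (j + 1) []) (x (j + 1))) ∧
      (∀ i < j, IsInitial (us.getD i []) (x i)) ∧
      ∀ i > j, IsInitial (us.getD (i + 1) []) (x (i + 1)) := by
  refine ⟨fun h => ⟨⟨h _, h _⟩, fun i _ => h i, fun i _ => h _⟩, fun ⟨⟨h0, h1⟩, h2, h3⟩ i => ?_⟩
  rcases lt_trichotomy i j with hi | rfl | hi
  · exact h2 i hi
  · exact h0
  · rcases Nat.lt_or_ge (j + 1) i with hi' | hi'
    · have := h3 (i - 1) (by omega)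
      rwa [Nat.sub_add_cancel (by omega)] at this
    · rw [show i = j + 1 by omega]
      exact h1

/-- All strings in the cover have the same length, so only the truncation of the interleaving itself
can be an initial segment of it. It belongs to the cover exactly when all of `us` are visible, so
the family has the effect of one move at `us`. -/
theorem filterMap_cover {β : Type*} {us : List (List Bool)} (hk : 0 < us.length)
    {x : ℕ → ℕ → Bool} {f : List Bool → Option β} {o : Option β}
    (h1 : ∀ w, ¬ IsInitial w (weave us.length x) → f w = none)
    (h2 : ∀ w, IsInitial w (weave us.length x) → f w = o)
    [Decidable (∀ i < us.length, IsInitial (us.getD i []) (x i))] :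
    (cover us).filterMap f =
      if ∀ i < us.length, IsInitial (us.getD i []) (x i) then o.toList else [] := by
  rw [filterMap_unique (nodup_cover us) (trunc (us.length * maxLen us) (weave us.length x)),
    h2 _ (isInitial_trunc _ _)]
  · by_cases hc : ∀ i < us.length, IsInitial (us.getD i []) (x i)
    · rw [if_pos hc, if_pos ((trunc_mem_cover hk).2 hc)]
    · rw [if_neg hc, if_neg fun h => hc ((trunc_mem_cover hk).1 h)]
  · intro w hw hne
    refine h1 w fun hi => hne ?_
    rw [← length_of_mem_cover hw]
    exact hi.eq_trunc

/-- The conclusion `B` has two copies of the overgroup `j` of `A`. -/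
structure Duplicates (A B : Cirquent) (j : ℕ) : Prop where
  forms : A.forms = B.forms
  under : A.undergroups = B.undergroups
  lt : j < A.overgroups.length
  length : B.overgroups.length = A.overgroups.length + 1
  group : ∀ i < B.overgroups.length, B.overgroup i = A.overgroup (if i ≤ j then i else i - 1)

/-- Translation of moves of the environment. -/
def dupUp (j : ℕ) (_ : ℕ) (m : PMove) : List PMove :=
  (cover [m.2.1.getD j [], m.2.1.getD (j + 1) []]).map fun w => (m.1, joinAt j w m.2.1, m.2.2)

/-- Translation of moves of the machine. -/
def dupDown (j : ℕ) (_ : ℕ) (m : PMove) : List PMove :=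
  [(m.1, splitAt j (unweave 2 0 (m.2.1.getD j [])) (unweave 2 1 (m.2.1.getD j [])) m.2.1, m.2.2)]

/-- Interleave the strings `j` and `j + 1`. -/
def fuse (j : ℕ) (x : ℕ → ℕ → Bool) (i : ℕ) : ℕ → Bool :=
  if i < j then x i else if i = j then weave 2 fun t => x (j + t) else x (i + 1)

section
variable {A B : Cirquent} {j : ℕ}

theorem forall_lt_two {p : ℕ → Prop} : (∀ i < 2, p i) ↔ p 0 ∧ p 1 := by
  refine ⟨fun h => ⟨h 0 (by omega), h 1 (by omega)⟩, fun h i hi => ?_⟩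
  interval_cases i
  · exact h.1
  · exact h.2

/-- The strings at `j` and `j + 1` in the conclusion are the even and the odd bits of the string at
`j` in the premise. A string of the premise is simply taken apart; a pair of strings of the
conclusion is replaced by its cover. -/
theorem Duplicates.matches (h : Duplicates A B j) (I : Interpretation) (a : ℕ)
    (x : ℕ → ℕ → Bool) :
    Matches (A.sys I) (B.sys I) (dupUp j) (dupDown j) (a, fuse j x) (a, x) := by
  have hlt := h.lt
  have hlen := h.length
  have e1 : ∀ i < j, fuse j x i = x i := fun i hi => by simp [fuse, hi]
  have e2 : fuse j x j = weave 2 fun t => x (j + t) := by simp [fuse]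
  have e3 : ∀ i > j, fuse j x i = x (i + 1) := fun i hi => by
    rw [fuse, if_neg (by omega), if_neg (by omega)]
  refine ⟨?_, ?_, ?_⟩
  · show (A.form a).interp I = (B.form a).interp I
    rw [Cirquent.form, h.forms, Cirquent.form]
  · intro n m hm _
    classical
    have hml : j + 1 < m.2.1.length := by rw [hm.2.1]; omega
    show (dupUp j n m).filterMap (pj (a, fuse j x)) = (pj (a, x) m).toList
    unfold dupUp
    rw [List.filterMap_map]
    by_cases hma : m.1 = a
    swap
    · rw [pj_none (fun e => absurd e hma)]
      refine List.filterMap_eq_nil_iff.2 fun w _ => ?_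
      exact pj_none (fun e => absurd e hma)
    rw [filterMap_cover (by simp) (x := fun t => x (j + t))
      (o := if (∀ i < j, IsInitial (m.2.1.getD i []) (x i)) ∧
        ∀ i > j, IsInitial (m.2.1.getD (i + 1) []) (x (i + 1)) then some m.2.2 else none)]
    · unfold pj
      rw [vis_at₂ j]
      simp only [List.length_cons, List.length_nil, Nat.zero_add, Nat.reduceAdd, forall_lt_two,
        List.getD_cons_zero, List.getD_cons_succ, Nat.add_zero, hma, true_and]
      by_cases c1 : IsInitial (m.2.1.getD j []) (x j) ∧
          IsInitial (m.2.1.getD (j + 1) []) (x (j + 1))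
      · rw [if_pos c1]
        exact congrArg _ (if_congr (by rw [and_iff_right c1]) rfl rfl)
      · rw [if_neg c1, if_neg (fun c => c1 c.1)]
        rfl
    · intro w hw
      refine pj_none fun _ hv => hw ?_
      have := ((vis_joinAt hml).1 hv).1
      change IsInitial w (fuse j x j) at this
      rwa [e2] at this
    · intro w hw
      change IsInitial w (weave 2 _) at hw
      refine if_congr ?_ rfl rfl
      show m.1 = a ∧ Vis (fuse j x) _ ↔ _
      rw [vis_joinAt hml, and_iff_right hma, e2, and_iff_right hw]
      refine and_congr ?_ ?_
      · exact forall₂_congr fun i hi => by rw [e1 i hi]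
      · exact forall₂_congr fun i hi => by rw [e3 i hi]
  · intro n m hm
    have hml : j < m.2.1.length := by rw [hm.2.1]; exact h.lt
    show (pj _ m).toList = _
    unfold dupDown
    rw [filterMap_single]
    congr 1
    refine pj_eq rfl (and_congr Iff.rfl ?_)
    have hs := vis_splitAt (u := unweave 2 0 (m.2.1.getD j []))
      (v := unweave 2 1 (m.2.1.getD j [])) (x := x) hml
    rw [← and_assoc] at hs
    rw [vis_at j]
    refine Iff.trans ?_ hs.symm
    refine and_congr ?_ (and_congr ?_ ?_)
    · simp only [e2]
      rw [isInitial_weave (by omega), forall_lt_two]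
      exact Iff.rfl
    · exact forall₂_congr fun i hi => by simp only [e1 i hi]
    · exact forall₂_congr fun i hi => by simp only [e3 i hi]

theorem Duplicates.sim (h : Duplicates A B j) (I : Interpretation) :
    Sim (A.sys I) (B.sys I) (dupUp j) (dupDown j) := by
  have hlt := h.lt
  have hlen := h.length
  refine Sim.of_matches ?_ ?_ ?_ ?_
  · intro n m hm _ m' hm'
    obtain ⟨w, hw, rfl⟩ := List.mem_map.1 hm'
    refine ⟨by rw [h.forms]; exact hm.1, by simp [joinAt, hm.2.1, hlen], ?_⟩
    intro i hi
    change m.1 ∉ _ at hi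
    show (joinAt j w m.2.1).getD i [] = []
    unfold joinAt
    rw [getD_tab]
    split_ifs with c1 c2 c3
    · refine hm.2.2 i ?_
      rwa [h.group i (by omega), if_pos (by omega)]
    · have g1 := hm.2.2 j (by rwa [h.group j (by omega), if_pos le_rfl, ← c3])
      have g2 := hm.2.2 (j + 1) (by
        rwa [h.group (j + 1) (by omega), if_neg (by omega), Nat.add_sub_cancel, ← c3])
      rw [g1, g2] at hw
      -- Outside the group both strings are empty, and the cover of two empty strings contains only
      -- strings of length zero.
      have := length_of_mem_cover hw
      simpa [maxLen] using this
    · refine hm.2.2 (i + 1) ?_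
      rw [hm.2.1] at c1
      rwa [h.group (i + 1) (by omega), if_neg (by omega), Nat.add_sub_cancel]
    · rfl
  · intro n m hm m' hm'
    rw [dupDown, List.mem_singleton] at hm'
    subst hm'
    refine ⟨by rw [← h.forms]; exact hm.1, by simp [splitAt, hm.2.1, hlen], ?_⟩
    intro i hi
    change m.1 ∉ _ at hi
    show (splitAt j _ _ m.2.1).getD i [] = []
    unfold splitAt
    rw [getD_tab]
    split_ifs with c1 c2 c3 c4
    · rw [hm.2.1] at c1
      rw [h.group i (by omega), if_pos (by omega)] at hi
      exact hm.2.2 i hi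
    · rw [h.group i (by omega), if_pos (by omega), c3] at hi
      rw [hm.2.2 j hi]
      rfl
    · rw [h.group i (by omega), if_neg (by omega), c4, Nat.add_sub_cancel] at hi
      rw [hm.2.2 j hi]
      rfl
    · rw [hm.2.1] at c1
      rw [h.group i (by omega), if_neg (by omega)] at hi
      exact hm.2.2 _ hi
    · rfl
  · intro i
    -- Every thread of the premise has the form `fuse j x`: take the even bits and the odd bits of
    -- its string at `j`.
    refine Or.inl ⟨(i.1, fun s => if s < j then i.2 s else if s = j then fun t => i.2 j (2 * t + 0)
      else if s = j + 1 then fun t => i.2 j (2 * t + 1) else i.2 (s - 1)), ?_⟩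
    convert h.matches I i.1 _ using 2
    rcases i with ⟨a, x'⟩
    funext s
    simp only [fuse]
    split_ifs with c1 c2 c3 c4
    · rfl
    · subst c2
      conv_lhs => rw [← weave_unweave (k := 2) (x' s)]
      funext r
      have : r % 2 < 2 := Nat.mod_lt _ (by omega)
      simp only [weave]
      interval_cases hr : r % 2
      · simp
      · simp
    all_goals first | omega | skip
    · rw [Nat.add_sub_cancel]
  · exact fun i => Or.inl ⟨_, h.matches I i.1 i.2⟩

theorem Duplicates.solves (h : Duplicates A B j) {I : Interpretation} {S : Strategy}
    (hS : S.Bounding) (hw : S.Solves I A) : (S.lift (dupUp j) (dupDown j)).Solves I B := by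
  refine (h.sim I).wins hS hw (ρ := fun i k => ∃ a x, i = (a, fuse j x) ∧ k = (a, x)) ?_ ?_
  · rintro i k ⟨a, x, rfl, rfl⟩ J hb hg
    exact (h.matches I a x).view_eq hb hg
  · intro tA tB _ ht hWA U hU x hx
    rw [← h.under] at hU
    obtain ⟨a, ha, hwin⟩ := hWA U hU (fuse j x) (fun i => by
      unfold fuse
      split_ifs
      · exact hx _
      · exact EssFinite.weave (by omega) fun i => hx _
      · exact hx _)
    refine ⟨a, ha, ?_⟩
    rw [← ht (a, fuse j x) (a, x) ⟨a, x, rfl, rfl⟩, Cirquent.form, ← h.forms]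
    exact hwin

end

/-- The overgroup `j` of `B` is the union of the overgroups `j` and `j + 1` (with the elements `G` and
`H`) of `A`. -/
structure Merges (A B : Cirquent) (j : ℕ) (G H : List ℕ) : Prop where
  forms : A.forms = B.forms
  under : A.undergroups = B.undergroups
  lt : j < B.overgroups.length
  length : A.overgroups.length = B.overgroups.length + 1
  left : ∀ i < j, B.overgroup i = A.overgroup i
  right : ∀ i < B.overgroups.length, j < i → B.overgroup i = A.overgroup (i + 1)
  union : ∀ b < B.forms.length, b ∈ B.overgroup j ↔ b ∈ G ∨ b ∈ H
  memG : ∀ b < B.forms.length, b ∈ A.overgroup j ↔ b ∈ G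
  memH : ∀ b < B.forms.length, b ∈ A.overgroup (j + 1) ↔ b ∈ H

/-- Translation of moves of the environment. -/
def mergeUp (j : ℕ) (G H : List ℕ) (n : ℕ) (m : PMove) : List PMove :=
  if m.1 ∈ G then
    if m.1 ∈ H then
      ((allBits n).filter fun w =>
        decide (m.2.1.getD j [] = w.take (m.2.1.getD j []).length)).map
        fun w => (m.1, splitAt j w w m.2.1, m.2.2)
    else [(m.1, splitAt j (m.2.1.getD j []) [] m.2.1, m.2.2)]
  else [(m.1, splitAt j [] (m.2.1.getD j []) m.2.1, m.2.2)]

/-- The longer of two strings. -/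
def longer (u v : List Bool) : List Bool := if u.length ≤ v.length then v else u

/-- Translation of moves of the machine. -/
def mergeDown (j : ℕ) (_ : ℕ) (m : PMove) : List PMove :=
  let u := m.2.1.getD j []
  let v := m.2.1.getD (j + 1) []
  if u = (longer u v).take u.length ∧ v = (longer u v).take v.length then
    [(m.1, joinAt j (longer u v) m.2.1, m.2.2)] else []

/-- Two initial segments of one string are comparable. An incomparable pair is visible in no
diagonal thread, so `mergeDown` may drop it. -/
theorem isInitial_longer {u v : List Bool} {x : ℕ → Bool} :
    IsInitial u x ∧ IsInitial v x ↔
      (u = (longer u v).take u.length ∧ v = (longer u v).take v.length) ∧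
        IsInitial (longer u v) x := by
  unfold longer
  split_ifs with h
  · constructor
    · rintro ⟨h1, h2⟩
      refine ⟨⟨?_, by simp⟩, h2⟩
      rw [h2.eq_trunc]
      exact (isInitial_take h).1 h1
    · rintro ⟨⟨h1, -⟩, h2⟩
      exact ⟨h1 ▸ h2.take _, h2⟩
  · constructor
    · rintro ⟨h1, h2⟩
      refine ⟨⟨by simp, ?_⟩, h1⟩
      rw [h1.eq_trunc]
      exact (isInitial_take (by omega)).1 h2
    · rintro ⟨⟨-, h1⟩, h2⟩
      exact ⟨h2, h1 ▸ h2.take _⟩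

/-- Repeat the string `j`. -/
def dupl (j : ℕ) (x : ℕ → ℕ → Bool) (i : ℕ) : ℕ → Bool := if i ≤ j then x i else x (i - 1)

theorem length_getD_le_size (m : PMove) (j : ℕ) : (m.2.1.getD j []).length ≤ m.size := by
  by_cases hj : j < m.2.1.length
  · rw [List.getD_eq_getElem _ _ hj]
    exact ((List.sublist_flatten_of_mem (List.getElem_mem hj)).length_le).trans
      (Nat.le_add_right _ _)
  · rw [getD_eq_nil (by omega)]
    simp

section
variable {A B : Cirquent} {j : ℕ} {G H : List ℕ}

/-- Threads of the conclusion correspond to the diagonal threads of the premise, whose strings at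
`j` and `j + 1` are equal. Of the extensions of the given string to length `n`, a diagonal thread
sees exactly one or none. -/
theorem Merges.matches (h : Merges A B j G H) (I : Interpretation) (a : ℕ)
    (x : ℕ → ℕ → Bool) :
    Matches (A.sys I) (B.sys I) (mergeUp j G H) (mergeDown j) (a, dupl j x) (a, x) := by
  have hlt := h.lt
  have hlen := h.length
  have e1 : ∀ i ≤ j, dupl j x i = x i := fun i hi => by simp [dupl, hi]
  have e2 : ∀ i ≥ j, dupl j x (i + 1) = x i := fun i hi => by
    rw [dupl, if_neg (by omega), Nat.add_sub_cancel]
  refine ⟨?_, ?_, ?_⟩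
  · show (A.form a).interp I = (B.form a).interp I
    rw [Cirquent.form, h.forms, Cirquent.form]
  · intro n m hm hsize
    have hml : j < m.2.1.length := by rw [hm.2.1]; omega
    have hvis : ∀ u v, Vis (dupl j x) (splitAt j u v m.2.1) ↔
        (IsInitial u (x j) ∧ IsInitial v (x j)) ∧ (∀ i < j, IsInitial (m.2.1.getD i []) (x i)) ∧
        ∀ i > j, IsInitial (m.2.1.getD i []) (x i) := by
      intro u v
      rw [vis_splitAt hml, e1 j le_rfl, e2 j le_rfl, ← and_assoc]
      refine and_congr Iff.rfl (and_congr ?_ ?_)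
      · exact forall₂_congr fun i hi => by rw [e1 i hi.le]
      · exact forall₂_congr fun i hi => by rw [e2 i (le_of_lt hi)]
    show _ = (pj _ m).toList
    unfold mergeUp
    split_ifs with h1 h2
    · rw [List.filterMap_map]
      show List.filterMap (fun w => pj (a, dupl j x) (m.1, splitAt j w w m.2.1, m.2.2)) _ = _
      -- The bound `n` is large enough for strings of length `n` to extend the string of the move.
      have hw : (m.2.1.getD j []).length ≤ n := (length_getD_le_size m j).trans hsize
      rw [filterMap_unique ((nodup_allBits n).filter _) (trunc n (x j))]
      · split_ifs with hc
        · congr 1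
          refine pj_eq rfl (and_congr Iff.rfl ?_)
          simp only [List.mem_filter, mem_allBits, length_trunc, true_and,
            decide_eq_true_eq] at hc
          rw [← isInitial_take hw] at hc
          refine (hvis _ _).trans ?_
          rw [vis_at j]
          refine and_congr ?_ Iff.rfl
          exact ⟨fun _ => hc, fun _ => ⟨isInitial_trunc _ _, isInitial_trunc _ _⟩⟩
        · rw [pj_none]
          · rfl
          · intro _ hv
            refine hc ?_
            simp only [List.mem_filter, mem_allBits, length_trunc, true_and,
              decide_eq_true_eq]
            rw [← isInitial_take hw]
            exact hv j
      · intro w hw' hne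
        refine pj_none fun _ hv => hne ?_
        have := ((hvis _ _).1 hv).1.1
        rw [List.mem_filter, mem_allBits] at hw'
        rw [← hw'.1]
        exact this.eq_trunc
    · rw [filterMap_single]
      congr 1
      refine pj_eq rfl (and_congr Iff.rfl ((hvis _ _).trans ?_))
      rw [vis_at j]
      simp
    · rw [filterMap_single]
      congr 1
      refine pj_eq rfl (and_congr Iff.rfl ((hvis _ _).trans ?_))
      rw [vis_at j]
      simp
  · intro n m hm
    have hml : j + 1 < m.2.1.length := by rw [hm.2.1]; omega
    have key : Vis (dupl j x) m.2.1 ↔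
        (IsInitial (m.2.1.getD j []) (x j) ∧ IsInitial (m.2.1.getD (j + 1) []) (x j)) ∧
        (∀ i < j, IsInitial (m.2.1.getD i []) (x i)) ∧
        ∀ i > j, IsInitial (m.2.1.getD (i + 1) []) (x i) := by
      rw [vis_at₂ j, e1 j le_rfl, e2 j le_rfl]
      refine and_congr Iff.rfl (and_congr ?_ ?_)
      · exact forall₂_congr fun i hi => by rw [e1 i hi.le]
      · exact forall₂_congr fun i hi => by rw [e2 i (le_of_lt hi)]
    rw [isInitial_longer] at key
    show (pj _ m).toList = List.filterMap (pj (a, x)) _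
    unfold mergeDown
    simp only
    split_ifs with hc
    · rw [filterMap_single]
      congr 1
      refine pj_eq rfl (and_congr Iff.rfl (key.trans ?_))
      rw [vis_joinAt hml, and_iff_right hc]
    · rw [pj_none]
      · rfl
      · intro _ hv
        exact hc (key.1 hv).1.1

theorem Merges.wf_up (h : Merges A B j G H) {n : ℕ} {m m' : PMove} (hm : B.Wf m)
    (hm' : m' ∈ mergeUp j G H n m) : A.Wf m' ∧ m'.1 = m.1 := by
  have hlt := h.lt
  have hlen := h.length
  have key : ∀ u v, (m.1 ∉ A.overgroup j → u = []) → (m.1 ∉ A.overgroup (j + 1) → v = []) →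
      A.Wf (m.1, splitAt j u v m.2.1, m.2.2) := by
    intro u v hu hv
    refine ⟨by rw [h.forms]; exact hm.1, by simp [splitAt, hm.2.1, hlen], ?_⟩
    intro i hi
    change m.1 ∉ _ at hi
    show (splitAt j u v m.2.1).getD i [] = []
    unfold splitAt
    rw [getD_tab]
    split_ifs with c1 c2 c3 c4
    · refine hm.2.2 i ?_
      rwa [h.left i c2]
    · rw [c3] at hi
      exact hu hi
    · rw [c4] at hi
      exact hv hi
    · refine hm.2.2 (i - 1) ?_
      rw [hm.2.1] at c1
      rwa [h.right (i - 1) (by omega) (by omega), Nat.sub_add_cancel (by omega)]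
    · rfl
  have hG := h.memG m.1 hm.1
  have hH := h.memH m.1 hm.1
  have hU := h.union m.1 hm.1
  unfold mergeUp at hm'
  split_ifs at hm' with h1 h2
  · obtain ⟨w, -, rfl⟩ := List.mem_map.1 hm'
    exact ⟨key w w (fun c => absurd (hG.2 h1) c) (fun c => absurd (hH.2 h2) c), rfl⟩
  · rw [List.mem_singleton] at hm'
    subst hm'
    exact ⟨key _ _ (fun c => absurd (hG.2 h1) c) (fun _ => rfl), rfl⟩
  · rw [List.mem_singleton] at hm'
    subst hm'
    refine ⟨key _ _ (fun _ => rfl) (fun c => hm.2.2 j ?_), rfl⟩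
    rw [hU]
    rw [hH] at c
    tauto

theorem Merges.wf_down (h : Merges A B j G H) {n : ℕ} {m m' : PMove} (hm : A.Wf m)
    (hm' : m' ∈ mergeDown j n m) : B.Wf m' := by
  have hlt := h.lt
  have hlen := h.length
  have hm1 : m.1 < B.forms.length := by rw [← h.forms]; exact hm.1
  unfold mergeDown at hm'
  simp only at hm'
  split_ifs at hm' with hc
  swap
  · simp at hm'
  rw [List.mem_singleton] at hm'
  subst hm'
  refine ⟨hm1, by simp [joinAt, hm.2.1, hlen], ?_⟩
  intro i hi
  change m.1 ∉ _ at hi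
  show (joinAt j _ m.2.1).getD i [] = []
  unfold joinAt
  rw [getD_tab]
  split_ifs with c1 c2 c3
  · refine hm.2.2 i ?_
    rwa [← h.left i c2]
  · rw [c3, h.union _ hm1, ← h.memG _ hm1, ← h.memH _ hm1, not_or] at hi
    rw [hm.2.2 _ hi.1, hm.2.2 _ hi.2]
    rfl
  · refine hm.2.2 (i + 1) ?_
    rw [hm.2.1] at c1
    rwa [← h.right i (by omega) (by omega)]
  · rfl

/-- If the strings `x' j` and `x' (j + 1)` agree as far as can be seen, the thread `x'` of the premise
equals a thread of the conclusion. -/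
theorem Merges.view_eq (h : Merges A B j G H) (I : Interpretation) {J : List Event} {a : ℕ}
    {x x' : ℕ → ℕ → Bool} (hb : Bounded J) (hg : GoodEvents (A.sys I) (B.sys I) J)
    (hx : ∀ m ∈ J.flatMap (upView (mergeUp j G H)), pj (a, x') m.2 = pj (a, dupl j x) m.2) :
    (A.sys I).view (a, x') (J.flatMap (upView (mergeUp j G H))) =
      (B.sys I).view (a, x) (J.flatMap (downView (mergeDown j))) := by
  rw [← (h.matches I a x).view_eq hb hg]
  refine List.filterMap_congr fun m hm => ?_
  show Option.map _ (pj _ _) = Option.map _ (pj _ _)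
  rw [hx m hm]

theorem wf_of_mem_upView (h : Merges A B j G H) {I : Interpretation} {J : List Event}
    (hg : GoodEvents (A.sys I) (B.sys I) J) {m : Player × PMove}
    (hm : m ∈ J.flatMap (upView (mergeUp j G H))) : A.Wf m.2 := by
  obtain ⟨e, he, hme⟩ := List.mem_flatMap.1 hm
  have := hg e he
  unfold upView at hme
  split_ifs at hme this with hp
  · obtain ⟨m', hm', rfl⟩ := List.mem_map.1 hme
    exact (h.wf_up this hm').1
  · rw [List.mem_singleton] at hme
    subst hme
    exact this

/-- Moves of the environment in the premise have second strings as long as their own bounds, which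
are at most `n`; for earlier moves of the machine the size is bounded because a move of the
environment follows. -/
theorem length_of_mem_upView (h : Merges A B j G H) {I : Interpretation} {J : List Event} {n : ℕ}
    {m₀ : PMove} (hb : Bounded (J ++ [(n, bot, m₀)])) (hg : GoodEvents (A.sys I) (B.sys I) J)
    {m : Player × PMove}
    (hm : m ∈ (J ++ [(n, bot, m₀)]).flatMap (upView (mergeUp j G H))) (h1 : m.2.1 ∈ G)
    (h2 : m.2.1 ∈ H) (h0 : B.Wf m₀) : (m.2.2.1.getD (j + 1) []).length ≤ n := by
  have hlt := h.lt
  have key : ∀ n' m', n' ≤ n → B.Wf m' → ∀ m'' ∈ mergeUp j G H n' m', m''.1 ∈ G → m''.1 ∈ H →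
      (m''.2.1.getD (j + 1) []).length ≤ n := by
    intro n' m' hn hwf m'' hm'' g1 g2
    have e := (h.wf_up hwf hm'').2
    rw [e] at g1 g2
    unfold mergeUp at hm''
    rw [if_pos g1, if_pos g2] at hm''
    obtain ⟨w, hw, rfl⟩ := List.mem_map.1 hm''
    rw [List.mem_filter, mem_allBits] at hw
    have : (splitAt j w w m'.2.1).getD (j + 1) [] = w := by
      unfold splitAt
      rw [getD_tab, if_pos (by rw [hwf.2.1]; omega)]
      simp
    show ((splitAt j w w m'.2.1).getD (j + 1) []).length ≤ n
    rw [this, hw.1]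
    exact hn
  rw [List.flatMap_append, List.mem_append] at hm
  rcases hm with hm | hm
  · obtain ⟨e, he, hme⟩ := List.mem_flatMap.1 hm
    have hw := hg e he
    have hbe := (List.pairwise_append.1 hb.1).2.2 e he (n, bot, m₀) (by simp)
    unfold upView at hme
    split_ifs at hme hw with hp
    · obtain ⟨m', hm', rfl⟩ := List.mem_map.1 hme
      exact key e.1 e.2.2 hbe.1 hw m' hm' h1 h2
    · rw [List.mem_singleton] at hme
      subst hme
      exact (length_getD_le_size _ _).trans (hbe.2 (Or.inr rfl))
  · simp only [List.flatMap_cons, List.flatMap_nil, List.append_nil, upView, if_true] at hm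
    obtain ⟨m', hm', rfl⟩ := List.mem_map.1 hm
    exact key n m₀ le_rfl h0 m' hm' h1 h2

/-- The difficulty is an off-diagonal thread of the premise. If the oformula is in both overgroups,
the thread sees a translated move only when its two strings agree up to length `n`. No earlier
string at `j + 1` is longer, so the history of the thread is that of a diagonal thread. A
translation to a shorter pair could be seen by threads whose histories already differ from all
diagonal ones. -/
theorem Merges.sim (h : Merges A B j G H) (I : Interpretation) :
    Sim (A.sys I) (B.sys I) (mergeUp j G H) (mergeDown j) where
  wfE n m hm _ m' hm' := (h.wf_up hm hm').1
  wfM n m hm m' hm' := h.wf_down hm hm'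
  locM J n m i hb hg := Or.inr ⟨_, (h.matches I i.1 i.2).1,
    (h.matches I i.1 i.2).2.2 n m (by simpa using hg (n, top, m) (by simp)),
    (h.matches I i.1 i.2).view_eq (hb.prefix (List.prefix_append _ _))
        fun e he => hg e (List.mem_append_left _ he)⟩
  locE J n m i hb hg := by
    rcases i with ⟨a, x'⟩
    have hwf : B.Wf m := by
      have := hg (n, bot, m) (by simp)
      rw [if_pos rfl] at this
      exact this
    have hs : m.size ≤ n := hb.2 (n, bot, m) (by simp) rfl
    have hgJ : GoodEvents (A.sys I) (B.sys I) J := fun e he => hg e (List.mem_append_left _ he)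
    have hbJ := hb.prefix (List.prefix_append _ _)
    by_cases hma : m.1 = a
    swap
    · left
      refine List.filterMap_eq_nil_iff.2 fun m' hm' => pj_none fun e => absurd ?_ hma
      rw [← (h.wf_up hwf hm').2]
      exact e
    by_cases hnil : (mergeUp j G H n m).filterMap (pj (a, x')) = []
    · exact Or.inl hnil
    right
    have ha : a < B.forms.length := hma ▸ hwf.1
    suffices hsuff : ∃ x, ∀ e ∈ (J ++ [((n, bot, m) : Event)]).flatMap (upView (mergeUp j G H)),
        pj (a, x') e.2 = pj (a, dupl j x) e.2 by
      obtain ⟨x, hx⟩ := hsuff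
      rw [List.flatMap_append] at hx
      refine ⟨(a, x), (h.matches I a x).1, ?_, h.view_eq I hbJ hgJ
        fun e he => hx e (List.mem_append_left _ he)⟩
      rw [← (h.matches I a x).2.1 n m hwf hs]
      refine List.filterMap_congr fun m' hm' => ?_
      refine hx (bot, m') (List.mem_append_right _ ?_)
      simp only [List.flatMap_cons, List.flatMap_nil, List.append_nil, upView, if_true]
      exact List.mem_map_of_mem hm'
    by_cases hG : a ∈ G
    -- Keep the string at `j` and forget the one at `j + 1`, which is either indistinguishable from
    -- it so far or never consulted.
    · refine ⟨fun i => if i ≤ j then x' i else x' (i + 1), fun e he => ?_⟩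
      refine pj_eq rfl (and_congr_right fun hea => ?_)
      have hd : ∀ i, i ≠ j + 1 → dupl j (fun i => if i ≤ j then x' i else x' (i + 1)) i = x' i := by
        intro i hi
        simp only [dupl]
        split_ifs with c1 c2
        · rfl
        · omega
        · rw [Nat.sub_add_cancel (by omega)]
      have hd' : dupl j (fun i => if i ≤ j then x' i else x' (i + 1)) (j + 1) = x' j := by
        simp [dupl]
      refine forall_congr' fun i => ?_
      by_cases hi : i = j + 1
      swap
      · simp only
        rw [hd i hi]
      subst hi
      simp only
      rw [hd']
      by_cases hH : a ∈ H
      · have hle : (e.2.2.1.getD (j + 1) []).length ≤ n := by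
          refine length_of_mem_upView h hb hgJ he ?_ ?_ hwf
          · rw [hea]; exact hG
          · rw [hea]; exact hH
        -- A visible translated move has the same string of length `n` at both places.
        have hagree : ∀ t < n, x' (j + 1) t = x' j t := by
          by_contra hc
          refine hnil (List.filterMap_eq_nil_iff.2 fun m' hm' => pj_none fun _ hv => hc ?_)
          unfold mergeUp at hm'
          rw [if_pos (hma ▸ hG), if_pos (hma ▸ hH)] at hm'
          obtain ⟨w, hw, rfl⟩ := List.mem_map.1 hm'
          rw [List.mem_filter, mem_allBits] at hw
          have hml : j < m.2.1.length := by rw [hwf.2.1]; exact h.lt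
          obtain ⟨g1, g2, -⟩ := (vis_splitAt hml).1 hv
          intro t ht
          rw [isInitial_iff] at g1 g2
          exact (g2 t (by omega)).symm.trans (g1 t (by omega))
        exact isInitial_congr fun t ht => hagree t (by omega)
      · have := (wf_of_mem_upView h hg he).2.2 (j + 1) (by
          rw [hea, h.memH a ha]; exact hH)
        rw [this]
        simp
    -- Here the strings at `j` are empty in all moves, so the string at `j + 1` is the one to keep.
    · refine ⟨fun i => if i < j then x' i else x' (i + 1), fun e he => ?_⟩
      refine pj_eq rfl (and_congr_right fun hea => ?_)
      refine forall_congr' fun i => ?_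
      by_cases hi : i = j
      · have := (wf_of_mem_upView h hg he).2.2 j (by
          rw [hea, h.memG a ha]; exact hG)
        rw [hi, this]
        simp
      · have : dupl j (fun i => if i < j then x' i else x' (i + 1)) i = x' i := by
          simp only [dupl]
          split_ifs with c1 c2 c3
          · rfl
          · omega
          · omega
          · rw [Nat.sub_add_cancel (by omega)]
        simp only
        rw [this]

/-- Off-diagonal threads matter for legality only: a tuple of strings of the conclusion is tested on
its diagonal tuple in the premise. -/
theorem Merges.solves (h : Merges A B j G H) {I : Interpretation} {S : Strategy}
    (hS : S.Bounding) (hw : S.Solves I A) :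
    (S.lift (mergeUp j G H) (mergeDown j)).Solves I B := by
  refine (h.sim I).wins hS hw (ρ := fun i k => ∃ a x, i = (a, dupl j x) ∧ k = (a, x)) ?_ ?_
  · rintro i k ⟨a, x, rfl, rfl⟩ J hb hg
    exact (h.matches I a x).view_eq hb hg
  · intro tA tB _ ht hWA U hU x hx
    rw [← h.under] at hU
    obtain ⟨a, ha, hwin⟩ := hWA U hU (dupl j x) (fun i => by
      unfold dupl
      split_ifs <;> exact hx _)
    refine ⟨a, ha, ?_⟩
    rw [← ht (a, dupl j x) (a, x) ⟨a, x, rfl, rfl⟩, Cirquent.form, ← h.forms]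
    exact hwin

end

end CoL

namespace CoL

/-! ### Splitting an oformula: contraction, disjunction, conjunction -/

theorem mem_run_filterMap {f : LabMove → Option LabMove} {Γ : Run} {m' : LabMove} :
    m' ∈ Γ.filterMap f ↔ ∃ m ∈ Γ, f m = some m' := by
  constructor
  · intro h
    obtain ⟨n, hn⟩ := mem_take_of_mem h
    obtain ⟨t, ht⟩ := take_filterMap f Γ n
    obtain ⟨m, hm, he⟩ := List.mem_filterMap.1 (ht.subset hn)
    exact ⟨m, mem_of_mem_take hm, he⟩
  · rintro ⟨m, hm, he⟩
    obtain ⟨n, hn⟩ := mem_take_of_mem hm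
    have : m' ∈ (Γ.take n).filterMap f := List.mem_filterMap.2 ⟨m, hn, he⟩
    rw [← take_filterMap_length] at this
    exact mem_of_mem_take this

/-- The infinite string `s` followed by `x`. -/
def consBit (s : Bool) (x : ℕ → Bool) : ℕ → Bool
  | 0 => s
  | n + 1 => x n

theorem isInitial_cons {s b : Bool} {u : List Bool} {x : ℕ → Bool} :
    IsInitial (b :: u) (consBit s x) ↔ b = s ∧ IsInitial u x := by
  rw [isInitial_iff, isInitial_iff]
  constructor
  · intro h
    exact ⟨h 0 (by simp), fun i hi => h (i + 1) (by simpa using hi)⟩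
  · rintro ⟨rfl, h⟩ i hi
    cases i with
    | zero => rfl
    | succ i => exact h i (by simpa using hi)

theorem consBit_eta (x : ℕ → Bool) : consBit (x 0) (fun n => x (n + 1)) = x := by
  funext n
  cases n <;> rfl

theorem EssFinite.consBit {x : ℕ → Bool} (h : EssFinite x) (s : Bool) :
    EssFinite (consBit s x) := by
  refine ((h.image Nat.succ).insert 0).subset fun n hn => ?_
  cases n with
  | zero => exact Set.mem_insert _ _
  | succ n => exact Set.mem_insert_of_mem _ ⟨n, hn, rfl⟩

theorem bits_cons (b : Bool) (u : List Bool) : bits (b :: u) = digit b.toNat :: bits u := rfl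

theorem digit_bool_ne_dot (b : Bool) : digit b.toNat ≠ dot :=
  digit_ne_dot (by cases b <;> simp)

theorem half_dot (s : Bool) (m : Move) : half s (dot :: m) = some (dot :: m) := by simp [half]

/-- The form of the moves of recurrences, as far as visible from their first symbol. -/
def HalfForm (m : Move) : Prop := m.head? = some dot ∨ ∃ b : Bool, m.head? = some (digit b.toNat)

theorem brn_consBit (s : Bool) (x : ℕ → Bool) (m : Move) :
    brn (consBit s x) m = (half s m).bind (brn x) := by
  refine Option.ext fun β => ?_
  rw [Option.bind_eq_some_iff]
  simp only [brn_eq_some]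
  constructor
  · rintro ⟨u, hu, rfl⟩
    cases u with
    | nil => exact ⟨dot :: β, half_dot s β, [], isInitial_nil _, rfl⟩
    | cons b u =>
      rw [isInitial_cons] at hu
      refine ⟨bits u ++ dot :: β, ?_, u, hu.2, rfl⟩
      rw [bits_cons, List.cons_append, half_digit, if_pos hu.1.symm]
  · rintro ⟨m', hm', u, hu, rfl⟩
    unfold half at hm'
    split_ifs at hm' with h1 h2
    · rw [Option.some.inj hm'] at h1 ⊢
      cases u with
      | nil => exact ⟨[], isInitial_nil _, rfl⟩
      | cons b u =>
        rw [bits_cons, List.cons_append, List.head?_cons] at h1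
        exact absurd (Option.some.inj h1) (digit_bool_ne_dot b)
    · refine ⟨s :: u, isInitial_cons.2 ⟨rfl, hu⟩, ?_⟩
      rw [bits_cons, List.cons_append, ← Option.some.inj hm']
      cases m with
      | nil => simp at h2
      | cons c m =>
        rw [List.head?_cons] at h2
        rw [Option.some.inj h2]
        rfl

/-- The form of a move splits into a condition on its first symbol and the form of its halves, as
the format of `Decomp` requires. -/
theorem recForm_half {m : Move} :
    RecForm m ↔ HalfForm m ∧ ∀ s m', half s m = some m' → RecForm m' := by
  constructor
  · rintro ⟨w, α, rfl⟩
    cases w with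
    | nil =>
      refine ⟨Or.inl rfl, fun s m' h => ?_⟩
      rw [show bits [] ++ dot :: α = dot :: α from rfl, half_dot] at h
      exact ⟨[], α, (Option.some.inj h).symm⟩
    | cons b w =>
      refine ⟨Or.inr ⟨b, rfl⟩, fun s m' h => ?_⟩
      rw [bits_cons, List.cons_append, half_digit] at h
      split_ifs at h
      exact ⟨w, α, (Option.some.inj h).symm⟩
  · rintro ⟨h1, h2⟩
    rcases m with _ | ⟨c, m⟩
    · rcases h1 with h | ⟨b, h⟩ <;> simp at h
    rcases h1 with h | ⟨b, h⟩
    · rw [List.head?_cons] at h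
      rw [Option.some.inj h]
      exact ⟨[], m, rfl⟩
    · rw [List.head?_cons] at h
      rw [Option.some.inj h] at h2 ⊢
      obtain ⟨w, α, e⟩ := h2 b m (by rw [half_digit, if_pos rfl])
      exact ⟨b :: w, α, by rw [bits_cons, List.cons_append, e]⟩

theorem filterMap_half_brn (Γ : Run) (s : Bool) (x : ℕ → Bool) :
    (Γ.filterMap (lab (half s))).filterMap (lab (brn x)) =
      Γ.filterMap (lab (brn (consBit s x))) := by
  rw [filterMap_filterMap]
  congr 1
  funext m
  simp only [lab]
  rw [brn_consBit]
  cases half s m.2 <;> rfl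

/-- The tree of branches of `?A` consists of two copies of itself, according to the first bit; a
move at the root belongs to both copies. -/
theorem decomp_half (A : Game) : Decomp A.corecur HalfForm half fun _ : Bool => A.corecur := by
  intro Γ
  change Γ ∈ recLegal A ↔ _ ∧ ∀ s, _ ∈ recLegal A
  simp only [mem_recLegal]
  constructor
  · rintro ⟨h1, h2⟩
    refine ⟨fun m hm => (recForm_half.1 (h1 m hm)).1, fun s => ⟨fun m' hm' => ?_, fun x => ?_⟩⟩
    · obtain ⟨m, hm, he⟩ := mem_run_filterMap.1 hm'
      unfold lab at he
      obtain ⟨β, hβ, rfl⟩ := Option.map_eq_some_iff.1 he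
      exact (recForm_half.1 (h1 m hm)).2 s β hβ
    · rw [filterMap_half_brn]
      exact h2 _
  · rintro ⟨h1, h2⟩
    refine ⟨fun m hm => recForm_half.2 ⟨h1 m hm, fun s m' he => ?_⟩, fun x => ?_⟩
    · refine (h2 s).1 (m.1, m') (mem_run_filterMap.2 ⟨m, hm, ?_⟩)
      simp [lab, he]
    · have := (h2 (x 0)).2 fun n => x (n + 1)
      rwa [filterMap_half_brn, consBit_eta] at this

/-- A winning branch `v` of the half `s` is the branch `sv` of the whole, and one more bit does not
affect essential finiteness. -/
theorem corecur_wn_of_half {A : Game} {Γ : Run} (h : Γ ∈ A.corecur.Lr) {s : Bool}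
    (hw : A.corecur.Wn (Γ.filterMap (lab (half s))) = top) : A.corecur.Wn Γ = top := by
  rw [corecur_wn (((decomp_half A Γ).1 h).2 s)] at hw
  obtain ⟨v, hv, hw⟩ := hw
  rw [corecur_wn h]
  refine ⟨_, hv.consBit s, ?_⟩
  rwa [filterMap_half_brn] at hw

/-- An effective version of `side`. -/
def component (i : Bool) (m : Move) : Option Move :=
  if m.take 2 = compPrefix (i.toNat + 1) then some (m.drop 2) else none

/-- `side` is defined by choice; this form of it can be computed by the machine. -/
theorem side_eq_component : side = component := by
  funext i m
  refine Option.ext fun β => ?_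
  rw [side_eq_some]
  unfold component
  split_ifs with h
  · rw [← h, Option.some_inj]
    constructor
    · intro e
      conv_lhs => rw [e]
      rw [List.drop_left' ]
      simp only [h, compPrefix, List.length_cons, List.length_nil]
    · rintro rfl
      exact (List.take_append_drop 2 m).symm
  · refine ⟨fun e => absurd ?_ h, fun e => by simp at e⟩
    rw [e]
    simp [compPrefix]

/-- The place in the conclusion of an oformula of the premise. -/
def collapse (a b : ℕ) : ℕ := if b ≤ a then b else b - 1

/-- The oformulas `a` and `a + 1` of `A` result from splitting the oformula `a` of `B`. -/
structure Splits (A B : Cirquent) (a : ℕ) : Prop where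
  lt : a < B.forms.length
  length_forms : A.forms.length = B.forms.length + 1
  form_left : ∀ b < a, A.form b = B.form b
  form_right : ∀ b < B.forms.length, a < b → A.form (b + 1) = B.form b
  length_over : A.overgroups.length = B.overgroups.length
  mem_iff : ∀ b < A.forms.length, ∀ j < B.overgroups.length,
    b ∈ A.overgroup j ↔ collapse a b ∈ B.overgroup j

/-- Translation of moves of the environment. -/
def splitUp (f : Bool → Move → Option Move) (a : ℕ) (_ : ℕ) (m : PMove) : List PMove :=
  if m.1 < a then [m]
  else if m.1 = a then
    (f false m.2.2).toList.map (fun β => (a, m.2.1, β)) ++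
      (f true m.2.2).toList.map (fun β => (a + 1, m.2.1, β))
  else [(m.1 + 1, m.2.1, m.2.2)]

/-- Translation of moves of the machine. -/
def splitDown (inj : Bool → Move → Move) (a : ℕ) (_ : ℕ) (m : PMove) : List PMove :=
  [(collapse a m.1, m.2.1,
    if m.1 = a then inj false m.2.2 else if m.1 = a + 1 then inj true m.2.2 else m.2.2)]

section
variable {A B : Cirquent} {a : ℕ}

theorem Splits.mem_iff' (h : Splits A B a) {b : ℕ} (hb : b < A.forms.length) (j : ℕ) :
    b ∈ A.overgroup j ↔ collapse a b ∈ B.overgroup j := by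
  by_cases hj : j < B.overgroups.length
  · exact h.mem_iff b hb j hj
  · rw [Cirquent.overgroup, Cirquent.overgroup, List.getD_eq_default, List.getD_eq_default]
    · simp
    · omega
    · rw [h.length_over]; omega

theorem Splits.form_right' (h : Splits A B a) {b : ℕ} (hb : a < b) : A.form (b + 1) = B.form b := by
  by_cases hj : b < B.forms.length
  · exact h.form_right b hj hb
  · rw [Cirquent.form, Cirquent.form, List.getD_eq_default, List.getD_eq_default]
    · omega
    · rw [h.length_forms]; omega

theorem filterMap_map_toList {α β γ : Type*} (o : Option α) (g : α → β) (p : β → Option γ) :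
    (o.toList.map g).filterMap p = (o.bind fun x => p (g x)).toList := by
  cases o with
  | none => rfl
  | some x => simpa using filterMap_single p (g x)

variable {f : Bool → Move → Option Move} {inj : Bool → Move → Move} {form : Move → Prop}
  {I : Interpretation}

/-- The place in the premise of the part `s` of an oformula of the conclusion. -/
def expand (a b : ℕ) (s : Bool) : ℕ := if b < a then b else if b = a then a + s.toNat else b + 1

/-- The strings of overgroups are left alone, because both parts belong to the overgroups of the
original. The hypothesis `hf` says that a move injected into one part is seen there unchanged and
not at all in the other. -/
theorem Splits.matches (h : Splits A B a)
    (hf : ∀ s s' β, f s (inj s' β) = if s = s' then some β else none) (b : ℕ) (s : Bool)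
    (x : ℕ → ℕ → Bool) :
    Matches (A.sys I) (B.refined I a form f fun s => (A.form (a + s.toNat)).interp I)
      (splitUp f a) (splitDown inj a) (expand a b s, x) ((b, x), s) := by
  refine ⟨?_, ?_, ?_⟩
  · show (A.form (expand a b s)).interp I =
      if b = a then (A.form (a + s.toNat)).interp I else (B.form b).interp I
    unfold expand
    split_ifs with h1 h2 h3
    · omega
    · rw [h.form_left b h1]
    · rfl
    · rw [h.form_right' (by omega)]
  · intro n m hm _
    show (splitUp f a n m).filterMap (pj (expand a b s, x)) =
      (if b = a then (pj (b, x) m).bind (f s) else pj (b, x) m).toList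
    have hA : ∀ (c : ℕ) (β : Move) , c ≠ expand a b s → pj (expand a b s, x) (c, m.2.1, β) = none :=
      fun c β hc => pj_none fun e => absurd e hc
    unfold splitUp
    split_ifs with h1 h2 h3 h4
    · rw [filterMap_single, pj_none, pj_none]
      · rfl
      · intro e; change m.1 = b at e; omega
      · intro e
        change m.1 = expand a b s at e
        rw [expand, if_neg (by omega), if_pos h2] at e
        omega
    · rw [filterMap_single]
      congr 1
      refine pj_eq rfl (and_congr ?_ Iff.rfl)
      show m.1 = expand a b s ↔ m.1 = b
      unfold expand
      split_ifs <;> omega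
    · rw [List.filterMap_append, filterMap_map_toList, filterMap_map_toList]
      have hb : expand a b s = a + s.toNat := by rw [expand, if_neg (by omega), if_pos h4]
      classical
      have hbind : ∀ (s' : Bool) (c : ℕ),
          ((f s' m.2.2).bind fun β => pj (expand a b s, x) (c, m.2.1, β)) =
            if c = expand a b s ∧ Vis x m.2.1 then f s' m.2.2 else none := by
        intro s' c
        cases f s' m.2.2 with
        | none => simp
        | some β =>
          split_ifs with hc
          · exact pj_some hc.1 hc.2
          · exact pj_none fun g1 g2 => hc ⟨g1, g2⟩
      rw [hbind, hbind, hb]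
      by_cases hv : Vis x m.2.1
      · rw [pj_some (i := (b, x)) (m := m) (h3.trans h4.symm) hv, Option.bind_some]
        cases s <;> simp [hv]
      · rw [pj_none (i := (b, x)) (m := m) fun _ => hv]
        simp [hv]
    · rw [List.filterMap_append, filterMap_map_toList, filterMap_map_toList, pj_none]
      · have : ∀ (s' : Bool) c, c ≠ expand a b s →
            ((f s' m.2.2).bind fun β => pj (expand a b s, x) (c, m.2.1, β)) = none := by
          intro s' c hc
          cases f s' m.2.2 with
          | none => rfl
          | some β => exact hA _ _ hc
        rw [this, this]
        · rfl
        · unfold expand; split_ifs <;> omega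
        · unfold expand; split_ifs <;> omega
      · intro e; change m.1 = b at e; omega
    · rw [filterMap_single, pj_none, pj_none]
      · rfl
      · intro e; change m.1 = b at e; omega
      · intro e
        change m.1 + 1 = expand a b s at e
        rw [expand, if_neg (by omega), if_pos (by assumption)] at e
        cases s <;> simp at e <;> omega
    · rw [filterMap_single]
      congr 1
      refine pj_eq rfl (and_congr ?_ Iff.rfl)
      show m.1 + 1 = expand a b s ↔ m.1 = b
      unfold expand
      split_ifs <;> omega
  · intro n m hm
    show (pj (expand a b s, x) m).toList = (splitDown inj a n m).filterMap fun m =>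
      if b = a then (pj (b, x) m).bind (f s) else pj (b, x) m
    unfold splitDown
    rw [filterMap_single]
    congr 1
    split_ifs with h1 h2 h3
    · subst h1
      by_cases hv : Vis x m.2.1
      · rw [pj_some (i := (b, x)) (m := (collapse b m.1, m.2.1, inj false m.2.2))
          (by simp [collapse, h2]) hv]
        simp only [Option.bind_some, hf]
        cases s
        · rw [pj_some (by simp [expand, h2]) hv, if_pos rfl]
        · rw [if_neg (by simp), pj_none]
          intro e
          simp [expand] at e
          omega
      · rw [pj_none fun _ => hv, pj_none fun _ => hv]
        rfl
    · subst h1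
      by_cases hv : Vis x m.2.1
      · rw [pj_some (i := (b, x)) (m := (collapse b m.1, m.2.1, inj true m.2.2))
          (by simp [collapse, h3]) hv]
        simp only [Option.bind_some, hf]
        cases s
        · rw [if_neg (by simp), pj_none]
          intro e
          simp [expand] at e
          omega
        · rw [pj_some (by simp [expand, h3]) hv, if_pos rfl]
      · rw [pj_none fun _ => hv, pj_none fun _ => hv]
        rfl
    · rw [pj_none, pj_none]
      · rfl
      · intro e
        change collapse a m.1 = b at e
        unfold collapse at e
        split_ifs at e <;> omega
      · intro e
        change m.1 = expand a b s at e
        rw [expand, if_neg (by omega), if_pos h1] at e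
        cases s <;> simp at e <;> omega
    · rw [pj_none, pj_none]
      · intro e
        change collapse a m.1 = b at e
        unfold collapse at e
        split_ifs at e <;> omega
      · intro e
        change m.1 = expand a b s at e
        unfold expand at e
        split_ifs at e <;> omega
    · rw [pj_none, pj_none]
      · intro e
        change collapse a m.1 = b at e
        unfold collapse at e
        split_ifs at e <;> omega
      · intro e
        change m.1 = expand a b s at e
        unfold expand at e
        split_ifs at e <;> omega
    · refine pj_eq rfl (and_congr ?_ Iff.rfl)
      show m.1 = expand a b s ↔ collapse a m.1 = b
      unfold expand collapse
      split_ifs <;> omega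

theorem Splits.sim (h : Splits A B a)
    (hf : ∀ s s' β, f s (inj s' β) = if s = s' then some β else none)
    (hform : ∀ s β, form (inj s β)) :
    Sim (A.sys I) (B.refined I a form f fun s => (A.form (a + s.toNat)).interp I)
      (splitUp f a) (splitDown inj a) := by
  have hlen := h.length_forms
  have hlt := h.lt
  refine Sim.of_matches ?_ ?_ ?_ ?_
  · intro n m hm _ m' hm'
    have hm := hm.1
    have key : ∀ c β, c < A.forms.length → collapse a c = m.1 → A.Wf (c, m.2.1, β) := by
      intro c β hc he
      refine ⟨hc, hm.2.1.trans h.length_over.symm, fun j hj => hm.2.2 j ?_⟩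
      rwa [h.mem_iff' hc, he] at hj
    have hm1 := hm.1
    unfold splitUp at hm'
    split_ifs at hm' with h1 h2
    · rw [List.mem_singleton] at hm'
      subst hm'
      exact key m'.1 m'.2.2 (by omega) (by rw [collapse, if_pos (by omega)])
    · rcases List.mem_append.1 hm' with hm' | hm'
      · obtain ⟨β, -, rfl⟩ := List.mem_map.1 hm'
        exact key _ _ (by omega) (by rw [collapse, if_pos le_rfl, h2])
      · obtain ⟨β, -, rfl⟩ := List.mem_map.1 hm'
        exact key _ _ (by omega) (by rw [collapse, if_neg (by omega), h2, Nat.add_sub_cancel])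
    · rw [List.mem_singleton] at hm'
      subst hm'
      exact key _ _ (by omega) (by rw [collapse, if_neg (by omega), Nat.add_sub_cancel])
  · intro n m hm m' hm'
    rw [splitDown, List.mem_singleton] at hm'
    subst hm'
    have hm1 := hm.1
    refine ⟨⟨?_, hm.2.1.trans h.length_over, fun j hj => hm.2.2 j ?_⟩, fun e => ?_⟩
    · show collapse a m.1 < _
      unfold collapse
      split_ifs <;> omega
    · rwa [h.mem_iff' hm1]
    · change collapse a m.1 = a at e
      show form (if m.1 = a then _ else if m.1 = a + 1 then _ else _)
      split_ifs
      · exact hform _ _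
      · exact hform _ _
      · unfold collapse at e
        split_ifs at e <;> omega
  · rintro ⟨c, x⟩
    -- `c ↦ (collapse a c, c = a + 1)` inverts `expand`; for oformulas other than the split one the
    -- second component is immaterial.
    refine Or.inl ⟨((collapse a c, x), decide (c = a + 1)), ?_⟩
    convert h.matches (I := I) (form := form) hf (collapse a c) (decide (c = a + 1)) x using 2
    unfold expand collapse
    by_cases h1 : c = a + 1
    · simp [h1]
    · rw [decide_eq_false h1]
      simp only [Bool.toNat_false]
      split_ifs <;> omega
  · rintro ⟨⟨b, x⟩, s⟩
    exact Or.inl ⟨_, h.matches hf b s x⟩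

/-- Common to contraction, disjunction and conjunction. The connective `c` tells how victory in the
parts yields victory in the whole. In `hU` the predicate `P` stands for "this oformula of the
premise is won", so that `hU` is the purely combinatorial content of the change of undergroups. -/
theorem Splits.solves (h : Splits A B a)
    (hf : ∀ s s' β, f s (inj s' β) = if s = s' then some β else none)
    (hform : ∀ s β, form (inj s β))
    (hD : Decomp ((B.form a).interp I) form f fun s => (A.form (a + s.toNat)).interp I)
    (c : Prop → Prop → Prop)
    (hwin : ∀ Γ ∈ ((B.form a).interp I).Lr,
      c (((A.form a).interp I).Wn (Γ.filterMap (lab (f false))) = top)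
        (((A.form (a + 1)).interp I).Wn (Γ.filterMap (lab (f true))) = top) →
      ((B.form a).interp I).Wn Γ = top)
    (hU : ∀ U ∈ B.undergroups, ∀ P : ℕ → Prop, (∀ V ∈ A.undergroups, ∃ b ∈ V, P b) →
      (∃ b ∈ U, b ≠ a ∧ P (expand a b false)) ∨ a ∈ U ∧ c (P a) (P (a + 1)))
    {S : Strategy} (hS : S.Bounding) (hw : S.Solves I A) :
    (S.lift (splitUp f a) (splitDown inj a)).Solves I B := by
  refine Strategy.Wins.of_refined hD (W := fun t' => A.Won I fun i =>
    t' ((collapse a i.1, i.2), decide (i.1 = a + 1))) ?_ ?_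
  · refine (h.sim hf hform).wins hS hw (ρ := fun i j => ∃ b s x, i = (expand a b s, x) ∧
      j = ((b, x), s)) ?_ ?_
    · rintro i j ⟨b, s, x, rfl, rfl⟩ J hb hg
      exact (h.matches hf b s x).view_eq hb hg
    · intro tA tB _ ht hWA
      convert hWA using 1
      funext i
      refine (ht i _ ⟨_, _, _, ?_, rfl⟩).symm
      rcases i with ⟨b, x⟩
      refine Prod.ext ?_ rfl
      show b = expand a (collapse a b) (decide (b = a + 1))
      unfold expand collapse
      by_cases h1 : b = a + 1
      · simp [h1]
      · rw [decide_eq_false h1]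
        simp only [Bool.toNat_false]
        split_ifs <;> omega
  · intro t t' hl ht1 ht2 hWA U hUB x hx
    rcases hU U hUB (fun b => ((A.form b).interp I).Wn
        (t' ((collapse a b, x), decide (b = a + 1))) = top) (fun V hV => hWA V hV x hx) with
      ⟨b, hbU, hba, hb⟩ | ⟨haU, ha⟩
    · refine ⟨b, hbU, ?_⟩
      have e1 : collapse a (expand a b false) = b := by
        unfold collapse expand
        simp only [Bool.toNat_false]
        split_ifs <;> omega
      rw [e1, ht2 (b, x) _ hba] at hb
      have e2 : A.form (expand a b false) = B.form b := by
        unfold expand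
        split_ifs with g1
        · exact h.form_left b g1
        · exact h.form_right' (by omega)
      rwa [e2] at hb
    · refine ⟨a, haU, hwin _ (hl (a, x)) ?_⟩
      rw [← ht1 (a, x) false rfl, ← ht1 (a, x) true rfl]
      have e0 : collapse a a = a := by simp [collapse]
      have e1 : collapse a (a + 1) = a := by simp [collapse]
      have e2 : decide (a = a + 1) = false := by simp
      rw [e0, e1, e2, decide_eq_true rfl] at ha
      exact ha

/-- The two copies of `?F` are played in the branches that begin with `0` and with `1`, and victory
in either half suffices. -/
theorem Splits.solves_contraction (h : Splits A B a) {F : Formula} (h0 : B.form a = F.corecur)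
    (h1 : A.form a = F.corecur) (h2 : A.form (a + 1) = F.corecur)
    (hU : ∀ U ∈ B.undergroups, ∃ V ∈ A.undergroups, ∀ b ∈ V, collapse a b ∈ U)
    {S : Strategy} (hS : S.Bounding) (hw : S.Solves I A) :
    (S.lift (splitUp half a) (splitDown (fun s β => digit s.toNat :: β) a)).Solves I B := by
  refine h.solves (form := HalfForm) half_digit (fun s β => Or.inr ⟨s, rfl⟩) ?_ Or ?_ ?_ hS hw
  · rw [h0]
    have e : (fun s : Bool => (A.form (a + s.toNat)).interp I) =
        fun _ => F.corecur.interp I := by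
      funext s
      cases s
      · exact congrArg _ h1
      · exact congrArg _ h2
    rw [e]
    exact decomp_half (F.interp I)
  · rw [h0, h1, h2]
    intro Γ hΓ hc
    rcases hc with hc | hc
    · exact corecur_wn_of_half hΓ hc
    · exact corecur_wn_of_half hΓ hc
  · intro U hUB P hP
    obtain ⟨V, hV, hVU⟩ := hU U hUB
    obtain ⟨b, hb, hPb⟩ := hP V hV
    have := hVU b hb
    unfold collapse at this
    unfold expand
    split_ifs at this with g
    · by_cases hba : b = a
      · exact Or.inr ⟨hba ▸ this, Or.inl (hba ▸ hPb)⟩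
      · exact Or.inl ⟨b, this, hba, by rwa [if_pos (by omega)]⟩
    · by_cases hba : b = a + 1
      · subst hba
        exact Or.inr ⟨this, Or.inr hPb⟩
      · refine Or.inl ⟨b - 1, this, by omega, ?_⟩
        rwa [if_neg (by omega), if_neg (by omega), Nat.sub_add_cancel (by omega)]

theorem Splits.solves_disjunction (h : Splits A B a) {E F : Formula} (h0 : B.form a = E.disj F)
    (h1 : A.form a = E) (h2 : A.form (a + 1) = F)
    (hU : ∀ U ∈ B.undergroups, ∃ V ∈ A.undergroups, ∀ b ∈ V, collapse a b ∈ U)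
    {S : Strategy} (hS : S.Bounding) (hw : S.Solves I A) :
    (S.lift (splitUp component a)
      (splitDown (fun s β => compPrefix (s.toNat + 1) ++ β) a)).Solves I B := by
  rw [← side_eq_component]
  refine h.solves (form := ParForm) side_compPrefix ?_ ?_ Or ?_ ?_ hS hw
  · intro s β
    cases s
    · exact ⟨β, Or.inl rfl⟩
    · exact ⟨β, Or.inr rfl⟩
  · rw [h0]
    have e : (fun s : Bool => (A.form (a + s.toNat)).interp I) =
        fun i => cond i (F.interp I) (E.interp I) := by
      funext s
      cases s
      · exact congrArg _ h1
      · exact congrArg _ h2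
    rw [e]
    exact decomp_disj (E.interp I) (F.interp I)
  · rw [h0, h1, h2]
    intro Γ hΓ hc
    refine (disj_wn hΓ).2 ?_
    rw [Bool.exists_bool]
    exact hc
  · intro U hUB P hP
    obtain ⟨V, hV, hVU⟩ := hU U hUB
    obtain ⟨b, hb, hPb⟩ := hP V hV
    have := hVU b hb
    unfold collapse at this
    unfold expand
    split_ifs at this with g
    · by_cases hba : b = a
      · exact Or.inr ⟨hba ▸ this, Or.inl (hba ▸ hPb)⟩
      · exact Or.inl ⟨b, this, hba, by rwa [if_pos (by omega)]⟩
    · by_cases hba : b = a + 1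
      · subst hba
        exact Or.inr ⟨this, Or.inr hPb⟩
      · refine Or.inl ⟨b - 1, this, by omega, ?_⟩
        rwa [if_neg (by omega), if_neg (by omega), Nat.sub_add_cancel (by omega)]

/-- Each undergroup comes from two undergroups of the premise, one without the second conjunct and
one without the first. If their winners are the two conjuncts, the conjunction is won; otherwise one
of the winners is an unaffected element of the undergroup. -/
theorem Splits.solves_conjunction (h : Splits A B a) {E F : Formula} (h0 : B.form a = E.conj F)
    (h1 : A.form a = E) (h2 : A.form (a + 1) = F)
    (hU : ∀ U ∈ B.undergroups, (∃ V ∈ A.undergroups, ∀ b ∈ V, b ≠ a + 1 ∧ collapse a b ∈ U) ∧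
      ∃ V ∈ A.undergroups, ∀ b ∈ V, b ≠ a ∧ collapse a b ∈ U)
    {S : Strategy} (hS : S.Bounding) (hw : S.Solves I A) :
    (S.lift (splitUp component a)
      (splitDown (fun s β => compPrefix (s.toNat + 1) ++ β) a)).Solves I B := by
  rw [← side_eq_component]
  refine h.solves (form := ParForm) side_compPrefix ?_ ?_ And ?_ ?_ hS hw
  · intro s β
    cases s
    · exact ⟨β, Or.inl rfl⟩
    · exact ⟨β, Or.inr rfl⟩
  · rw [h0]
    have e : (fun s : Bool => (A.form (a + s.toNat)).interp I) =
        fun i => cond i (F.interp I) (E.interp I) := by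
      funext s
      cases s
      · exact congrArg _ h1
      · exact congrArg _ h2
    rw [e]
    exact decomp_conj (E.interp I) (F.interp I)
  · rw [h0, h1, h2]
    intro Γ hΓ hc
    refine (conj_wn hΓ).2 ?_
    rw [Bool.forall_bool]
    exact hc
  · intro U hUB P hP
    have key : ∀ b, b ≠ a → b ≠ a + 1 → collapse a b ∈ U → P b →
        ∃ b ∈ U, b ≠ a ∧ P (expand a b false) := by
      intro b g1 g2 g3 g4
      refine ⟨_, g3, ?_, ?_⟩
      · unfold collapse
        split_ifs <;> omega
      · convert g4 using 1
        unfold expand collapse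
        split_ifs <;> simp at * <;> omega
    obtain ⟨⟨V, hV, hVU⟩, V', hV', hVU'⟩ := hU U hUB
    obtain ⟨b, hb, hPb⟩ := hP V hV
    obtain ⟨b', hb', hPb'⟩ := hP V' hV'
    have g := hVU b hb
    have g' := hVU' b' hb'
    -- By the choice of `V` and `V'`, a winner `b` that is not `a`, or `b'` that is not `a + 1`, is
    -- neither of the two conjuncts.
    by_cases e : b = a
    · by_cases e' : b' = a + 1
      · subst e e'
        refine Or.inr ⟨?_, hPb, hPb'⟩
        simpa [collapse] using g.2
      · exact Or.inl (key b' g'.1 e' g'.2 hPb')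
    · exact Or.inl (key b e g.1 g.2 hPb)

end

end CoL

namespace CoL

/-! ### Recurrence -/

/-- Insert the string `w` at place `j`. -/
def insertStr (j : ℕ) (w : List Bool) (us : List (List Bool)) : List (List Bool) :=
  tab (us.length + 1) fun i =>
    if i < j then us.getD i [] else if i = j then w else us.getD (i - 1) []

/-- Remove the string at place `j`. -/
def removeStr (j : ℕ) (us : List (List Bool)) : List (List Bool) :=
  tab (us.length - 1) fun i => if i < j then us.getD i [] else us.getD (i + 1) []

/-- Insert the infinite string `v` at place `j`. -/
def insertInf (j : ℕ) (v : ℕ → Bool) (x : ℕ → ℕ → Bool) (i : ℕ) : ℕ → Bool :=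
  if i < j then x i else if i = j then v else x (i - 1)

theorem vis_insertStr {j : ℕ} {w : List Bool} {us : List (List Bool)} {v : ℕ → Bool}
    {x : ℕ → ℕ → Bool} (hj : j ≤ us.length) :
    Vis (insertInf j v x) (insertStr j w us) ↔ IsInitial w v ∧ Vis x us := by
  unfold insertStr
  rw [vis_tab, vis_iff]
  constructor
  · intro h
    refine ⟨by simpa [insertInf] using h j (by omega), fun i hi => ?_⟩
    by_cases hij : i < j
    · simpa [insertInf, hij] using h i (by omega)
    · have := h (i + 1) (by omega)
      simpa only [insertInf, if_neg (show ¬ i + 1 < j by omega),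
        if_neg (show ¬ i + 1 = j by omega), Nat.add_sub_cancel] using this
  · rintro ⟨h1, h2⟩ i hi
    unfold insertInf
    split_ifs with c1 c2
    · exact h2 i (by omega)
    · exact h1
    · exact h2 (i - 1) (by omega)

theorem vis_removeStr {j : ℕ} {us : List (List Bool)} {v : ℕ → Bool}
    {x : ℕ → ℕ → Bool} (hj : j < us.length) :
    Vis (insertInf j v x) us ↔ IsInitial (us.getD j []) v ∧ Vis x (removeStr j us) := by
  unfold removeStr
  rw [vis_tab, vis_iff]
  constructor
  · intro h
    refine ⟨by simpa [insertInf] using h j hj, fun i hi => ?_⟩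
    by_cases hij : i < j
    · simpa [insertInf, hij] using h i (by omega)
    · have := h (i + 1) (by omega)
      simpa only [insertInf, if_neg (show ¬ i + 1 < j by omega), hij, if_false,
        if_neg (show ¬ i + 1 = j by omega), Nat.add_sub_cancel] using this
  · rintro ⟨h1, h2⟩ i hi
    unfold insertInf
    split_ifs with c1 c2
    · have := h2 i (by omega)
      rwa [if_pos c1] at this
    · rw [c2]
      exact h1
    · have := h2 (i - 1) (by omega)
      rwa [if_neg (by omega), Nat.sub_add_cancel (by omega)] at this

/-- `B` follows from `A` by recurrence, applied to the oformula `a`, with the new overgroup at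
place `j`. -/
structure Recurs (A B : Cirquent) (a j : ℕ) : Prop where
  lt : a < B.forms.length
  length_forms : A.forms.length = B.forms.length
  form : ∀ b < B.forms.length, b ≠ a → A.form b = B.form b
  recur : B.form a = (A.form a).recur
  le : j ≤ B.overgroups.length
  length_over : A.overgroups.length = B.overgroups.length + 1
  left : ∀ i < j, A.overgroup i = B.overgroup i
  new : ∀ b < B.forms.length, b ∈ A.overgroup j ↔ b = a
  right : ∀ i < B.overgroups.length, j ≤ i → A.overgroup (i + 1) = B.overgroup i
  under : A.undergroups = B.undergroups

/-- Translation of moves of the environment. -/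
def recUp (a j : ℕ) (_ : ℕ) (m : PMove) : List PMove :=
  if m.1 = a then
    (parseBits m.2.2).toList.map fun p => (m.1, insertStr j p.1 m.2.1, p.2)
  else [(m.1, insertStr j [] m.2.1, m.2.2)]

/-- Translation of moves of the machine. -/
def recDown (a j : ℕ) (_ : ℕ) (m : PMove) : List PMove :=
  [(m.1, removeStr j m.2.1, if m.1 = a then bits (m.2.1.getD j []) ++ dot :: m.2.2 else m.2.2)]

section
variable {A B : Cirquent} {a j : ℕ} {I : Interpretation}

theorem Recurs.form' (h : Recurs A B a j) {b : ℕ} (hb : b ≠ a) : A.form b = B.form b := by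
  by_cases hj : b < B.forms.length
  · exact h.form b hj hb
  · rw [Cirquent.form, Cirquent.form, List.getD_eq_default, List.getD_eq_default]
    · omega
    · rw [h.length_forms]; omega

/-- The bitstring of a move in `!F` is moved into the list of strings at place `j`, and back. Thus
the branch `v` of `!F` is the thread whose new overgroup has the string `v`. -/
theorem Recurs.matches (h : Recurs A B a j) (b : ℕ) (x : ℕ → ℕ → Bool) (v : ℕ → Bool) :
    Matches (A.sys I) (B.refined I a RecForm brn fun _ => (A.form a).interp I)
      (recUp a j) (recDown a j) (b, insertInf j v x) ((b, x), v) := by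
  have hle := h.le
  have hlen := h.length_over
  refine ⟨?_, ?_, ?_⟩
  · show (A.form b).interp I = if b = a then (A.form a).interp I else (B.form b).interp I
    split_ifs with h1
    · rw [h1]
    · rw [h.form' h1]
  · intro n m hm _
    have hl : j ≤ m.2.1.length := by rw [hm.1.2.1]; exact hle
    show (recUp a j n m).filterMap (pj (b, insertInf j v x)) =
      (if b = a then (pj (b, x) m).bind (brn v) else pj (b, x) m).toList
    unfold recUp
    by_cases hma : m.1 = a
    · obtain ⟨w, γ, hw⟩ := hm.2 hma
      rw [if_pos hma, hw, parseBits_bits]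
      simp only [Option.toList_some, List.map_cons, List.map_nil, filterMap_single]
      congr 1
      by_cases hmb : m.1 = b
      · rw [if_pos (hmb.symm.trans hma)]
        have hv := vis_insertStr (w := w) (v := v) (x := x) hl
        by_cases c1 : Vis x m.2.1
        · rw [pj_some (i := (b, x)) hmb c1, hw, Option.bind_some, brn_bits]
          split_ifs with c2
          · exact pj_some hmb (hv.2 ⟨c2, c1⟩)
          · exact pj_none fun _ hc => c2 (hv.1 hc).1
        · rw [pj_none (i := (b, x)) fun _ => c1, pj_none fun _ hc => c1 (hv.1 hc).2]
          rfl
      · rw [if_neg (fun e => hmb (hma.trans e.symm)), pj_none fun e => absurd e hmb,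
          pj_none fun e => absurd e hmb]
    · rw [if_neg hma, filterMap_single]
      congr 1
      have hv := vis_insertStr (w := []) (v := v) (x := x) hl
      rw [and_iff_right (isInitial_nil v)] at hv
      by_cases hmb : m.1 = b
      · rw [if_neg (fun e => hma (hmb.trans e))]
        exact pj_eq rfl (and_congr Iff.rfl hv)
      · rw [pj_none (i := (b, x)) (m := m) fun e => absurd e hmb, pj_none fun e => absurd e hmb]
        split_ifs <;> rfl
  · intro n m hm
    have hl : j < m.2.1.length := by rw [hm.2.1]; omega
    show (pj (b, insertInf j v x) m).toList = (recDown a j n m).filterMap fun m =>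
      if b = a then (pj (b, x) m).bind (brn v) else pj (b, x) m
    unfold recDown
    rw [filterMap_single]
    congr 1
    have hv := vis_removeStr (v := v) (x := x) hl
    by_cases hmb : m.1 = b
    swap
    · rw [pj_none (i := (b, insertInf j v x)) fun e => absurd e hmb,
        pj_none (i := (b, x)) (m := (m.1, removeStr j m.2.1, _)) fun e => absurd e hmb]
      split_ifs <;> rfl
    by_cases hma : m.1 = a
    · rw [if_pos (hmb.symm.trans hma)]
      simp only [if_pos hma]
      by_cases c1 : Vis x (removeStr j m.2.1)
      · rw [pj_some (i := (b, x))
          (m := (m.1, removeStr j m.2.1, bits (m.2.1.getD j []) ++ dot :: m.2.2)) hmb c1]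
        simp only [Option.bind_some, brn_bits]
        split_ifs with c2
        · exact pj_some hmb (hv.2 ⟨c2, c1⟩)
        · exact pj_none fun _ hc => c2 (hv.1 hc).1
      · rw [pj_none (i := (b, x)) fun _ => c1, pj_none fun _ hc => c1 (hv.1 hc).2]
        rfl
    · rw [if_neg (fun e => hma (hmb.trans e))]
      simp only [if_neg hma]
      refine pj_eq rfl (and_congr Iff.rfl (hv.trans (and_iff_right ?_)))
      have hm1 : m.1 < B.forms.length := h.length_forms ▸ hm.1
      -- Other oformulas are not in the new overgroup, so the string removed from their moves is
      -- empty.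
      rw [hm.2.2 j fun hc => hma ((h.new _ hm1).1 hc)]
      exact isInitial_nil _

theorem Recurs.sim (h : Recurs A B a j) :
    Sim (A.sys I) (B.refined I a RecForm brn fun _ => (A.form a).interp I)
      (recUp a j) (recDown a j) := by
  have hle := h.le
  have hlen := h.length_over
  refine Sim.of_matches ?_ ?_ ?_ ?_
  · intro n m hm _ m' hm'
    have hm := hm.1
    have key : ∀ w β, (m.1 = a ∨ w = []) → A.Wf (m.1, insertStr j w m.2.1, β) := by
      intro w β hw
      refine ⟨h.length_forms ▸ hm.1, by simp [insertStr, hm.2.1, hlen], fun i hi => ?_⟩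
      change m.1 ∉ _ at hi
      show (insertStr j w m.2.1).getD i [] = []
      unfold insertStr
      rw [getD_tab, hm.2.1]
      split_ifs with c1 c2 c3
      · rw [h.left i c2] at hi
        exact hm.2.2 i hi
      · rw [c3, h.new _ hm.1] at hi
        tauto
      · refine hm.2.2 (i - 1) ?_
        rwa [← h.right (i - 1) (by omega) (by omega), Nat.sub_add_cancel (by omega)]
      · rfl
    unfold recUp at hm'
    split_ifs at hm' with h1
    · obtain ⟨p, -, rfl⟩ := List.mem_map.1 hm'
      exact key _ _ (Or.inl h1)
    · rw [List.mem_singleton] at hm'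
      subst hm'
      exact key _ _ (Or.inr rfl)
  · intro n m hm m' hm'
    rw [recDown, List.mem_singleton] at hm'
    subst hm'
    refine ⟨⟨h.length_forms ▸ hm.1, by simp [removeStr, hm.2.1, hlen], fun i hi => ?_⟩, fun e => ?_⟩
    · change m.1 ∉ _ at hi
      show (removeStr j m.2.1).getD i [] = []
      unfold removeStr
      rw [getD_tab, hm.2.1]
      split_ifs with c1 c2
      · rw [← h.left i c2] at hi
        exact hm.2.2 i hi
      · refine hm.2.2 (i + 1) ?_
        rwa [h.right i (by omega) (by omega)]
      · rfl
    · change m.1 = a at e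
      simp only [if_pos e]
      exact ⟨_, _, rfl⟩
  · rintro ⟨b, x⟩
    refine Or.inl ⟨((b, fun i => if i < j then x i else x (i + 1)), x j), ?_⟩
    convert h.matches (I := I) b (fun i => if i < j then x i else x (i + 1)) (x j) using 2
    funext i
    simp only [insertInf]
    split_ifs with c1 c2 c3
    · rfl
    · rw [c2]
    · omega
    · rw [Nat.sub_add_cancel (by omega)]
  · rintro ⟨⟨b, x⟩, v⟩
    exact Or.inl ⟨_, h.matches b x v⟩

theorem essFinite_zero : EssFinite fun _ => false := by simp [EssFinite]

/-- For fixed `x`, the winner in an undergroup of the premise may depend on the string `v` of the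
new overgroup. But threads of oformulas other than `a` do not depend on `v`: either one of them is
won, or `a` wins for every `v`, that is, in every branch of `!F`. -/
theorem Recurs.solves (h : Recurs A B a j) {S : Strategy} (hS : S.Bounding) (hw : S.Solves I A) :
    (S.lift (recUp a j) (recDown a j)).Solves I B := by
  refine Strategy.Wins.of_refined (κ := ℕ → Bool) (a := a) (form := RecForm) (g := brn)
    (H := fun _ => (A.form a).interp I)
    (W := fun t' => ∀ U ∈ B.undergroups, ∀ x v, (∀ j, EssFinite (x j)) → EssFinite v →
      ∃ b ∈ U, ((A.form b).interp I).Wn (t' ((b, x), v)) = top) ?_ ?_ ?_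
  · rw [h.recur]
    exact decomp_recur _
  · refine h.sim.wins hS hw (ρ := fun i j' => ∃ b x v, i = (b, insertInf j v x) ∧
      j' = ((b, x), v)) ?_ ?_
    · rintro i j' ⟨b, x, v, rfl, rfl⟩ J hb hg
      exact (h.matches b x v).view_eq hb hg
    · intro tA tB _ ht hWA U hU x v hx hv
      rw [← h.under] at hU
      obtain ⟨b, hb, hwin⟩ := hWA U hU (insertInf j v x) (fun i => by
        unfold insertInf
        split_ifs
        · exact hx _
        · exact hv
        · exact hx _)
      refine ⟨b, hb, ?_⟩
      rwa [← ht (b, insertInf j v x) ((b, x), v) ⟨b, x, v, rfl, rfl⟩]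
  · intro t t' hl ht1 ht2 hW U hU x hx
    by_cases hex : ∃ b ∈ U, b ≠ a ∧ ((B.form b).interp I).Wn (t (b, x)) = top
    · obtain ⟨b, hb, -, hwin⟩ := hex
      exact ⟨b, hb, hwin⟩
    · have key : ∀ v, EssFinite v → a ∈ U ∧ ((A.form a).interp I).Wn (t' ((a, x), v)) = top := by
        intro v hv
        obtain ⟨b, hb, hwin⟩ := hW U hU x v hx hv
        by_cases hba : b = a
        · subst hba
          exact ⟨hb, hwin⟩
        · refine absurd ⟨b, hb, hba, ?_⟩ hex
          rwa [ht2 (b, x) v hba, h.form' hba] at hwin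
      -- Membership of `a` in the undergroup requires at least one string `v`.
      refine ⟨a, (key _ essFinite_zero).1, ?_⟩
      have hla := hl (a, x)
      simp only at hla
      rw [h.recur] at hla ⊢
      refine (recur_wn hla).2 fun v hv => ?_
      rw [← ht1 (a, x) v rfl]
      exact (key v hv).2

end

/-! ### Corecurrence -/

/-- `B` follows from `A` by corecurrence, applied to the oformula `a`, which has been included in the
overgroups in `K`. -/
structure Corecurs (A B : Cirquent) (a : ℕ) (K : List ℕ) : Prop where
  lt : a < B.forms.length
  length_forms : A.forms.length = B.forms.length
  form : ∀ b < B.forms.length, b ≠ a → A.form b = B.form b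
  corecur : B.form a = (A.form a).corecur
  length_over : A.overgroups.length = B.overgroups.length
  mem_ne : ∀ b < B.forms.length, ∀ i < B.overgroups.length, b ≠ a →
    (b ∈ A.overgroup i ↔ b ∈ B.overgroup i)
  mem : ∀ i < B.overgroups.length, i ∉ K → (a ∈ A.overgroup i ↔ a ∈ B.overgroup i)
  idx : ∀ t < K.length, K.idxOf (K.getD t 0) = t
  lt_over : ∀ t < K.length, K.getD t 0 < B.overgroups.length
  memK : ∀ t < K.length, a ∈ A.overgroup (K.getD t 0)
  not_memK : ∀ t < K.length, a ∉ B.overgroup (K.getD t 0)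
  under : A.undergroups = B.undergroups

/-- Translation of moves of the environment. -/
def corecUp (a : ℕ) (K : List ℕ) (_ : ℕ) (m : PMove) : List PMove :=
  if m.1 = a then
    (parseBits m.2.2).toList.map fun p => (m.1, tab m.2.1.length fun i =>
      if K.idxOf i < K.length then unweave K.length (K.idxOf i) p.1 else m.2.1.getD i [], p.2)
  else [m]

/-- Translation of moves of the machine. -/
def corecDown (a : ℕ) (K : List ℕ) (_ : ℕ) (m : PMove) : List PMove :=
  if m.1 = a then
    (cover (K.map fun i => m.2.1.getD i [])).map fun w => (m.1, tab m.2.1.length fun i =>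
      if K.idxOf i < K.length then [] else m.2.1.getD i [], bits w ++ dot :: m.2.2)
  else [m]

/-- Translation of moves of the environment, when there are no new overgroups. -/
def zeroUp (a : ℕ) (_ : ℕ) (m : PMove) : List PMove :=
  if m.1 = a then
    (parseBits m.2.2).toList.flatMap fun p =>
      if p.1 = List.replicate p.1.length false then [(m.1, m.2.1, p.2)] else []
  else [m]

/-- Translation of moves of the machine, when there are no new overgroups. -/
def zeroDown (a : ℕ) (n : ℕ) (m : PMove) : List PMove :=
  [(m.1, m.2.1, if m.1 = a then bits (List.replicate n false) ++ dot :: m.2.2 else m.2.2)]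

section
variable {A B : Cirquent} {a : ℕ} {K : List ℕ} {I : Interpretation}

theorem Corecurs.form' (h : Corecurs A B a K) {b : ℕ} (hb : b ≠ a) : A.form b = B.form b := by
  by_cases hj : b < B.forms.length
  · exact h.form b hj hb
  · rw [Cirquent.form, Cirquent.form, List.getD_eq_default, List.getD_eq_default]
    · omega
    · rw [h.length_forms]; omega

theorem not_mem_overgroup {C : Cirquent} {i : ℕ} (h : C.overgroups.length ≤ i) (b : ℕ) :
    b ∉ C.overgroup i := by
  rw [Cirquent.overgroup, List.getD_eq_default _ _ h]
  simp

theorem Corecurs.mem_ne' (h : Corecurs A B a K) {b : ℕ} (hb : b < B.forms.length) (hba : b ≠ a)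
    (i : ℕ) : b ∈ A.overgroup i ↔ b ∈ B.overgroup i := by
  by_cases hi : i < B.overgroups.length
  · exact h.mem_ne b hb i hi hba
  · exact iff_of_false (not_mem_overgroup (by rw [h.length_over]; omega) b)
      (not_mem_overgroup (by omega) b)

theorem Corecurs.mem' (h : Corecurs A B a K) {i : ℕ} (hi : ¬ K.idxOf i < K.length) :
    a ∈ A.overgroup i ↔ a ∈ B.overgroup i := by
  by_cases hl : i < B.overgroups.length
  · exact h.mem i hl fun hc => hi (List.idxOf_lt_length_iff.2 hc)
  · exact iff_of_false (not_mem_overgroup (by rw [h.length_over]; omega) a)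
      (not_mem_overgroup (by omega) a)

theorem Corecurs.wf_iff (h : Corecurs A B a K) {b : ℕ} (hba : b ≠ a) (us : List (List Bool))
    (β : Move) : A.Wf (b, us, β) ↔ B.Wf (b, us, β) := by
  unfold Cirquent.Wf
  rw [h.length_forms, h.length_over]
  refine and_congr_right fun hb => and_congr Iff.rfl (forall_congr' fun i => ?_)
  rw [h.mem_ne' hb hba]

theorem Corecurs.wf_up (h : Corecurs A B a K) {m m' : PMove} {n : ℕ} (hm : B.Wf m)
    (hm' : m' ∈ corecUp a K n m) : A.Wf m' := by
  unfold corecUp at hm'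
  split_ifs at hm' with h1
  · obtain ⟨p, -, rfl⟩ := List.mem_map.1 hm'
    refine ⟨h.length_forms ▸ hm.1, by rw [length_tab, hm.2.1, h.length_over], fun i hi => ?_⟩
    change m.1 ∉ _ at hi
    rw [h1] at hi
    show (tab _ _).getD i [] = []
    rw [getD_tab]
    split_ifs with c1 c2
    · have := h.memK _ c2
      rw [getD_idxOf c2] at this
      exact absurd this hi
    · rw [h.mem' c2] at hi
      exact hm.2.2 i (h1 ▸ hi)
    · rfl
  · rw [List.mem_singleton] at hm'
    subst hm'
    exact (h.wf_iff h1 _ _).2 hm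

theorem Corecurs.wf_down (h : Corecurs A B a K) {m m' : PMove} {n : ℕ} (hm : A.Wf m)
    (hm' : m' ∈ corecDown a K n m) : B.Wf m' ∧ (m'.1 = a → RecForm m'.2.2) := by
  unfold corecDown at hm'
  split_ifs at hm' with h1
  · obtain ⟨w, -, rfl⟩ := List.mem_map.1 hm'
    refine ⟨⟨h.length_forms ▸ hm.1, by rw [length_tab, hm.2.1, h.length_over], fun i hi => ?_⟩,
      fun _ => ⟨_, _, rfl⟩⟩
    change m.1 ∉ _ at hi
    rw [h1] at hi
    show (tab _ _).getD i [] = []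
    rw [getD_tab]
    split_ifs with c1 c2
    · rfl
    · rw [← h.mem' c2] at hi
      exact hm.2.2 i (h1 ▸ hi)
    · rfl
  · rw [List.mem_singleton] at hm'
    subst hm'
    exact ⟨(h.wf_iff h1 _ _).1 hm, fun e => absurd e h1⟩

/-- Threads of the oformula `a`. -/
theorem Corecurs.matches (h : Corecurs A B a K) (hK : K ≠ []) {x y : ℕ → ℕ → Bool}
    (hxy : ∀ i, ¬ K.idxOf i < K.length → x i = y i) :
    Matches (A.sys I) (B.refined I a RecForm brn fun _ => (A.form a).interp I)
      (corecUp a K) (corecDown a K) (a, x)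
      ((a, y), weave K.length fun t => x (K.getD t 0)) := by
  have hk : 0 < K.length := List.length_pos_iff.2 hK
  refine ⟨?_, ?_, ?_⟩
  · show (A.form a).interp I = if a = a then (A.form a).interp I else _
    rw [if_pos rfl]
  · intro n m hm _
    show (corecUp a K n m).filterMap (pj (a, x)) =
      (if a = a then (pj (a, y) m).bind (brn _) else pj (a, y) m).toList
    rw [if_pos rfl]
    unfold corecUp
    split_ifs with hma
    swap
    · rw [filterMap_single, pj_none fun e => absurd e hma, pj_none fun e => absurd e hma]
      rfl
    obtain ⟨w, γ, hw⟩ := hm.2 hma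
    rw [hw, parseBits_bits]
    simp only [Option.toList_some, List.map_cons, List.map_nil, filterMap_single]
    congr 1
    -- In the premise the overgroups in `K` receive the parts of the branch `w`. In the conclusion
    -- `a` is not in these overgroups, so their strings are empty and can be overwritten without
    -- loss.
    have hv : Vis x (tab m.2.1.length fun i => if K.idxOf i < K.length then
        unweave K.length (K.idxOf i) w else m.2.1.getD i []) ↔
        Vis y m.2.1 ∧ IsInitial w (weave K.length fun t => x (K.getD t 0)) := by
      rw [vis_tab, isInitial_weave hk, vis_iff]
      constructor
      · intro hv
        refine ⟨fun i hi => ?_, fun t ht => ?_⟩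
        · have := hv i hi
          split_ifs at this with c
          · have := h.not_memK _ c
            rw [getD_idxOf c] at this
            rw [hm.1.2.2 i (hma ▸ this)]
            exact isInitial_nil _
          · rwa [← hxy i c]
        · have := hv (K.getD t 0) (by rw [hm.1.2.1]; exact h.lt_over t ht)
          rwa [h.idx t ht, if_pos ht] at this
      · rintro ⟨h1, h2⟩ i hi
        split_ifs with c
        · have := h2 _ c
          rwa [getD_idxOf c] at this
        · rw [hxy i c]
          exact h1 i hi
    by_cases c1 : Vis y m.2.1
    · rw [pj_some (i := (a, y)) hma c1, hw, Option.bind_some, brn_bits]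
      split_ifs with c2
      · exact pj_some hma (hv.2 ⟨c1, c2⟩)
      · exact pj_none fun _ hc => c2 (hv.1 hc).2
    · rw [pj_none (i := (a, y)) fun _ => c1, pj_none fun _ hc => c1 (hv.1 hc).1]
      rfl
  · intro n m hm
    show (pj (a, x) m).toList = (corecDown a K n m).filterMap fun m =>
      if a = a then (pj (a, y) m).bind (brn _) else pj (a, y) m
    simp only [if_true]
    unfold corecDown
    split_ifs with hma
    swap
    · rw [filterMap_single, pj_none fun e => absurd e hma, pj_none fun e => absurd e hma]
      rfl
    classical
    have hl : (K.map fun i => m.2.1.getD i []).length = K.length := List.length_map _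
    have hg : ∀ t < K.length, (K.map fun i => m.2.1.getD i []).getD t [] =
        m.2.1.getD (K.getD t 0) [] := by
      intro t ht
      rw [List.getD_eq_getElem _ _ (by rwa [hl]), List.getElem_map, List.getD_eq_getElem K _ ht]
    -- The strings in `K` determine only parts of a branch, of unequal lengths, so the machine moves
    -- at all strings of their cover.
    rw [List.filterMap_map, filterMap_cover (by rwa [hl]) (x := fun t => x (K.getD t 0))
      (o := if Vis y (tab m.2.1.length fun i => if K.idxOf i < K.length then []
        else m.2.1.getD i []) then some m.2.2 else none)]
    · rw [hl]
      have hv : Vis x m.2.1 ↔ (∀ t < K.length, IsInitial ((K.map fun i => m.2.1.getD i []).getD t [])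
          (x (K.getD t 0))) ∧ Vis y (tab m.2.1.length fun i => if K.idxOf i < K.length then []
            else m.2.1.getD i []) := by
        rw [vis_tab]
        constructor
        · intro hv
          refine ⟨fun t ht => ?_, fun i hi => ?_⟩
          · rw [hg t ht]
            exact hv _
          · split_ifs with c
            · exact isInitial_nil _
            · rw [← hxy i c]
              exact hv i
        · rintro ⟨h1, h2⟩
          rw [vis_iff]
          intro i hi
          by_cases c : K.idxOf i < K.length
          · have := h1 _ c
            rwa [hg _ c, getD_idxOf c] at this
          · have := h2 i hi
            rwa [if_neg c, ← hxy i c] at this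
      by_cases c : Vis x m.2.1
      · rw [pj_some hma c, if_pos (hv.1 c).1, if_pos (hv.1 c).2]
      · rw [pj_none fun _ => c]
        split_ifs with c1 c2
        · exact absurd (hv.2 ⟨c1, c2⟩) c
        · rfl
        · rfl
    · intro w hw
      rw [hl] at hw
      simp only [Function.comp]
      by_cases c : Vis y (tab m.2.1.length fun i => if K.idxOf i < K.length then []
            else m.2.1.getD i [])
      · have := pj_some (i := (a, y)) (m := (m.1, tab m.2.1.length fun i =>
          if K.idxOf i < K.length then [] else m.2.1.getD i [], bits w ++ dot :: m.2.2)) hma c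
        rw [this, Option.bind_some]
        simp only [brn_bits]
        rw [if_neg hw]
      · rw [pj_none (i := (a, y)) fun _ => c]
        rfl
    · intro w hw
      rw [hl] at hw
      simp only [Function.comp]
      by_cases c : Vis y (tab m.2.1.length fun i => if K.idxOf i < K.length then []
            else m.2.1.getD i [])
      · have := pj_some (i := (a, y)) (m := (m.1, tab m.2.1.length fun i =>
          if K.idxOf i < K.length then [] else m.2.1.getD i [], bits w ++ dot :: m.2.2)) hma c
        rw [this, Option.bind_some, if_pos c]
        simp only [brn_bits]
        rw [if_pos hw]
      · rw [pj_none (i := (a, y)) fun _ => c, if_neg c]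
        rfl

/-- Threads of other oformulas. -/
theorem Corecurs.matches_ne (h : Corecurs A B a K) {b : ℕ} (hb : b ≠ a) (x : ℕ → ℕ → Bool)
    (v : ℕ → Bool) :
    Matches (A.sys I) (B.refined I a RecForm brn fun _ => (A.form a).interp I)
      (corecUp a K) (corecDown a K) (b, x) ((b, x), v) := by
  refine ⟨?_, ?_, ?_⟩
  · show (A.form b).interp I = if b = a then (A.form a).interp I else (B.form b).interp I
    rw [if_neg hb, h.form' hb]
  · intro n m hm _
    show (corecUp a K n m).filterMap (pj (b, x)) =
      (if b = a then (pj (b, x) m).bind (brn v) else pj (b, x) m).toList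
    rw [if_neg hb]
    unfold corecUp
    split_ifs with hma
    · have hmb : m.1 ≠ b := fun e => hb (e.symm.trans hma)
      rw [pj_none (i := (b, x)) (m := m) fun e => absurd e hmb]
      refine List.filterMap_eq_nil_iff.2 fun m' hm' => ?_
      obtain ⟨p, -, rfl⟩ := List.mem_map.1 hm'
      exact pj_none fun e => absurd e hmb
    · exact filterMap_single _ _
  · intro n m hm
    show (pj (b, x) m).toList = (corecDown a K n m).filterMap fun m =>
      if b = a then (pj (b, x) m).bind (brn v) else pj (b, x) m
    simp only [if_neg hb]
    unfold corecDown
    split_ifs with hma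
    · have hmb : m.1 ≠ b := fun e => hb (e.symm.trans hma)
      rw [pj_none (i := (b, x)) (m := m) fun e => absurd e hmb]
      refine (List.filterMap_eq_nil_iff.2 fun m' hm' => ?_).symm
      obtain ⟨p, -, rfl⟩ := List.mem_map.1 hm'
      exact pj_none fun e => absurd e hmb
    · exact (filterMap_single _ _).symm

theorem Corecurs.sim (h : Corecurs A B a K) (hK : K ≠ []) :
    Sim (A.sys I) (B.refined I a RecForm brn fun _ => (A.form a).interp I)
      (corecUp a K) (corecDown a K) := by
  refine Sim.of_matches (fun n m hm _ m' hm' => h.wf_up hm.1 hm')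
    (fun n m hm m' hm' => h.wf_down hm hm') ?_ ?_
  · rintro ⟨b, x⟩
    by_cases hb : b = a
    · subst hb
      exact Or.inl ⟨_, h.matches hK (fun _ _ => rfl)⟩
    · exact Or.inl ⟨_, h.matches_ne hb x fun _ => false⟩
  · rintro ⟨⟨b, y⟩, v⟩
    by_cases hb : b = a
    · subst hb
      -- Every branch `v` is an interleaving: its `t`-th part serves as the string of the `t`-th
      -- overgroup in `K`, and the other strings are kept.
      refine Or.inl ⟨(b, fun i => if K.idxOf i < K.length then
        fun s => v (K.length * s + K.idxOf i) else y i), ?_⟩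
      have hk : 0 < K.length := List.length_pos_iff.2 hK
      convert h.matches (I := I) (y := y) hK (x := fun i => if K.idxOf i < K.length then
        fun s => v (K.length * s + K.idxOf i) else y i) (fun i hi => if_neg hi) using 2
      conv_lhs => rw [← weave_unweave (k := K.length) v]
      funext s
      have hs : s % K.length < K.length := Nat.mod_lt _ hk
      simp only [weave, h.idx _ hs, if_pos hs]
    · exact Or.inl ⟨_, h.matches_ne hb y v⟩

/-- The winning condition. -/
theorem Corecurs.solves_of (h : Corecurs A B a K) {S : Strategy}
    {tr back : ℕ → PMove → List PMove}
    (hsim : Sim (A.sys I) (B.refined I a RecForm brn fun _ => (A.form a).interp I) tr back)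
    (v : (ℕ → ℕ → Bool) → ℕ → Bool) (hv : ∀ x, (∀ j, EssFinite (x j)) → EssFinite (v x))
    (hm : ∀ b x, Matches (A.sys I)
      (B.refined I a RecForm brn fun _ => (A.form a).interp I) tr back (b, x) ((b, x), v x))
    (hS : S.Bounding) (hw : S.Solves I A) :
    (S.lift tr back).Solves I B := by
  refine Strategy.Wins.of_refined (κ := ℕ → Bool) (a := a) (form := RecForm) (g := brn)
    (H := fun _ => (A.form a).interp I)
    (W := fun t' => A.Won I fun i => t' (i, v i.2)) ?_ ?_ ?_
  · rw [h.corecur]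
    exact decomp_corecur _
  · refine hsim.wins hS hw (ρ := fun i j => j = (i, v i.2)) ?_ ?_
    · rintro ⟨b, x⟩ j rfl J hb hg
      exact (hm b x).view_eq hb hg
    · intro tA tB _ ht hWA
      convert hWA using 1
      funext i
      exact (ht i _ rfl).symm
  · intro t t' hl ht1 ht2 hW U hU x hx
    rw [← h.under] at hU
    obtain ⟨b, hb, hwin⟩ := hW U hU x hx
    refine ⟨b, hb, ?_⟩
    by_cases hba : b = a
    · subst hba
      have hla := hl (b, x)
      simp only at hla
      rw [h.corecur] at hla ⊢
      -- The branch of `?F` that is won is the one on which the thread `x` of `F` has been played.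
      refine (corecur_wn hla).2 ⟨v x, hv x hx, ?_⟩
      rwa [← ht1 (b, x) (v x) rfl]
    · simp only at hwin
      rwa [ht2 (b, x) _ hba, h.form' hba] at hwin

theorem Corecurs.solves (h : Corecurs A B a K) (hK : K ≠ []) {S : Strategy} (hS : S.Bounding)
    (hw : S.Solves I A) : (S.lift (corecUp a K) (corecDown a K)).Solves I B := by
  refine h.solves_of (h.sim hK) (fun x => weave K.length fun t => x (K.getD t 0))
    (fun _ hx => EssFinite.weave (List.length_pos_iff.2 hK) fun _ => hx _) (fun b x => ?_) hS hw
  by_cases hb : b = a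
  · subst hb
    exact h.matches hK fun _ _ => rfl
  · exact h.matches_ne hb x _

theorem isInitial_zero {w : List Bool} :
    IsInitial w (fun _ => false) ↔ w = List.replicate w.length false := by
  unfold IsInitial
  rw [List.map_const', List.length_range]

theorem isInitial_of_zero {w : List Bool} {n : ℕ} {v : ℕ → Bool}
    (hv : IsInitial (List.replicate n false) v) (hw : w.length ≤ n) :
    IsInitial w v ↔ IsInitial w fun _ => false := by
  refine isInitial_congr fun i hi => ?_
  rw [isInitial_iff] at hv
  rw [← hv i (by simp; omega)]
  simp

theorem length_le_of_bits {m : PMove} {w : List Bool} {γ : Move}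
    (h : m.2.2 = bits w ++ dot :: γ) : w.length ≤ m.size := by
  unfold PMove.size
  rw [h]
  simp [bits]
  omega

theorem Corecurs.zero_matches_ne (h : Corecurs A B a []) {b : ℕ} (hb : b ≠ a) (x : ℕ → ℕ → Bool)
    (v : ℕ → Bool) :
    Matches (A.sys I) (B.refined I a RecForm brn fun _ => (A.form a).interp I)
      (zeroUp a) (zeroDown a) (b, x) ((b, x), v) := by
  refine ⟨?_, ?_, ?_⟩
  · show (A.form b).interp I = if b = a then (A.form a).interp I else (B.form b).interp I
    rw [if_neg hb, h.form' hb]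
  · intro n m hm _
    show (zeroUp a n m).filterMap (pj (b, x)) =
      (if b = a then (pj (b, x) m).bind (brn v) else pj (b, x) m).toList
    rw [if_neg hb]
    unfold zeroUp
    split_ifs with hma
    · have hmb : m.1 ≠ b := fun e => hb (e.symm.trans hma)
      rw [pj_none (i := (b, x)) (m := m) fun e => absurd e hmb]
      refine List.filterMap_eq_nil_iff.2 fun m' hm' => ?_
      obtain ⟨p, -, hp⟩ := List.mem_flatMap.1 hm'
      split_ifs at hp
      · rw [List.mem_singleton] at hp
        subst hp
        exact pj_none fun e => absurd e hmb
      · simp at hp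
    · exact filterMap_single _ _
  · intro n m hm
    show (pj (b, x) m).toList = (zeroDown a n m).filterMap fun m =>
      if b = a then (pj (b, x) m).bind (brn v) else pj (b, x) m
    simp only [if_neg hb]
    unfold zeroDown
    rw [filterMap_single]
    by_cases hma : m.1 = a
    · have hmb : m.1 ≠ b := fun e => hb (e.symm.trans hma)
      rw [pj_none (i := (b, x)) (m := m) fun e => absurd e hmb, pj_none fun e => absurd e hmb]
    · rw [if_neg hma]

/-- `F` is played in the zero branch of `?F`: moves of the environment at other strings are ignored,
and a move of the machine at `n` zeros is seen there for every `n`. -/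
theorem Corecurs.zero_matches (h : Corecurs A B a []) (b : ℕ) (x : ℕ → ℕ → Bool) :
    Matches (A.sys I) (B.refined I a RecForm brn fun _ => (A.form a).interp I)
      (zeroUp a) (zeroDown a) (b, x) ((b, x), fun _ => false) := by
  by_cases hb : b = a
  swap
  · exact h.zero_matches_ne hb x _
  subst hb
  refine ⟨?_, ?_, ?_⟩
  · show (A.form b).interp I = if b = b then (A.form b).interp I else _
    rw [if_pos rfl]
  · intro n m hm _
    show (zeroUp b n m).filterMap (pj (b, x)) =
      (if b = b then (pj (b, x) m).bind (brn _) else pj (b, x) m).toList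
    rw [if_pos rfl]
    unfold zeroUp
    split_ifs with hmb
    · obtain ⟨w, γ, hw⟩ := hm.2 hmb
      rw [hw, parseBits_bits]
      simp only [Option.toList_some, List.flatMap_cons, List.flatMap_nil, List.append_nil]
      by_cases c1 : Vis x m.2.1
      · rw [pj_some (i := (b, x)) hmb c1, hw, Option.bind_some, brn_bits]
        simp only [isInitial_zero]
        split_ifs with c2
        · rw [filterMap_single, pj_some hmb c1]
        · rfl
      · rw [pj_none (i := (b, x)) fun _ => c1]
        split_ifs
        · rw [filterMap_single, pj_none fun _ => c1]
          rfl
        · rfl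
    · rw [filterMap_single, pj_none fun e => absurd e hmb]
      rfl
  · intro n m hm
    show (pj (b, x) m).toList = (zeroDown b n m).filterMap fun m =>
      if b = b then (pj (b, x) m).bind (brn _) else pj (b, x) m
    simp only [if_true]
    unfold zeroDown
    rw [filterMap_single]
    congr 1
    by_cases c : m.1 = b ∧ Vis x m.2.1
    · have := pj_some (i := (b, x)) (m := (m.1, m.2.1,
        bits (List.replicate n false) ++ dot :: m.2.2)) c.1 c.2
      rw [if_pos c.1, pj_some c.1 c.2, this, Option.bind_some]
      simp only [brn_bits]
      rw [if_pos (isInitial_zero.2 (by simp))]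
    · rw [pj_none (i := (b, x)) (m := m) fun h1 h2 => c ⟨h1, h2⟩,
        pj_none (i := (b, x)) (m := (m.1, m.2.1, if m.1 = b then
          bits (List.replicate n false) ++ dot :: m.2.2 else m.2.2)) fun h1 h2 => c ⟨h1, h2⟩]
      rfl

theorem Corecurs.zero_wf_iff (h : Corecurs A B a []) (b : ℕ) (us : List (List Bool))
    (β β' : Move) : A.Wf (b, us, β) ↔ B.Wf (b, us, β') := by
  unfold Cirquent.Wf
  rw [h.length_forms, h.length_over]
  refine and_congr_right fun hb => and_congr Iff.rfl (forall_congr' fun i => ?_)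
  by_cases hba : b = a
  · simp only [hba]
    rw [h.mem' (by simp)]
  · rw [h.mem_ne' hb hba]

/-- A move of the machine at the root would appear in all branches of `?F`, also in those where the
environment has made other moves, and could be illegal there. Placed at `n` zeros, with `n` at least
the lengths of all bitstrings used before in `?F`, it is seen only in branches that have so far the
same content as the zero branch. -/
theorem Corecurs.zero_sim (h : Corecurs A B a []) :
    Sim (A.sys I) (B.refined I a RecForm brn fun _ => (A.form a).interp I)
      (zeroUp a) (zeroDown a) where
  wfE n m hm _ m' hm' := by
    unfold zeroUp at hm'
    split_ifs at hm' with h1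
    · obtain ⟨p, -, hp⟩ := List.mem_flatMap.1 hm'
      split_ifs at hp
      · rw [List.mem_singleton] at hp
        subst hp
        exact (h.zero_wf_iff _ _ _ m.2.2).2 hm.1
      · simp at hp
    · rw [List.mem_singleton] at hm'
      subst hm'
      exact (h.zero_wf_iff _ _ _ _).2 hm.1
  wfM n m hm m' hm' := by
    rw [zeroDown, List.mem_singleton] at hm'
    subst hm'
    refine ⟨(h.zero_wf_iff _ _ m.2.2 _).1 hm, fun e => ?_⟩
    change m.1 = a at e
    simp only [if_pos e]
    exact ⟨_, _, rfl⟩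
  locE J n m i hb hg := by
    have hwf := hg (n, bot, m) (by simp)
    rw [if_pos rfl] at hwf
    exact Or.inr ⟨_, (h.zero_matches i.1 i.2).1,
      (h.zero_matches i.1 i.2).2.1 n m hwf (hb.2 (n, bot, m) (by simp) rfl),
      (h.zero_matches i.1 i.2).view_eq (hb.prefix (List.prefix_append _ _))
        fun e he => hg e (List.mem_append_left _ he)⟩
  locM J n m i hb hg := by
    obtain ⟨⟨b, y⟩, v⟩ := i
    have hwf := hg (n, top, m) (by simp)
    rw [if_neg (by simp)] at hwf
    have hbJ := hb.prefix (List.prefix_append _ _)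
    have hgJ : GoodEvents (A.sys I) (B.refined I a RecForm brn fun _ => (A.form a).interp I) J :=
      fun e he => hg e (List.mem_append_left _ he)
    by_cases hba : b = a
    swap
    · exact Or.inr ⟨_, (h.zero_matches_ne hba y v).1, (h.zero_matches_ne hba y v).2.2 n m hwf,
        (h.zero_matches_ne hba y v).view_eq hbJ hgJ⟩
    subst hba
    by_cases hv : IsInitial (List.replicate n false) v
    swap
    · left
      show (zeroDown b n m).filterMap (fun m =>
        if b = b then (pj (b, y) m).bind (brn v) else pj (b, y) m) = []
      unfold zeroDown
      rw [filterMap_single]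
      simp only [if_true]
      by_cases c : m.1 = b ∧ Vis y m.2.1
      · have := pj_some (i := (b, y)) (m := (m.1, m.2.1,
          bits (List.replicate n false) ++ dot :: m.2.2)) c.1 c.2
        rw [if_pos c.1, this, Option.bind_some]
        simp only [brn_bits]
        rw [if_neg hv]
        rfl
      · rw [pj_none (i := (b, y)) (m := (m.1, m.2.1, if m.1 = b then
          bits (List.replicate n false) ++ dot :: m.2.2 else m.2.2)) fun h1 h2 => c ⟨h1, h2⟩]
        rfl
    · right
      have hz := h.zero_matches (I := I) b y
      -- Since `v` begins with `n` zeros, a move at a string of length at most `n` is seen in `v`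
      -- exactly when it is seen in the zero branch.
      have hpr : ∀ m' : PMove, B.Wf m' ∧ (m'.1 = b → RecForm m'.2.2) → (∀ w γ, m'.1 = b →
          m'.2.2 = bits w ++ dot :: γ → w.length ≤ n) →
          (B.refined I b RecForm brn fun _ => (A.form b).interp I).pr ((b, y), v) m' =
          (B.refined I b RecForm brn fun _ => (A.form b).interp I).pr
            ((b, y), fun _ => false) m' := by
        intro m' hm' hw
        show (if b = b then (pj (b, y) m').bind (brn v) else pj (b, y) m') =
          if b = b then (pj (b, y) m').bind (brn fun _ => false) else pj (b, y) m'
        rw [if_pos rfl, if_pos rfl]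
        by_cases c : m'.1 = b ∧ Vis y m'.2.1
        · obtain ⟨w, γ, hwγ⟩ := hm'.2 c.1
          rw [pj_some (i := (b, y)) c.1 c.2, hwγ, Option.bind_some, Option.bind_some, brn_bits,
            brn_bits]
          have := isInitial_of_zero hv (hw w γ c.1 hwγ)
          by_cases c2 : IsInitial w v
          · rw [if_pos c2, if_pos (this.1 c2)]
          · rw [if_neg c2, if_neg fun hc => c2 (this.2 hc)]
        · rw [pj_none (i := (b, y)) fun h1 h2 => c ⟨h1, h2⟩]
          rfl
      have hdown : ∀ n' m₁, n' ≤ n → A.Wf m₁ → ∀ m' ∈ zeroDown b n' m₁,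
          (B.Wf m' ∧ (m'.1 = b → RecForm m'.2.2)) ∧ ∀ w γ, m'.1 = b →
          m'.2.2 = bits w ++ dot :: γ → w.length ≤ n := by
        intro n' m₁ hn hm₁ m' hm'
        rw [zeroDown, List.mem_singleton] at hm'
        subst hm'
        refine ⟨⟨(h.zero_wf_iff _ _ m₁.2.2 _).1 hm₁, fun e => ?_⟩, fun w γ e he => ?_⟩
        · change m₁.1 = b at e
          simp only [if_pos e]
          exact ⟨_, _, rfl⟩
        · change m₁.1 = b at e
          simp only [if_pos e] at he
          rw [← parseBits_eq_some, parseBits_bits] at he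
          have := congrArg (fun p => p.map fun q => q.1.length) he
          simp at this
          omega
      refine ⟨(b, y), hz.1, ?_, ?_⟩
      · rw [hz.2.2 n m hwf]
        refine List.filterMap_congr fun m' hm' => ?_
        have := hdown n m le_rfl hwf m' hm'
        exact (hpr m' this.1 this.2).symm
      · rw [hz.view_eq hbJ hgJ]
        refine List.filterMap_congr fun e he => ?_
        obtain ⟨e', he', hd⟩ := List.mem_flatMap.1 he
        have hw' := hgJ e' he'
        -- Earlier moves of the environment have size at most `n`, and earlier moves of the machine
        -- stand at at most `n` zeros.
        have hbe := (List.pairwise_append.1 hb.1).2.2 e' he' (n, top, m) (by simp)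
        unfold lab
        congr 1
        unfold downView at hd
        split_ifs at hd hw' with hp
        · rw [List.mem_singleton] at hd
          subst hd
          refine (hpr _ hw' fun w γ _ hwγ => ?_).symm
          exact (length_le_of_bits hwγ).trans (hbe.2 (Or.inl hp))
        · obtain ⟨m', hm', rfl⟩ := List.mem_map.1 hd
          have := hdown _ _ hbe.1 hw' m' hm'
          exact (hpr m' this.1 this.2).symm

theorem Corecurs.zero_solves (h : Corecurs A B a []) {S : Strategy} (hS : S.Bounding)
    (hw : S.Solves I A) : (S.lift (zeroUp a) (zeroDown a)).Solves I B :=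
  h.solves_of h.zero_sim (fun _ _ => false) (fun _ _ => essFinite_zero) h.zero_matches hS hw

end

end CoL

namespace CoL

/-! ### Axioms: the copy-cat strategy -/

/-- The other element of the pair `{2i, 2i + 1}`. -/
def mate (b : ℕ) : ℕ := if b % 2 = 0 then b + 1 else b - 1

theorem mate_mate (b : ℕ) : mate (mate b) = b := by
  unfold mate
  split_ifs <;> omega

theorem mate_div (b : ℕ) : mate b / 2 = b / 2 := by
  unfold mate
  split_ifs <;> omega

/-- Copy a move into the other oformula of the pair. -/
def mirror (m : PMove) : PMove := (mate m.1, m.2)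

/-- The copy-cat strategy. -/
def copycat : Strategy := fun x => (max x.1 (sizes x.2), x.2.map mirror)

theorem copycat_bounding : copycat.Bounding := by
  intro N E
  refine ⟨le_max_left _ _, fun m hm => (size_le_sizes hm).trans (le_max_right _ _), ?_⟩
  intro m hm
  obtain ⟨m', hm', rfl⟩ := List.mem_map.1 hm
  exact (size_le_sizes (m := m') hm').trans (le_max_right _ _)

theorem pj_mirror (b : ℕ) (x : ℕ → ℕ → Bool) (m : PMove) :
    pj (b, x) (mirror m) = pj (mate b, x) m := by
  refine pj_eq rfl (and_congr ?_ Iff.rfl)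
  show mate m.1 = b ↔ m.1 = mate b
  constructor
  · rintro rfl
    rw [mate_mate]
  · intro h
    rw [h, mate_mate]

/-- The moves made by the player `p`. -/
def played (p : Player) (φ : SPos) : List PMove :=
  φ.filterMap fun e => if e.1 = p then some e.2 else none

theorem played_append (p : Player) (φ ψ : SPos) : played p (φ ++ ψ) = played p φ ++ played p ψ :=
  List.filterMap_append

theorem played_map (p q : Player) (l : List PMove) :
    played p (l.map fun m => (q, m)) = if q = p then l else [] := by
  unfold played
  rw [List.filterMap_map]
  split_ifs with h
  · subst h
    convert List.filterMap_some (l := l) using 2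
    simp
  · refine List.filterMap_eq_nil_iff.2 fun m _ => ?_
    simp [h]

theorem view_sel (g : PMove → Option Move) (p : Player) (φ : SPos) :
    (φ.filterMap (lab g)).filterMap (sel p) =
      ((played p φ).filterMap g).map fun β => (p, β) := by
  induction φ with
  | nil => rfl
  | cons e φ ih =>
    obtain ⟨q, m⟩ := e
    have h1 : played p ((q, m) :: φ) = (if q = p then [m] else []) ++ played p φ := by
      by_cases h : q = p <;> simp [played, h]
    rw [h1, List.filterMap_append, List.map_append, ← ih]
    by_cases h : q = p
    · subst h
      cases hg : g m <;> simp [lab, sel, hg]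
    · cases hg : g m <;> simp [lab, sel, hg, h]

/-- With labels switched, the moves of the environment in `mate b` are the originals of the moves of
the machine in `b`. The machine may lag behind in `b`, and its own copies in `mate b` may lag behind
the originals in `b`. -/
theorem behind_mirror {φ ψ : SPos} (h1 : played top φ <+: (played bot ψ).map mirror)
    (h2 : (played top ψ).map mirror <+: played bot φ) (b : ℕ) (x : ℕ → ℕ → Bool) :
    Behind top (φ.filterMap (lab (pj (b, x)))) ((ψ.filterMap (lab (pj (mate b, x)))).map flip) := by
  have e : ∀ l : List PMove, (l.map mirror).filterMap (pj (b, x)) =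
      l.filterMap (pj (mate b, x)) := by
    intro l
    rw [List.filterMap_map]
    exact List.filterMap_congr fun m _ => pj_mirror b x m
  have e' : ∀ (p : Player) (l : List Move),
      (l.map fun β => (p, β)).map flip = l.map fun β => ((!p, β) : LabMove) := by
    intro p l
    rw [List.map_map]
    rfl
  constructor
  · rw [sel_flip, view_sel, view_sel, e', ← e, Bool.not_not]
    exact (h1.filterMap _).map _
  · rw [sel_flip, view_sel, view_sel, e', ← e]
    exact (h2.filterMap _).map _

theorem mirror_mirror (m : PMove) : mirror (mirror m) = m := by
  unfold mirror
  rw [mate_mate]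

theorem map_mirror_mirror (l : List PMove) : (l.map mirror).map mirror = l := by
  rw [List.map_map]
  convert List.map_id l
  funext m
  exact mirror_mirror m

theorem played_hist (N : ℕ → ℕ) (E : ℕ → List PMove) (r : ℕ) :
    played top (hist copycat N E r) = (played bot (hist copycat N E r)).map mirror := by
  induction r with
  | zero => rfl
  | succ r ih =>
    simp only [hist, played_append, played_map, List.map_append, ih, copycat]
    simp

theorem prefix_append_cases {α : Type*} {l a b : List α} (h : l <+: a ++ b) :
    l <+: a ∨ ∃ r, l = a ++ r ∧ r <+: b := by
  obtain ⟨t, ht⟩ := h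
  rcases List.append_eq_append_iff.1 ht with ⟨c, h1, -⟩ | ⟨c, h1, h2⟩
  · exact Or.inl ⟨c, h1.symm⟩
  · exact Or.inr ⟨c, h1, t, h2.symm⟩

/-- Whole rounds are balanced by `played_hist`, and inside a round the replies come after all the
moves that they copy and in the same order. -/
theorem played_prefix {N : ℕ → ℕ} {E : ℕ → List PMove} {r : ℕ} {ψ : SPos}
    (h : ψ <+: hist copycat N E r) : played top ψ <+: (played bot ψ).map mirror := by
  induction r with
  | zero =>
    rw [hist, List.prefix_nil] at h
    subst h
    exact List.prefix_rfl
  | succ r ih =>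
    rcases prefix_append_cases h with h | ⟨ρ, rfl, hρ⟩
    · exact ih h
    · rw [played_append, played_append, List.map_append, played_hist]
      rw [List.prefix_append_right_inj]
      -- The last round is cut either among the moves of the environment or among the replies.
      rcases prefix_append_cases hρ with hσ | ⟨σ, rfl, hσ⟩
      · obtain ⟨l, hl⟩ := hσ
        obtain ⟨l₁, l₂, -, h1, -⟩ := List.map_eq_append_iff.1 hl.symm
        rw [← h1, played_map]
        simp
      · obtain ⟨l, hl⟩ := hσ
        obtain ⟨l₁, l₂, h0, h1, -⟩ := List.map_eq_append_iff.1 hl.symm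
        rw [← h1]
        simp only [played_append, played_map]
        simp only [Bool.false_eq_true, if_false, if_true, List.nil_append, List.append_nil,
          Bool.true_eq_false]
        simp only [copycat] at h0
        rw [h0]
        exact List.prefix_append _ _

/-- The oformulas `2i` and `2i + 1` of `C` are negations of each other and form the groups
number `i`. -/
structure Paired (C : Cirquent) (k : ℕ) : Prop where
  length_forms : C.forms.length = 2 * k
  form : ∀ i < k, C.form (2 * i) = (C.form (2 * i + 1)).neg
  under : ∀ U ∈ C.undergroups, ∃ i < k, 2 * i ∈ U ∧ 2 * i + 1 ∈ U
  mem_over : ∀ b j, b < 2 * k → (b ∈ C.overgroup j ↔ b / 2 = j)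

theorem IsAxiom.paired {C : Cirquent} (h : IsAxiom C) : ∃ k, Paired C k := by
  obtain ⟨Fs, -, h1, h2, h3⟩ := h
  refine ⟨Fs.length, ?_, ?_, ?_, ?_⟩
  · rw [h1]
    simp [List.length_flatMap]
    ring
  · intro i hi
    unfold Cirquent.form
    rw [h1]
    clear h1 h2 h3
    induction Fs generalizing i with
    | nil => simp at hi
    | cons F Fs ih =>
      cases i with
      | zero => simp
      | succ i =>
        have := ih i (by simpa using hi)
        rw [show 2 * (i + 1) = 2 * i + 1 + 1 by ring]
        simpa using this
  · intro U hU
    rw [h2] at hU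
    obtain ⟨i, hi, rfl⟩ := List.mem_map.1 hU
    exact ⟨i, List.mem_range.1 hi, by simp, by simp⟩
  · intro b j hb
    unfold Cirquent.overgroup
    rw [h3]
    by_cases hj : j < Fs.length
    · rw [List.getD_eq_getElem _ _ (by simpa using hj)]
      simp
      omega
    · rw [List.getD_eq_default _ _ (by simpa using hj)]
      simp
      omega

section
variable {C : Cirquent} {k : ℕ}

theorem mate_lt {b k : ℕ} (h : b < 2 * k) : mate b < 2 * k := by
  unfold mate
  split_ifs <;> omega

theorem Paired.form_mate (h : Paired C k) {b : ℕ} (hb : b < 2 * k) :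
    C.form (mate b) = (C.form b).neg := by
  unfold mate
  split_ifs with hp
  · have := h.form (b / 2) (by omega)
    rw [show 2 * (b / 2) = b by omega] at this
    rw [this, Formula.neg_neg]
  · have := h.form (b / 2) (by omega)
    rwa [show 2 * (b / 2) + 1 = b by omega, show 2 * (b / 2) = b - 1 by omega] at this

theorem Paired.wf_mirror (h : Paired C k) {m : PMove} (hm : C.Wf m) : C.Wf (mirror m) := by
  have hb : m.1 < 2 * k := h.length_forms ▸ hm.1
  refine ⟨?_, hm.2.1, fun j hj => hm.2.2 j ?_⟩
  · rw [h.length_forms]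
    exact mate_lt hb
  · change mate m.1 ∉ _ at hj
    rw [h.mem_over _ _ (mate_lt hb), mate_div] at hj
    rwa [h.mem_over _ _ hb]

/-- The thread of `mate b`, with labels switched, is a legal position of the same game as the thread
of `b`, because the formulas are negations of each other. The thread of `b` with the reply is a
`PosDelay` of it, so legality follows from `Game.Transfer`. -/
theorem Paired.legal_reply (h : Paired C k) {I : Interpretation} {N : ℕ → ℕ}
    {E : ℕ → List PMove} {r : ℕ} {q : SPos} {m : PMove}
    (hq : q ++ [(top, m)] <+: hist copycat N E r) (hl : (C.sys I).Legal q) :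
    (C.sys I).Legal (q ++ [(top, m)]) := by
  have hp := played_prefix hq
  have hpq := played_prefix ((List.prefix_append _ _).trans hq)
  have et : played top (q ++ [(top, m)]) = played top q ++ [m] := by
    rw [played_append]; rfl
  have eb : played bot (q ++ [(top, m)]) = played bot q := by
    rw [played_append]
    simp [played]
  have hmem : m ∈ (played bot q).map mirror := by
    rw [et, eb] at hp
    exact hp.subset (by simp)
  have hwf : C.Wf m := by
    obtain ⟨m', hm', rfl⟩ := List.mem_map.1 hmem
    unfold played at hm'
    obtain ⟨e, he, hem⟩ := List.mem_filterMap.1 hm'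
    split_ifs at hem
    rw [← Option.some.inj hem]
    exact h.wf_mirror (hl.1 e he)
  refine ⟨fun e he => ?_, fun i => ?_⟩
  · rcases List.mem_append.1 he with he | he
    · exact hl.1 e he
    · rw [List.mem_singleton] at he
      rw [he]
      exact hwf
  · obtain ⟨b, x⟩ := i
    have hb := hl.2 (b, x)
    unfold Sys.view at hb ⊢
    rw [List.filterMap_append, filterMap_lab_single]
    by_cases hmb : m.1 = b ∧ Vis x m.2.1
    swap
    · rw [show (C.sys I).pr (b, x) m = none from pj_none fun h1 h2 => hmb ⟨h1, h2⟩]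
      simpa using hb
    have hpj : (C.sys I).pr (b, x) m = some m.2.2 := pj_some hmb.1 hmb.2
    have hb2 : b < 2 * k := by rw [← hmb.1, ← h.length_forms]; exact hwf.1
    rw [hpj]
    have ev : (q ++ [(top, m)]).filterMap (lab (pj (b, x))) =
        q.filterMap (lab (pj (b, x))) ++ [(top, m.2.2)] := by
      rw [List.filterMap_append, filterMap_lab_single, pj_some hmb.1 hmb.2]
      rfl
    -- A cut of the play with the reply is compared with a cut without it that has the same moves of
    -- the environment.
    have step : ∀ φ ψ : SPos, φ <+: q ++ [(top, m)] → ψ <+: q →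
        played bot φ = played bot ψ →
        Behind top (φ.filterMap (lab (pj (b, x))))
          ((ψ.filterMap (lab (pj (mate b, x)))).map flip) := by
      intro φ ψ h1 h2 h4
      refine behind_mirror ?_ ?_ b x
      · rw [← h4]
        exact played_prefix (h1.trans hq)
      · have := (played_prefix (h2.trans ((List.prefix_append _ _).trans hq))).map mirror
        rw [map_mirror_mirror] at this
        rwa [h4]
    refine (Formula.transfer I (C.form b)).legal top _ m.2.2
      ((q.filterMap (lab (pj (mate b, x)))).map flip) ⟨?_, fun t => ?_⟩ ?_ hb
    · rw [show (C.sys I).pr (b, x) = pj (b, x) from rfl, ← ev]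
      exact step _ q List.prefix_rfl List.prefix_rfl eb
    · rw [show (C.sys I).pr (b, x) = pj (b, x) from rfl, ← ev]
      obtain ⟨t', ht'⟩ := list_take_filterMap (lab (pj (b, x))) (q ++ [(top, m)]) t
      rw [ht']
      refine ⟨((q.take t').filterMap (lab (pj (mate b, x)))).length, ?_⟩
      rw [← List.map_take, ← List.prefix_iff_eq_take.1 ((List.take_prefix t' q).filterMap _)]
      refine step _ _ (List.take_prefix _ _) (List.take_prefix _ _) ?_
      -- Cutting `q ++ [(top, m)]` and `q` at the same place loses or keeps the same moves of the
      -- environment, as the additional move is one of the machine.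
      · rw [List.take_append, played_append]
        rcases Nat.eq_zero_or_pos (t' - q.length) with h0 | h0
        · rw [h0]
          simp [played]
        · rw [List.take_of_length_le (l := [(top, m)]) (by rw [List.length_singleton]; exact h0)]
          simp [played]
    · have := hl.2 (mate b, x)
      change Position.toRun _ ∈ ((C.form (mate b)).interp I).Lr at this
      rw [h.form_mate hb2, (Formula.neg_interp I _).1, neg_toRun] at this
      exact this

theorem run_neg_limit {s : ℕ → Position} (hs : Chain s) :
    (Run.limit s).neg = Run.limit fun r => (s r).map flip := by
  rw [neg_eq, filterMap_limit hs]
  simp only [List.filterMap_eq_map']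

/-- In the limit all moves have been copied, so both runs have the same moves of each player. An
initial segment of one thread comes from some cut of the play, and is compared with the other thread
of the same cut. -/
theorem runDelay_copycat (N : ℕ → ℕ) (E : ℕ → List PMove) (b : ℕ) (x : ℕ → ℕ → Bool) :
    RunDelay top (Run.limit fun r => (hist copycat N E r).filterMap (lab (pj (b, x))))
      (Run.limit fun r => (hist copycat N E r).filterMap (lab (pj (mate b, x)))).neg := by
  have hc : ∀ i : Thread, Chain fun r => (hist copycat N E r).filterMap (lab (pj i)) :=
    fun i _ _ hrs => (hist_prefix copycat N E hrs).filterMap _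
  have hc' : Chain fun r => ((hist copycat N E r).filterMap (lab (pj (mate b, x)))).map flip :=
    fun r s hrs => (hc _ r s hrs).map _
  rw [run_neg_limit (hc _)]
  have key : ∀ r, Behind top ((hist copycat N E r).filterMap (lab (pj (b, x))))
      (((hist copycat N E r).filterMap (lab (pj (mate b, x)))).map flip) := by
    intro r
    have := played_hist N E r
    exact behind_mirror (this ▸ List.prefix_rfl)
      (by rw [this, map_mirror_mirror]) b x
  refine ⟨fun q => ?_, fun t => ?_⟩
  · rw [filterMap_limit (hc _), filterMap_limit hc']
    congr 1
    funext r
    have e : ∀ l : List PMove, (l.map mirror).filterMap (pj (b, x)) =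
        l.filterMap (pj (mate b, x)) := by
      intro l
      rw [List.filterMap_map]
      exact List.filterMap_congr fun m _ => pj_mirror b x m
    have h1 := played_hist N E r
    have h2 : (played top (hist copycat N E r)).map mirror = played bot (hist copycat N E r) := by
      rw [h1, map_mirror_mirror]
    rw [sel_flip, view_sel, view_sel, ← e]
    cases q
    · rw [show (!false) = top from rfl, h2, List.map_map]
      rfl
    · rw [show (!true) = bot from rfl, ← h1, List.map_map]
      rfl
  · obtain ⟨r, hr⟩ := take_limit_prefix (hc (b, x)) t
    obtain ⟨t', ht'⟩ := list_take_filterMap (lab (pj (b, x))) (hist copycat N E r)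
      ((Run.limit fun r => (hist copycat N E r).filterMap (lab (pj (b, x)))).take t).length
    rw [← List.prefix_iff_eq_take.1 hr] at ht'
    set ψ := (hist copycat N E r).take t'
    have hψ : ψ <+: hist copycat N E r := List.take_prefix _ _
    refine ⟨(ψ.filterMap (lab (pj (mate b, x)))).length, ?_⟩
    have e2 : (Run.limit fun r => ((hist copycat N E r).filterMap
        (lab (pj (mate b, x)))).map flip).take (ψ.filterMap (lab (pj (mate b, x)))).length =
        (ψ.filterMap (lab (pj (mate b, x)))).map flip := by
      have hle : (ψ.filterMap (lab (pj (mate b, x)))).length ≤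
          (((hist copycat N E r).filterMap (lab (pj (mate b, x)))).map flip).length := by
        rw [List.length_map]
        exact (hψ.filterMap _).length_le
      rw [take_eq _ hle, take_limit_length hc' r, ← List.map_take,
        ← List.prefix_iff_eq_take.1 (hψ.filterMap _)]
    rw [e2, ht']
    have := played_prefix hψ
    refine behind_mirror this ?_ b x
    have := this.map mirror
    rwa [map_mirror_mirror] at this

/-- If `F` is not won in a thread, the same run with labels switched is won in `¬F`. The actual
thread of `¬F` is a `⊤`-delay of that run, hence is won too. -/
theorem Paired.solves (h : Paired C k) (I : Interpretation) : copycat.Solves I C := by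
  intro N E _
  by_cases hbi : (C.sys I).BotIllegal (hist copycat N E)
  · exact Or.inl hbi
  refine Or.inr ?_
  have hleg : ∀ (r : ℕ) (q : SPos), q <+: hist copycat N E r → (C.sys I).Legal q := by
    intro r q
    induction q using List.reverseRecOn with
    | nil => exact fun _ => Sys.legal_nil _
    | append_singleton q e ih =>
      intro hq
      have hl := ih ((List.prefix_append _ _).trans hq)
      obtain ⟨p, m⟩ := e
      cases p
      · by_contra hc
        exact hbi ⟨r, q, m, hq, hl, hc⟩
      · exact h.legal_reply hq hl
  have hl := fun r => hleg r _ List.prefix_rfl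
  refine ⟨hl, fun U hU x hx => ?_⟩
  obtain ⟨i, hi, h0, h1⟩ := h.under U hU
  have hlim : ∀ j : Thread, (Run.limit fun r => (C.sys I).view j (hist copycat N E r)) ∈
      ((C.form j.1).interp I).Lr := fun j =>
    (mem_of_limit ((C.sys I).G j).lr_iff (chain_view (C.sys I) j copycat N E)).2
      fun r => (hl r).2 j
  by_cases hw : ((C.form (2 * i + 1)).interp I).Wn
      (Run.limit fun r => (C.sys I).view (2 * i + 1, x) (hist copycat N E r)) = top
  · exact ⟨_, h1, hw⟩
  refine ⟨_, h0, ?_⟩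
  have hm : mate (2 * i) = 2 * i + 1 := by simp [mate]
  have hd := runDelay_copycat N E (2 * i) x
  rw [hm] at hd
  have l0 := hlim (2 * i, x)
  have l1 := hlim (2 * i + 1, x)
  simp only at l0 l1
  rw [h.form i hi] at l0 ⊢
  have l2 : (Run.limit fun r => (C.sys I).view (2 * i + 1, x) (hist copycat N E r)).neg ∈
      ((C.form (2 * i + 1)).neg.interp I).Lr := by
    rw [(Formula.neg_interp I _).1, neg_neg_run]
    exact l1
  refine (Formula.transfer I _).win top _ _ hd l0 l2 ?_
  refine ((Formula.neg_interp I _).2 _ l2).2 ?_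
  rw [neg_neg_run]
  simpa using hw

end

end CoL

namespace CoL

/-! ### Descriptions of rule applications -/

/-- A description of an application of a rule: a tag, an oformula, an overgroup, a number of
overgroups, and two lists. -/
abbrev Descr := ℕ × ℕ × ℕ × ℕ × List ℕ × List ℕ

/-- The tag of a description. -/
abbrev Descr.tag (d : Descr) : ℕ := d.1

/-- The oformula of a description. -/
abbrev Descr.ofm (d : Descr) : ℕ := d.2.1

/-- The overgroup of a description. -/
abbrev Descr.ovg (d : Descr) : ℕ := d.2.2.1

/-- The number of overgroups of a description. -/
abbrev Descr.num (d : Descr) : ℕ := d.2.2.2.1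

/-- The first list of a description. -/
abbrev Descr.fstList (d : Descr) : List ℕ := d.2.2.2.2.1

/-- The second list of a description. -/
abbrev Descr.sndList (d : Descr) : List ℕ := d.2.2.2.2.2

/-- The translation of moves of the environment. -/
def Descr.up (d : Descr) (n : ℕ) (m : PMove) : List PMove :=
  if d.tag = 0 then reindexUp d.fstList d.sndList n m
  else if d.tag = 1 then dupUp d.ovg n m
  else if d.tag = 2 then mergeUp d.ovg d.fstList d.sndList n m
  else if d.tag = 3 then splitUp half d.ofm n m
  else if d.tag = 4 then splitUp component d.ofm n m
  else if d.tag = 5 then recUp d.ofm d.ovg n m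
  else if d.tag = 6 then corecUp d.ofm d.fstList n m
  else zeroUp d.ofm n m

/-- The translation of moves of the machine. -/
def Descr.down (d : Descr) (n : ℕ) (m : PMove) : List PMove :=
  if d.tag = 0 then reindexDown d.fstList d.sndList d.num n m
  else if d.tag = 1 then dupDown d.ovg n m
  else if d.tag = 2 then mergeDown d.ovg n m
  else if d.tag = 3 then splitDown (fun s β => digit s.toNat :: β) d.ofm n m
  else if d.tag = 4 then splitDown (fun s β => compPrefix (s.toNat + 1) ++ β) d.ofm n m
  else if d.tag = 5 then recDown d.ofm d.ovg n m
  else if d.tag = 6 then corecDown d.ofm d.fstList n m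
  else zeroDown d.ofm n m

/-- The condition of the rules that split an oformula into parts in the same undergroups. -/
def SplitsUnder (A B : Cirquent) (a : ℕ) : Prop :=
  ∀ U ∈ B.undergroups, ∃ V ∈ A.undergroups, ∀ b ∈ V, collapse a b ∈ U

/-- The condition of the rule that splits an oformula into parts in different undergroups. -/
def SplitsApart (A B : Cirquent) (a : ℕ) : Prop :=
  ∀ U ∈ B.undergroups, (∃ V ∈ A.undergroups, ∀ b ∈ V, b ≠ a + 1 ∧ collapse a b ∈ U) ∧
    ∃ V ∈ A.undergroups, ∀ b ∈ V, b ≠ a ∧ collapse a b ∈ U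

/-- `B` follows from `A` by the described application of a rule. -/
inductive Descr.Step (d : Descr) (A B : Cirquent) : Prop
  | reindex (ht : d.tag = 0) (hn : d.num = B.overgroups.length)
      (h : Reindexes A B d.fstList d.sndList)
  | duplicate (ht : d.tag = 1) (h : Duplicates A B d.ovg)
  | merge (ht : d.tag = 2) (h : Merges A B d.ovg d.fstList d.sndList)
  | contract (ht : d.tag = 3) (h : Splits A B d.ofm) (h0 : ∃ F : Formula, B.form d.ofm = F.corecur)
      (h1 : A.form d.ofm = B.form d.ofm) (h2 : A.form (d.ofm + 1) = B.form d.ofm)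
      (hU : SplitsUnder A B d.ofm)
  | disj (ht : d.tag = 4) (h : Splits A B d.ofm)
      (h0 : B.form d.ofm = (A.form d.ofm).disj (A.form (d.ofm + 1))) (hU : SplitsUnder A B d.ofm)
  | conj (ht : d.tag = 4) (h : Splits A B d.ofm)
      (h0 : B.form d.ofm = (A.form d.ofm).conj (A.form (d.ofm + 1))) (hU : SplitsApart A B d.ofm)
  | recur (ht : d.tag = 5) (h : Recurs A B d.ofm d.ovg)
  | corecur (ht : d.tag = 6) (hK : d.fstList ≠ []) (h : Corecurs A B d.ofm d.fstList)
  | zero (ht : d.tag = 7) (h : Corecurs A B d.ofm [])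

theorem Descr.Step.solves {d : Descr} {A B : Cirquent} (h : d.Step A B) {I : Interpretation}
    {S : Strategy} (hS : S.Bounding) (hw : S.Solves I A) : (S.lift d.up d.down).Solves I B := by
  have key : ∀ {up down}, d.up = up → d.down = down → (S.lift up down).Solves I B →
      (S.lift d.up d.down).Solves I B := by
    rintro _ _ rfl rfl h
    exact h
  cases h with
  | reindex ht hn h =>
    refine key ?_ ?_ (h.solves hS hw)
    · funext n m
      simp only [Descr.up, ht, if_true]
    · funext n m
      simp only [Descr.down, ht, if_true, hn]
  | duplicate ht h =>
    refine key ?_ ?_ (h.solves hS hw) <;> funext n m <;> simp [Descr.up, Descr.down, ht]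
  | merge ht h =>
    refine key ?_ ?_ (h.solves hS hw) <;> funext n m <;> simp [Descr.up, Descr.down, ht]
  | contract ht h h0 h1 h2 hU =>
    obtain ⟨F, hF⟩ := h0
    refine key ?_ ?_ (h.solves_contraction hF (h1.trans hF) (h2.trans hF) hU hS hw) <;>
      funext n m <;> simp [Descr.up, Descr.down, ht]
  | disj ht h h0 hU =>
    refine key ?_ ?_ (h.solves_disjunction h0 rfl rfl hU hS hw) <;>
      funext n m <;> simp [Descr.up, Descr.down, ht]
  | conj ht h h0 hU =>
    refine key ?_ ?_ (h.solves_conjunction h0 rfl rfl hU hS hw) <;>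
      funext n m <;> simp [Descr.up, Descr.down, ht]
  | recur ht h =>
    refine key ?_ ?_ (h.solves hS hw) <;> funext n m <;> simp [Descr.up, Descr.down, ht]
  | corecur ht hK h =>
    refine key ?_ ?_ (h.solves hK hS hw) <;> funext n m <;> simp [Descr.up, Descr.down, ht]
  | zero ht h =>
    refine key ?_ ?_ (h.zero_solves hS hw) <;> funext n m <;> simp [Descr.up, Descr.down, ht]

/-! ### Every application of a rule has a description -/

theorem getD_mid {α : Type*} (L R : List α) (G d : α) (j : ℕ) :
    (L ++ [G] ++ R).getD j d = if j < L.length then L.getD j d else if j = L.length then G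
      else R.getD (j - L.length - 1) d := by
  simp only [List.getD_eq_getElem?_getD]
  split_ifs with h1 h2
  · rw [List.append_assoc, List.getElem?_append_left h1]
  · subst h2
    simp
  · rw [List.getElem?_append_right (by simp; omega)]
    congr 2
    simp
    omega

theorem getD_mid₂ {α : Type*} (L R : List α) (G H d : α) (j : ℕ) :
    (L ++ [G, H] ++ R).getD j d = if j < L.length then L.getD j d else if j = L.length then G
      else if j = L.length + 1 then H else R.getD (j - L.length - 2) d := by
  simp only [List.getD_eq_getElem?_getD]
  split_ifs with h1 h2 h3
  · rw [List.append_assoc, List.getElem?_append_left h1]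
  · subst h2
    simp
  · subst h3
    rw [List.getElem?_append_left (by simp), List.getElem?_append_right (by omega)]
    simp
  · rw [List.getElem?_append_right (by simp; omega)]
    congr 2
    simp
    omega

theorem getD_append {α : Type*} (L R : List α) (d : α) (j : ℕ) :
    (L ++ R).getD j d = if j < L.length then L.getD j d else R.getD (j - L.length) d := by
  simp only [List.getD_eq_getElem?_getD]
  split_ifs with h1
  · rw [List.getElem?_append_left h1]
  · rw [List.getElem?_append_right (by omega)]

theorem idxOf_getD {l : List ℕ} (h : l.Nodup) {t : ℕ} (ht : t < l.length) :
    l.idxOf (l.getD t 0) = t := by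
  rw [List.getD_eq_getElem _ _ ht, h.idxOf_getElem t ht]

theorem getD_map_range (f : ℕ → ℕ) {n t : ℕ} (ht : t < n) :
    ((List.range n).map f).getD t 0 = f t := by
  rw [List.getD_eq_getElem _ _ (by simpa using ht)]
  simp

section
variable {A B : Cirquent}

theorem lt_of_mem_undergroup {U : Finset ℕ} (hU : U ∈ A.undergroups) {b : ℕ} (hb : b ∈ U) :
    b < A.forms.length := Finset.mem_range.1 ((A.under_mem U hU).2 hb)

/-- Renaming by functions. -/
theorem Reindexes.of_injective {f g : ℕ → ℕ} (hf : f.Injective) (hg : g.Injective)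
    (lt_forms : ∀ a < A.forms.length, f a < B.forms.length)
    (form : ∀ a < A.forms.length, A.form a = B.form (f a))
    (lt_over : ∀ j < A.overgroups.length, g j < B.overgroups.length)
    (mem_iff : ∀ a < A.forms.length, ∀ j < A.overgroups.length,
      a ∈ A.overgroup j ↔ f a ∈ B.overgroup (g j))
    (surj : ∀ j < B.overgroups.length, ∃ i < A.overgroups.length, g i = j)
    (under : ∀ U ∈ B.undergroups, ∃ V ∈ A.undergroups, ∀ b ∈ V, f b ∈ U) :
    Reindexes A B ((List.range A.forms.length).map f) ((List.range A.overgroups.length).map g) where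
  length_forms := by simp
  idx_forms a ha := idxOf_getD ((List.nodup_range).map hf) ha
  lt_forms a ha := by
    rw [List.length_map, List.length_range] at ha
    rw [getD_map_range f ha]
    exact lt_forms a ha
  form a ha := by
    rw [List.length_map, List.length_range] at ha
    rw [getD_map_range f ha]
    exact form a ha
  length_over := by simp
  idx_over a ha := idxOf_getD ((List.nodup_range).map hg) ha
  lt_over j hj := by
    rw [List.length_map, List.length_range] at hj
    rw [getD_map_range g hj]
    exact lt_over j hj
  mem_iff a ha j hj := by
    rw [List.length_map, List.length_range] at ha hj
    rw [getD_map_range f ha, getD_map_range g hj]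
    exact mem_iff a ha j hj
  not_mem a ha j hj hc := by
    obtain ⟨i, hi, rfl⟩ := surj j hj
    exact absurd (List.mem_map_of_mem (List.mem_range.2 hi)) hc
  under U hU := by
    obtain ⟨V, hV, h⟩ := under U hU
    refine ⟨V, hV, fun b hb => ?_⟩
    rw [getD_map_range f (lt_of_mem_undergroup hV hb)]
    exact h b hb

/-- Rules that change only undergroups. -/
theorem exists_step_of_under (hF : A.forms = B.forms) (hO : A.overgroups = B.overgroups)
    (hU : ∀ U ∈ B.undergroups, ∃ V ∈ A.undergroups, V ⊆ U) : ∃ d : Descr, d.Step A B := by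
  refine ⟨(0, 0, 0, B.overgroups.length, _, _), .reindex rfl rfl
    (Reindexes.of_injective (f := id) (g := id) Function.injective_id Function.injective_id
      ?_ ?_ ?_ ?_ ?_ ?_)⟩
  · simp [hF]
  · intro a _
    rw [Cirquent.form, Cirquent.form, hF]
    rfl
  · simp [hO]
  · intro a _ j _
    rw [Cirquent.overgroup, Cirquent.overgroup, hO]
    rfl
  · intro j hj
    exact ⟨j, hO ▸ hj, rfl⟩
  · intro U h
    obtain ⟨V, hV, hVU⟩ := hU U h
    exact ⟨V, hV, fun b hb => hVU hb⟩

theorem swap_lt {a n i : ℕ} (ha : a + 1 < n) (hi : i < n) : Equiv.swap a (a + 1) i < n := by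
  rw [Equiv.swap_apply_def]
  split_ifs <;> omega

theorem getD_swap {α : Type*} (L R : List α) (G H d : α) (j : ℕ) :
    (L ++ [G, H] ++ R).getD j d =
      (L ++ [H, G] ++ R).getD (Equiv.swap L.length (L.length + 1) j) d := by
  rw [getD_mid₂, getD_mid₂, Equiv.swap_apply_def]
  split_ifs <;> first | rfl | omega

theorem exists_step_overgroupExchange {L R : List (Finset ℕ)} {G H : Finset ℕ}
    (hF : B.forms = A.forms) (hU : B.undergroups = A.undergroups)
    (hA : A.overgroups = L ++ [G, H] ++ R) (hB : B.overgroups = L ++ [H, G] ++ R) :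
    ∃ d : Descr, d.Step A B := by
  have hlA : A.overgroups.length = L.length + 2 + R.length := by rw [hA]; simp; omega
  have hlB : B.overgroups.length = L.length + 2 + R.length := by rw [hB]; simp; omega
  refine ⟨(0, 0, 0, B.overgroups.length, _, _), .reindex rfl rfl
    (Reindexes.of_injective (f := id) (g := Equiv.swap L.length (L.length + 1))
      Function.injective_id (Equiv.injective _) ?_ ?_ ?_ ?_ ?_ ?_)⟩
  · simp [hF]
  · intro a _
    rw [Cirquent.form, Cirquent.form, hF]
    rfl
  · intro j hj
    exact swap_lt (by omega) (by omega)
  · intro a _ j _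
    rw [Cirquent.overgroup, Cirquent.overgroup, hA, hB, getD_swap]
    rfl
  · intro j hj
    exact ⟨Equiv.swap L.length (L.length + 1) j, swap_lt (by omega) (by omega),
      Equiv.swap_apply_self _ _ _⟩
  · intro U h
    exact ⟨U, hU ▸ h, fun b hb => hb⟩

theorem getD_map_finset (f : Finset ℕ → Finset ℕ) (hf : f ∅ = ∅) (l : List (Finset ℕ)) (j : ℕ) :
    (l.map f).getD j ∅ = f (l.getD j ∅) := by
  rw [List.getD_eq_getElem?_getD, List.getD_eq_getElem?_getD, List.getElem?_map]
  cases l[j]? with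
  | none => exact hf.symm
  | some x => rfl

theorem exists_step_oformulaExchange {L R : List Formula} {E F : Formula}
    (hA : A.forms = L ++ [E, F] ++ R) (hB : B.forms = L ++ [F, E] ++ R)
    (hU : B.undergroups = A.undergroups.map (Finset.image (Equiv.swap L.length (L.length + 1))))
    (hO : B.overgroups = A.overgroups.map (Finset.image (Equiv.swap L.length (L.length + 1)))) :
    ∃ d : Descr, d.Step A B := by
  have hlA : A.forms.length = L.length + 2 + R.length := by rw [hA]; simp; omega
  have hlB : B.forms.length = L.length + 2 + R.length := by rw [hB]; simp; omega
  refine ⟨(0, 0, 0, B.overgroups.length, _, _), .reindex rfl rfl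
    (Reindexes.of_injective (g := id) (f := Equiv.swap L.length (L.length + 1))
      (Equiv.injective _) Function.injective_id ?_ ?_ ?_ ?_ ?_ ?_)⟩
  · intro j hj
    exact swap_lt (by omega) (by omega)
  · intro a _
    rw [Cirquent.form, Cirquent.form, hA, hB, getD_swap]
  · simp [hO]
  · intro a _ j _
    rw [Cirquent.overgroup, Cirquent.overgroup, hO, getD_map_finset _ (by simp)]
    simp
  · intro j hj
    exact ⟨j, by simpa [hO] using hj, rfl⟩
  · intro U h
    rw [hU] at h
    obtain ⟨V, hV, rfl⟩ := List.mem_map.1 h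
    exact ⟨V, hV, fun b hb => Finset.mem_image_of_mem _ hb⟩

theorem mem_deleteFrom {a b : ℕ} {G : Finset ℕ} :
    b ∈ deleteFrom a G ↔ (if b < a then b else b + 1) ∈ G := by
  unfold deleteFrom
  rw [Finset.mem_image]
  constructor
  · rintro ⟨i, hi, rfl⟩
    rw [Finset.mem_erase] at hi
    convert hi.2 using 1
    split_ifs <;> omega
  · intro h
    refine ⟨_, Finset.mem_erase.2 ⟨?_, h⟩, ?_⟩ <;> split_ifs <;> omega

theorem eq_map_getD (l : List (Finset ℕ)) :
    l = (List.range l.length).map fun j => l.getD j ∅ := by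
  refine List.ext_getElem (by simp) fun i h1 h2 => ?_
  rw [List.getElem_map, List.getElem_range, List.getD_eq_getElem _ _ h1]

/-- A renaming that skips the place `a`. The list `γ` consists of the overgroups that remain
nonempty; the order is unchanged, so the `j`-th overgroup of `A` comes from the `j`-th entry of `γ`.
-/
theorem exists_step_weakening {a : ℕ} (ha : a < B.forms.length)
    (hF : A.forms = B.forms.eraseIdx a)
    (hU : A.undergroups = B.undergroups.map (deleteFrom a))
    (hO : A.overgroups = (B.overgroups.map (deleteFrom a)).filter (fun O => O.Nonempty)) :
    ∃ d : Descr, d.Step A B := by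
  set f : ℕ → ℕ := fun b => if b < a then b else b + 1 with hf
  set γ : List ℕ := (List.range B.overgroups.length).filter
    fun j => (deleteFrom a (B.overgroup j)).Nonempty with hγ
  have hlen : A.forms.length = B.forms.length - 1 := by
    rw [hF, List.length_eraseIdx_of_lt ha]
  have hOγ : A.overgroups = γ.map fun j => deleteFrom a (B.overgroup j) := by
    rw [hO, hγ]
    conv_lhs => rw [eq_map_getD B.overgroups]
    rw [List.map_map, List.filter_map]
    rfl
  have hog : ∀ j < γ.length, A.overgroup j = deleteFrom a (B.overgroup (γ.getD j 0)) := by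
    intro j hj
    rw [Cirquent.overgroup, hOγ, List.getD_eq_getElem _ _ (by simpa using hj), List.getElem_map,
      List.getD_eq_getElem γ _ hj]
  have hinj : f.Injective := by
    intro x y h
    simp only [hf] at h
    split_ifs at h <;> omega
  have hl : ((List.range A.forms.length).map f).length = A.forms.length := by simp
  refine ⟨(0, 0, 0, B.overgroups.length, (List.range A.forms.length).map f, γ),
    .reindex rfl rfl ?_⟩
  have hg : ∀ b < A.forms.length, ((List.range A.forms.length).map f).getD b 0 = f b :=
    fun b hb => getD_map_range f hb
  constructor
  · exact hl
  · intro b hb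
    exact idxOf_getD (List.nodup_range.map hinj) hb
  · intro b hb
    replace hb := hl ▸ hb
    refine (hg b hb).symm ▸ ?_
    simp only [hf]
    split_ifs <;> omega
  · intro b hb
    replace hb := hl ▸ hb
    refine (hg b hb).symm ▸ ?_
    rw [Cirquent.form, Cirquent.form, hF]
    simp only [List.getD_eq_getElem?_getD, List.getElem?_eraseIdx, hf]
    split_ifs <;> rfl
  · rw [hOγ, List.length_map]
  · intro j hj
    exact idxOf_getD (List.nodup_range.filter _) hj
  · intro j hj
    have : γ.getD j 0 ∈ γ := by
      rw [List.getD_eq_getElem _ _ hj]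
      exact List.getElem_mem hj
    exact List.mem_range.1 (List.mem_filter.1 this).1
  · intro b hb j hj
    replace hb := hl ▸ hb
    refine (hg b hb).symm ▸ ?_
    rw [hog j hj, mem_deleteFrom]
  · intro b hb j hj hjγ
    replace hb := hl ▸ hb
    refine (hg b hb).symm ▸ ?_
    intro hc
    -- An overgroup that contains a surviving oformula has not become empty, so it is listed in `γ`.
    refine hjγ (List.mem_filter.2 ⟨List.mem_range.2 hj, ?_⟩)
    rw [decide_eq_true_eq]
    exact ⟨b, mem_deleteFrom.2 hc⟩
  · intro U hUB
    have hV : deleteFrom a U ∈ A.undergroups := by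
      rw [hU]
      exact List.mem_map_of_mem hUB
    refine ⟨_, hV, fun b hb => ?_⟩
    refine (hg b (lt_of_mem_undergroup hV hb)).symm ▸ ?_
    exact mem_deleteFrom.1 hb

theorem mem_splitGroup {a b : ℕ} {N G : Finset ℕ} :
    b ∈ splitGroup a N G ↔ (b < a ∧ b ∈ G) ∨ (a ∈ G ∧ b ∈ N) ∨ (a + 1 < b ∧ b - 1 ∈ G) := by
  unfold splitGroup
  rw [Finset.mem_biUnion]
  constructor
  · rintro ⟨i, hi, hb⟩
    split_ifs at hb with h1 h2
    · rw [Finset.mem_singleton] at hb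
      subst hb
      exact Or.inl ⟨h1, hi⟩
    · exact Or.inr (Or.inl ⟨h2 ▸ hi, hb⟩)
    · rw [Finset.mem_singleton] at hb
      subst hb
      exact Or.inr (Or.inr ⟨by omega, by simpa using hi⟩)
  · rintro (⟨h1, h2⟩ | ⟨h1, h2⟩ | ⟨h1, h2⟩)
    · exact ⟨b, h2, by simp [h1]⟩
    · exact ⟨a, h1, by simpa using h2⟩
    · refine ⟨b - 1, h2, ?_⟩
      rw [if_neg (by omega), if_neg (by omega), Finset.mem_singleton]
      omega

theorem mem_splitGroup_pair {a b : ℕ} {G : Finset ℕ} :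
    b ∈ splitGroup a {a, a + 1} G ↔ collapse a b ∈ G := by
  rw [mem_splitGroup, Finset.mem_insert, Finset.mem_singleton]
  unfold collapse
  split_ifs with h
  · constructor
    · rintro (h1 | h1 | h1)
      · exact h1.2
      · rcases h1 with ⟨h1, rfl | rfl⟩
        · exact h1
        · omega
      · omega
    · intro h1
      by_cases hba : b = a
      · exact Or.inr (Or.inl ⟨hba ▸ h1, Or.inl hba⟩)
      · exact Or.inl ⟨by omega, h1⟩
  · constructor
    · rintro (h1 | h1 | h1)
      · omega
      · rcases h1 with ⟨h1, rfl | rfl⟩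
        · omega
        · simpa using h1
      · exact h1.2
    · intro h1
      by_cases hba : b = a + 1
      · subst hba
        exact Or.inr (Or.inl ⟨by simpa using h1, Or.inr rfl⟩)
      · exact Or.inr (Or.inr ⟨by omega, h1⟩)

theorem splits_of {L R : List Formula} {D E F : Formula}
    (hB : B.forms = L ++ [D] ++ R) (hA : A.forms = L ++ [E, F] ++ R)
    (hO : A.overgroups = B.overgroups.map (splitGroup L.length {L.length, L.length + 1})) :
    Splits A B L.length ∧ B.form L.length = D ∧ A.form L.length = E ∧
      A.form (L.length + 1) = F := by
  refine ⟨⟨?_, ?_, ?_, ?_, ?_, ?_⟩, ?_, ?_, ?_⟩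
  · rw [hB]
    simp
  · rw [hA, hB]
    simp
    omega
  · intro b hb
    rw [Cirquent.form, Cirquent.form, hA, hB, getD_mid, getD_mid₂, if_pos hb, if_pos hb]
  · intro b _ hb
    rw [Cirquent.form, Cirquent.form, hA, hB, getD_mid, getD_mid₂, if_neg (by omega),
      if_neg (by omega), if_neg (by omega), if_neg (by omega), if_neg (by omega)]
    congr 1
    omega
  · rw [hO, List.length_map]
  · intro b _ j _
    rw [Cirquent.overgroup, hO, getD_map_finset _ (by simp [splitGroup]), mem_splitGroup_pair]
    rfl
  · rw [Cirquent.form, hB, getD_mid, if_neg (lt_irrefl _), if_pos rfl]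
  · rw [Cirquent.form, hA, getD_mid₂, if_neg (lt_irrefl _), if_pos rfl]
  · rw [Cirquent.form, hA, getD_mid₂, if_neg (by omega), if_neg (by omega), if_pos rfl]

theorem splitsUnder_of {a : ℕ}
    (hU : A.undergroups = B.undergroups.map (splitGroup a {a, a + 1})) : SplitsUnder A B a := by
  intro U h
  refine ⟨_, hU ▸ List.mem_map_of_mem h, fun b hb => mem_splitGroup_pair.1 hb⟩

/-- An undergroup without the conjunction has a single version in the premise, which contains
neither conjunct and serves for both clauses. -/
theorem splitsApart_of {a : ℕ} (hU : A.undergroups = B.undergroups.flatMap fun G =>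
    if a ∈ G then [splitGroup a {a} G, splitGroup a {a + 1} G] else [splitGroup a ∅ G]) :
    SplitsApart A B a := by
  intro U h
  have key : ∀ (N : Finset ℕ), N ⊆ {a, a + 1} → ∀ b ∈ splitGroup a N U, collapse a b ∈ U := by
    intro N hN b hb
    rw [← mem_splitGroup_pair]
    rw [mem_splitGroup] at hb ⊢
    exact hb.imp id (Or.imp (And.imp id fun h => hN h) id)
  by_cases ha : a ∈ U
  · refine ⟨⟨splitGroup a {a} U, ?_, fun b hb => ⟨?_, key _ (by simp) b hb⟩⟩,
      splitGroup a {a + 1} U, ?_, fun b hb => ⟨?_, key _ (by simp) b hb⟩⟩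
    · rw [hU]
      exact List.mem_flatMap.2 ⟨U, h, by simp [ha]⟩
    · rintro rfl
      rw [mem_splitGroup, Finset.mem_singleton] at hb
      omega
    · rw [hU]
      exact List.mem_flatMap.2 ⟨U, h, by simp [ha]⟩
    · rintro rfl
      rw [mem_splitGroup, Finset.mem_singleton] at hb
      omega
  · have hmem : splitGroup a ∅ U ∈ A.undergroups := by
      rw [hU]
      exact List.mem_flatMap.2 ⟨U, h, by simp [ha]⟩
    refine ⟨⟨_, hmem, fun b hb => ⟨?_, key _ (by simp) b hb⟩⟩,
      _, hmem, fun b hb => ⟨?_, key _ (by simp) b hb⟩⟩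
    · rintro rfl
      rw [mem_splitGroup] at hb
      simp at hb
    · rintro rfl
      rw [mem_splitGroup] at hb
      simp at hb

theorem duplicates_of {L R : List (Finset ℕ)} {G : Finset ℕ}
    (hF : B.forms = A.forms) (hU : B.undergroups = A.undergroups)
    (hA : A.overgroups = L ++ [G] ++ R) (hB : B.overgroups = L ++ [G, G] ++ R) :
    Duplicates A B L.length := by
  refine ⟨hF.symm, hU.symm, ?_, ?_, ?_⟩
  · rw [hA]
    simp
  · rw [hA, hB]
    simp
    omega
  · intro i _
    rw [Cirquent.overgroup, Cirquent.overgroup, hA, hB, getD_mid, getD_mid₂]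
    split_ifs <;> first | rfl | omega | (congr 1; omega)

theorem merges_of {L R : List (Finset ℕ)} {G H : Finset ℕ}
    (hF : B.forms = A.forms) (hU : B.undergroups = A.undergroups)
    (hA : A.overgroups = L ++ [G, H] ++ R) (hB : B.overgroups = L ++ [G ∪ H] ++ R) :
    Merges A B L.length G.toList H.toList := by
  refine ⟨hF.symm, hU.symm, ?_, ?_, ?_, ?_, ?_, ?_, ?_⟩
  · rw [hB]
    simp
  · rw [hA, hB]
    simp
    omega
  · intro i hi
    rw [Cirquent.overgroup, Cirquent.overgroup, hA, hB, getD_mid, getD_mid₂, if_pos hi, if_pos hi]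
  · intro i _ hi
    rw [Cirquent.overgroup, Cirquent.overgroup, hA, hB, getD_mid, getD_mid₂]
    split_ifs <;> first | omega | (congr 1; omega)
  · intro b _
    rw [Cirquent.overgroup, hB, getD_mid, if_neg (lt_irrefl _), if_pos rfl]
    simp
  · intro b _
    rw [Cirquent.overgroup, hA, getD_mid₂, if_neg (lt_irrefl _), if_pos rfl]
    simp
  · intro b _
    rw [Cirquent.overgroup, hA, getD_mid₂, if_neg (by omega), if_neg (by omega), if_pos rfl]
    simp

theorem forms_of_replace {L R : List Formula} {D E : Formula}
    (hB : B.forms = L ++ [D] ++ R) (hA : A.forms = L ++ [E] ++ R) :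
    L.length < B.forms.length ∧ A.forms.length = B.forms.length ∧
      (∀ b, b ≠ L.length → A.form b = B.form b) ∧ B.form L.length = D ∧ A.form L.length = E := by
  refine ⟨?_, ?_, ?_, ?_, ?_⟩
  · rw [hB]
    simp
  · rw [hA, hB]
    simp
  · intro b hb
    rw [Cirquent.form, Cirquent.form, hA, hB, getD_mid, getD_mid, if_neg hb, if_neg hb]
  · rw [Cirquent.form, hB, getD_mid, if_neg (lt_irrefl _), if_pos rfl]
  · rw [Cirquent.form, hA, getD_mid, if_neg (lt_irrefl _), if_pos rfl]

theorem recurs_of {L R : List Formula} {F : Formula} {O O' : List (Finset ℕ)}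
    (hB : B.forms = L ++ [F.recur] ++ R) (hA : A.forms = L ++ [F] ++ R)
    (hU : A.undergroups = B.undergroups)
    (hOB : B.overgroups = O ++ O') (hOA : A.overgroups = O ++ [{L.length}] ++ O') :
    Recurs A B L.length O.length := by
  obtain ⟨h1, h2, h3, h4, h5⟩ := forms_of_replace hB hA
  refine ⟨h1, h2, fun b _ => h3 b, by rw [h4, h5], ?_, ?_, ?_, ?_, ?_, hU⟩
  · rw [hOB]
    simp
  · rw [hOA, hOB]
    simp
    omega
  · intro i hi
    rw [Cirquent.overgroup, Cirquent.overgroup, hOA, hOB, getD_mid, getD_append, if_pos hi,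
      if_pos hi]
  · intro b _
    rw [Cirquent.overgroup, hOA, getD_mid, if_neg (lt_irrefl _), if_pos rfl, Finset.mem_singleton]
  · intro i _ hi
    rw [Cirquent.overgroup, Cirquent.overgroup, hOA, hOB, getD_mid, getD_append,
      if_neg (by omega), if_neg (by omega), if_neg (by omega)]
    congr 1
    omega

/-- The list consists of the overgroups that the oformula really joins: including it in an overgroup
to which it already belongs changes nothing, so membership decides and not the alternative of the
rule that was used. -/
theorem corecurs_of {L R : List Formula} {F : Formula}
    (hB : B.forms = L ++ [F.corecur] ++ R) (hA : A.forms = L ++ [F] ++ R)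
    (hU : A.undergroups = B.undergroups)
    (hO : List.Forall₂ (fun G' G => G' = G ∨ G' = insert L.length G) A.overgroups B.overgroups) :
    Corecurs A B L.length ((List.range B.overgroups.length).filter fun i =>
      L.length ∈ A.overgroup i ∧ L.length ∉ B.overgroup i) := by
  obtain ⟨h1, h2, h3, h4, h5⟩ := forms_of_replace hB hA
  have hlen := hO.length_eq
  have hg : ∀ i < B.overgroups.length, A.overgroup i = B.overgroup i ∨
      A.overgroup i = insert L.length (B.overgroup i) := by
    intro i hi
    have := hO.get (by omega) hi
    simp only [List.get_eq_getElem] at this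
    rw [Cirquent.overgroup, Cirquent.overgroup, List.getD_eq_getElem _ _ hi,
      List.getD_eq_getElem _ _ (by omega)]
    exact this
  set K := (List.range B.overgroups.length).filter fun i =>
    decide (L.length ∈ A.overgroup i ∧ L.length ∉ B.overgroup i) with hK
  have hmem : ∀ t < K.length, K.getD t 0 ∈ K := by
    intro t ht
    rw [List.getD_eq_getElem _ _ ht]
    exact List.getElem_mem ht
  have hKm : ∀ i ∈ K, i < B.overgroups.length ∧ L.length ∈ A.overgroup i ∧
      L.length ∉ B.overgroup i := by
    intro i hi
    rw [hK, List.mem_filter, List.mem_range, decide_eq_true_eq] at hi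
    exact hi
  refine ⟨h1, h2, fun b _ => h3 b, by rw [h4, h5], hlen, ?_, ?_, ?_, ?_, ?_, ?_, hU⟩
  · intro b _ i hi hb
    rcases hg i hi with h | h
    · rw [h]
    · rw [h, Finset.mem_insert]
      tauto
  · intro i hi hiK
    rcases hg i hi with h | h
    · rw [h]
    · constructor
      · intro hA'
        by_contra hc
        refine hiK ?_
        rw [hK, List.mem_filter, List.mem_range, decide_eq_true_eq]
        exact ⟨hi, hA', hc⟩
      · intro hB'
        rw [h]
        exact Finset.mem_insert_self _ _
  · intro t ht
    exact idxOf_getD (List.nodup_range.filter _) ht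
  · exact fun t ht => (hKm _ (hmem t ht)).1
  · exact fun t ht => (hKm _ (hmem t ht)).2.1
  · exact fun t ht => (hKm _ (hmem t ht)).2.2

theorem Rule.exists_step (h : Rule A B) : ∃ d : Descr, d.Step A B := by
  cases h with
  | undergroupExchange L R G H hF hO hA hB =>
    refine exists_step_of_under hF.symm hO.symm fun U hU => ⟨U, ?_, subset_rfl⟩
    rw [hB] at hU
    rw [hA]
    simp only [List.mem_append, List.mem_cons, List.not_mem_nil, or_false] at hU ⊢
    tauto
  | overgroupExchange L R G H hF hU hA hB => exact exists_step_overgroupExchange hF hU hA hB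
  | oformulaExchange L R E F hA hB hU hO => exact exists_step_oformulaExchange hA hB hU hO
  | undergroupDuplication L R G hF hO hA hB =>
    refine exists_step_of_under hF.symm hO.symm fun U hU => ⟨U, ?_, subset_rfl⟩
    rw [hB] at hU
    rw [hA]
    simp only [List.mem_append, List.mem_cons, List.not_mem_nil, or_false] at hU ⊢
    tauto
  | overgroupDuplication L R G hF hU hA hB =>
    exact ⟨(1, 0, L.length, 0, [], []), .duplicate rfl (duplicates_of hF hU hA hB)⟩
  | merging L R G H hF hU hA hB =>
    exact ⟨(2, 0, L.length, 0, G.toList, H.toList), .merge rfl (merges_of hF hU hA hB)⟩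
  | weakeningArc L R U a hB ha hU hother hF hA hO =>
    refine exists_step_of_under hF hO fun V hV => ?_
    rw [hB] at hV
    rw [hA]
    simp only [List.mem_append, List.mem_singleton] at hV ⊢
    rcases hV with (hV | rfl) | hV
    · exact ⟨V, Or.inl (Or.inl hV), subset_rfl⟩
    · exact ⟨_, Or.inl (Or.inr rfl), Finset.erase_subset _ _⟩
    · exact ⟨V, Or.inr hV, subset_rfl⟩
  | weakeningOformula L R U a hB ha hU honly hF hA hO =>
    refine exists_step_weakening (lt_of_mem_undergroup (U := U) ?_ ha) hF (hB ▸ hA) hO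
    rw [hB]
    simp
  | contraction L R F hB hA hU hO =>
    obtain ⟨h1, h2, h3, h4⟩ := splits_of hB hA hO
    exact ⟨(3, L.length, 0, 0, [], []), .contract rfl h1 ⟨F, h2⟩ (h3.trans h2.symm)
      (h4.trans h2.symm) (splitsUnder_of hU)⟩
  | disjunction L R E F hB hA hU hO =>
    obtain ⟨h1, h2, h3, h4⟩ := splits_of hB hA hO
    refine ⟨(4, L.length, 0, 0, [], []), .disj rfl h1 ?_ (splitsUnder_of hU)⟩
    show B.form L.length = (A.form L.length).disj (A.form (L.length + 1))
    rw [h2, h3, h4]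
  | conjunction L R E F hB hA hU hO =>
    obtain ⟨h1, h2, h3, h4⟩ := splits_of hB hA hO
    refine ⟨(4, L.length, 0, 0, [], []), .conj rfl h1 ?_ (splitsApart_of hU)⟩
    show B.form L.length = (A.form L.length).conj (A.form (L.length + 1))
    rw [h2, h3, h4]
  | recurrence L R F O O' hB hA hU hOB hOA =>
    exact ⟨(5, L.length, O.length, 0, [], []), .recur rfl (recurs_of hB hA hU hOB hOA)⟩
  | corecurrence L R F hB hA hU hO =>
    have h := corecurs_of hB hA hU hO
    set K := (List.range B.overgroups.length).filter fun i =>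
      decide (L.length ∈ A.overgroup i ∧ L.length ∉ B.overgroup i)
    -- There is no interleaving of zero strings, so the case without new overgroups uses the zero
    -- branch instead.
    by_cases hK : K = []
    · rw [hK] at h
      exact ⟨(7, L.length, 0, 0, [], []), .zero rfl h⟩
    · exact ⟨(6, L.length, 0, 0, K, []), .corecur rfl hK h⟩

end

end CoL

namespace CoL

/-! ### Written-out cirquents -/

/-- Prefix notation needs no brackets. Allowing arbitrary continuations `r` and `s` makes the
induction work for binary connectives. -/
theorem Formula.word_append_inj {E F : Formula} {r s : List ℕ} (h : E.word ++ r = F.word ++ s) :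
    E = F ∧ r = s := by
  induction E generalizing F r s with
  | atom P => cases F <;> simp_all [Formula.word]
  | natom P => cases F <;> simp_all [Formula.word]
  | conj E₁ E₂ h₁ h₂ =>
    cases F <;> simp only [Formula.word, List.cons_append, List.append_assoc, List.cons.injEq,
      Nat.reduceEqDiff, reduceCtorEq, false_and, true_and] at h
    obtain ⟨rfl, h'⟩ := h₁ h
    obtain ⟨rfl, rfl⟩ := h₂ h'
    exact ⟨rfl, rfl⟩
  | disj E₁ E₂ h₁ h₂ =>
    cases F <;> simp only [Formula.word, List.cons_append, List.append_assoc, List.cons.injEq,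
      Nat.reduceEqDiff, reduceCtorEq, false_and, true_and] at h
    obtain ⟨rfl, h'⟩ := h₁ h
    obtain ⟨rfl, rfl⟩ := h₂ h'
    exact ⟨rfl, rfl⟩
  | recur E₁ h₁ | corecur E₁ h₁ =>
    cases F <;> simp only [Formula.word, List.cons_append, List.append_assoc, List.cons.injEq,
      Nat.reduceEqDiff, reduceCtorEq, false_and, true_and] at h
    obtain ⟨rfl, rfl⟩ := h₁ h
    exact ⟨rfl, rfl⟩

theorem Formula.word_injective : Formula.word.Injective := fun E F h =>
  (Formula.word_append_inj (r := []) (s := []) (by rw [h])).1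

/-- The formula at place `a`. -/
def CirquentWord.form (w : CirquentWord) (a : ℕ) : List ℕ := w.1.getD a [0, 0]

/-- The overgroup at place `j`. -/
def CirquentWord.overgroup (w : CirquentWord) (j : ℕ) : List ℕ := w.2.2.getD j []

/-- Bounded quantification. -/
def allLt (n : ℕ) (p : ℕ → Bool) : Bool := (List.range n).all p

theorem allLt_eq_true {n : ℕ} {p : ℕ → Bool} : allLt n p = true ↔ ∀ i < n, p i = true := by
  simp [allLt]

section
variable (C : Cirquent)

theorem Cirquent.word_form (a : ℕ) : CirquentWord.form C.word a = (C.form a).word := by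
  simp only [CirquentWord.form, Cirquent.word, Cirquent.form, List.getD_eq_getElem?_getD,
    List.getElem?_map]
  cases C.forms[a]? <;> rfl

theorem Cirquent.word_overgroup (j : ℕ) :
    CirquentWord.overgroup C.word j = (C.overgroup j).sort (· ≤ ·) := by
  simp only [CirquentWord.overgroup, Cirquent.word, Cirquent.overgroup,
    List.getD_eq_getElem?_getD, List.getElem?_map]
  cases C.overgroups[j]? <;> simp

theorem Cirquent.mem_word_overgroup (j a : ℕ) :
    a ∈ CirquentWord.overgroup C.word j ↔ a ∈ C.overgroup j := by
  rw [C.word_overgroup, Finset.mem_sort]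

theorem Cirquent.length_word_forms : C.word.1.length = C.forms.length := by simp [Cirquent.word]

theorem Cirquent.length_word_overgroups : C.word.2.2.length = C.overgroups.length := by
  simp [Cirquent.word]

variable {C} {A B : Cirquent}

theorem sort_inj {G H : Finset ℕ} : G.sort (· ≤ ·) = H.sort (· ≤ ·) ↔ G = H :=
  ⟨fun h => by rw [← Finset.sort_toFinset G (· ≤ ·), h, Finset.sort_toFinset], fun h => h ▸ rfl⟩

theorem Cirquent.word_form_inj {a b : ℕ} :
    CirquentWord.form A.word a = CirquentWord.form B.word b ↔ A.form a = B.form b := by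
  rw [A.word_form, B.word_form, Formula.word_injective.eq_iff]

theorem Cirquent.word_overgroup_inj {i j : ℕ} :
    CirquentWord.overgroup A.word i = CirquentWord.overgroup B.word j ↔
      A.overgroup i = B.overgroup j := by
  rw [A.word_overgroup, B.word_overgroup, sort_inj]

theorem Cirquent.word_forms_inj : A.word.1 = B.word.1 ↔ A.forms = B.forms :=
  (List.map_injective_iff.2 Formula.word_injective).eq_iff

theorem Cirquent.word_undergroups_inj : A.word.2.1 = B.word.2.1 ↔
    A.undergroups = B.undergroups :=
  (List.map_injective_iff.2 fun _ _ h => sort_inj.1 h).eq_iff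

end

/-- Every undergroup of `v` contains the images of the elements of one of `u` that satisfies a
condition. -/
def underCheck (u v : CirquentWord) (f : ℕ → ℕ) (p : ℕ → Bool) : Bool :=
  v.2.1.all fun U => u.2.1.any fun V => V.all fun b => p b && decide (f b ∈ U)

theorem underCheck_eq_true {A B : Cirquent} {f : ℕ → ℕ} {p : ℕ → Bool} :
    underCheck A.word B.word f p = true ↔
      ∀ U ∈ B.undergroups, ∃ V ∈ A.undergroups, ∀ b ∈ V, p b = true ∧ f b ∈ U := by
  simp [underCheck, Cirquent.word]

/-! ### Checking descriptions -/

section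
variable (u v : CirquentWord)

/-- `Reindexes` on words. -/
def reindexCheck (ι γ : List ℕ) : Bool :=
  decide (ι.length = u.1.length) && allLt ι.length (fun a => decide (ι.idxOf (ι.getD a 0) = a)) &&
  allLt ι.length (fun a => decide (ι.getD a 0 < v.1.length)) &&
  allLt ι.length (fun a => decide (u.form a = v.form (ι.getD a 0))) &&
  decide (γ.length = u.2.2.length) && allLt γ.length (fun j => decide (γ.idxOf (γ.getD j 0) = j)) &&
  allLt γ.length (fun j => decide (γ.getD j 0 < v.2.2.length)) &&
  allLt ι.length (fun a => allLt γ.length fun j =>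
    decide (decide (a ∈ u.overgroup j) = decide (ι.getD a 0 ∈ v.overgroup (γ.getD j 0)))) &&
  allLt ι.length (fun a => allLt v.2.2.length fun j =>
    decide (j ∈ γ) || !decide (ι.getD a 0 ∈ v.overgroup j)) &&
  underCheck u v (fun b => ι.getD b 0) fun _ => true

/-- `Duplicates` on words. -/
def duplicateCheck (j : ℕ) : Bool :=
  decide (u.1 = v.1) && decide (u.2.1 = v.2.1) && decide (j < u.2.2.length) &&
  decide (v.2.2.length = u.2.2.length + 1) &&
  allLt v.2.2.length (fun i => decide (v.overgroup i = u.overgroup (if i ≤ j then i else i - 1)))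

/-- `Merges` on words. -/
def mergeCheck (j : ℕ) (G H : List ℕ) : Bool :=
  decide (u.1 = v.1) && decide (u.2.1 = v.2.1) && decide (j < v.2.2.length) &&
  decide (u.2.2.length = v.2.2.length + 1) &&
  allLt j (fun i => decide (v.overgroup i = u.overgroup i)) &&
  allLt v.2.2.length (fun i => !decide (j < i) || decide (v.overgroup i = u.overgroup (i + 1))) &&
  allLt v.1.length (fun b =>
    decide (decide (b ∈ v.overgroup j) = (decide (b ∈ G) || decide (b ∈ H)))) &&
  allLt v.1.length (fun b => decide (decide (b ∈ u.overgroup j) = decide (b ∈ G))) &&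
  allLt v.1.length (fun b => decide (decide (b ∈ u.overgroup (j + 1)) = decide (b ∈ H)))

/-- `Splits` on words. -/
def splitCheck (a : ℕ) : Bool :=
  decide (a < v.1.length) && decide (u.1.length = v.1.length + 1) &&
  allLt a (fun b => decide (u.form b = v.form b)) &&
  allLt v.1.length (fun b => !decide (a < b) || decide (u.form (b + 1) = v.form b)) &&
  decide (u.2.2.length = v.2.2.length) &&
  allLt u.1.length (fun b => allLt v.2.2.length fun j =>
    decide (decide (b ∈ u.overgroup j) = decide (collapse a b ∈ v.overgroup j)))

/-- `Recurs` on words. -/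
def recurCheck (a j : ℕ) : Bool :=
  decide (a < v.1.length) && decide (u.1.length = v.1.length) &&
  allLt v.1.length (fun b => decide (b = a) || decide (u.form b = v.form b)) &&
  decide (v.form a = 4 :: u.form a) && decide (j ≤ v.2.2.length) &&
  decide (u.2.2.length = v.2.2.length + 1) &&
  allLt j (fun i => decide (u.overgroup i = v.overgroup i)) &&
  allLt v.1.length (fun b => decide (decide (b ∈ u.overgroup j) = decide (b = a))) &&
  allLt v.2.2.length (fun i => !decide (j ≤ i) || decide (u.overgroup (i + 1) = v.overgroup i)) &&
  decide (u.2.1 = v.2.1)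

/-- `Corecurs` on words. -/
def corecurCheck (a : ℕ) (K : List ℕ) : Bool :=
  decide (a < v.1.length) && decide (u.1.length = v.1.length) &&
  allLt v.1.length (fun b => decide (b = a) || decide (u.form b = v.form b)) &&
  decide (v.form a = 5 :: u.form a) && decide (u.2.2.length = v.2.2.length) &&
  allLt v.1.length (fun b => allLt v.2.2.length fun i => decide (b = a) ||
    decide (decide (b ∈ u.overgroup i) = decide (b ∈ v.overgroup i))) &&
  allLt v.2.2.length (fun i => decide (i ∈ K) ||
    decide (decide (a ∈ u.overgroup i) = decide (a ∈ v.overgroup i))) &&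
  allLt K.length (fun t => decide (K.idxOf (K.getD t 0) = t)) &&
  allLt K.length (fun t => decide (K.getD t 0 < v.2.2.length)) &&
  allLt K.length (fun t => decide (a ∈ u.overgroup (K.getD t 0))) &&
  allLt K.length (fun t => !decide (a ∈ v.overgroup (K.getD t 0))) &&
  decide (u.2.1 = v.2.1)

/-- `SplitsApart` on words. -/
def apartCheck (a : ℕ) : Bool :=
  underCheck u v (collapse a) (fun b => !decide (b = a + 1)) &&
  underCheck u v (collapse a) (fun b => !decide (b = a))

/-- `Descr.Step` on words. -/
def Descr.check (d : Descr) : Bool :=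
  (decide (d.tag = 0) && decide (d.num = v.2.2.length) && reindexCheck u v d.fstList d.sndList) ||
  (decide (d.tag = 1) && duplicateCheck u v d.ovg) ||
  (decide (d.tag = 2) && mergeCheck u v d.ovg d.fstList d.sndList) ||
  (decide (d.tag = 3) && splitCheck u v d.ofm && decide ((v.form d.ofm).head? = some 5) &&
    decide (u.form d.ofm = v.form d.ofm) && decide (u.form (d.ofm + 1) = v.form d.ofm) &&
    underCheck u v (collapse d.ofm) fun _ => true) ||
  (decide (d.tag = 4) && splitCheck u v d.ofm &&
    decide (v.form d.ofm = 3 :: (u.form d.ofm ++ u.form (d.ofm + 1))) &&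
    underCheck u v (collapse d.ofm) fun _ => true) ||
  (decide (d.tag = 4) && splitCheck u v d.ofm &&
    decide (v.form d.ofm = 2 :: (u.form d.ofm ++ u.form (d.ofm + 1))) &&
    apartCheck u v d.ofm) ||
  (decide (d.tag = 5) && recurCheck u v d.ofm d.ovg) ||
  (decide (d.tag = 6) && !decide (d.fstList = []) && corecurCheck u v d.ofm d.fstList) ||
  (decide (d.tag = 7) && corecurCheck u v d.ofm [])

end

/-! ### Correctness of the checks on written-out cirquents. -/

section
variable {A B : Cirquent}

theorem reindexCheck_eq_true {ι γ : List ℕ} :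
    reindexCheck A.word B.word ι γ = true ↔ Reindexes A B ι γ := by
  simp only [reindexCheck, Bool.and_eq_true, allLt_eq_true, decide_eq_true_eq,
    A.length_word_forms, B.length_word_forms, A.length_word_overgroups, B.length_word_overgroups,
    Cirquent.word_form_inj, Cirquent.mem_word_overgroup, decide_eq_decide, Bool.or_eq_true,
    Bool.not_eq_true', decide_eq_false_iff_not, underCheck_eq_true, true_and, and_assoc]
  constructor
  · rintro ⟨h1, h2, h3, h4, h5, h6, h7, h8, h9, h10⟩
    exact ⟨h1, h2, h3, h4, h5, h6, h7, h8, fun a ha j hj h => (h9 a ha j hj).resolve_left h, h10⟩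
  · rintro ⟨h1, h2, h3, h4, h5, h6, h7, h8, h9, h10⟩
    exact ⟨h1, h2, h3, h4, h5, h6, h7, h8, fun a ha j hj => or_iff_not_imp_left.2 (h9 a ha j hj),
      h10⟩

theorem duplicateCheck_eq_true {j : ℕ} :
    duplicateCheck A.word B.word j = true ↔ Duplicates A B j := by
  simp only [duplicateCheck, Bool.and_eq_true, allLt_eq_true, decide_eq_true_eq,
    A.length_word_overgroups, B.length_word_overgroups, Cirquent.word_forms_inj,
    Cirquent.word_undergroups_inj, Cirquent.word_overgroup_inj, and_assoc]
  exact ⟨fun ⟨h1, h2, h3, h4, h5⟩ => ⟨h1, h2, h3, h4, h5⟩,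
    fun ⟨h1, h2, h3, h4, h5⟩ => ⟨h1, h2, h3, h4, h5⟩⟩

theorem mergeCheck_eq_true {j : ℕ} {G H : List ℕ} :
    mergeCheck A.word B.word j G H = true ↔ Merges A B j G H := by
  simp only [mergeCheck, Bool.and_eq_true, allLt_eq_true, decide_eq_true_eq, ← Bool.decide_or,
    A.length_word_overgroups, B.length_word_overgroups, B.length_word_forms,
    Cirquent.word_forms_inj, Cirquent.word_undergroups_inj, Cirquent.word_overgroup_inj,
    Cirquent.mem_word_overgroup, decide_eq_decide, Bool.or_eq_true, Bool.not_eq_true',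
    decide_eq_false_iff_not, and_assoc, ← imp_iff_not_or]
  exact ⟨fun ⟨h1, h2, h3, h4, h5, h6, h7, h8, h9⟩ => ⟨h1, h2, h3, h4, h5, h6, h7, h8, h9⟩,
    fun ⟨h1, h2, h3, h4, h5, h6, h7, h8, h9⟩ => ⟨h1, h2, h3, h4, h5, h6, h7, h8, h9⟩⟩

theorem splitCheck_eq_true {a : ℕ} : splitCheck A.word B.word a = true ↔ Splits A B a := by
  simp only [splitCheck, Bool.and_eq_true, allLt_eq_true, decide_eq_true_eq,
    A.length_word_forms, B.length_word_forms, A.length_word_overgroups, B.length_word_overgroups,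
    Cirquent.word_form_inj, Cirquent.mem_word_overgroup, decide_eq_decide, Bool.or_eq_true,
    Bool.not_eq_true', decide_eq_false_iff_not, and_assoc, ← imp_iff_not_or]
  exact ⟨fun ⟨h1, h2, h3, h4, h5, h6⟩ => ⟨h1, h2, h3, h4, h5, h6⟩,
    fun ⟨h1, h2, h3, h4, h5, h6⟩ => ⟨h1, h2, h3, h4, h5, h6⟩⟩

theorem Cirquent.word_recur {a b : ℕ} :
    CirquentWord.form B.word a = 4 :: CirquentWord.form A.word b ↔
      B.form a = (A.form b).recur := by
  rw [A.word_form, B.word_form, ← Formula.word_injective.eq_iff (a := B.form a), Formula.word]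

theorem Cirquent.word_corecur {a b : ℕ} :
    CirquentWord.form B.word a = 5 :: CirquentWord.form A.word b ↔
      B.form a = (A.form b).corecur := by
  rw [A.word_form, B.word_form, ← Formula.word_injective.eq_iff (a := B.form a), Formula.word]

theorem Cirquent.word_disj {a b c : ℕ} : CirquentWord.form B.word a =
      3 :: (CirquentWord.form A.word b ++ CirquentWord.form A.word c) ↔
    B.form a = (A.form b).disj (A.form c) := by
  rw [A.word_form, A.word_form, B.word_form, ← Formula.word_injective.eq_iff (a := B.form a),
    Formula.word]

theorem Cirquent.word_conj {a b c : ℕ} : CirquentWord.form B.word a =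
      2 :: (CirquentWord.form A.word b ++ CirquentWord.form A.word c) ↔
    B.form a = (A.form b).conj (A.form c) := by
  rw [A.word_form, A.word_form, B.word_form, ← Formula.word_injective.eq_iff (a := B.form a),
    Formula.word]

theorem Cirquent.head?_word {a : ℕ} : (CirquentWord.form B.word a).head? = some 5 ↔
    ∃ F : Formula, B.form a = F.corecur := by
  rw [B.word_form]
  cases B.form a <;> simp [Formula.word]

theorem recurCheck_eq_true {a j : ℕ} : recurCheck A.word B.word a j = true ↔ Recurs A B a j := by
  simp only [recurCheck, Bool.and_eq_true, allLt_eq_true, decide_eq_true_eq,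
    A.length_word_forms, B.length_word_forms, A.length_word_overgroups, B.length_word_overgroups,
    Cirquent.word_form_inj, Cirquent.mem_word_overgroup, decide_eq_decide, Bool.or_eq_true,
    Cirquent.word_undergroups_inj, Cirquent.word_overgroup_inj, Cirquent.word_recur,
    Bool.not_eq_true', decide_eq_false_iff_not, and_assoc, or_iff_not_imp_left, not_not]
  exact ⟨fun ⟨h1, h2, h3, h4, h5, h6, h7, h8, h9, h10⟩ => ⟨h1, h2, h3, h4, h5, h6, h7, h8, h9, h10⟩,
    fun ⟨h1, h2, h3, h4, h5, h6, h7, h8, h9, h10⟩ => ⟨h1, h2, h3, h4, h5, h6, h7, h8, h9, h10⟩⟩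

theorem corecurCheck_eq_true {a : ℕ} {K : List ℕ} :
    corecurCheck A.word B.word a K = true ↔ Corecurs A B a K := by
  simp only [corecurCheck, Bool.and_eq_true, allLt_eq_true, decide_eq_true_eq,
    A.length_word_forms, B.length_word_forms, A.length_word_overgroups, B.length_word_overgroups,
    Cirquent.word_form_inj, Cirquent.mem_word_overgroup, decide_eq_decide, Bool.or_eq_true,
    Cirquent.word_undergroups_inj, Cirquent.word_corecur,
    Bool.not_eq_true', decide_eq_false_iff_not, and_assoc, or_iff_not_imp_left]
  exact ⟨fun ⟨h1, h2, h3, h4, h5, h6, h7, h8, h9, h10, h11, h12⟩ =>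
      ⟨h1, h2, h3, h4, h5, h6, h7, h8, h9, h10, h11, h12⟩,
    fun ⟨h1, h2, h3, h4, h5, h6, h7, h8, h9, h10, h11, h12⟩ =>
      ⟨h1, h2, h3, h4, h5, h6, h7, h8, h9, h10, h11, h12⟩⟩

theorem apartCheck_eq_true {a : ℕ} : apartCheck A.word B.word a = true ↔ SplitsApart A B a := by
  simp only [apartCheck, Bool.and_eq_true, underCheck_eq_true, Bool.not_eq_true',
    decide_eq_false_iff_not, SplitsApart, forall_and]

/-- Both directions are used: one guarantees that a search for descriptions succeeds on a proof, the
other that whatever is found may be used. -/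
theorem Descr.check_eq_true {d : Descr} : d.check A.word B.word = true ↔ d.Step A B := by
  simp only [Descr.check, Bool.or_eq_true, Bool.and_eq_true, decide_eq_true_eq,
    B.length_word_overgroups, reindexCheck_eq_true, duplicateCheck_eq_true, mergeCheck_eq_true,
    splitCheck_eq_true, Cirquent.head?_word, Cirquent.word_form_inj, underCheck_eq_true,
    Cirquent.word_disj, Cirquent.word_conj, apartCheck_eq_true, recurCheck_eq_true,
    corecurCheck_eq_true, true_and, Bool.not_eq_true', decide_eq_false_iff_not, and_assoc, or_assoc]
  constructor
  · rintro (⟨h1, h2, h3⟩ | ⟨h1, h2⟩ | ⟨h1, h2⟩ | ⟨h1, h2, h3, h4, h5, h6⟩ | ⟨h1, h2, h3, h4⟩ |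
      ⟨h1, h2, h3, h4⟩ | ⟨h1, h2⟩ | ⟨h1, h2, h3⟩ | ⟨h1, h2⟩)
    exacts [.reindex h1 h2 h3, .duplicate h1 h2, .merge h1 h2, .contract h1 h2 h3 h4 h5 h6,
      .disj h1 h2 h3 h4, .conj h1 h2 h3 h4, .recur h1 h2, .corecur h1 h2 h3, .zero h1 h2]
  · rintro (⟨h1, h2, h3⟩ | ⟨h1, h2⟩ | ⟨h1, h2⟩ | ⟨h1, h2, h3, h4, h5, h6⟩ | ⟨h1, h2, h3, h4⟩ |
      ⟨h1, h2, h3, h4⟩ | ⟨h1, h2⟩ | ⟨h1, h2, h3⟩ | ⟨h1, h2⟩)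
    exacts [.inl ⟨h1, h2, h3⟩, .inr (.inl ⟨h1, h2⟩), .inr (.inr (.inl ⟨h1, h2⟩)),
      .inr (.inr (.inr (.inl ⟨h1, h2, h3, h4, h5, h6⟩))),
      .inr (.inr (.inr (.inr (.inl ⟨h1, h2, h3, h4⟩)))),
      .inr (.inr (.inr (.inr (.inr (.inl ⟨h1, h2, h3, h4⟩))))),
      .inr (.inr (.inr (.inr (.inr (.inr (.inl ⟨h1, h2⟩)))))),
      .inr (.inr (.inr (.inr (.inr (.inr (.inr (.inl ⟨h1, h2, h3⟩))))))),
      .inr (.inr (.inr (.inr (.inr (.inr (.inr (.inr ⟨h1, h2⟩)))))))]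

end

end CoL

namespace CoL

/-! ### Primitive recursive functions -/

attribute [fun_prop] Primrec

section
variable {α β γ σ : Type} [Primcodable α] [Primcodable β] [Primcodable γ] [Primcodable σ]

@[fun_prop]
theorem primrec_id : Primrec fun a : α => a := Primrec.id

@[fun_prop]
theorem primrec_const (x : σ) : Primrec fun _ : α => x := Primrec.const x

@[fun_prop]
theorem primrec_comp {f : β → σ} {g : α → β} (hf : Primrec f) (hg : Primrec g) :
    Primrec fun a => f (g a) := hf.comp hg

@[fun_prop]
theorem primrec_fst {f : α → β × γ} (h : Primrec f) : Primrec fun a => (f a).1 :=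
  Primrec.fst.comp h

@[fun_prop]
theorem primrec_snd {f : α → β × γ} (h : Primrec f) : Primrec fun a => (f a).2 :=
  Primrec.snd.comp h

@[fun_prop]
theorem primrec_mk {f : α → β} {g : α → γ} (hf : Primrec f) (hg : Primrec g) :
    Primrec fun a => (f a, g a) := hf.pair hg

@[fun_prop]
theorem primrec_add {f g : α → ℕ} (hf : Primrec f) (hg : Primrec g) :
    Primrec fun a => f a + g a := Primrec.nat_add.comp hf hg

@[fun_prop]
theorem primrec_sub {f g : α → ℕ} (hf : Primrec f) (hg : Primrec g) :
    Primrec fun a => f a - g a := Primrec.nat_sub.comp hf hg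

@[fun_prop]
theorem primrec_mul {f g : α → ℕ} (hf : Primrec f) (hg : Primrec g) :
    Primrec fun a => f a * g a := Primrec.nat_mul.comp hf hg

@[fun_prop]
theorem primrec_div {f g : α → ℕ} (hf : Primrec f) (hg : Primrec g) :
    Primrec fun a => f a / g a := Primrec.nat_div.comp hf hg

@[fun_prop]
theorem primrec_mod {f g : α → ℕ} (hf : Primrec f) (hg : Primrec g) :
    Primrec fun a => f a % g a := Primrec.nat_mod.comp hf hg

@[fun_prop]
theorem primrec_max {f g : α → ℕ} (hf : Primrec f) (hg : Primrec g) :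
    Primrec fun a => max (f a) (g a) := Primrec.nat_max.comp hf hg

@[fun_prop]
theorem primrec_decide_lt {f g : α → ℕ} (hf : Primrec f) (hg : Primrec g) :
    Primrec fun a => decide (f a < g a) := Primrec.nat_lt.decide.comp hf hg

@[fun_prop]
theorem primrec_decide_le {f g : α → ℕ} (hf : Primrec f) (hg : Primrec g) :
    Primrec fun a => decide (f a ≤ g a) := Primrec.nat_le.decide.comp hf hg

@[fun_prop]
theorem primrec_decide_eq [DecidableEq β] {f g : α → β} (hf : Primrec f) (hg : Primrec g) :
    Primrec fun a => decide (f a = g a) := Primrec.eq.decide.comp hf hg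

@[fun_prop]
theorem primrec_decide_and {p q : α → Prop} [DecidablePred p] [DecidablePred q]
    (hp : Primrec fun a => decide (p a)) (hq : Primrec fun a => decide (q a)) :
    Primrec fun a => decide (p a ∧ q a) :=
  (Primrec.and.comp hp hq).of_eq fun _ => (Bool.decide_and _ _).symm

@[fun_prop]
theorem primrec_and {f g : α → Bool} (hf : Primrec f) (hg : Primrec g) :
    Primrec fun a => f a && g a := Primrec.and.comp hf hg

@[fun_prop]
theorem primrec_or {f g : α → Bool} (hf : Primrec f) (hg : Primrec g) :
    Primrec fun a => f a || g a := Primrec.or.comp hf hg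

@[fun_prop]
theorem primrec_not {f : α → Bool} (hf : Primrec f) : Primrec fun a => !f a :=
  Primrec.not.comp hf

@[fun_prop]
theorem primrec_ite {p : α → Prop} [DecidablePred p] {f g : α → σ}
    (hp : Primrec fun a => decide (p a)) (hf : Primrec f) (hg : Primrec g) :
    Primrec fun a => if p a then f a else g a := Primrec.ite hp.primrecPred hf hg

@[fun_prop]
theorem primrec_some {f : α → β} (hf : Primrec f) : Primrec fun a => some (f a) :=
  Primrec.option_some.comp hf

@[fun_prop]
theorem primrec_option_map {f : α → Option β} {g : α → β → σ} (hf : Primrec f)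
    (hg : Primrec fun p : α × β => g p.1 p.2) : Primrec fun a => (f a).map (g a) :=
  Primrec.option_map hf hg

@[fun_prop]
theorem primrec_option_getD {f : α → Option β} {g : α → β} (hf : Primrec f) (hg : Primrec g) :
    Primrec fun a => (f a).getD (g a) := Primrec.option_getD.comp hf hg

@[fun_prop]
theorem primrec_toList {f : α → Option β} (hf : Primrec f) : Primrec fun a => (f a).toList :=
  Primrec.optionToList.comp hf

@[fun_prop]
theorem primrec_cons {f : α → β} {g : α → List β} (hf : Primrec f) (hg : Primrec g) :
    Primrec fun a => f a :: g a := Primrec.list_cons.comp hf hg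

@[fun_prop]
theorem primrec_append {f g : α → List β} (hf : Primrec f) (hg : Primrec g) :
    Primrec fun a => f a ++ g a := Primrec.list_append.comp hf hg

@[fun_prop]
theorem primrec_length {f : α → List β} (hf : Primrec f) : Primrec fun a => (f a).length :=
  Primrec.list_length.comp hf

@[fun_prop]
theorem primrec_flatten {f : α → List (List β)} (hf : Primrec f) :
    Primrec fun a => (f a).flatten := Primrec.list_flatten.comp hf

@[fun_prop]
theorem primrec_head? {f : α → List β} (hf : Primrec f) : Primrec fun a => (f a).head? :=
  Primrec.list_head?.comp hf

@[fun_prop]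
theorem primrec_tail {f : α → List β} (hf : Primrec f) : Primrec fun a => (f a).tail :=
  Primrec.list_tail.comp hf

@[fun_prop]
theorem primrec_range {f : α → ℕ} (hf : Primrec f) : Primrec fun a => List.range (f a) :=
  Primrec.list_range.comp hf

@[fun_prop]
theorem primrec_take {f : α → ℕ} {g : α → List β} (hf : Primrec f) (hg : Primrec g) :
    Primrec fun a => (g a).take (f a) := Primrec.list_take.comp hf hg

@[fun_prop]
theorem primrec_drop {f : α → ℕ} {g : α → List β} (hf : Primrec f) (hg : Primrec g) :
    Primrec fun a => (g a).drop (f a) := Primrec.list_drop.comp hf hg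

@[fun_prop]
theorem primrec_getElem? {f : α → List β} {g : α → ℕ} (hf : Primrec f) (hg : Primrec g) :
    Primrec fun a => (f a)[g a]? := Primrec.list_getElem?.comp hf hg

@[fun_prop]
theorem primrec_getD {f : α → List β} {g : α → ℕ} {d : α → β} (hf : Primrec f) (hg : Primrec g)
    (hd : Primrec d) : Primrec fun a => (f a).getD (g a) (d a) :=
  (primrec_option_getD (primrec_getElem? hf hg) hd).of_eq fun _ => by
    rw [List.getD_eq_getElem?_getD]

@[fun_prop]
theorem primrec_idxOf [DecidableEq β] {f : α → β} {g : α → List β} (hf : Primrec f)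
    (hg : Primrec g) : Primrec fun a => (g a).idxOf (f a) := Primrec.list_idxOf.comp hf hg

@[fun_prop]
theorem primrec_decide_mem [DecidableEq β] {f : α → β} {g : α → List β} (hf : Primrec f)
    (hg : Primrec g) : Primrec fun a => decide (f a ∈ g a) :=
  (primrec_decide_lt (primrec_idxOf hf hg) (primrec_length hg)).of_eq fun a => by
    simp [List.idxOf_lt_length_iff]

@[fun_prop]
theorem primrec_map {f : α → List β} {g : α → β → σ} (hf : Primrec f)
    (hg : Primrec fun p : α × β => g p.1 p.2) : Primrec fun a => (f a).map (g a) :=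
  Primrec.list_map hf hg

@[fun_prop]
theorem primrec_flatMap {f : α → List β} {g : α → β → List σ} (hf : Primrec f)
    (hg : Primrec fun p : α × β => g p.1 p.2) : Primrec fun a => (f a).flatMap (g a) :=
  Primrec.list_flatMap hf hg

@[fun_prop]
theorem primrec_filterMap {f : α → List β} {g : α → β → Option σ} (hf : Primrec f)
    (hg : Primrec fun p : α × β => g p.1 p.2) : Primrec fun a => (f a).filterMap (g a) :=
  Primrec.listFilterMap hf hg

@[fun_prop]
theorem primrec_foldr {f : α → List β} {g : α → σ} {h : α → β → σ → σ} (hf : Primrec f)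
    (hg : Primrec g) (hh : Primrec fun p : α × β × σ => h p.1 p.2.1 p.2.2) :
    Primrec fun a => (f a).foldr (h a) (g a) :=
  Primrec.list_foldr (h := fun a p => h a p.1 p.2) hf hg hh

@[fun_prop]
theorem primrec_foldl {f : α → List β} {g : α → σ} {h : α → σ → β → σ} (hf : Primrec f)
    (hg : Primrec g) (hh : Primrec fun p : α × σ × β => h p.1 p.2.1 p.2.2) :
    Primrec fun a => (f a).foldl (h a) (g a) :=
  Primrec.list_foldl (h := fun a p => h a p.1 p.2) hf hg hh

@[fun_prop]
theorem primrec_all {f : α → List β} {g : α → β → Bool} (hf : Primrec f)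
    (hg : Primrec fun p : α × β => g p.1 p.2) : Primrec fun a => (f a).all (g a) :=
  (primrec_foldr hf (primrec_const true) (h := fun a b r => g a b && r)
    (primrec_and (hg.comp (by fun_prop : Primrec fun p : α × β × Bool => (p.1, p.2.1)))
      (by fun_prop))).of_eq fun a => by
    induction f a <;> simp_all

@[fun_prop]
theorem primrec_any {f : α → List β} {g : α → β → Bool} (hf : Primrec f)
    (hg : Primrec fun p : α × β => g p.1 p.2) : Primrec fun a => (f a).any (g a) :=
  (primrec_foldr hf (primrec_const false) (h := fun a b r => g a b || r)
    (primrec_or (hg.comp (by fun_prop : Primrec fun p : α × β × Bool => (p.1, p.2.1)))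
      (by fun_prop))).of_eq fun a => by
    induction f a <;> simp_all

@[fun_prop]
theorem primrec_filter {f : α → List β} {g : α → β → Bool} (hf : Primrec f)
    (hg : Primrec fun p : α × β => g p.1 p.2) : Primrec fun a => (f a).filter (g a) :=
  (primrec_flatMap hf (g := fun a b => if g a b = true then [b] else []) (by
    refine primrec_ite ?_ (by fun_prop) (by fun_prop)
    simpa using hg)).of_eq fun a => by
    induction f a with
    | nil => rfl
    | cons b l ih =>
      rw [List.flatMap_cons, ih, List.filter_cons]
      split_ifs <;> rfl

@[fun_prop]
theorem primrec_replicate {f : α → ℕ} {g : α → β} (hf : Primrec f) (hg : Primrec g) :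
    Primrec fun a => List.replicate (f a) (g a) :=
  (primrec_map (primrec_range hf) (g := fun a _ => g a) (by fun_prop)).of_eq fun a => by simp

end

/-! ### Primitive recursiveness of the check -/

section
variable {α : Type} [Primcodable α]

@[fun_prop]
theorem primrec_form {f : α → CirquentWord} {g : α → ℕ} (hf : Primrec f) (hg : Primrec g) :
    Primrec fun a => CirquentWord.form (f a) (g a) := by
  unfold CirquentWord.form
  fun_prop

@[fun_prop]
theorem primrec_overgroup {f : α → CirquentWord} {g : α → ℕ} (hf : Primrec f) (hg : Primrec g) :
    Primrec fun a => CirquentWord.overgroup (f a) (g a) := by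
  unfold CirquentWord.overgroup
  fun_prop

@[fun_prop]
theorem primrec_allLt {f : α → ℕ} {g : α → ℕ → Bool} (hf : Primrec f)
    (hg : Primrec fun p : α × ℕ => g p.1 p.2) : Primrec fun a => allLt (f a) (g a) := by
  unfold allLt
  fun_prop

@[fun_prop]
theorem primrec_collapse {f g : α → ℕ} (hf : Primrec f) (hg : Primrec g) :
    Primrec fun a => collapse (f a) (g a) := by
  unfold collapse
  fun_prop

@[fun_prop]
theorem primrec_underCheck {u v : α → CirquentWord} {f : α → ℕ → ℕ} {g : α → ℕ → Bool}
    (hu : Primrec u) (hv : Primrec v) (hf : Primrec fun p : α × ℕ => f p.1 p.2)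
    (hg : Primrec fun p : α × ℕ => g p.1 p.2) :
    Primrec fun a => underCheck (u a) (v a) (f a) (g a) := by
  unfold underCheck
  fun_prop

@[fun_prop]
theorem primrec_reindexCheck {u v : α → CirquentWord} {f : α → List ℕ} {g : α → List ℕ} (hu : Primrec u) (hv : Primrec v)
    (hf : Primrec f) (hg : Primrec g) : Primrec fun a => reindexCheck (u a) (v a) (f a) (g a) := by
  unfold reindexCheck
  fun_prop

@[fun_prop]
theorem primrec_duplicateCheck {u v : α → CirquentWord} {f : α → ℕ} (hu : Primrec u) (hv : Primrec v)
    (hf : Primrec f) : Primrec fun a => duplicateCheck (u a) (v a) (f a) := by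
  unfold duplicateCheck
  fun_prop

@[fun_prop]
theorem primrec_mergeCheck {u v : α → CirquentWord} {f : α → ℕ} {g : α → List ℕ} {h : α → List ℕ} (hu : Primrec u) (hv : Primrec v)
    (hf : Primrec f) (hg : Primrec g) (hh : Primrec h) : Primrec fun a => mergeCheck (u a) (v a) (f a) (g a) (h a) := by
  unfold mergeCheck
  fun_prop

@[fun_prop]
theorem primrec_splitCheck {u v : α → CirquentWord} {f : α → ℕ} (hu : Primrec u) (hv : Primrec v)
    (hf : Primrec f) : Primrec fun a => splitCheck (u a) (v a) (f a) := by
  unfold splitCheck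
  fun_prop

@[fun_prop]
theorem primrec_recurCheck {u v : α → CirquentWord} {f : α → ℕ} {g : α → ℕ} (hu : Primrec u) (hv : Primrec v)
    (hf : Primrec f) (hg : Primrec g) : Primrec fun a => recurCheck (u a) (v a) (f a) (g a) := by
  unfold recurCheck
  fun_prop

@[fun_prop]
theorem primrec_corecurCheck {u v : α → CirquentWord} {f : α → ℕ} {g : α → List ℕ} (hu : Primrec u) (hv : Primrec v)
    (hf : Primrec f) (hg : Primrec g) : Primrec fun a => corecurCheck (u a) (v a) (f a) (g a) := by
  unfold corecurCheck
  fun_prop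

@[fun_prop]
theorem primrec_apartCheck {u v : α → CirquentWord} {f : α → ℕ} (hu : Primrec u) (hv : Primrec v)
    (hf : Primrec f) : Primrec fun a => apartCheck (u a) (v a) (f a) := by
  unfold apartCheck
  fun_prop

@[fun_prop]
theorem primrec_check {u v : α → CirquentWord} {d : α → Descr} (hu : Primrec u) (hv : Primrec v)
    (hd : Primrec d) : Primrec fun a => Descr.check (u a) (v a) (d a) := by
  unfold Descr.check
  simp only [Descr.tag, Descr.num, Descr.fstList, Descr.sndList, Descr.ovg, Descr.ofm]
  fun_prop

/-! ### Primitive recursiveness of the translations -/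

theorem primrec_allBits : Primrec allBits :=
  (Primrec.nat_rec₁ [[]] (f := fun _ l => l.flatMap fun w => [false :: w, true :: w])
    (by unfold Primrec₂; fun_prop)).of_eq fun n => by
    induction n with
    | zero => rfl
    | succ n ih => rw [allBits, ← ih]

@[fun_prop]
theorem primrec_allBits_comp {f : α → ℕ} (hf : Primrec f) : Primrec fun a => allBits (f a) :=
  primrec_allBits.comp hf

@[fun_prop]
theorem primrec_unweave {f g : α → ℕ} {h : α → List Bool} (hf : Primrec f) (hg : Primrec g)
    (hh : Primrec h) : Primrec fun a => unweave (f a) (g a) (h a) := by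
  unfold unweave
  fun_prop

@[fun_prop]
theorem primrec_cover {f : α → List (List Bool)} (hf : Primrec f) :
    Primrec fun a => cover (f a) := by
  unfold cover maxLen
  fun_prop

@[fun_prop]
theorem primrec_tab {f : α → ℕ} {g : α → ℕ → List Bool} (hf : Primrec f)
    (hg : Primrec fun p : α × ℕ => g p.1 p.2) : Primrec fun a => tab (f a) (g a) := by
  unfold tab
  fun_prop

@[fun_prop]
theorem primrec_bits {f : α → List Bool} (hf : Primrec f) : Primrec fun a => bits (f a) := by
  unfold bits
  exact primrec_map hf ((Primrec.dom_bool fun b => digit b.toNat).comp Primrec.snd)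

/-- The recursion uses the remaining string as well as the recursive value, so the fold carries
both; primitive recursiveness is then a matter of composition. -/
theorem parseBits_eq_foldr (m : Move) : parseBits m =
    (m.foldr (fun c (r : Move × Option (List Bool × Move)) => (c :: r.1,
      if c = dot then some ([], r.1)
      else if c = digit 0 then r.2.map fun p => (false :: p.1, p.2)
      else if c = digit 1 then r.2.map fun p => (true :: p.1, p.2)
      else none)) ([], none)).2 := by
  have key : ∀ m : Move, m.foldr (fun c (r : Move × Option (List Bool × Move)) => (c :: r.1,
      if c = dot then some ([], r.1)
      else if c = digit 0 then r.2.map fun p => (false :: p.1, p.2)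
      else if c = digit 1 then r.2.map fun p => (true :: p.1, p.2)
      else none)) ([], none) = (m, parseBits m) := by
    intro m
    induction m with
    | nil => rfl
    | cons c l ih => rw [List.foldr_cons, ih, parseBits]
  rw [key]

@[fun_prop]
theorem primrec_parseBits {f : α → Move} (hf : Primrec f) : Primrec fun a => parseBits (f a) := by
  simp only [parseBits_eq_foldr]
  fun_prop

@[fun_prop]
theorem primrec_half {f : α → Move} (b : Bool) (hf : Primrec f) :
    Primrec fun a => half b (f a) := by
  unfold half
  fun_prop

@[fun_prop]
theorem primrec_component {f : α → Move} (b : Bool) (hf : Primrec f) :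
    Primrec fun a => component b (f a) := by
  unfold component
  fun_prop

@[fun_prop]
theorem primrec_up {d : α → Descr} {n : α → ℕ} {m : α → PMove} (hd : Primrec d) (hn : Primrec n)
    (hm : Primrec m) : Primrec fun a => Descr.up (d a) (n a) (m a) := by
  unfold Descr.up reindexUp dupUp mergeUp splitUp recUp corecUp zeroUp joinAt splitAt insertStr
  simp only [Descr.tag, Descr.fstList, Descr.sndList, Descr.ovg, Descr.ofm]
  fun_prop

@[fun_prop]
theorem primrec_down {d : α → Descr} {n : α → ℕ} {m : α → PMove} (hd : Primrec d) (hn : Primrec n)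
    (hm : Primrec m) : Primrec fun a => Descr.down (d a) (n a) (m a) := by
  unfold Descr.down reindexDown dupDown mergeDown splitDown recDown corecDown zeroDown joinAt splitAt
    removeStr longer
  simp only [Descr.tag, Descr.num, Descr.fstList, Descr.sndList, Descr.ovg, Descr.ofm]
  fun_prop

end
end CoL

namespace CoL

/-! ### Structured moves as strings -/

/-- A structured move as a string; with at least one bitstring, this is `a;u₁,…,uₙ.β`. -/
def unparse (p : PMove) : Move :=
  numeral (p.1 + 1) ++ semicolon :: (if p.2.1 = [] then semicolon :: p.2.2
    else (p.2.1.flatMap fun u => comma :: bits u).tail ++ dot :: p.2.2)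

theorem intercalate_comma (l : List Move) :
    [comma].intercalate l = (l.flatMap fun m => comma :: m).tail := by
  induction l with
  | nil => rfl
  | cons m l ih =>
    cases l with
    | nil => simp
    | cons m' l => simpa using ih

theorem cirMove_eq {n : ℕ} (hn : n ≠ 0) (a : ℕ) (u : Fin n → List Bool) (β : Move) :
    cirMove (a + 1) u β = unparse (a, List.ofFn u, β) := by
  rw [cirMove, unparse, if_neg, intercalate_comma]
  · have : (List.ofFn fun j => bits (u j)) = (List.ofFn u).map bits := by
      rw [List.map_ofFn]
      rfl
    rw [this, List.flatMap_map]
  · rw [List.ofFn_eq_nil_iff]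
    exact hn

/-- The number with the given decimal notation. -/
def numValue (m : Move) : ℕ := m.foldl (fun r c => 10 * r + (c.val - 48)) 0

/-- The bitstrings separated by commas in a string. -/
def groups (m : Move) : List (List Bool) :=
  m.foldr (fun c st => if c = comma then [] :: st
    else (decide (c = digit 1) :: st.head?.getD []) :: st.tail) [[]]

/-- The structured move that a string would have to stand for. -/
def preparse (m : Move) : PMove :=
  let s := m.drop (m.idxOf semicolon + 1)
  (numValue (m.take (m.idxOf semicolon)) - 1,
    if s.head? = some semicolon then ([], s.tail)
    else (groups (s.take (s.idxOf dot)), s.drop (s.idxOf dot + 1)))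

/-- The structured move that a string stands for. -/
def parse (m : Move) : PMove := if unparse (preparse m) = m then preparse m else (0, [], [])

theorem digit_ne_of_lt {c : Sym} (hc : c.val < 48 ∨ 57 < c.val) {d : ℕ} (hd : d < 10) :
    digit d ≠ c := by
  rintro rfl
  simp only [digit, Fin.ofNat] at hc
  omega

theorem not_mem_numeral {c : Sym} (hc : c.val < 48 ∨ 57 < c.val) (a : ℕ) : c ∉ numeral a := by
  intro h
  simp only [numeral, List.mem_reverse, List.mem_map] at h
  obtain ⟨d, hd, h⟩ := h
  exact digit_ne_of_lt hc (Nat.digits_lt_base (by norm_num) hd) h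

theorem not_mem_bits {c : Sym} (hc : c.val < 48 ∨ 57 < c.val) (u : List Bool) : c ∉ bits u := by
  intro h
  simp only [bits, List.mem_map] at h
  obtain ⟨b, _, h⟩ := h
  exact digit_ne_of_lt hc (by cases b <;> simp) h

theorem digit_val_sub {d : ℕ} (hd : d < 10) : (digit d).val - 48 = d := by
  simp only [digit, Fin.ofNat]
  omega

theorem numValue_numeral (a : ℕ) : numValue (numeral a) = a := by
  have key : ∀ l : List ℕ, (∀ d ∈ l, d < 10) →
      (l.map digit).foldr (fun c r => 10 * r + (c.val - 48)) 0 = Nat.ofDigits 10 l := by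
    intro l hl
    induction l with
    | nil => rfl
    | cons d l ih =>
      rw [List.map_cons, List.foldr_cons, ih fun d' hd' => hl d' (List.mem_cons_of_mem _ hd'),
        Nat.ofDigits_cons, digit_val_sub (hl d List.mem_cons_self)]
      simp [add_comm]
  rw [numValue, numeral, List.foldl_reverse,
    key _ fun d hd => Nat.digits_lt_base (by norm_num) hd, Nat.ofDigits_digits]

theorem take_idxOf {l r : Move} {c : Sym} (h : c ∉ l) :
    (l ++ c :: r).take ((l ++ c :: r).idxOf c) = l := by
  rw [List.idxOf_append_of_notMem h]
  simp

theorem drop_idxOf {l r : Move} {c : Sym} (h : c ∉ l) :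
    (l ++ c :: r).drop ((l ++ c :: r).idxOf c + 1) = r := by
  rw [List.idxOf_append_of_notMem h]
  simp

/-- Digits read before `m` are attached to the first group of `m`. -/
theorem groups_bits (u : List Bool) (m : Move) :
    groups (bits u ++ m) = (u ++ (groups m).head?.getD []) :: (groups m).tail := by
  induction u with
  | nil =>
    rw [bits, List.map_nil, List.nil_append, List.nil_append]
    cases m with
    | nil => rfl
    | cons c m =>
      simp only [groups, List.foldr_cons]
      split_ifs <;> rfl
  | cons b u ih =>
    rw [bits, List.map_cons, List.cons_append]
    rw [bits] at ih
    simp only [groups, List.foldr_cons] at ih ⊢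
    rw [ih, if_neg (digit_ne_of_lt (.inl (by decide)) (by cases b <;> simp))]
    cases b
    · simp only [Bool.toNat_false]
      rfl
    · rfl

theorem groups_flatMap {us : List (List Bool)} (h : us ≠ []) :
    groups (us.flatMap fun u => comma :: bits u).tail = us := by
  have key : ∀ l : List (List Bool), groups (l.flatMap fun u => comma :: bits u) = [] :: l := by
    intro l
    induction l with
    | nil => rfl
    | cons u l ih =>
      have e : ∀ m, groups (comma :: m) = [] :: groups m := fun m => by simp [groups]
      rw [List.flatMap_cons, List.cons_append, e, groups_bits, ih]
      simp
  obtain ⟨u, l, rfl⟩ := List.exists_cons_of_ne_nil h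
  rw [List.flatMap_cons, List.cons_append, List.tail_cons, groups_bits, key]
  simp

theorem not_mem_groups {c : Sym} (hc : c.val < 48 ∨ 57 < c.val) (hc' : c ≠ comma)
    (us : List (List Bool)) : c ∉ (us.flatMap fun u => comma :: bits u).tail := by
  intro h
  obtain ⟨u, _, h⟩ := List.mem_flatMap.1 (List.mem_of_mem_tail h)
  rcases List.mem_cons.1 h with h | h
  · exact hc' h
  · exact not_mem_bits hc u h

/-- Numerals contain no semicolon, and lists of bitstrings contain neither full stops nor
semicolons, so the first occurrence of each separator is the intended one, whatever symbols occur in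
the remaining move. -/
theorem preparse_unparse (p : PMove) : preparse (unparse p) = p := by
  obtain ⟨a, us, β⟩ := p
  have h1 : semicolon ∉ numeral (a + 1) := not_mem_numeral (.inr (by decide)) _
  simp only [unparse, preparse, take_idxOf h1, drop_idxOf h1, numValue_numeral]
  by_cases hu : us = []
  · simp [hu]
  · have h2 := not_mem_groups (c := dot) (.inl (by decide)) (by decide) us
    have h3 := not_mem_groups (c := semicolon) (.inr (by decide)) (by decide) us
    simp only [hu, if_false, take_idxOf h2, drop_idxOf h2, groups_flatMap hu]
    -- A second semicolon directly after the first marks the empty list of strings; it cannot begin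
    -- a nonempty list.
    rw [if_neg]
    · simp
    · cases h : (us.flatMap fun u => comma :: bits u).tail with
      | nil =>
        simp only [List.nil_append, List.head?_cons, Option.some.injEq]
        decide
      | cons c l =>
        rw [h] at h3
        rintro h'
        simp only [List.cons_append, List.head?_cons, Option.some.injEq] at h'
        exact h3 (h' ▸ List.mem_cons_self)

theorem parse_unparse (p : PMove) : parse (unparse p) = p := by
  rw [parse, preparse_unparse, if_pos rfl]

/-- Strings that stand for nothing are parsed as a move without bitstrings, which is not well-formed
because cirquents have at least one overgroup. -/
theorem unparse_parse {m : Move} (h : (parse m).2.1 ≠ []) : unparse (parse m) = m := by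
  unfold parse at h ⊢
  split_ifs at h ⊢ with h'
  · exact h'
  · exact absurd rfl h

/-! ### The game on strings and the game on structured moves -/

section
variable {C : Cirquent} {I : Interpretation}

theorem Cirquent.length_overgroups_ne (C : Cirquent) : C.overgroups.length ≠ 0 := by
  simpa using C.over_ne

theorem Cirquent.parse_cirMove (C : Cirquent) (a : ℕ) (u : Fin C.overgroups.length → List Bool)
    (β : Move) : parse (cirMove (a + 1) u β) = (a, List.ofFn u, β) := by
  rw [cirMove_eq C.length_overgroups_ne, parse_unparse]

theorem getD_ofFn {n : ℕ} (u : Fin n → List Bool) (j : Fin n) : (List.ofFn u).getD j [] = u j := by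
  rw [List.getD_eq_getElem _ _ (by simp)]
  simp

theorem Cirquent.eq_cirMove {m : Move} (h : C.Wf (parse m)) : m = cirMove ((parse m).1 + 1)
    (fun j : Fin C.overgroups.length => (parse m).2.1.getD j []) (parse m).2.2 := by
  rw [cirMove_eq C.length_overgroups_ne]
  have e : (List.ofFn fun j : Fin C.overgroups.length => (parse m).2.1.getD j []) =
      (parse m).2.1 := by
    refine List.ext_getElem (by simp [h.2.1]) fun i h1 h2 => ?_
    rw [List.getElem_ofFn, List.getD_eq_getElem _ _ h2]
  rw [e]
  refine (unparse_parse fun h' => ?_).symm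
  exact C.length_overgroups_ne (by rw [← h.2.1, h']; rfl)

theorem Cirquent.wf_parse {m : Move} : C.Wf (parse m) ↔ ∃ (a : Fin C.forms.length)
    (u : Fin C.overgroups.length → List Bool) (α : Move), m = cirMove (a + 1) u α ∧
      ∀ j, (a : ℕ) ∉ C.overgroups[j] → u j = [] := by
  constructor
  · intro h
    refine ⟨⟨_, h.1⟩, _, _, Cirquent.eq_cirMove h, fun j hj => h.2.2 j ?_⟩
    rwa [Cirquent.overgroup, List.getD_eq_getElem _ _ j.2]
  · rintro ⟨a, u, α, rfl, h⟩
    rw [C.parse_cirMove]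
    refine ⟨a.2, by simp, fun j hj => ?_⟩
    by_cases hjn : j < C.overgroups.length
    · have := h ⟨j, hjn⟩ (by rwa [Cirquent.overgroup, List.getD_eq_getElem _ _ hjn] at hj)
      exact (getD_ofFn u ⟨j, hjn⟩).trans this
    · exact List.getD_eq_default _ _ (by simpa using hjn)

/-- Extend a tuple of infinite bitstrings by zeros. -/
def extend {n : ℕ} (x : Fin n → ℕ → Bool) (j : ℕ) : ℕ → Bool :=
  if h : j < n then x ⟨j, h⟩ else fun _ => false

/-- What is seen of a move in a thread of the game on strings. -/
noncomputable def threadPart {n : ℕ} (a : ℕ) (x : Fin n → ℕ → Bool) : Move → Option Move :=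
  pick fun m β => ∃ u : Fin n → List Bool, (∀ j, IsInitial (u j) (x j)) ∧ m = cirMove a u β

theorem Cirquent.vis_iff {us : List (List Bool)} (hl : us.length = C.overgroups.length)
    {x : ℕ → ℕ → Bool} :
    Vis x us ↔ ∀ j : Fin C.overgroups.length, IsInitial (us.getD j []) (x j) := by
  refine ⟨fun h j => h j, fun h j => ?_⟩
  by_cases hjn : j < C.overgroups.length
  · exact h ⟨j, hjn⟩
  · rw [List.getD_eq_default _ _ (by omega)]
    rfl

/-- Parsing shows that the choice in the definition of threads is unambiguous, so both views of a
move agree; oformulas are counted from `1` in strings and from `0` in structured moves. -/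
theorem Cirquent.threadPart_eq {m : Move} (h : C.Wf (parse m)) (a : ℕ) {x : ℕ → ℕ → Bool}
    {y : Fin C.overgroups.length → ℕ → Bool} (hy : ∀ j, y j = x j) :
    threadPart (a + 1) y m = pj (a, x) (parse m) := by
  have huniq : ∀ (m β β' : Move),
      (∃ u : Fin C.overgroups.length → List Bool, (∀ j, IsInitial (u j) (y j)) ∧
        m = cirMove (a + 1) u β) →
      (∃ u : Fin C.overgroups.length → List Bool, (∀ j, IsInitial (u j) (y j)) ∧
        m = cirMove (a + 1) u β') → β = β' := by
    rintro _ β β' ⟨u, _, rfl⟩ ⟨u', _, h'⟩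
    have := congrArg parse h'
    rw [C.parse_cirMove, C.parse_cirMove] at this
    simpa using (congrArg (fun p : PMove => p.2.2) this)
  refine Option.ext fun β => ?_
  rw [threadPart, pick_eq_some huniq]
  constructor
  · rintro ⟨u, hu, rfl⟩
    rw [C.parse_cirMove]
    refine pj_some (i := (a, x)) rfl ((Cirquent.vis_iff (C := C) (by simp)).2 fun j => ?_)
    rw [getD_ofFn]
    have := hu j
    rwa [hy] at this
  · intro h'
    obtain ⟨h1, h2, rfl⟩ := pj_eq_some h'
    refine ⟨_, fun j => ?_, by rw [show a = (parse m).1 from h1.symm]; exact Cirquent.eq_cirMove h⟩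
    rw [hy]
    exact h2 j

/-- A labelled string as a labelled structured move. -/
def parseLab (e : LabMove) : Player × PMove := (e.1, parse e.2)

theorem Cirquent.filterMap_threadPart {Φ : Position} (h : ∀ e ∈ Φ, C.Wf (parse e.2)) (a : ℕ)
    {x : ℕ → ℕ → Bool} {y : Fin C.overgroups.length → ℕ → Bool} (hy : ∀ j, y j = x j) :
    Φ.filterMap (lab (threadPart (a + 1) y)) = (C.sys I).view (a, x) (Φ.map parseLab) := by
  rw [Sys.view, List.filterMap_map]
  refine List.filterMap_congr fun e he => ?_
  simp only [lab, Function.comp, parseLab, Cirquent.sys]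
  rw [Cirquent.threadPart_eq (h e he) a hy]

theorem Cirquent.legal_toRun {Φ : Position} :
    Position.toRun Φ ∈ C.legal I ↔ (C.sys I).Legal (Φ.map parseLab) := by
  have hwf : (∀ m ∈ Position.toRun Φ, ∃ (a : Fin C.forms.length)
      (u : Fin C.overgroups.length → List Bool) (α : Move),
      m.2 = cirMove (a + 1) u α ∧ ∀ j, (a : ℕ) ∉ C.overgroups[j] → u j = []) ↔
      ∀ e ∈ Φ, C.Wf (parse e.2) := by
    simp only [mem_toRun, Cirquent.wf_parse]
  have hwf' : (∀ e ∈ Φ.map parseLab, (C.sys I).wf e.2) ↔ ∀ e ∈ Φ, C.Wf (parse e.2) :=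
    List.forall_mem_map
  rw [Cirquent.legal, Set.mem_ofPred_eq, Sys.Legal, hwf, hwf']
  refine and_congr_right fun h => ?_
  have key : ∀ (a : Fin C.forms.length) (x : ℕ → ℕ → Bool)
      (y : Fin C.overgroups.length → ℕ → Bool), (∀ j, y j = x j) →
      ((Position.toRun Φ).thread (a + 1) y ∈ (C.forms[a].interp I).Lr ↔
        Position.toRun ((C.sys I).view (a, x) (Φ.map parseLab)) ∈ ((C.sys I).G (a, x)).Lr) := by
    intro a x y hy
    have e : C.form a = C.forms[a] := List.getD_eq_getElem _ _ a.2
    rw [Run.thread, project_eq, filterMap_toRun]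
    change Position.toRun (Φ.filterMap (lab (threadPart (a + 1) y))) ∈ _ ↔
      _ ∈ ((C.form a).interp I).Lr
    rw [Cirquent.filterMap_threadPart (I := I) h a hy, e]
  constructor
  · rintro h' ⟨a, x⟩
    by_cases ha : a < C.forms.length
    · exact (key ⟨a, ha⟩ x _ fun _ => rfl).1 (h' ⟨a, ha⟩ fun j => x j)
    -- Structured threads are indexed by all numbers; at a place without an oformula nothing is ever
    -- seen, and the empty run is legal in any game.
    · have : (C.sys I).view (a, x) (Φ.map parseLab) = [] := by
        rw [Sys.view, List.filterMap_map, List.filterMap_eq_nil_iff]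
        intro e he
        have : pj (a, x) (parse e.2) = none :=
          pj_none fun h1 => absurd (h e he).1 (by rw [h1]; exact ha)
        simp [lab, parseLab, Cirquent.sys, this]
      rw [this]
      exact ((C.sys I).G (a, x)).lr_iff.empty_mem
  · intro h' a y
    exact (key a (extend y) y fun j => by simp [extend]).2 (h' _)

end

end CoL

namespace CoL

/-! ### Machines from strategies -/

/-- The moves of the environment in a position. -/
def envMoves (Φ : Position) : List Move := Φ.filterMap fun e => if e.1 = bot then some e.2 else none

/-- One round: a bound and a position are updated when the environment plays `m`. -/
def Strategy.round (S : Strategy) (st : ℕ × Position) (m : Move) : ℕ × Position :=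
  ((S (st.1, [parse m])).1,
    st.2 ++ (bot, m) :: (S (st.1, [parse m])).2.map fun p => (top, unparse p))

/-- The position in which all replies to the given moves of the environment have been made. -/
def Strategy.play (S : Strategy) (e : List Move) : ℕ × Position := e.foldl S.round (0, [])

/-- The next move of the machine, if any. -/
def Strategy.next (S : Strategy) (Φ : Position) : Option Move :=
  (S.play (envMoves Φ)).2[Φ.length]?.map Prod.snd

/-- The transition function of a memoryless machine that plays the strategy `S`. -/
def Strategy.trans (S : Strategy) (x : ℕ × Position) : ℕ × Action :=
  (0, Action.equiv.symm (some (S.next x.2)))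

/-- A strategy that does nothing when the environment does nothing. -/
def Strategy.Silent (S : Strategy) : Prop := ∀ N, S (N, []) = (N, [])

section
variable {S : Strategy}

theorem Strategy.play_concat (e : List Move) (m : Move) :
    S.play (e ++ [m]) = S.round (S.play e) m := by
  rw [Strategy.play, List.foldl_append]
  rfl

theorem envMoves_top (Φ : Position) (m : Move) : envMoves (Φ ++ [(top, m)]) = envMoves Φ := by
  simp [envMoves]

theorem envMoves_bot (Φ : Position) (m : Move) :
    envMoves (Φ ++ [(bot, m)]) = envMoves Φ ++ [m] := by
  simp [envMoves]

/-- The machine has yet to make the moves `w`. -/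
def Strategy.Owes (S : Strategy) (Φ : Position) (w : List Move) : Prop :=
  (S.play (envMoves Φ)).2 = Φ ++ w.map fun m => (top, m)

theorem Strategy.Owes.next {Φ : Position} {w : List Move} (h : S.Owes Φ w) :
    S.next Φ = w.head? := by
  rw [Strategy.next, show (S.play (envMoves Φ)).2 = _ from h,
    List.getElem?_append_right le_rfl, Nat.sub_self, ← List.head?_eq_getElem?]
  cases w <;> rfl

variable {M : EPM} {B : ℕ → ℕ × Position}

theorem Strategy.Owes.succ_cons {t : ℕ} {m : Move} {w : List Move} (h : S.Owes (B t).2 (m :: w))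
    (hM : M.trans = S.trans) (hB : M.IsBranch B) :
    (B (t + 1)).2 = (B t).2 ++ [(top, m)] ∧ S.Owes (B (t + 1)).2 w := by
  have hs := (hB.2 t).2
  rw [hM, Strategy.trans, h.next] at hs
  replace hs : (B (t + 1)).2 = (B t).2 ++ [(top, m)] := hs
  refine ⟨hs, ?_⟩
  rw [hs, Strategy.Owes, envMoves_top, show (S.play (envMoves (B t).2)).2 = _ from h]
  simp

theorem Strategy.Owes.succ_nil {t : ℕ} (h : S.Owes (B t).2 [])
    (hM : M.trans = S.trans) (hB : M.IsBranch B) :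
    (M.trans (B t)).2 = .grant ∧ ((B (t + 1)).2 = (B t).2 ∨
      ∃ α, (B (t + 1)).2 = (B t).2 ++ [(bot, α)]) := by
  have hs := (hB.2 t).2
  rw [hM, Strategy.trans, h.next] at hs
  refine ⟨?_, hs⟩
  rw [hM, Strategy.trans, h.next]
  rfl

/-- The machine grants permission only when nothing is owed, so the environment never interrupts a
list of replies and the run tape is always an initial segment of the play of `S`. -/
theorem exists_owes (hM : M.trans = S.trans) (hB : M.IsBranch B) (t : ℕ) :
    ∃ w, S.Owes (B t).2 w := by
  induction t with
  | zero =>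
    refine ⟨[], ?_⟩
    rw [hB.1]
    rfl
  | succ t ih =>
    obtain ⟨w, hw⟩ := ih
    cases w with
    | cons m w => exact ⟨w, (hw.succ_cons hM hB).2⟩
    | nil =>
      rcases (hw.succ_nil hM hB).2 with h | ⟨α, h⟩
      · exact ⟨[], h ▸ hw⟩
      · refine ⟨(S ((S.play (envMoves (B t).2)).1, [parse α])).2.map unparse, ?_⟩
        rw [h, Strategy.Owes, envMoves_bot, Strategy.play_concat, Strategy.round,
          show (S.play (envMoves (B t).2)).2 = _ from hw]
        simp

/-- While replies are owed, one is made on every clock cycle. Hence the debt is paid after finitely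
many cycles, which gives fairness and lets the tape catch up with the play. -/
theorem exists_owes_nil (hM : M.trans = S.trans) (hB : M.IsBranch B) (t : ℕ) :
    ∃ s ≥ t, (B s).2 = (S.play (envMoves (B t).2)).2 ∧ S.Owes (B s).2 [] := by
  obtain ⟨w, hw⟩ := exists_owes hM hB t
  induction w generalizing t with
  | nil =>
    refine ⟨t, le_rfl, ?_, hw⟩
    have : (S.play (envMoves (B t).2)).2 = _ := hw
    simpa using this.symm
  | cons m w ih =>
    obtain ⟨h1, h2⟩ := hw.succ_cons hM hB
    obtain ⟨s, hs, h3, h4⟩ := ih (t + 1) h2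
    refine ⟨s, by omega, ?_, h4⟩
    rw [h3, h1, envMoves_top]

theorem fair_of_trans (hM : M.trans = S.trans) (hB : M.IsBranch B) : M.Fair B := by
  intro t
  obtain ⟨s, hs, _, h⟩ := exists_owes_nil hM hB t
  exact ⟨s, hs, (h.succ_nil hM hB).1⟩

theorem envMoves_succ (hM : M.trans = S.trans) (hB : M.IsBranch B) (t : ℕ) :
    envMoves (B (t + 1)).2 = envMoves (B t).2 ∨
    ∃ α, envMoves (B (t + 1)).2 = envMoves (B t).2 ++ [α] := by
  obtain ⟨w, hw⟩ := exists_owes hM hB t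
  cases w with
  | cons m w => exact .inl (by rw [(hw.succ_cons hM hB).1, envMoves_top])
  | nil =>
    rcases (hw.succ_nil hM hB).2 with h | ⟨α, h⟩
    · exact .inl (by rw [h])
    · exact .inr ⟨α, by rw [h, envMoves_bot]⟩

theorem branch_prefix_succ (hM : M.trans = S.trans) (hB : M.IsBranch B) (t : ℕ) :
    (B t).2 <+: (B (t + 1)).2 := by
  obtain ⟨w, hw⟩ := exists_owes hM hB t
  cases w with
  | cons m w => exact (hw.succ_cons hM hB).1 ▸ List.prefix_append _ _
  | nil =>
    rcases (hw.succ_nil hM hB).2 with h | ⟨α, h⟩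
    · rw [h]
    · exact h ▸ List.prefix_append _ _

/-- The tape is at all times a prefix of the completed play, and the completed play is reached by
the tape later, so the two chains are cofinal in each other. -/
theorem spelled_eq (hM : M.trans = S.trans) (hB : M.IsBranch B) :
    Chain (fun t => (S.play (envMoves (B t).2)).2) ∧
    spelled B = Run.limit fun t => (S.play (envMoves (B t).2)).2 := by
  have hc : Chain fun t => (S.play (envMoves (B t).2)).2 := Chain.of_succ fun t => by
    rcases envMoves_succ hM hB t with h | ⟨α, h⟩
    · simp only [h]
      exact List.prefix_rfl
    · simp only [h, Strategy.play_concat]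
      exact List.prefix_append _ _
  refine ⟨hc, limit_congr (Chain.of_succ (branch_prefix_succ hM hB)) hc (fun t => ⟨t, ?_⟩)
    fun t => ?_⟩
  · obtain ⟨w, hw⟩ := exists_owes hM hB t
    rw [show (S.play (envMoves (B t).2)).2 = _ from hw]
    exact List.prefix_append _ _
  · obtain ⟨s, _, h, _⟩ := exists_owes_nil hM hB t
    exact ⟨s, by rw [h]⟩

/-- Every clock cycle counts as a round in which the environment makes its new move, if any. In a
cycle without such a move nothing may change, hence the requirement that `S` be silent. -/
theorem exists_hist (hM : M.trans = S.trans) (hB : M.IsBranch B) (hS : S.Silent) :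
    ∃ N E, (∀ r, (S (N r, E r)).1 ≤ N (r + 1)) ∧
    ∀ t, (S.play (envMoves (B t).2)).2.map parseLab = hist S N E t := by
  refine ⟨fun t => (S.play (envMoves (B t).2)).1, fun t =>
    ((envMoves (B (t + 1)).2).drop (envMoves (B t).2).length).map parse, fun t => ?_, fun t => ?_⟩
  · rcases envMoves_succ hM hB t with h | ⟨α, h⟩
    · simp [h, hS _]
    · simp [h, Strategy.play_concat, Strategy.round]
  · induction t with
    | zero =>
      rw [hB.1]
      rfl
    | succ t ih =>
      rw [hist, ← ih]
      rcases envMoves_succ hM hB t with h | ⟨α, h⟩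
      · simp [h, hS _]
      · simp only [h, Strategy.play_concat, Strategy.round, List.drop_left', List.map_append,
          List.map_cons, List.map_map, List.map_nil]
        congr 1
        simp [parseLab, parse_unparse, Function.comp_def]

end

/-! ### From winning strategies to winning machines. -/

section
variable {C : Cirquent} {I : Interpretation}

/-- Legality of positions is the same for strings and for structured moves, so the first illegal
move is found at the same place of the run on strings. -/
theorem wn_eq_top_of_botIllegal {s : ℕ → Position} (hs : Chain s) {r : ℕ} {q : SPos} {m : PMove}
    (hq : q ++ [(bot, m)] <+: (s r).map parseLab) (h1 : (C.sys I).Legal q)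
    (h2 : ¬ (C.sys I).Legal (q ++ [(bot, m)])) : (C.interp I).Wn (Run.limit s) = top := by
  obtain ⟨q', hq'⟩ := hq
  rw [List.append_assoc] at hq'
  obtain ⟨Q, T, hQT, rfl, hT⟩ := List.map_eq_append_iff.1 hq'.symm
  obtain ⟨e, T', rfl, he, -⟩ := List.map_eq_cons_iff.1 hT
  have hlim : ∀ k ≤ (s r).length, (Run.limit s).take k = (s r).take k := fun k hk => by
    rw [take_eq _ hk, take_limit_length hs]
  have hlen : (s r).length = Q.length + T'.length + 1 := by
    rw [hQT]
    simp
    omega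
  refine (C.interp I).wn_illegal bot _ ⟨Q.length, e.2, ?_, fun k hk => ?_, ?_⟩
  · rw [get?_limit hs (t := r) (by omega), hQT]
    simp only [le_refl, List.getElem?_append_right, Nat.sub_self, List.getElem?_cons_zero,
      Option.some.injEq]
    have : e.1 = bot := congrArg Prod.fst he
    rw [← this]
  · rw [hlim k (by omega)]
    refine (C.isLegality_legal I).prefix (Ψ := Q) ?_ (Cirquent.legal_toRun.2 h1)
    rw [hQT, List.take_append_of_le_length hk]
    exact List.take_prefix _ _
  · rw [hlim _ (by omega), hQT]
    intro h
    refine h2 ?_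
    have e' : (Q ++ e :: T').take (Q.length + 1) = Q ++ [e] := by simp [List.take_append]
    rw [e'] at h
    have := Cirquent.legal_toRun.1 h
    rwa [List.map_append, List.map_cons, List.map_nil, he] at this

theorem wn_eq_top_of_won {s : ℕ → Position} (hs : Chain s)
    (hl : ∀ r, (C.sys I).Legal ((s r).map parseLab))
    (hw : C.Won I fun i => Run.limit fun r => (C.sys I).view i ((s r).map parseLab)) :
    (C.interp I).Wn (Run.limit s) = top := by
  have hmem : Run.limit s ∈ C.legal I :=
    (mem_of_limit (C.isLegality_legal I) hs).2 fun r => Cirquent.legal_toRun.2 (hl r)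
  refine (ofWin_wn hmem).2 fun U hU x hx => ?_
  -- The strings beyond the last overgroup are irrelevant, but must be essentially finite; zeros
  -- are.
  obtain ⟨a, ha, h⟩ := hw U hU (extend x) fun j => by
    unfold extend
    split_ifs with hj
    · exact hx _
    · simp [EssFinite]
  have ha' := lt_of_mem_undergroup hU ha
  have e : C.form a = C.forms[a] := List.getD_eq_getElem _ _ ha'
  refine ⟨⟨a, ha'⟩, ha, ?_⟩
  rw [e] at h
  rw [← h, Run.thread, project_eq, filterMap_limit hs]
  congr 2
  funext r
  refine Cirquent.filterMap_threadPart (fun e he => ?_) a fun j => by simp [extend]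
  exact (hl r).1 _ (List.mem_map_of_mem (f := parseLab) he)

theorem Strategy.Solves.wins {S : Strategy} (h : S.Solves I C) (hS : S.Silent) {M : EPM}
    (hM : M.trans = S.trans) : M.Wins (C.interp I) := by
  intro B hB
  refine ⟨?_, .inl (fair_of_trans hM hB)⟩
  obtain ⟨hc, hsp⟩ := spelled_eq hM hB
  obtain ⟨N, E, hN, hh⟩ := exists_hist hM hB hS
  rw [hsp]
  rcases h N E hN with ⟨r, q, m, hq, h1, h2⟩ | ⟨hl, hw⟩
  · exact wn_eq_top_of_botIllegal hc (hh r ▸ hq) h1 h2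
  · refine wn_eq_top_of_won hc (fun r => hh r ▸ hl r) ?_
    simpa only [hh] using hw

end

end CoL

namespace CoL

/-! ### Strategies from descriptions -/

/-- The strategy for the conclusion of the described sequence of applications of rules. -/
def Strategy.ofDescrs (ds : List Descr) : Strategy :=
  ds.foldl (fun S d => S.lift d.up d.down) copycat

/-- From the conclusion to the premise. -/
def Descr.upStep (d : Descr) (x : ℕ × List PMove) : ℕ × List PMove :=
  (max x.1 (sizes x.2), x.2.flatMap (d.up (max x.1 (sizes x.2))))

/-- From the premise to the conclusion. -/
def Descr.downStep (r : ℕ × List PMove) (d : Descr) : ℕ × List PMove :=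
  (max r.1 (sizes (r.2.flatMap (d.down r.1))), r.2.flatMap (d.down r.1))

/-- A fold whose values are strategies is replaced by two folds over data: moves travel from the
conclusion up to the axiom, `S` answers, and the answer travels back. In this form primitive
recursiveness is visible. -/
theorem foldl_lift (S : Strategy) (ds : List Descr) (x : ℕ × List PMove) :
    ds.foldl (fun S d => S.lift d.up d.down) S x =
      ds.foldl Descr.downStep (S (ds.foldr Descr.upStep x)) := by
  induction ds generalizing S with
  | nil => rfl
  | cons d ds ih =>
    rw [List.foldl_cons, ih, List.foldl_cons, List.foldr_cons]
    rfl

theorem Strategy.silent_ofDescrs (ds : List Descr) : (Strategy.ofDescrs ds).Silent := by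
  have key : ∀ S : Strategy, S.Silent →
      (ds.foldl (fun S d => S.lift d.up d.down) S).Silent := by
    induction ds with
    | nil => exact fun S hS => hS
    | cons d ds ih =>
      refine fun S hS => ih _ fun N => ?_
      simp [Strategy.lift, hS _, sizes]
  exact key _ fun N => by simp [copycat, sizes]

/-- `ds` describes the sequence of written-out cirquents `ws`. -/
def describes (ds : List Descr) (ws : List CirquentWord) : Bool :=
  decide (ws.length = ds.length + 1) && allLt ds.length fun i =>
    Descr.check (ws.getD i ([], [], [])) (ws.getD (i + 1) ([], [], []))
      (ds.getD i (0, 0, 0, 0, [], []))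

theorem describes_nil {ws : List CirquentWord} : describes [] ws = true ↔ ws.length = 1 := by
  simp [describes, allLt]

theorem describes_cons {d : Descr} {ds : List Descr} {u v : CirquentWord} {ws : List CirquentWord} :
    describes (d :: ds) (u :: v :: ws) = true ↔
      Descr.check u v d = true ∧ describes ds (v :: ws) = true := by
  simp only [describes, Bool.and_eq_true, decide_eq_true_eq, allLt_eq_true, List.length_cons,
    Nat.add_right_cancel_iff]
  constructor
  · rintro ⟨h1, h2⟩
    exact ⟨h2 0 (by omega), h1, fun i hi => h2 (i + 1) (by omega)⟩
  · rintro ⟨h1, h2, h3⟩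
    refine ⟨h2, fun i hi => ?_⟩
    cases i with
    | zero => exact h1
    | succ i => exact h3 i (by omega)

theorem exists_describes {P : List Cirquent} (h : P.IsChain Rule) (hP : P ≠ []) :
    ∃ ds, describes ds (P.map Cirquent.word) = true := by
  induction P with
  | nil => exact absurd rfl hP
  | cons A P ih =>
    cases P with
    | nil => exact ⟨[], describes_nil.2 rfl⟩
    | cons B P =>
      rw [List.isChain_cons_cons] at h
      obtain ⟨ds, hds⟩ := ih h.2 (by simp)
      obtain ⟨d, hd⟩ := h.1.exists_step
      exact ⟨d :: ds, describes_cons.2 ⟨Descr.check_eq_true.2 hd, hds⟩⟩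

/-- The descriptions only have to pass the check; they need not be those extracted from the rules of
the given proof. -/
theorem solves_of_describes {I : Interpretation} {C A : Cirquent} {P : List Cirquent}
    {ds : List Descr} (h : describes ds ((A :: P).map Cirquent.word) = true)
    (hC : (A :: P).getLast? = some C) {S : Strategy} (hS : S.Bounding) (hA : S.Solves I A) :
    (ds.foldl (fun S d => S.lift d.up d.down) S).Solves I C := by
  induction P generalizing A ds S with
  | nil =>
    cases ds with
    | nil =>
      rw [List.getLast?_singleton, Option.some.injEq] at hC
      exact hC ▸ hA
    | cons d ds => simp [describes] at h
  | cons B P ih =>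
    cases ds with
    | nil => simp [describes] at h
    | cons d ds =>
      obtain ⟨h1, h2⟩ := describes_cons.1 h
      exact ih h2 (by rwa [List.getLast?_cons_cons] at hC) hS.lift
        ((Descr.check_eq_true.1 h1).solves hS hA)

theorem IsProof.solves {P : List Cirquent} {C : Cirquent} (hP : IsProof P C) {ds : List Descr}
    (h : describes ds (P.map Cirquent.word) = true) (I : Interpretation) :
    (Strategy.ofDescrs ds).Solves I C := by
  obtain ⟨⟨A, hA, hax⟩, -, hC⟩ := hP
  cases P with
  | nil => simp at hA
  | cons A' P =>
    rw [List.head?_cons, Option.some.injEq] at hA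
    subst hA
    obtain ⟨k, hk⟩ := hax.paired
    exact solves_of_describes h hC copycat_bounding (hk.solves I)

/-! ### Computability -/

section
variable {α : Type} [Primcodable α]

@[fun_prop]
theorem primrec_describes {f : α → List Descr} {g : α → List CirquentWord} (hf : Primrec f)
    (hg : Primrec g) : Primrec fun a => describes (f a) (g a) := by
  unfold describes
  fun_prop

@[fun_prop]
theorem primrec_sizes {f : α → List PMove} (hf : Primrec f) : Primrec fun a => sizes (f a) := by
  unfold sizes PMove.size
  fun_prop

@[fun_prop]
theorem primrec_ofDescrs {f : α → List Descr} {g : α → ℕ × List PMove} (hf : Primrec f)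
    (hg : Primrec g) : Primrec fun a => Strategy.ofDescrs (f a) (g a) := by
  unfold Strategy.ofDescrs
  simp only [foldl_lift]
  unfold copycat mirror mate
  have h : Primrec fun a => (f a).foldr Descr.upStep (g a) := by
    unfold Descr.upStep
    fun_prop
  unfold Descr.downStep
  fun_prop

theorem primrec_digit : Primrec digit := by
  refine Primrec.fin_val_iff.1 ?_
  simp only [digit, Fin.ofNat]
  fun_prop

theorem numeral_eq {n : ℕ} (hn : n ≠ 0) : numeral n = numeral (n / 10) ++ [digit (n % 10)] := by
  rw [numeral, Nat.digits_of_two_le_of_pos (by norm_num) (by omega)]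
  simp [numeral]

/-- Course-of-values recursion: the numeral of `n` is that of `n / 10` followed by one digit, and
the length of the list of earlier values is `n` itself. -/
theorem primrec_numeral : Primrec numeral := by
  have h := Primrec.nat_strong_rec (α := Unit) (fun _ n => numeral n)
    (g := fun _ l => some (if l.length = 0 then []
      else l.getD (l.length / 10) [] ++ [digit (l.length % 10)])) (by
        unfold Primrec₂
        have := primrec_digit
        fun_prop) (fun _ n => by
        simp only [List.length_map, List.length_range, Option.some.injEq]
        split_ifs with hn
        · simp [hn, numeral]
        · rw [List.getD_eq_getElem _ _ (by simp; omega), List.getElem_map, List.getElem_range,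
            ← numeral_eq hn])
  exact h.comp (Primrec.const ()) Primrec.id

@[fun_prop]
theorem primrec_numeral_comp {f : α → ℕ} (hf : Primrec f) : Primrec fun a => numeral (f a) :=
  primrec_numeral.comp hf

@[fun_prop]
theorem primrec_unparse {f : α → PMove} (hf : Primrec f) : Primrec fun a => unparse (f a) := by
  unfold unparse
  fun_prop

@[fun_prop]
theorem primrec_val {f : α → Sym} (hf : Primrec f) : Primrec fun a => (f a).val :=
  Primrec.fin_val.comp hf

@[fun_prop]
theorem primrec_parse {f : α → Move} (hf : Primrec f) : Primrec fun a => parse (f a) := by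
  have h : Primrec preparse := by
    unfold preparse numValue groups
    fun_prop
  unfold parse
  fun_prop

theorem primrec_trans {f : α → List Descr} {g : α → ℕ × Position} (hf : Primrec f)
    (hg : Primrec g) : Primrec fun a => (Strategy.ofDescrs (f a)).trans (g a) := by
  unfold Strategy.trans
  refine primrec_mk (primrec_const 0) (Primrec.of_equiv_symm.comp ?_)
  unfold Strategy.next Strategy.play Strategy.round envMoves
  fun_prop

end

/-- Search for a description of a sequence of written-out cirquents. -/
def search (ws : List CirquentWord) : Part (List Descr) :=
  Nat.rfindOpt fun n => (Encodable.decode (α := List Descr) n).bind fun ds =>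
    if describes ds ws = true then some ds else none

theorem describes_of_mem_search {ws : List CirquentWord} {ds : List Descr} (h : ds ∈ search ws) :
    describes ds ws = true := by
  obtain ⟨n, hn⟩ := Nat.rfindOpt_spec h
  obtain ⟨ds', -, h'⟩ := Option.mem_bind_iff.1 hn
  split_ifs at h' with hd
  · rw [Option.mem_some_iff] at h'
    exact h' ▸ hd
  · simp at h'

theorem exists_mem_search {ws : List CirquentWord} {ds : List Descr} (h : describes ds ws = true) :
    ∃ ds', ds' ∈ search ws :=
  Part.dom_iff_mem.1 (Nat.rfindOpt_dom.2 ⟨Encodable.encode ds, ds, by simp [h]⟩)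

/-- The machine has no memory, so the search is part of every transition; it terminates whenever the
words come from a proof. -/
theorem partrec_search_trans : Partrec fun y : List CirquentWord × ℕ × Position =>
    (search y.1).map fun ds => (Strategy.ofDescrs ds).trans y.2 := by
  refine Partrec.map (Partrec.rfindOpt ?_) ?_
  · refine (Primrec.option_bind (Primrec.decode.comp Primrec.snd) ?_).to_comp
    unfold Primrec₂
    fun_prop
  · exact (primrec_trans (α := (List CirquentWord × ℕ × Position) × List Descr)
      (f := Prod.snd) (g := fun p => p.1.2) Primrec.snd (by fun_prop)).to_comp

/-- A program that, given a written-out proof and the configuration of a machine, computes the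
transition of the machine for the proof. -/
theorem exists_code_search : ∃ c : Nat.Partrec.Code, ∀ (ws : List CirquentWord) (x : ℕ × Position),
    c.eval (Encodable.encode (ws, x)) =
      (search ws).map fun ds => Encodable.encode ((Strategy.ofDescrs ds).trans x) := by
  obtain ⟨c, hc⟩ := Nat.Partrec.Code.exists_code.1 partrec_search_trans
  refine ⟨c, fun ws x => ?_⟩
  rw [hc]
  simp only [Encodable.encodek, Part.coe_some, Part.bind_some, Part.map_map]
  rfl

/-- The procedure merely inserts the written-out proof into a fixed program, so it is total and
computable for arbitrary input; the search is left to the resulting program. -/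
theorem exists_computable_solutions : ∃ f : List CirquentWord → Nat.Partrec.Code, Computable f ∧
    ∀ (P : List Cirquent) (C : Cirquent), IsProof P C →
      ∃ M : EPM, M.code = f (P.map Cirquent.word) ∧ M.IsUniformSolution C := by
  obtain ⟨c, hc⟩ := exists_code_search
  refine ⟨fun ws => c.curry (Encodable.encode ws), ?_, fun P C hP => ?_⟩
  · exact (Nat.Partrec.Code.primrec₂_curry.comp (Primrec.const c) Primrec.encode).to_comp
  · have hne : P ≠ [] := by
      rintro rfl
      obtain ⟨⟨A, hA, -⟩, -⟩ := hP
      simp at hA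
    obtain ⟨ds₀, h₀⟩ := exists_describes hP.2.1 hne
    obtain ⟨ds, hds⟩ := exists_mem_search h₀
    -- The search has one definite outcome `ds` on this proof, so the program computes the total
    -- transition function of the strategy for `ds`.
    refine ⟨⟨c.curry (Encodable.encode (P.map Cirquent.word)), (Strategy.ofDescrs ds).trans,
      fun x => ?_⟩, rfl, fun I => ?_⟩
    · rw [Nat.Partrec.Code.eval_curry]
      have := hc (P.map Cirquent.word) x
      rw [Part.eq_some_iff.2 hds, Part.map_some] at this
      exact this
    · exact (hP.solves (describes_of_mem_search hds) I).wins (Strategy.silent_ofDescrs ds) rfl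

end CoL

theorem theorem4p7 :
    (∀ C : CoL.Cirquent, C.Provable → C.UniformlyValid) ∧
    ∃ f : List CoL.CirquentWord → Nat.Partrec.Code, Computable f ∧
      ∀ (P : List CoL.Cirquent) (C : CoL.Cirquent), CoL.IsProof P C →
        ∃ M : CoL.EPM, M.code = f (P.map CoL.Cirquent.word) ∧ M.IsUniformSolution C := by
  refine ⟨fun C hC => ?_, CoL.exists_computable_solutions⟩
  obtain ⟨P, hP⟩ := hC
  obtain ⟨f, -, hf⟩ := CoL.exists_computable_solutions
  obtain ⟨M, -, hM⟩ := hf P C hP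
  exact ⟨M, hM⟩
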